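/- **Setting.** Let $(A_i,\boldsymbol X_i,(\epsilon_i^{(h)})_{1\le h\le H})$, $i=1,2,\dots$, be i.i.d., where $A_i\in\{1,\dots,H\}$ is the treatment received, $T_i^{(h)}=1\{A_i=h\}$, and $\boldsymbol X_i\in\mathbb R^p$ ($p,H$ fixed). Potential outcomes are $Y_i^{(h)}=\mu^{(h)}(\boldsymbol X_i)+f(\boldsymbol X_i)+\epsilon_i^{(h)}$ with $\mu^{(h)}$ (for instance linear) and $f$ Lipschitz continuous, $\epsilon_i^{(h)}\sim N(0,\sigma^2)$ independent of $\boldsymbol X_i$, $\sigma>0$; observed are $A_i$, $\boldsymbol X_i$ and $Y_i=\sum_hT_i^{(h)}Y_i^{(h)}$. Let $c^{(1)}+\dots+c^{(H)}=0$. Assume $Y_i^{(h)}\perp T_i^{(h)}\mid\boldsymbol X_i$ for each $h$ and $0<e^{(h)}(\boldsymbol X_i)<1$ a.s., where $e^{(h)}(\boldsymbol X_i)=P(T_i^{(h)}=1\mid\boldsymbol X_i)$ is the propensity score. Assume also $E\{(1+\|\boldsymbol X_1\|^4)/e^{(h)}(\boldsymbol X_1)\}<\infty$ for each $h$ and that $E(\boldsymbol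 X_1\boldsymbol X_1')$ is positive definite. **Selection and target.** For sample size $n$ let $X$ be the matrix with rows $\boldsymbol X_i'$, $X_M$ its columns in $M\subset\{1,\dots,p\}$, $Y=(Y_1,\dots,Y_n)'$, $W^{(h)}=\mathrm{diag}(T_i^{(h)}/e^{(h)}(\boldsymbol X_i))_{i}$ and $W=\sum_hc^{(h)}W^{(h)}$. Let $\hat\beta$ minimize $\frac12\|WY-X\beta\|_2^2+\lambda_n\|\beta\|_1$, $\lambda_n>0$, and let $\hat M=\{j:\hat\beta_j\ne0\}$. For $j\in M$ let $e_j\in\mathbb R^{M}$ be the corresponding unit vector, $\beta_j^M=e_j'(X_M'X_M)^{-1}X_M'\sum_hc^{(h)}(\mu^{(h)}(\boldsymbol X_1),\dots,\mu^{(h)}(\boldsymbol X_n))'$ and $\eta_j=X_M(X_M'X_M)^{-1}e_j$. **Truncation set.** For $s\in\{-1,1\}^M$ and $P_M=X_M(X_M'X_M)^{-1}X_M'$ put $$A=\frac1{\lambda_n}\begin{pmatrix}X_{M^c}'(I-P_M)\\-X_{M^c}'(I-P_M)\\-\mathrm{diag}(s)(X_M'X_M)^{-1}X_M'\end{pmatrix},\qquad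 b=\begin{pmatrix}1-X_{M^c}'X_M(X_M'X_M)^{-1}s\\1+X_{M^c}'X_M(X_M'X_M)^{-1}s\\-\mathrm{diag}(s)(X_M'X_M)^{-1}s\end{pmatrix},$$ $D=W^2\eta_j(\eta_j'W^2\eta_j)^{-1}$, $Z=(I-D\eta_j')WY$, and $$V^-_s=\max_{k:(AD)_k<0}\frac{b_k-(AZ)_k}{(AD)_k},\quad V^+_s=\min_{k:(AD)_k>0}\frac{b_k-(AZ)_k}{(AD)_k},\quad V^0_s=\min_{k:(AD)_k=0}\{b_k-(AZ)_k\},$$ with $\max\emptyset=-\infty$ and $\min\emptyset=+\infty$. Let $S_j^M=\bigcup_{s:\,V_s^0\ge0}[V_s^-,V_s^+]$ (the union over all $s$ if no $(AD)_k$ vanishes). Write $F^S_{m,v}$ for the distribution function of $N(m,v)$ truncated to $S$. **Nearest-neighbour estimator.** Let $\delta_n\to0$, $\mathcal N_i^{(h)}=\{l\le n: l\ne i,\ \|\boldsymbol X_l-\boldsymbol X_i\|_2\le\delta_n,\ T_l^{(h)}=1\}$, and suppose that $|\mathcal N_i^{(h)}|\to\infty$ in probability for each fixed $i$ and $h$.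 Let $\hat\beta^{(h)}$ minimize $\sum_iT_i^{(h)}(Y_i-\boldsymbol X_i'\beta)^2$ and $$Y_i^{(h)*}=\boldsymbol X_i'\hat\beta^{(h)}+\frac1{|\mathcal N_i^{(h)}|}\sum_{l\in\mathcal N_i^{(h)}}(Y_l-\boldsymbol X_l'\hat\beta^{(h)}),$$ $$\tau_j^M(Y^*)=e_j'(X_M'X_M)^{-1}X_M'\sum_hc^{(h)}(W^{(h)}-I)Y^{(h)*},\qquad Y^{(h)*}=(Y_1^{(h)*},\dots,Y_n^{(h)*})',$$ $$\rho_j^M=\sigma^2\eta_j'W^2\eta_j+\sigma^2\sum_h(c^{(h)})^2\eta_j'K^{(h)}\eta_j,\qquad K^{(h)}=\mathrm{diag}\Big(\frac{1/e^{(h)}(\boldsymbol X_i)-1}{|\mathcal N_i^{(h)}|}\Big)_i$$ (terms with an empty $\mathcal N_i^{(h)}$ in the denominator are read as $0$). **Theorem.** Let $0<\alpha<1$ and let $L_j,U_j$ ($j\in\hat M$) be random variables such that $$F^{S_j^{\hat M}}_{L_j+\tau_j^{\hat M}(Y^*),\,\rho_j^{\hat M}}(\eta_j'WY)=1-\frac\alpha2,\qquad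 F^{S_j^{\hat M}}_{U_j+\tau_j^{\hat M}(Y^*),\,\rho_j^{\hat M}}(\eta_j'WY)=\frac\alpha2$$ whenever the respective equation is solvable. Then $$\limsup_{n\to\infty}E\left(\frac{|\{j\in\hat M:\beta_j^{\hat M}\notin[L_j,U_j]\}|}{|\hat M|};\ |\hat M|>0\right)\le\alpha .$$ -/

import Mathlib

open MeasureTheory ProbabilityTheory Filter Topology
open scoped NNReal ENNReal Matrix

noncomputable section

namespace IPW

/-- `U` and `V` are conditionally independent given `W`: for all events in `σ(U)` and `σ(V)` the
conditional probability given `σ(W)` factorizes almost surely. -/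
def CondIndepGiven {Ω α β γ : Type*} [MeasurableSpace Ω] [MeasurableSpace α] [MeasurableSpace β]
    [mγ : MeasurableSpace γ] (P : Measure Ω) (U : Ω → α) (V : Ω → β) (W : Ω → γ) : Prop :=
  ∀ (s : Set α) (t : Set β), MeasurableSet s → MeasurableSet t →
    P⟦U ⁻¹' s ∩ V ⁻¹' t | mγ.comap W⟧ =ᵐ[P]
      P⟦U ⁻¹' s | mγ.comap W⟧ * P⟦V ⁻¹' t | mγ.comap W⟧

/-- Observed data of size `n`: confounders `x i ∈ ℝ^p`, the index `a i` of the treatment received,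
and the observed outcome `y i`. -/
structure Sample (n p H : ℕ) where
  x : Fin n → EuclideanSpace ℝ (Fin p)
  a : Fin n → Fin H
  y : Fin n → ℝ

variable {n p H : ℕ}

/-! ### Matrices built from the sample -/

/-- The assignment variable `T_i^{(h)} ∈ {0, 1}`. -/
def Sample.treat (S : Sample n p H) (h : Fin H) (i : Fin n) : ℝ := if S.a i = h then 1 else 0

/-- The design matrix with rows `x_i'`. -/
def Sample.design (S : Sample n p H) : Matrix (Fin n) (Fin p) ℝ := Matrix.of fun i k => S.x i k

/-- The columns of the design matrix with indices in `M`. -/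
def Sample.sub (S : Sample n p H) (M : Finset (Fin p)) : Matrix (Fin n) M ℝ :=
  Matrix.of fun i k => S.x i k

/-- `X_M' X_M`. -/
def Sample.gram (S : Sample n p H) (M : Finset (Fin p)) : Matrix M M ℝ := (S.sub M)ᵀ * S.sub M

/-- The weight matrix `W^{(h)} = diag (T_i^{(h)} / e^{(h)}(x_i))`. -/
def Sample.weightArm (S : Sample n p H) (e : Fin H → EuclideanSpace ℝ (Fin p) → ℝ) (h : Fin H) :
    Matrix (Fin n) (Fin n) ℝ :=
  Matrix.diagonal fun i => S.treat h i / e h (S.x i)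

/-- The weight matrix `W = ∑ h, c^{(h)} W^{(h)}`. -/
def Sample.weight (S : Sample n p H) (c : Fin H → ℝ)
    (e : Fin H → EuclideanSpace ℝ (Fin p) → ℝ) : Matrix (Fin n) (Fin n) ℝ :=
  ∑ h, c h • S.weightArm e h

/-- `η_j = X_M (X_M' X_M)⁻¹ e_j`. -/
def Sample.eta (S : Sample n p H) (M : Finset (Fin p)) (j : M) : Fin n → ℝ :=
  S.sub M *ᵥ ((S.gram M)⁻¹ *ᵥ Pi.single j 1)

/-- The estimand `β^M = (X_M' X_M)⁻¹ X_M' ∑ h, c^{(h)} μ^{(h)}(X)`. -/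
def Sample.target (S : Sample n p H) (c : Fin H → ℝ)
    (μ : Fin H → EuclideanSpace ℝ (Fin p) → ℝ) (M : Finset (Fin p)) : M → ℝ :=
  ((S.gram M)⁻¹ * (S.sub M)ᵀ) *ᵥ fun i => ∑ h, c h * μ h (S.x i)

/-- The statistic `η_j' W Y`. -/
def Sample.stat (S : Sample n p H) (c : Fin H → ℝ) (e : Fin H → EuclideanSpace ℝ (Fin p) → ℝ)
    (M : Finset (Fin p)) (j : M) : ℝ :=
  S.eta M j ⬝ᵥ (S.weight c e *ᵥ S.y)

/-! ### Model selection by the inverse-probability-weighted Lasso -/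

/-- `‖W Y - X b‖₂² / 2 + lam ‖b‖₁`. -/
def Sample.lassoLoss (S : Sample n p H) (c : Fin H → ℝ)
    (e : Fin H → EuclideanSpace ℝ (Fin p) → ℝ) (lam : ℝ) (b : Fin p → ℝ) : ℝ :=
  1 / 2 * ∑ i, ((S.weight c e *ᵥ S.y) i - (S.design *ᵥ b) i) ^ 2 + lam * ∑ k, |b k|

/-- The model selected by a coefficient vector: the indices of its non-zero coefficients. -/
def supportModel (b : Fin p → ℝ) : Finset (Fin p) := Finset.univ.filter fun k => b k ≠ 0

/-- The matrix `A(M, s)` of the polyhedral description of `{selected model = M, signs = s}`. -/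
def Sample.polyA (S : Sample n p H) (lam : ℝ) (M : Finset (Fin p)) (s : M → ℝ) :
    Matrix ((↥Mᶜ ⊕ ↥Mᶜ) ⊕ M) (Fin n) ℝ :=
  lam⁻¹ • Matrix.fromRows
    (Matrix.fromRows
      ((S.sub Mᶜ)ᵀ * (1 - S.sub M * (S.gram M)⁻¹ * (S.sub M)ᵀ))
      (-((S.sub Mᶜ)ᵀ * (1 - S.sub M * (S.gram M)⁻¹ * (S.sub M)ᵀ))))
    (-(Matrix.diagonal s * (S.gram M)⁻¹ * (S.sub M)ᵀ))

/-- The vector `b(M, s)` of the polyhedral description of `{selected model = M, signs = s}`. -/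
def Sample.polyB (S : Sample n p H) (M : Finset (Fin p)) (s : M → ℝ) :
    (↥Mᶜ ⊕ ↥Mᶜ) ⊕ M → ℝ :=
  Sum.elim
    (Sum.elim
      (1 - ((S.sub Mᶜ)ᵀ * S.sub M * (S.gram M)⁻¹) *ᵥ s)
      (1 + ((S.sub Mᶜ)ᵀ * S.sub M * (S.gram M)⁻¹) *ᵥ s))
    (-((Matrix.diagonal s * (S.gram M)⁻¹) *ᵥ s))

/-! ### The truncation region -/

/-- `D = W² η_j (η_j' W² η_j)⁻¹`. -/
def Sample.vecD (S : Sample n p H) (c : Fin H → ℝ) (e : Fin H → EuclideanSpace ℝ (Fin p) → ℝ)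
    (M : Finset (Fin p)) (j : M) : Fin n → ℝ :=
  (S.eta M j ⬝ᵥ (S.weight c e ^ 2 *ᵥ S.eta M j))⁻¹ • (S.weight c e ^ 2 *ᵥ S.eta M j)

/-- `Z = (I - D η_j') W Y`. -/
def Sample.vecZ (S : Sample n p H) (c : Fin H → ℝ) (e : Fin H → EuclideanSpace ℝ (Fin p) → ℝ)
    (M : Finset (Fin p)) (j : M) : Fin n → ℝ :=
  S.weight c e *ᵥ S.y - S.stat c e M j • S.vecD c e M j

section
variable (S : Sample n p H) (c : Fin H → ℝ) (e : Fin H → EuclideanSpace ℝ (Fin p) → ℝ) (lam : ℝ)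
  (M : Finset (Fin p)) (j : M) (s : M → ℝ)

/-- `(A(M, s) D)_k`. -/
def Sample.slope (k : (↥Mᶜ ⊕ ↥Mᶜ) ⊕ M) : ℝ := (S.polyA lam M s *ᵥ S.vecD c e M j) k

/-- `b(M, s)_k - (A(M, s) Z)_k`. -/
def Sample.slack (k : (↥Mᶜ ⊕ ↥Mᶜ) ⊕ M) : ℝ :=
  S.polyB M s k - (S.polyA lam M s *ᵥ S.vecZ c e M j) k

/-- `V⁻`: a maximum over a finite set, equal to `-∞` if that set is empty. -/
def Sample.vMinus : EReal :=
  ⨆ (k : (↥Mᶜ ⊕ ↥Mᶜ) ⊕ M) (_ : S.slope c e lam M j s k < 0),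
    ((S.slack c e lam M j s k / S.slope c e lam M j s k : ℝ) : EReal)

/-- `V⁺`: a minimum over a finite set, equal to `+∞` if that set is empty. -/
def Sample.vPlus : EReal :=
  ⨅ (k : (↥Mᶜ ⊕ ↥Mᶜ) ⊕ M) (_ : 0 < S.slope c e lam M j s k),
    ((S.slack c e lam M j s k / S.slope c e lam M j s k : ℝ) : EReal)

/-- `V⁰`: a minimum over a finite set, equal to `+∞` if that set is empty. -/
def Sample.vZero : EReal :=
  ⨅ (k : (↥Mᶜ ⊕ ↥Mᶜ) ⊕ M) (_ : S.slope c e lam M j s k = 0),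
    ((S.slack c e lam M j s k : ℝ) : EReal)

end

/-- The truncation set: the union of the intervals `[V⁻_s, V⁺_s]` over the sign vectors
`s ∈ {-1, 1}^M` for which the constraints not involving `η_j' W Y` hold, that is `V⁰_s ≥ 0`. -/
def Sample.truncSet (S : Sample n p H) (c : Fin H → ℝ)
    (e : Fin H → EuclideanSpace ℝ (Fin p) → ℝ) (lam : ℝ) (M : Finset (Fin p)) (j : M) : Set ℝ :=
  ⋃ s ∈ {s : M → ℝ | (∀ k, s k = -1 ∨ s k = 1) ∧ 0 ≤ S.vZero c e lam M j s},
    {r : ℝ | S.vMinus c e lam M j s ≤ (r : EReal) ∧ (r : EReal) ≤ S.vPlus c e lam M j s}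

/-- If every constraint involves `η_j' W Y`, the truncation set is the union over all signs. -/
theorem Sample.truncSet_eq_of_slope_ne_zero (S : Sample n p H) (c : Fin H → ℝ)
    (e : Fin H → EuclideanSpace ℝ (Fin p) → ℝ) (lam : ℝ) (M : Finset (Fin p)) (j : M)
    (hne : ∀ s : M → ℝ, (∀ k, s k = -1 ∨ s k = 1) → ∀ k, S.slope c e lam M j s k ≠ 0) :
    S.truncSet c e lam M j =
      ⋃ s ∈ {s : M → ℝ | ∀ k, s k = -1 ∨ s k = 1},
        {r : ℝ | S.vMinus c e lam M j s ≤ (r : EReal) ∧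
          (r : EReal) ≤ S.vPlus c e lam M j s} := by
  have key : {s : M → ℝ | (∀ k, s k = -1 ∨ s k = 1) ∧ 0 ≤ S.vZero c e lam M j s} =
      {s : M → ℝ | ∀ k, s k = -1 ∨ s k = 1} := by
    ext s
    simp only [Set.mem_ofPred_eq, and_iff_left_iff_imp]
    intro hs
    simp only [Sample.vZero, le_iInf_iff]
    intro k hk
    exact absurd hk (hne s hs k)
  rw [Sample.truncSet, key]

/-- The cumulative distribution function at `r` of `N(m, v)` truncated to the set `B`. -/
def truncCdf (B : Set ℝ) (m : ℝ) (v : ℝ≥0) (r : ℝ) : ℝ :=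
  (ProbabilityTheory.cond (gaussianReal m v) B).real (Set.Iic r)

/-! ### The nearest-neighbour estimator, the mean shift and the variance -/

/-- `‖T^{(h)} (Y - X b)‖₂²`. -/
def Sample.armLoss (S : Sample n p H) (h : Fin H) (b : Fin p → ℝ) : ℝ :=
  ∑ i, (S.treat h i * (S.y i - (S.design *ᵥ b) i)) ^ 2

/-- The neighbourhood `{l ≠ i : ‖x_l - x_i‖₂ ≤ δ, T_l^{(h)} = 1}`. -/
def Sample.nbhd (S : Sample n p H) (δ : ℝ) (h : Fin H) (i : Fin n) : Finset (Fin n) :=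
  Finset.univ.filter fun l => l ≠ i ∧ ‖S.x l - S.x i‖ ≤ δ ∧ S.a l = h

/-- The estimator `Y_i^{(h)*}`: the linear fit with coefficients `b h` plus the average residual
over the neighbourhood (the average over an empty neighbourhood is `0`). -/
def Sample.yStar (S : Sample n p H) (δ : ℝ) (b : Fin H → Fin p → ℝ) (h : Fin H) (i : Fin n) : ℝ :=
  (S.design *ᵥ b h) i +
    (∑ l ∈ S.nbhd δ h i, (S.y l - (S.design *ᵥ b h) l)) / ((S.nbhd δ h i).card : ℝ)

/-- `τ_j^M(Y†) = e_j' (X_M' X_M)⁻¹ X_M' ∑ h, c^{(h)} (W^{(h)} - I) Y^{(h)†}`. -/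
def Sample.tau (S : Sample n p H) (c : Fin H → ℝ) (e : Fin H → EuclideanSpace ℝ (Fin p) → ℝ)
    (M : Finset (Fin p)) (yd : Fin H → Fin n → ℝ) (j : M) : ℝ :=
  (((S.gram M)⁻¹ * (S.sub M)ᵀ) *ᵥ ∑ h, c h • ((S.weightArm e h - 1) *ᵥ yd h)) j

/-- `ζ_j^M = σ² e_j' (X_M' X_M)⁻¹ X_M' W² X_M (X_M' X_M)⁻¹ e_j`. -/
def Sample.zeta (S : Sample n p H) (c : Fin H → ℝ) (e : Fin H → EuclideanSpace ℝ (Fin p) → ℝ)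
    (σ : ℝ) (M : Finset (Fin p)) (j : M) : ℝ :=
  σ ^ 2 * (Pi.single j 1 ⬝ᵥ
    (((S.gram M)⁻¹ * (S.sub M)ᵀ * S.weight c e ^ 2 * S.sub M * (S.gram M)⁻¹) *ᵥ Pi.single j 1))

/-- `K^{(h)} = diag ((1 / e^{(h)}(x_i) - 1) / |N_i^{(h)}|)`; an entry with an empty neighbourhood
is `0`. -/
def Sample.matK (S : Sample n p H) (e : Fin H → EuclideanSpace ℝ (Fin p) → ℝ) (δ : ℝ)
    (h : Fin H) : Matrix (Fin n) (Fin n) ℝ :=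
  Matrix.diagonal fun i => (1 / e h (S.x i) - 1) / ((S.nbhd δ h i).card : ℝ)

/-- `ρ_j^M = ζ_j^M + σ² ∑ h, (c^{(h)})² η_j' K^{(h)} η_j`. -/
def Sample.rho (S : Sample n p H) (c : Fin H → ℝ) (e : Fin H → EuclideanSpace ℝ (Fin p) → ℝ)
    (σ δ : ℝ) (M : Finset (Fin p)) (j : M) : ℝ :=
  S.zeta c e σ M j +
    σ ^ 2 * ∑ h, c h ^ 2 * (S.eta M j ⬝ᵥ (S.matK e δ h *ᵥ S.eta M j))

/-- The pivot with mean parameter `l + τ_j^M(Y*)` and variance parameter `ρ_j^M`, truncated to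
the truncation set and evaluated at `η_j' W Y`; `b` holds the least-squares coefficients of the
treatments. -/
def Sample.pivot (S : Sample n p H) (c : Fin H → ℝ) (e : Fin H → EuclideanSpace ℝ (Fin p) → ℝ)
    (σ δ lam : ℝ) (b : Fin H → Fin p → ℝ) (M : Finset (Fin p)) (j : M) (l : ℝ) : ℝ :=
  truncCdf (S.truncSet c e lam M j) (l + S.tau c e M (S.yStar δ b) j)
    (S.rho c e σ δ M j).toNNReal (S.stat c e M j)

/-- The false coverage proportion of the intervals `[L_j, U_j]`, `j ∈ M`, for `β^M`. -/
def Sample.falseCoverage (S : Sample n p H) (c : Fin H → ℝ)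
    (μ : Fin H → EuclideanSpace ℝ (Fin p) → ℝ) (M : Finset (Fin p)) (L U : Fin p → ℝ) : ℝ :=
  (Nat.card {j : M // S.target c μ M j ∉ Set.Icc (L j) (U j)} : ℝ) / (M.card : ℝ)

/-! ### The causal model -/

/-- The potential outcome `Y^{(h)} = μ^{(h)}(X) + f(X) + ε^{(h)}`. -/
def potential {Ω : Type*} (μ : Fin H → EuclideanSpace ℝ (Fin p) → ℝ)
    (f : EuclideanSpace ℝ (Fin p) → ℝ) (X : Ω → EuclideanSpace ℝ (Fin p)) (ε : Fin H → Ω → ℝ)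
    (h : Fin H) (ω : Ω) : ℝ :=
  μ h (X ω) + f (X ω) + ε h ω

/-- The assignment variable `T^{(h)}`, where `A` is the index of the treatment received. -/
def assigned {Ω : Type*} (A : Ω → Fin H) (h : Fin H) (ω : Ω) : ℝ := if A ω = h then 1 else 0

/-- The first `n` observations, with observed outcome `Y_i = ∑ h, T_i^{(h)} Y_i^{(h)}`. -/
def sampleOf {Ω : Type*} (μ : Fin H → EuclideanSpace ℝ (Fin p) → ℝ)
    (f : EuclideanSpace ℝ (Fin p) → ℝ) (A : ℕ → Ω → Fin H)
    (X : ℕ → Ω → EuclideanSpace ℝ (Fin p)) (ε : ℕ → Fin H → Ω → ℝ) (n : ℕ) (ω : Ω) :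
    Sample n p H where
  x := fun i => X i ω
  a := fun i => A i ω
  y := fun i => ∑ h, assigned (A i) h ω * potential μ f (X i) (ε i) h ω

end IPW

end

/-!
The proof compares the intervals with the ones that use the unknown shift `τ(Y)` and variance `ζ`.

*Exact inference for fixed treatments and confounders.* By ignorability the standardised noise of
the observed outcomes is a standard Gaussian vector `z` independent of all treatments and
confounders (`map_obs_eq_prod`). Given the latter, `η_j' W Y` is normal with variance `ζ` and mean
`β_j + τ(Y)`, where `τ` is evaluated at the mean responses (`Sample.condMean_eq_target_add_tau`),
and the vector `Z` is a function of the component of `z` orthogonal to the direction `u` of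
`η_j' W Y`. By the Karush-Kuhn-Tucker conditions `M` is selected exactly if `η_j' W Y` lies in the
truncation set, up to a null set on which a constraint is tight. The truncation set depends on the
orthogonal component only, so on the event of selection the pivot with the exact parameters is
uniform (`noiseLaw_pivot_tails_le`). Summing over `j` and the models `M`, the events of selection
being almost surely disjoint, gives false coverage rate `α`.

*Perturbation of the pivot.* Relative errors `r` of mean and variance change the pivot by at most
`4 κ`, provided that the truncation set has Gaussian mass at least `r / κ` times its mass under a
fixed finite measure (`truncCdf_perturb`). Selection together with failure of this condition has
probability of order `r / κ` (`noiseLaw_small_set_le`), so no lower bound for the probability of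
selection is needed. A limit that misses the target forces the estimated pivot at the target to be
extreme, because the pivot is monotone in the mean and takes all values in `(0, 1)`
(`pivot_extreme_of_not_mem_Icc`).

*Consistency of the plug-in parameters.* It remains to see that `τ(Y*) - τ(Y)` is small compared
with `√ζ`, which is of order `n ^ (-1/2)`, and `ρ / ζ` close to `1` (`withHighProb_plugIn`). The
coefficients of `η_j` are of order `1 / n` by the law of large numbers, and what is left are sums
`∑ i, g_i ξ_i R_i` over products of an inverse-probability residual `ξ_i = T_i / e_i - 1` and a
local average. The residuals are centred given the confounders, and `R_i` depends on the treatment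
of individual `k` only through the membership of `k` in the neighbourhood of `i`; this makes all
but a few mixed moments vanish and bounds the second moment of the sum by that of its diagonal
(`IsPropensity.integral_sq_sum_le`). The diagonal is negligible since `f` and `μ` are Lipschitz, the
radii tend to zero, and the numbers of neighbours, whose laws do not depend on the individual, tend
to infinity in probability.
-/

noncomputable section

namespace IPW

/-! ### The Lasso: optimality conditions and uniqueness -/

/-- The Lasso loss `‖v - X b‖₂² / 2 + lam ‖b‖₁` of a general linear model. -/
def lassoObj {m q : Type*} [Fintype m] [Fintype q] (X : Matrix m q ℝ) (v : m → ℝ) (lam : ℝ)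
    (b : q → ℝ) : ℝ :=
  1 / 2 * ∑ i, (v i - (X *ᵥ b) i) ^ 2 + lam * ∑ k, |b k|

/-- The Karush-Kuhn-Tucker conditions of the Lasso; in the second one `|g b| ≤ lam |b|` always
holds, so equality says that the gradient is `lam * sign b` wherever `b ≠ 0`. -/
def LassoKKT {m q : Type*} [Fintype m] [Fintype q] (X : Matrix m q ℝ) (v : m → ℝ) (lam : ℝ)
    (b : q → ℝ) : Prop :=
  ∀ k, |(Xᵀ *ᵥ (v - X *ᵥ b)) k| ≤ lam ∧ (Xᵀ *ᵥ (v - X *ᵥ b)) k * b k = lam * |b k|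

section Lasso
variable {m q : Type*} [Fintype m] [Fintype q] (X : Matrix m q ℝ) (v : m → ℝ) (lam : ℝ)

lemma lassoObj_eq (b d : q → ℝ) :
    lassoObj X v lam (b + d) = lassoObj X v lam b + 1 / 2 * ∑ i, ((X *ᵥ d) i) ^ 2
      - ∑ k, (Xᵀ *ᵥ (v - X *ᵥ b)) k * d k + lam * (∑ k, |b k + d k| - ∑ k, |b k|) := by
  have h1 : ∑ k, (Xᵀ *ᵥ (v - X *ᵥ b)) k * d k = ∑ i, (v i - (X *ᵥ b) i) * (X *ᵥ d) i := by
    change (Xᵀ *ᵥ (v - X *ᵥ b)) ⬝ᵥ d = (v - X *ᵥ b) ⬝ᵥ (X *ᵥ d)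
    rw [Matrix.mulVec_transpose, Matrix.dotProduct_mulVec]
  have h2 : ∑ i, (v i - (X *ᵥ (b + d)) i) ^ 2 = ∑ i, (v i - (X *ᵥ b) i) ^ 2
      + ∑ i, ((X *ᵥ d) i) ^ 2 - 2 * ∑ i, (v i - (X *ᵥ b) i) * (X *ᵥ d) i := by
    rw [Finset.mul_sum, ← Finset.sum_add_distrib, ← Finset.sum_sub_distrib]
    refine Finset.sum_congr rfl fun i _ => ?_
    rw [Matrix.mulVec_add, Pi.add_apply]; ring
  simp only [lassoObj, h1, h2, Pi.add_apply]; ring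

variable {X v lam}

/-- A linear inequality `a t ≤ N t²` for small positive `t` forces `a ≤ 0`. -/
lemma nonpos_of_mul_le_sq {a N : ℝ} (h : ∀ t, 0 < t → t < 1 → a * t ≤ N * t ^ 2) : a ≤ 0 := by
  by_contra! ha
  have hN : 0 < |N| + a + 1 := by positivity
  have ht1 : a / (|N| + a + 1) < 1 := by
    rw [div_lt_one hN]; linarith [abs_nonneg N]
  have ht0 : 0 < a / (|N| + a + 1) := by positivity
  have := h _ ht0 ht1
  have h2 : a ≤ N * (a / (|N| + a + 1)) := by
    refine le_of_mul_le_mul_right (this.trans (le_of_eq (by ring))) ht0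
  have h3 : N * (a / (|N| + a + 1)) ≤ |N| * (a / (|N| + a + 1)) :=
    mul_le_mul_of_nonneg_right (le_abs_self N) ht0.le
  have h4 : |N| * (a / (|N| + a + 1)) < a := by
    rw [mul_div_assoc', div_lt_iff₀ hN]; nlinarith [abs_nonneg N]
  linarith

lemma LassoKKT.of_isMinOn (hlam : 0 < lam) {b : q → ℝ}
    (hb : IsMinOn (lassoObj X v lam) Set.univ b) : LassoKKT X v lam b := by
  classical
  intro k
  set g := (Xᵀ *ᵥ (v - X *ᵥ b)) k with hg
  set N := 1 / 2 * ∑ i, (X i k) ^ 2 with hN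
  -- the loss along the `k`-th coordinate direction
  have key : ∀ t : ℝ, 0 ≤ N * t ^ 2 - g * t + lam * (|b k + t| - |b k|) := by
    intro t
    have h0 : lassoObj X v lam b ≤ lassoObj X v lam (b + Pi.single k t) :=
      hb (Set.mem_univ _)
    rw [lassoObj_eq] at h0
    have h1 : ∑ i, ((X *ᵥ Pi.single k t) i) ^ 2 = (∑ i, (X i k) ^ 2) * t ^ 2 := by
      rw [Finset.sum_mul]
      refine Finset.sum_congr rfl fun i _ => ?_
      simp [Matrix.mulVec_single]; ring
    have h2 : ∑ l, (Xᵀ *ᵥ (v - X *ᵥ b)) l * (Pi.single k t : q → ℝ) l = g * t := by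
      rw [Finset.sum_eq_single k] <;> simp +contextual [hg]
    have h3 : ∑ l, |b l + (Pi.single k t : q → ℝ) l| - ∑ l, |b l| = |b k + t| - |b k| := by
      rw [← Finset.sum_sub_distrib, Finset.sum_eq_single k] <;> simp +contextual
    rw [h1, h2, h3] at h0
    rw [hN]; linarith
  have hle : |g| ≤ lam := by
    rw [abs_le]
    constructor
    · have : -g - lam ≤ 0 := by
        refine nonpos_of_mul_le_sq (N := N) fun t ht _ => ?_
        have h1 := key (-t)
        have h2 : |b k + -t| - |b k| ≤ t := by
          have := abs_add_le (b k) (-t); rw [abs_neg, abs_of_pos ht] at this; linarith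
        nlinarith
      linarith
    · have : g - lam ≤ 0 := by
        refine nonpos_of_mul_le_sq (N := N) fun t ht _ => ?_
        have h1 := key t
        have h2 : |b k + t| - |b k| ≤ t := by
          have := abs_add_le (b k) t; rw [abs_of_pos ht] at this; linarith
        nlinarith
      linarith
  refine ⟨hle, le_antisymm ?_ ?_⟩
  · calc g * b k ≤ |g * b k| := le_abs_self _
      _ = |g| * |b k| := abs_mul _ _
      _ ≤ lam * |b k| := mul_le_mul_of_nonneg_right hle (abs_nonneg _)
  · -- shrink the `k`-th coefficient towards zero
    have : lam * |b k| - g * b k ≤ 0 := by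
      refine nonpos_of_mul_le_sq (N := N * b k ^ 2) fun t ht ht1 => ?_
      have h1 := key (-(t * b k))
      have h2 : |b k + -(t * b k)| = (1 - t) * |b k| := by
        rw [show b k + -(t * b k) = (1 - t) * b k by ring, abs_mul, abs_of_pos (by linarith)]
      rw [h2] at h1
      nlinarith
    linarith

/-- Strict convexity: with a design of full column rank the point satisfying the optimality
conditions is the only minimizer. -/
lemma LassoKKT.eq_of_isMinOn (hinj : ∀ d, X *ᵥ d = 0 → d = 0) {b b' : q → ℝ}
    (hb : LassoKKT X v lam b) (hb' : IsMinOn (lassoObj X v lam) Set.univ b') : b' = b := by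
  have h0 : lassoObj X v lam b' ≤ lassoObj X v lam b := hb' (Set.mem_univ _)
  obtain ⟨d, rfl⟩ : ∃ d, b' = b + d := ⟨b' - b, by simp⟩
  rw [lassoObj_eq] at h0
  have h1 : ∑ k, (Xᵀ *ᵥ (v - X *ᵥ b)) k * d k ≤ lam * (∑ k, |b k + d k| - ∑ k, |b k|) := by
    rw [← Finset.sum_sub_distrib, Finset.mul_sum]
    refine Finset.sum_le_sum fun k _ => ?_
    obtain ⟨h2, h3⟩ := hb k
    have h4 : (Xᵀ *ᵥ (v - X *ᵥ b)) k * (b k + d k) ≤ lam * |b k + d k| := by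
      calc _ ≤ |(Xᵀ *ᵥ (v - X *ᵥ b)) k * (b k + d k)| := le_abs_self _
        _ = |(Xᵀ *ᵥ (v - X *ᵥ b)) k| * |b k + d k| := abs_mul _ _
        _ ≤ _ := mul_le_mul_of_nonneg_right h2 (abs_nonneg _)
    linarith
  have h2 : ∑ i, ((X *ᵥ d) i) ^ 2 = 0 :=
    le_antisymm (by linarith) (Finset.sum_nonneg fun i _ => sq_nonneg _)
  have h3 : X *ᵥ d = 0 := by
    ext i
    have := (Finset.sum_eq_zero_iff_of_nonneg fun i _ => sq_nonneg _).1 h2 i (Finset.mem_univ i)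
    simpa using this
  rw [hinj d h3, add_zero]

end Lasso

/-! ### The selection event as a polyhedron -/

section Sample
variable {n p H : ℕ} (S : Sample n p H) (c : Fin H → ℝ)
  (e : Fin H → EuclideanSpace ℝ (Fin p) → ℝ) (lam : ℝ)

/-- The weight `c^{(a)} / e^{(a)}(x)` of an individual. -/
def wt (c : Fin H → ℝ) (e : Fin H → EuclideanSpace ℝ (Fin p) → ℝ)
    (z : Fin H × EuclideanSpace ℝ (Fin p)) : ℝ := c z.1 / e z.1 z.2

lemma Sample.weight_eq :
    S.weight c e = Matrix.diagonal fun i => wt c e (S.a i, S.x i) := by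
  ext i k
  simp only [Sample.weight, Sample.weightArm, Matrix.sum_apply, Matrix.smul_apply,
    Matrix.diagonal_apply, Sample.treat, wt, smul_eq_mul]
  by_cases h : i = k
  · simp only [h, if_true]
    rw [Finset.sum_eq_single (S.a k)]
    · simp [div_eq_mul_inv]
    · intro h' _ hne; simp [Ne.symm hne]
    · simp
  · simp [h]

/-- The vector with the coefficients `b` on `M` and zeros elsewhere. -/
def extendModel (M : Finset (Fin p)) (b : M → ℝ) (k : Fin p) : ℝ :=
  if h : k ∈ M then b ⟨k, h⟩ else 0

lemma Sample.design_mulVec_extendModel (M : Finset (Fin p)) (b : M → ℝ) :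
    S.design *ᵥ extendModel M b = S.sub M *ᵥ b := by
  ext i
  simp only [Matrix.mulVec, dotProduct, Sample.design, Sample.sub, Matrix.of_apply]
  rw [← Finset.sum_subset (Finset.subset_univ M) (fun k _ hk => by simp [extendModel, hk]),
    ← Finset.sum_coe_sort M]
  exact Finset.sum_congr rfl fun k _ => by simp [extendModel]

/-- The design matrix has full column rank. -/
def Sample.FullRank : Prop := ∀ b : Fin p → ℝ, S.design *ᵥ b = 0 → b = 0

variable {S}

lemma Sample.FullRank.isUnit_det (hS : S.FullRank) (M : Finset (Fin p)) :
    IsUnit (S.gram M).det := by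
  rw [isUnit_iff_ne_zero]
  intro h
  obtain ⟨b, hb0, hb⟩ := Matrix.exists_mulVec_eq_zero_iff.2 h
  have h1 : S.sub M *ᵥ b = 0 := by
    rw [Sample.gram, ← Matrix.mulVec_mulVec] at hb
    have : (S.sub M *ᵥ b) ⬝ᵥ (S.sub M *ᵥ b) = 0 := by
      rw [Matrix.dotProduct_mulVec, ← Matrix.mulVec_transpose, hb, zero_dotProduct]
    exact dotProduct_self_eq_zero.1 this
  rw [← S.design_mulVec_extendModel] at h1
  apply hb0
  ext k
  simpa [extendModel] using congrFun (hS _ h1) k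

variable (S)

/-- The coefficients `(X_M' X_M)⁻¹ (X_M' v - lam s)` of the Lasso on the model `M` with signs `s`. -/
def Sample.signedFit (v : Fin n → ℝ) (M : Finset (Fin p)) (s : M → ℝ) : M → ℝ :=
  (S.gram M)⁻¹ *ᵥ ((S.sub M)ᵀ *ᵥ v) - lam • ((S.gram M)⁻¹ *ᵥ s)

variable {lam}

/-- The last block of constraints says that the signed fit has the signs `s`. -/
lemma Sample.polyA_inr_le_iff (hlam : 0 < lam) (v : Fin n → ℝ) (M : Finset (Fin p)) (s : M → ℝ)
    (k : M) : (S.polyA lam M s *ᵥ v) (Sum.inr k) ≤ S.polyB M s (Sum.inr k) ↔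
      0 ≤ s k * S.signedFit lam v M s k := by
  have h1 : (S.polyA lam M s *ᵥ v) (Sum.inr k) =
      -(lam⁻¹ * (s k * ((S.gram M)⁻¹ *ᵥ ((S.sub M)ᵀ *ᵥ v)) k)) := by
    rw [Sample.polyA, Matrix.smul_mulVec, Pi.smul_apply, Matrix.fromRows_mulVec, Sum.elim_inr,
      Matrix.neg_mulVec, Matrix.mul_assoc, ← Matrix.mulVec_mulVec, ← Matrix.mulVec_mulVec,
      Pi.neg_apply, Matrix.mulVec_diagonal, smul_eq_mul, mul_neg]
  have h2 : S.polyB M s (Sum.inr k) = -(s k * ((S.gram M)⁻¹ *ᵥ s) k) := by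
    rw [Sample.polyB, Sum.elim_inr, ← Matrix.mulVec_mulVec, Pi.neg_apply, Matrix.mulVec_diagonal]
  rw [h1, h2, Sample.signedFit, Pi.sub_apply, Pi.smul_apply, smul_eq_mul, neg_le_neg_iff,
    inv_mul_eq_div, le_div_iff₀ hlam, mul_sub, sub_nonneg]
  constructor <;> intro h <;> linarith

lemma Sample.polyA_inr_eq_iff (hlam : 0 < lam) (v : Fin n → ℝ) (M : Finset (Fin p)) (s : M → ℝ)
    (k : M) : (S.polyA lam M s *ᵥ v) (Sum.inr k) = S.polyB M s (Sum.inr k) ↔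
      s k * S.signedFit lam v M s k = 0 := by
  have h1 : (S.polyA lam M s *ᵥ v) (Sum.inr k) =
      -(lam⁻¹ * (s k * ((S.gram M)⁻¹ *ᵥ ((S.sub M)ᵀ *ᵥ v)) k)) := by
    rw [Sample.polyA, Matrix.smul_mulVec, Pi.smul_apply, Matrix.fromRows_mulVec, Sum.elim_inr,
      Matrix.neg_mulVec, Matrix.mul_assoc, ← Matrix.mulVec_mulVec, ← Matrix.mulVec_mulVec,
      Pi.neg_apply, Matrix.mulVec_diagonal, smul_eq_mul, mul_neg]
  have h2 : S.polyB M s (Sum.inr k) = -(s k * ((S.gram M)⁻¹ *ᵥ s) k) := by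
    rw [Sample.polyB, Sum.elim_inr, ← Matrix.mulVec_mulVec, Pi.neg_apply, Matrix.mulVec_diagonal]
  rw [h1, h2, Sample.signedFit, Pi.sub_apply, Pi.smul_apply, smul_eq_mul, neg_inj,
    inv_mul_eq_div, div_eq_iff hlam.ne', mul_sub, sub_eq_zero]
  constructor <;> intro h <;> linarith

/-- The first two blocks of constraints are the gradient condition for the columns outside `M`. -/
lemma Sample.polyA_inl_le_iff (hlam : 0 < lam) (v : Fin n → ℝ) (M : Finset (Fin p)) (s : M → ℝ)
    (k : ↥Mᶜ) : ((S.polyA lam M s *ᵥ v) (Sum.inl (Sum.inl k)) ≤ S.polyB M s (Sum.inl (Sum.inl k)) ∧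
      (S.polyA lam M s *ᵥ v) (Sum.inl (Sum.inr k)) ≤ S.polyB M s (Sum.inl (Sum.inr k))) ↔
      |((S.sub Mᶜ)ᵀ *ᵥ (v - S.sub M *ᵥ S.signedFit lam v M s)) k| ≤ lam := by
  set r := ((S.sub Mᶜ)ᵀ *ᵥ (v - S.sub M *ᵥ ((S.gram M)⁻¹ *ᵥ ((S.sub M)ᵀ *ᵥ v)))) k with hr
  set t := ((S.sub Mᶜ)ᵀ *ᵥ (S.sub M *ᵥ ((S.gram M)⁻¹ *ᵥ s))) k with ht
  have e1 : (S.polyA lam M s *ᵥ v) (Sum.inl (Sum.inl k)) = lam⁻¹ * r := by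
    rw [Sample.polyA, Matrix.smul_mulVec, Pi.smul_apply, Matrix.fromRows_mulVec, Sum.elim_inl,
      Matrix.fromRows_mulVec, Sum.elim_inl, smul_eq_mul, hr, ← Matrix.mulVec_mulVec,
      Matrix.sub_mulVec, Matrix.one_mulVec, ← Matrix.mulVec_mulVec, ← Matrix.mulVec_mulVec]
  have e2 : (S.polyA lam M s *ᵥ v) (Sum.inl (Sum.inr k)) = -(lam⁻¹ * r) := by
    rw [Sample.polyA, Matrix.smul_mulVec, Pi.smul_apply, Matrix.fromRows_mulVec, Sum.elim_inl,
      Matrix.fromRows_mulVec, Sum.elim_inr, smul_eq_mul, hr, Matrix.neg_mulVec,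
      ← Matrix.mulVec_mulVec, Matrix.sub_mulVec, Matrix.one_mulVec, ← Matrix.mulVec_mulVec,
      ← Matrix.mulVec_mulVec, Pi.neg_apply, mul_neg]
  have e3 : S.polyB M s (Sum.inl (Sum.inl k)) = 1 - t := by
    rw [Sample.polyB, Sum.elim_inl, Sum.elim_inl, ht, Pi.sub_apply, ← Matrix.mulVec_mulVec,
      ← Matrix.mulVec_mulVec, Pi.one_apply]
  have e4 : S.polyB M s (Sum.inl (Sum.inr k)) = 1 + t := by
    rw [Sample.polyB, Sum.elim_inl, Sum.elim_inr, ht, Pi.add_apply, ← Matrix.mulVec_mulVec,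
      ← Matrix.mulVec_mulVec, Pi.one_apply]
  have e5 : ((S.sub Mᶜ)ᵀ *ᵥ (v - S.sub M *ᵥ S.signedFit lam v M s)) k = r + lam * t := by
    simp only [hr, ht, Sample.signedFit, Matrix.mulVec_sub, Matrix.mulVec_smul, Pi.sub_apply,
      Pi.smul_apply, smul_eq_mul]
    ring
  rw [e1, e2, e3, e4, e5, abs_le, inv_mul_eq_div, div_le_iff₀ hlam, ← neg_div,
    div_le_iff₀ hlam]
  constructor
  · rintro ⟨h1, h2⟩; constructor <;> linarith
  · rintro ⟨h1, h2⟩; constructor <;> linarith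

lemma Sample.signedFit_normal_eq (hS : S.FullRank) (v : Fin n → ℝ) (M : Finset (Fin p))
    (s : M → ℝ) : (S.sub M)ᵀ *ᵥ (v - S.sub M *ᵥ S.signedFit lam v M s) = lam • s := by
  have h := hS.isUnit_det M
  have h1 : S.gram M *ᵥ S.signedFit lam v M s = (S.sub M)ᵀ *ᵥ v - lam • s := by
    simp only [Sample.signedFit, Matrix.mulVec_sub, Matrix.mulVec_smul, Matrix.mulVec_mulVec,
      ← Matrix.mul_assoc, Matrix.mul_nonsing_inv _ h, Matrix.one_mul, Matrix.one_mulVec]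
  rw [Matrix.mulVec_sub, Matrix.mulVec_mulVec, ← Sample.gram, h1, sub_sub_cancel]

lemma Sample.eq_signedFit (hS : S.FullRank) (v : Fin n → ℝ) (M : Finset (Fin p))
    (s b : M → ℝ) (hb : (S.sub M)ᵀ *ᵥ (v - S.sub M *ᵥ b) = lam • s) :
    b = S.signedFit lam v M s := by
  have h := hS.isUnit_det M
  have h1 : S.gram M *ᵥ b = (S.sub M)ᵀ *ᵥ v - lam • s := by
    rw [← hb, Matrix.mulVec_sub, sub_sub_cancel, Matrix.mulVec_mulVec, ← Sample.gram]
  rw [Sample.signedFit, ← Matrix.mulVec_smul, ← Matrix.mulVec_sub, ← h1, Matrix.mulVec_mulVec,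
    Matrix.nonsing_inv_mul _ h, Matrix.one_mulVec]

lemma extendModel_supportModel (b : Fin p → ℝ) :
    extendModel (supportModel b) (fun k => b k) = b := by
  ext k
  by_cases h : b k = 0 <;> simp [extendModel, supportModel, h]

/-- If the Lasso selects `M` with signs `s`, the response satisfies the constraints `A v ≤ b`. -/
lemma Sample.polyA_le_of_isMinOn (hS : S.FullRank) (hlam : 0 < lam) (v : Fin n → ℝ)
    {b : Fin p → ℝ} (hb : IsMinOn (lassoObj S.design v lam) Set.univ b) :
    ∃ s : supportModel b → ℝ, (∀ k, s k = -1 ∨ s k = 1) ∧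
      ∀ k, (S.polyA lam (supportModel b) s *ᵥ v) k ≤ S.polyB (supportModel b) s k := by
  have hK := LassoKKT.of_isMinOn hlam hb
  have hfit : S.design *ᵥ b = S.sub (supportModel b) *ᵥ fun k => b k := by
    rw [← S.design_mulVec_extendModel, extendModel_supportModel]
  have hne : ∀ k : supportModel b, b k ≠ 0 := fun k => by
    have := k.2; simpa [supportModel] using this
  let s : supportModel b → ℝ := fun k => b k / |b k|
  have hs : ∀ k, s k = -1 ∨ s k = 1 := fun k => by
    rcases lt_or_gt_of_ne (hne k) with h | h
    · left; simp only [s]; rw [abs_of_neg h, div_neg, div_self h.ne]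
    · right; simp only [s]; rw [abs_of_pos h, div_self h.ne']
  have hsb : (fun k : supportModel b => b k) = S.signedFit lam v _ s := by
    refine S.eq_signedFit hS v _ s _ ?_
    ext k
    have h2 := (hK k).2
    rw [hfit] at h2
    change (((S.design)ᵀ *ᵥ (v - S.sub (supportModel b) *ᵥ fun k => b k)) k) = lam * s k
    simp only [s]
    rw [mul_div_assoc', eq_div_iff (abs_ne_zero.2 (hne k))]
    rcases lt_or_gt_of_ne (hne k) with h | h
    · rw [abs_of_neg h] at h2 ⊢; linarith
    · rw [abs_of_pos h] at h2 ⊢; linarith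
  refine ⟨s, hs, ?_⟩
  rw [Sum.forall]
  constructor
  · have key := fun k => (S.polyA_inl_le_iff hlam v (supportModel b) s k).2 (by
      rw [← hsb, ← hfit]; exact (hK k).1)
    rw [Sum.forall]
    exact ⟨fun k => (key k).1, fun k => (key k).2⟩
  · intro k
    rw [S.polyA_inr_le_iff hlam, ← hsb]
    simp only [s]
    rw [div_mul_eq_mul_div]
    exact div_nonneg (mul_self_nonneg _) (abs_nonneg _)

/-- If the response satisfies the constraints `A v ≤ b`, strictly for the active variables, then
the Lasso selects `M`. -/
lemma Sample.supportModel_eq_of_polyA_le (hS : S.FullRank) (hlam : 0 < lam) (v : Fin n → ℝ)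
    {b : Fin p → ℝ} (hb : IsMinOn (lassoObj S.design v lam) Set.univ b) (M : Finset (Fin p))
    (s : M → ℝ) (hs : ∀ k, s k = -1 ∨ s k = 1)
    (h : ∀ k, (S.polyA lam M s *ᵥ v) k ≤ S.polyB M s k)
    (hne : ∀ k, (S.polyA lam M s *ᵥ v) (Sum.inr k) ≠ S.polyB M s (Sum.inr k)) :
    supportModel b = M := by
  have hpos : ∀ k, 0 < s k * S.signedFit lam v M s k := fun k =>
    lt_of_le_of_ne ((S.polyA_inr_le_iff hlam v M s k).1 (h _))
      (Ne.symm fun h0 => hne k ((S.polyA_inr_eq_iff hlam v M s k).2 h0))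
  have hK : LassoKKT S.design v lam (extendModel M (S.signedFit lam v M s)) := by
    intro k
    rw [S.design_mulVec_extendModel]
    by_cases hk : k ∈ M
    · have h1 : ((S.design)ᵀ *ᵥ (v - S.sub M *ᵥ S.signedFit lam v M s)) k = lam * s ⟨k, hk⟩ :=
        congrFun (S.signedFit_normal_eq hS v M s) ⟨k, hk⟩
      have h2 := hpos ⟨k, hk⟩
      have h3 : extendModel M (S.signedFit lam v M s) k = S.signedFit lam v M s ⟨k, hk⟩ := by
        simp [extendModel, hk]
      rw [h1, h3]
      rcases hs ⟨k, hk⟩ with h4 | h4 <;> rw [h4] at h2 ⊢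
      · refine ⟨by simp [abs_of_pos hlam], ?_⟩
        rw [abs_of_neg (by linarith)]; ring
      · refine ⟨by simp [abs_of_pos hlam], ?_⟩
        rw [abs_of_pos (by linarith)]; ring
    · have hk' : k ∈ Mᶜ := Finset.mem_compl.2 hk
      have h1 := (S.polyA_inl_le_iff hlam v M s ⟨k, hk'⟩).1 ⟨h _, h _⟩
      refine ⟨h1, ?_⟩
      simp [extendModel, hk]
  rw [hK.eq_of_isMinOn hS hb]
  ext k
  by_cases hk : k ∈ M
  · have := hpos ⟨k, hk⟩
    have h0 : S.signedFit lam v M s ⟨k, hk⟩ ≠ 0 := fun h0 => by rw [h0] at this; simp at this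
    simp [supportModel, extendModel, hk, h0]
  · simp [supportModel, extendModel, hk]

variable (lam)

/-! ### The truncation set -/

lemma Sample.mem_truncSet_iff (M : Finset (Fin p)) (j : M) (r : ℝ) :
    r ∈ S.truncSet c e lam M j ↔ ∃ s : M → ℝ, (∀ k, s k = -1 ∨ s k = 1) ∧
      ∀ k, S.slope c e lam M j s k * r ≤ S.slack c e lam M j s k := by
  simp only [Sample.truncSet, Set.mem_iUnion, Set.mem_ofPred_eq, exists_prop]
  refine exists_congr fun s => ?_
  rw [and_assoc]
  refine and_congr_right fun _ => ?_
  simp only [Sample.vZero, Sample.vMinus, Sample.vPlus, le_iInf_iff, iSup_le_iff,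
    EReal.coe_le_coe_iff, EReal.coe_nonneg]
  constructor
  · rintro ⟨h0, h1, h2⟩ k
    rcases lt_trichotomy (S.slope c e lam M j s k) 0 with hk | hk | hk
    · have := h1 k hk; rw [div_le_iff_of_neg hk] at this; linarith
    · rw [hk, zero_mul]; exact h0 k hk
    · have := h2 k hk; rw [le_div_iff₀ hk] at this; linarith
  · intro h
    refine ⟨fun k hk => ?_, fun k hk => ?_, fun k hk => ?_⟩
    · have := h k; rwa [hk, zero_mul] at this
    · rw [div_le_iff_of_neg hk]; linarith [h k]
    · rw [le_div_iff₀ hk]; linarith [h k]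

lemma Sample.slope_mul_stat_sub_slack (M : Finset (Fin p)) (j : M) (s : M → ℝ)
    (k : (↥Mᶜ ⊕ ↥Mᶜ) ⊕ M) :
    S.slope c e lam M j s k * S.stat c e M j - S.slack c e lam M j s k =
      (S.polyA lam M s *ᵥ (S.weight c e *ᵥ S.y)) k - S.polyB M s k := by
  rw [Sample.slope, Sample.slack, Sample.vecZ, Matrix.mulVec_sub, Matrix.mulVec_smul,
    Pi.sub_apply, Pi.smul_apply, smul_eq_mul]
  ring

/-- The truncation set contains the statistic exactly if the response satisfies the constraints
of the selection event of `M` for some signs. -/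
lemma Sample.stat_mem_truncSet_iff (M : Finset (Fin p)) (j : M) :
    S.stat c e M j ∈ S.truncSet c e lam M j ↔ ∃ s : M → ℝ, (∀ k, s k = -1 ∨ s k = 1) ∧
      ∀ k, (S.polyA lam M s *ᵥ (S.weight c e *ᵥ S.y)) k ≤ S.polyB M s k := by
  rw [S.mem_truncSet_iff]
  refine exists_congr fun s => and_congr_right fun _ => forall_congr' fun k => ?_
  rw [← sub_nonpos, S.slope_mul_stat_sub_slack, sub_nonpos]

/-- If no constraint with a non-zero slope is tight, the statistic is an interior point of the
truncation set. -/
lemma Sample.truncSet_mem_nhds (M : Finset (Fin p)) (j : M)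
    (hmem : S.stat c e M j ∈ S.truncSet c e lam M j)
    (hne : ∀ s : M → ℝ, (∀ k, s k = -1 ∨ s k = 1) → ∀ k, S.slope c e lam M j s k ≠ 0 →
      (S.polyA lam M s *ᵥ (S.weight c e *ᵥ S.y)) k ≠ S.polyB M s k) :
    S.truncSet c e lam M j ∈ 𝓝 (S.stat c e M j) := by
  obtain ⟨s, hs, h⟩ := (S.mem_truncSet_iff c e lam M j _).1 hmem
  have key : ∀ᶠ r in 𝓝 (S.stat c e M j), ∀ k,
      S.slope c e lam M j s k * r ≤ S.slack c e lam M j s k := by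
    rw [eventually_all]
    intro k
    by_cases h0 : S.slope c e lam M j s k = 0
    · refine Eventually.of_forall fun r => ?_
      have := h k
      rw [h0, zero_mul] at this ⊢; exact this
    · have hlt : S.slope c e lam M j s k * S.stat c e M j < S.slack c e lam M j s k := by
        refine lt_of_le_of_ne (h k) fun heq => hne s hs k h0 ?_
        rw [← sub_eq_zero, ← S.slope_mul_stat_sub_slack, heq, sub_self]
      have hc : Continuous fun r => S.slope c e lam M j s k * r := by fun_prop
      exact (hc.continuousAt.eventually_lt continuousAt_const hlt).mono fun r hr => hr.le
  filter_upwards [key] with r hr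
  exact (S.mem_truncSet_iff c e lam M j r).2 ⟨s, hs, hr⟩

end Sample

/-! ### The truncated normal distribution on the line -/

lemma truncCdf_eq {B : Set ℝ} (hB : MeasurableSet B) (m : ℝ) (v : ℝ≥0) (r : ℝ) :
    truncCdf B m v r =
      (gaussianReal m v).real (B ∩ Set.Iic r) / (gaussianReal m v).real B := by
  rw [truncCdf, measureReal_def, cond_apply hB, ENNReal.toReal_mul, ENNReal.toReal_inv,
    measureReal_def, measureReal_def, div_eq_inv_mul]

/-- Standardization of a truncated normal distribution. -/
lemma truncCdf_affine {B : Set ℝ} (hB : MeasurableSet B) (a : ℝ) {b : ℝ} (hb : 0 < b) (m : ℝ)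
    (v : ℝ≥0) (r : ℝ) :
    truncCdf B (a + b * m) (.mk (b ^ 2) (sq_nonneg b) * v) (a + b * r) =
      truncCdf ((fun t => a + b * t) ⁻¹' B) m v r := by
  have hmeas : Measurable fun t : ℝ => a + b * t := by fun_prop
  have hmap : gaussianReal (a + b * m) (.mk (b ^ 2) (sq_nonneg b) * v) =
      (gaussianReal m v).map fun t => a + b * t := by
    have : (fun t : ℝ => a + b * t) = (fun t => a + t) ∘ fun t => b * t := rfl
    rw [this, ← Measure.map_map (by fun_prop) (by fun_prop), gaussianReal_map_const_mul,
      gaussianReal_map_const_add, add_comm]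
  have hI : (fun t : ℝ => a + b * t) ⁻¹' (Set.Iic (a + b * r)) = Set.Iic r := by
    ext t; simp [hb]
  rw [truncCdf_eq hB, truncCdf_eq (hmeas hB), hmap,
    map_measureReal_apply hmeas (hB.inter measurableSet_Iic), map_measureReal_apply hmeas hB,
    Set.preimage_inter, hI]

/-- Integrals of exponential families whose exponent is non-positive. -/
lemma tilted_integral {s : Set ℝ} (hs : MeasurableSet s) {g h : ℝ → ℝ}
    (hle : ∀ x ∈ s, g x ≤ 0)
    (hlt : ∀ᵐ x ∂volume.restrict s, g x < 0)
    (hint : ∀ m : ℝ, IntegrableOn (fun x => Real.exp (m * g x - h x)) s) :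
    Antitone (fun m : ℝ => ∫ x in s, Real.exp (m * g x - h x)) ∧
      Continuous (fun m : ℝ => ∫ x in s, Real.exp (m * g x - h x)) ∧
      Tendsto (fun m : ℝ => ∫ x in s, Real.exp (m * g x - h x)) atTop (𝓝 0) := by
  have hmono : ∀ m m' : ℝ, m ≤ m' → ∀ x ∈ s,
      Real.exp (m' * g x - h x) ≤ Real.exp (m * g x - h x) := fun m m' hm x hx => by
    have := mul_le_mul_of_nonpos_right hm (hle x hx)
    gcongr
  have hae : ∀ m m' : ℝ, m ≤ m' → ∀ᵐ x ∂volume.restrict s,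
      ‖Real.exp (m' * g x - h x)‖ ≤ Real.exp (m * g x - h x) := fun m m' hm => by
    filter_upwards [ae_restrict_mem hs] with x hx
    rw [Real.norm_eq_abs, abs_of_pos (Real.exp_pos _)]
    exact hmono m m' hm x hx
  have hmeas : ∀ m : ℝ, AEStronglyMeasurable (fun x => Real.exp (m * g x - h x))
      (volume.restrict s) := fun m => (hint m).aestronglyMeasurable
  refine ⟨fun m m' hm => ?_, ?_, ?_⟩
  · exact setIntegral_mono_on (hint m') (hint m) hs (hmono m m' hm)
  · rw [continuous_iff_continuousAt]
    intro m₀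
    refine continuousAt_of_dominated (bound := fun x => Real.exp ((m₀ - 1) * g x - h x))
      (Eventually.of_forall hmeas) ?_ (hint _) ?_
    · filter_upwards [lt_mem_nhds (show m₀ - 1 < m₀ by linarith)] with m hm
      exact hae _ _ hm.le
    · exact Eventually.of_forall fun x => by fun_prop
  · have : (0 : ℝ) = ∫ x in s, (0 : ℝ) := by simp
    rw [this]
    refine tendsto_integral_filter_of_dominated_convergence
      (fun x => Real.exp (0 * g x - h x)) (Eventually.of_forall hmeas) ?_ (hint _) ?_
    · filter_upwards [eventually_ge_atTop 0] with m hm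
      exact hae _ _ hm
    · filter_upwards [hlt] with x hx
      refine Real.tendsto_exp_atBot.comp ?_
      exact tendsto_atBot_add_const_right _ _ (tendsto_id.atTop_mul_const_of_neg hx)

/-- The mass of `s` under `N(m, v)`, up to a factor that does not depend on `s`. The exponent is
centred at `r`, which makes the mass of a set on either side of `r` monotone in `m`. -/
def tiltedMass (v r : ℝ) (s : Set ℝ) (m : ℝ) : ℝ :=
  ∫ x in s, Real.exp (m * ((x - r) / v) - x ^ 2 / (2 * v))

lemma gaussianPDFReal_eq_tilt (m : ℝ) (v : ℝ≥0) (r x : ℝ) (hv : v ≠ 0) :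
    gaussianPDFReal m v x = ((√(2 * Real.pi * v))⁻¹ * Real.exp (m * r / v - m ^ 2 / (2 * v))) *
      Real.exp (m * ((x - r) / v) - x ^ 2 / (2 * v)) := by
  have hv' : (v : ℝ) ≠ 0 := by exact_mod_cast hv
  rw [gaussianPDFReal, mul_assoc (√(2 * Real.pi * v))⁻¹, ← Real.exp_add]
  congr 2
  field_simp
  ring

lemma integrable_tilt (m r : ℝ) {v : ℝ≥0} (hv : v ≠ 0) :
    Integrable fun x : ℝ => Real.exp (m * ((x - r) / v) - x ^ 2 / (2 * v)) := by
  have hv' : (0 : ℝ) < v := by positivity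
  have h := (integrable_gaussianPDFReal m v).const_mul
    ((√(2 * Real.pi * v))⁻¹ * Real.exp (m * r / v - m ^ 2 / (2 * v)))⁻¹
  refine h.congr (Eventually.of_forall fun x => ?_)
  simp only
  rw [gaussianPDFReal_eq_tilt m v r x hv, inv_mul_cancel_left₀]
  positivity

lemma gaussianReal_real_eq_tilt (m r : ℝ) {v : ℝ≥0} (hv : v ≠ 0) (s : Set ℝ) :
    (gaussianReal m v).real s =
      ((√(2 * Real.pi * v))⁻¹ * Real.exp (m * r / v - m ^ 2 / (2 * v))) * tiltedMass v r s m := by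
  rw [measureReal_def, gaussianReal_apply_eq_integral m hv, ENNReal.toReal_ofReal
    (integral_nonneg fun x => gaussianPDFReal_nonneg m v x), tiltedMass, ← integral_const_mul]
  simp_rw [gaussianPDFReal_eq_tilt m v r _ hv]

lemma truncCdf_eq_tilt {B : Set ℝ} (hB : MeasurableSet B) (m r : ℝ) {v : ℝ≥0} (hv : v ≠ 0) :
    truncCdf B m v r = tiltedMass v r (B ∩ Set.Iic r) m /
      (tiltedMass v r (B ∩ Set.Iic r) m + tiltedMass v r (B ∩ Set.Ioi r) m) := by
  have hv' : (0 : ℝ) < v := by positivity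
  have hsum : tiltedMass v r B m =
      tiltedMass v r (B ∩ Set.Iic r) m + tiltedMass v r (B ∩ Set.Ioi r) m := by
    rw [tiltedMass, tiltedMass, tiltedMass, ← setIntegral_union]
    · rw [← Set.inter_union_distrib_left, Set.Iic_union_Ioi, Set.inter_univ]
    · exact (Set.Iic_disjoint_Ioi le_rfl).mono Set.inter_subset_right Set.inter_subset_right
    · exact hB.inter measurableSet_Ioi
    · exact (integrable_tilt m r hv).integrableOn
    · exact (integrable_tilt m r hv).integrableOn
  rw [truncCdf_eq hB, gaussianReal_real_eq_tilt m r hv, gaussianReal_real_eq_tilt m r hv,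
    mul_div_mul_left _ _ (by positivity), hsum]

section
variable {B : Set ℝ} (hB : MeasurableSet B) {r : ℝ} {v : ℝ≥0} (hv : v ≠ 0)
include hB hv

lemma tiltedMass_left : Antitone (tiltedMass v r (B ∩ Set.Iic r)) ∧
    Continuous (tiltedMass v r (B ∩ Set.Iic r)) ∧
    Tendsto (tiltedMass v r (B ∩ Set.Iic r)) atTop (𝓝 0) := by
  have hv' : (0 : ℝ) < v := by positivity
  refine tilted_integral (hB.inter measurableSet_Iic)
    (fun x hx => ?_) ?_ fun m => (integrable_tilt m r hv).integrableOn
  · exact div_nonpos_of_nonpos_of_nonneg (by linarith [Set.mem_Iic.1 hx.2]) hv'.le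
  · rw [ae_restrict_iff' (hB.inter measurableSet_Iic)]
    filter_upwards [compl_mem_ae_iff.2 (measure_singleton (μ := volume) r)] with x hx hxs
    exact div_neg_of_neg_of_pos (sub_neg.2 (lt_of_le_of_ne hxs.2 hx)) hv'

lemma tiltedMass_right : Monotone (tiltedMass v r (B ∩ Set.Ioi r)) ∧
    Continuous (tiltedMass v r (B ∩ Set.Ioi r)) ∧
    Tendsto (tiltedMass v r (B ∩ Set.Ioi r)) atBot (𝓝 0) := by
  have hv' : (0 : ℝ) < v := by positivity
  have heq : tiltedMass v r (B ∩ Set.Ioi r) = (fun m : ℝ => ∫ x in B ∩ Set.Ioi r,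
      Real.exp (m * (-((x - r) / v)) - x ^ 2 / (2 * v))) ∘ Neg.neg := by
    ext m
    simp only [tiltedMass, Function.comp_apply, neg_mul_neg]
  obtain ⟨h1, h2, h3⟩ := tilted_integral (s := B ∩ Set.Ioi r) (g := fun x => -((x - r) / v))
    (h := fun x => x ^ 2 / (2 * v)) (hB.inter measurableSet_Ioi)
    (fun x hx => by
      have := div_pos (sub_pos.2 (Set.mem_Ioi.1 hx.2)) hv'
      linarith)
    (by
      filter_upwards [ae_restrict_mem (hB.inter measurableSet_Ioi)] with x hx
      have := div_pos (sub_pos.2 (Set.mem_Ioi.1 hx.2)) hv'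
      linarith)
    (fun m => by
      have := (integrable_tilt (-m) r hv).integrableOn (s := B ∩ Set.Ioi r)
      simpa only [neg_mul_comm] using this)
  rw [heq]
  exact ⟨h1.comp fun a b hab => neg_le_neg hab, h2.comp continuous_neg,
    h3.comp tendsto_neg_atBot_atTop⟩

omit hB in
lemma tiltedMass_pos {s : Set ℝ} (hs : volume s ≠ 0) (m : ℝ) : 0 < tiltedMass v r s m := by
  rw [tiltedMass, integral_pos_iff_support_of_nonneg (fun _ => (Real.exp_pos _).le)
    (integrable_tilt m r hv).integrableOn]
  have : (Function.support fun x : ℝ => Real.exp (m * ((x - r) / v) - x ^ 2 / (2 * v))) =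
      Set.univ := by
    ext x; simp [(Real.exp_pos _).ne']
  rw [this, Measure.restrict_apply_univ]
  exact pos_iff_ne_zero.2 hs

omit hB hv in
lemma volume_inter_ne_zero_of_mem_nhds (hr : B ∈ 𝓝 r) :
    volume (B ∩ Set.Iic r) ≠ 0 ∧ volume (B ∩ Set.Ioi r) ≠ 0 := by
  obtain ⟨ε, hε, hsub⟩ := Metric.mem_nhds_iff.1 hr
  rw [Real.ball_eq_Ioo] at hsub
  constructor
  · refine ((lt_of_lt_of_le ?_ (measure_mono (show Set.Ioo (r - ε) r ⊆ _ from fun x hx =>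
      Set.mem_inter (hsub ⟨hx.1, by linarith [hx.2]⟩) (Set.mem_Iic.2 hx.2.le))))).ne'
    simp [hε]
  · refine ((lt_of_lt_of_le ?_ (measure_mono (show Set.Ioo r (r + ε) ⊆ _ from fun x hx =>
      Set.mem_inter (hsub ⟨by linarith [hx.1], hx.2⟩) (Set.mem_Ioi.2 hx.1))))).ne'
    simp [hε]

/-- The truncated normal distribution is stochastically increasing in its mean parameter
(monotone likelihood ratio). -/
lemma truncCdf_antitone (hr : B ∈ 𝓝 r) : Antitone fun m => truncCdf B m v r := by
  intro m m' hm
  obtain ⟨hl, hu⟩ := volume_inter_ne_zero_of_mem_nhds hr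
  simp only [truncCdf_eq_tilt hB _ r hv]
  have a1 := (tiltedMass_left hB hv (r := r)).1 hm
  have b1 := (tiltedMass_right hB hv (r := r)).1 hm
  have a0 := tiltedMass_pos hv (r := r) hl m
  have b0 := tiltedMass_pos hv (r := r) hu m
  have a0' := tiltedMass_pos hv (r := r) hl m'
  have b0' := tiltedMass_pos hv (r := r) hu m'
  rw [div_le_div_iff₀ (by positivity) (by positivity)]
  nlinarith

/-- At an interior point of the truncation set every level in `(0, 1)` is attained by the
truncated normal distribution function for some mean parameter. -/
lemma exists_truncCdf_eq (hr : B ∈ 𝓝 r) {q : ℝ} (hq0 : 0 < q) (hq1 : q < 1) :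
    ∃ m, truncCdf B m v r = q := by
  obtain ⟨hl, hu⟩ := volume_inter_ne_zero_of_mem_nhds hr
  obtain ⟨amono, acont, alim⟩ := tiltedMass_left hB hv (r := r)
  obtain ⟨bmono, bcont, blim⟩ := tiltedMass_right hB hv (r := r)
  have apos := tiltedMass_pos hv (r := r) hl
  have bpos := tiltedMass_pos hv (r := r) hu
  have hcont : Continuous fun m => truncCdf B m v r := by
    simp only [truncCdf_eq_tilt hB _ r hv]
    exact acont.div (acont.add bcont) fun m => (add_pos (apos m) (bpos m)).ne'
  refine mem_range_of_exists_le_of_exists_ge hcont ?_ ?_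
  · have h1 : ∀ᶠ m in atTop, tiltedMass v r (B ∩ Set.Iic r) m <
        q * tiltedMass v r (B ∩ Set.Ioi r) 0 :=
      alim.eventually_lt_const (mul_pos hq0 (bpos 0))
    obtain ⟨m, hm, hm0⟩ := (h1.and (eventually_ge_atTop 0)).exists
    refine ⟨m, ?_⟩
    rw [truncCdf_eq_tilt hB _ r hv, div_le_iff₀ (add_pos (apos m) (bpos m))]
    nlinarith [bmono hm0, apos m]
  · have h1 : ∀ᶠ m in atBot, tiltedMass v r (B ∩ Set.Ioi r) m <
        (1 - q) * tiltedMass v r (B ∩ Set.Iic r) 0 :=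
      blim.eventually_lt_const (mul_pos (by linarith) (apos 0))
    obtain ⟨m, hm, hm0⟩ := (h1.and (eventually_le_atBot 0)).exists
    refine ⟨m, ?_⟩
    rw [truncCdf_eq_tilt hB _ r hv, le_div_iff₀ (add_pos (apos m) (bpos m))]
    nlinarith [amono hm0, bpos m]

end

/-! ### Perturbation of the parameters -/

/-- An integrable function that dominates the effect of small changes of the parameters on the
standard normal density. The exponential dominates, up to the factor `2`, all normal densities
with mean in `[-1/2, 1/2]` and variance in `[1/2, 3/2]`, and `3 (1 + x²)` dominates the change of
the logarithm of the density, relative to the size of the change of the parameters. -/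
def perturbDensity (x : ℝ) : ℝ := 9 * (1 + x ^ 2) * Real.exp (-x ^ 2 / 8)

/-- The finite measure with density `perturbDensity`. -/
def perturbMeasure : Measure ℝ := volume.withDensity fun x => ENNReal.ofReal (perturbDensity x)

lemma perturbDensity_nonneg (x : ℝ) : 0 ≤ perturbDensity x := by
  unfold perturbDensity; positivity

lemma integrable_perturbDensity : Integrable perturbDensity := by
  have h1 : Integrable fun x : ℝ => Real.exp (-(1 / 8) * x ^ 2) :=
    integrable_exp_neg_mul_sq (by norm_num)
  have h2 : Integrable fun x : ℝ => x ^ (2 : ℝ) * Real.exp (-(1 / 8) * x ^ 2) :=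
    integrable_rpow_mul_exp_neg_mul_sq (by norm_num) (by norm_num)
  refine ((h1.add h2).const_mul 9).congr (Eventually.of_forall fun x => ?_)
  simp only [Pi.add_apply, perturbDensity, Real.rpow_two]
  rw [show -(1 / 8) * x ^ 2 = -x ^ 2 / 8 by ring]
  ring

instance : IsFiniteMeasure perturbMeasure :=
  isFiniteMeasure_withDensity_ofReal integrable_perturbDensity.2

lemma perturbMeasure_real {s : Set ℝ} (hs : MeasurableSet s) :
    perturbMeasure.real s = ∫ x in s, perturbDensity x := by
  rw [measureReal_def, perturbMeasure, withDensity_apply _ hs,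
    ← ofReal_integral_eq_lintegral_ofReal integrable_perturbDensity.integrableOn
      (Eventually.of_forall perturbDensity_nonneg),
    ENNReal.toReal_ofReal (integral_nonneg perturbDensity_nonneg)]

lemma abs_exp_sub_exp_le (a b : ℝ) :
    |Real.exp a - Real.exp b| ≤ |a - b| * (Real.exp a + Real.exp b) := by
  have key : ∀ a b : ℝ, b ≤ a → |Real.exp a - Real.exp b| ≤ |a - b| * (Real.exp a + Real.exp b) := by
    intro a b hab
    rw [abs_of_nonneg (sub_nonneg.2 (Real.exp_le_exp.2 hab)), abs_of_nonneg (sub_nonneg.2 hab)]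
    have h1 : Real.exp b = Real.exp a * Real.exp (b - a) := by rw [← Real.exp_add]; ring_nf
    have h2 := Real.add_one_le_exp (b - a)
    have h3 := Real.exp_pos a
    have h4 := Real.exp_pos b
    nlinarith [mul_nonneg (sub_nonneg.2 hab) h4.le]
  rcases le_total b a with h | h
  · exact key a b h
  · rw [abs_sub_comm, abs_sub_comm a, add_comm]; exact key b a h

/-- Write both densities as exponentials of quadratic functions and use that `exp` is locally
Lipschitz. -/
lemma gaussianPDFReal_perturb {θ d : ℝ} {w : ℝ≥0} (hd : d ≤ 1 / 2) (hθ : |θ| ≤ d)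
    (hw : |(w : ℝ) - 1| ≤ d) (x : ℝ) :
    |gaussianPDFReal θ w x - gaussianPDFReal 0 1 x| ≤ d * perturbDensity x := by
  obtain ⟨hw1, hw2⟩ := abs_le.1 hw
  obtain ⟨hθ1, hθ2⟩ := abs_le.1 hθ
  have hd0 : 0 ≤ d := (abs_nonneg _).trans hθ
  have hw0 : (1 / 2 : ℝ) ≤ w := by linarith
  have hwpos : (0 : ℝ) < w := by linarith
  have h2pi : 1 ≤ 2 * Real.pi * w := by nlinarith [Real.pi_gt_three]
  have hform : ∀ (m : ℝ) (u : ℝ≥0), (0 : ℝ) < u → gaussianPDFReal m u x =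
      Real.exp (-(Real.log (2 * Real.pi * u)) / 2 - (x - m) ^ 2 / (2 * u)) := by
    intro m u hu
    have hp : 0 < 2 * Real.pi * u := by positivity
    rw [gaussianPDFReal, Real.sqrt_eq_rpow, ← Real.rpow_neg hp.le, Real.rpow_def_of_pos hp,
      ← Real.exp_add]
    congr 1; ring
  have hA : gaussianPDFReal θ w x ≤ 2 * Real.exp (-x ^ 2 / 8) := by
    rw [gaussianPDFReal]
    have h1 : (√(2 * Real.pi * w))⁻¹ ≤ 1 := inv_le_one_of_one_le₀ (Real.one_le_sqrt.2 h2pi)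
    have h2 : -(x - θ) ^ 2 / (2 * w) ≤ 1 / 2 + -x ^ 2 / 8 := by
      have hq : (x - θ) ^ 2 / (2 * w) ≥ (x - θ) ^ 2 / 4 := by
        apply div_le_div_of_nonneg_left (sq_nonneg _) (by positivity) (by linarith)
      have : x ^ 2 / 2 - θ ^ 2 ≤ (x - θ) ^ 2 := by nlinarith [sq_nonneg (x - 2 * θ)]
      have : θ ^ 2 ≤ 1 := by nlinarith
      rw [neg_div]; linarith
    have h3 : Real.exp (1 / 2) ≤ 2 := by
      have h4 := Real.exp_one_lt_d9
      have h5 : Real.exp (1 / 2) ^ 2 = Real.exp 1 := by rw [← Real.exp_nat_mul]; norm_num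
      nlinarith [Real.exp_pos (1 / 2)]
    calc _ ≤ 1 * Real.exp (-(x - θ) ^ 2 / (2 * w)) :=
          mul_le_mul_of_nonneg_right h1 (Real.exp_pos _).le
      _ ≤ Real.exp (1 / 2 + -x ^ 2 / 8) := by rw [one_mul]; gcongr
      _ = Real.exp (1 / 2) * Real.exp (-x ^ 2 / 8) := Real.exp_add _ _
      _ ≤ _ := mul_le_mul_of_nonneg_right h3 (Real.exp_pos _).le
  have hB : gaussianPDFReal 0 1 x ≤ Real.exp (-x ^ 2 / 8) := by
    rw [gaussianPDFReal]
    have h1 : (√(2 * Real.pi * (1 : ℝ≥0)))⁻¹ ≤ 1 := by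
      refine inv_le_one_of_one_le₀ (Real.one_le_sqrt.2 ?_)
      rw [NNReal.coe_one]; nlinarith [Real.pi_gt_three]
    calc _ ≤ 1 * Real.exp (-(x - 0) ^ 2 / (2 * (1 : ℝ≥0))) :=
          mul_le_mul_of_nonneg_right h1 (Real.exp_pos _).le
      _ ≤ _ := by
        rw [one_mul, NNReal.coe_one, sub_zero]
        refine Real.exp_le_exp.2 ?_
        linarith [sq_nonneg x]
  have hlog : |Real.log w| ≤ 2 * d := by
    rw [abs_le]
    constructor
    · have h1 := Real.log_le_sub_one_of_pos (inv_pos.2 hwpos)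
      rw [Real.log_inv] at h1
      have h2 : (w : ℝ)⁻¹ - 1 ≤ 2 * d := by
        rw [inv_eq_one_div, div_sub_one hwpos.ne', div_le_iff₀ hwpos]; nlinarith
      linarith
    · have := Real.log_le_sub_one_of_pos hwpos; linarith
  have hexp : |(-(Real.log (2 * Real.pi * w)) / 2 - (x - θ) ^ 2 / (2 * w)) -
      (-(Real.log (2 * Real.pi * (1 : ℝ≥0))) / 2 - (x - 0) ^ 2 / (2 * (1 : ℝ≥0)))| ≤
      3 * d * (1 + x ^ 2) := by
    rw [Real.log_mul (by positivity) hwpos.ne', NNReal.coe_one, mul_one, mul_one, sub_zero]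
    have h1 : (-(Real.log (2 * Real.pi) + Real.log w) / 2 - (x - θ) ^ 2 / (2 * w)) -
        (-Real.log (2 * Real.pi) / 2 - x ^ 2 / 2) =
        -(Real.log w / 2) + ((w - 1) * x ^ 2 + 2 * x * θ - θ ^ 2) / (2 * w) := by
      field_simp; ring
    rw [h1]
    have h2 : |((w - 1) * x ^ 2 + 2 * x * θ - θ ^ 2) / (2 * w)| ≤ 2 * d * (1 + x ^ 2) := by
      rw [abs_div, abs_of_pos (show (0 : ℝ) < 2 * w by positivity), div_le_iff₀ (by positivity)]
      have h3 : |((w : ℝ) - 1) * x ^ 2 + 2 * x * θ - θ ^ 2| ≤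
          |((w : ℝ) - 1) * x ^ 2| + |2 * x * θ| + |θ ^ 2| :=
        (abs_sub _ _).trans (add_le_add_left (abs_add_le _ _) _)
      have h4 : |((w : ℝ) - 1) * x ^ 2| ≤ d * x ^ 2 := by
        rw [abs_mul, abs_of_nonneg (sq_nonneg x)]
        exact mul_le_mul_of_nonneg_right hw (sq_nonneg x)
      have h5 : |2 * x * θ| ≤ (1 + x ^ 2) * d := by
        rw [abs_mul]
        refine mul_le_mul ?_ hθ (abs_nonneg _) (by positivity)
        rw [abs_le]; constructor <;> nlinarith [sq_nonneg (x - 1), sq_nonneg (x + 1)]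
      have h6 : |θ ^ 2| ≤ d := by
        rw [abs_of_nonneg (sq_nonneg _), ← sq_abs]; nlinarith [abs_nonneg θ]
      have h7 : d * (1 + x ^ 2) * 2 ≤ 2 * d * (1 + x ^ 2) * (2 * w) := by
        have : 0 ≤ d * (1 + x ^ 2) := by positivity
        nlinarith
      linarith
    have h8 : |-(Real.log w / 2)| ≤ d := by
      rw [abs_neg, abs_div, abs_two]; linarith
    refine (abs_add_le _ _).trans ?_
    nlinarith [sq_nonneg x]
  rw [hform θ w hwpos] at hA ⊢
  rw [hform 0 1 (by simp)] at hB ⊢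
  refine (abs_exp_sub_exp_le _ _).trans ?_
  calc _ ≤ 3 * d * (1 + x ^ 2) * (2 * Real.exp (-x ^ 2 / 8) + Real.exp (-x ^ 2 / 8)) :=
        mul_le_mul hexp (add_le_add hA hB) (by positivity) (by positivity)
    _ = d * perturbDensity x := by rw [perturbDensity]; ring

lemma gaussianReal_real_perturb {θ d : ℝ} {w : ℝ≥0} (hd : d ≤ 1 / 2) (hθ : |θ| ≤ d)
    (hw : |(w : ℝ) - 1| ≤ d) {s : Set ℝ} (hs : MeasurableSet s) :
    |(gaussianReal θ w).real s - (gaussianReal 0 1).real s| ≤ d * perturbMeasure.real s := by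
  have hw0 : w ≠ 0 := by
    rintro rfl
    rw [NNReal.coe_zero] at hw; norm_num at hw; linarith
  have h : ∀ (m : ℝ) (u : ℝ≥0), u ≠ 0 →
      (gaussianReal m u).real s = ∫ x in s, gaussianPDFReal m u x := fun m u hu => by
    rw [measureReal_def, gaussianReal_apply_eq_integral m hu, ENNReal.toReal_ofReal
      (integral_nonneg fun x => gaussianPDFReal_nonneg m u x)]
  rw [h θ w hw0, h 0 1 one_ne_zero, perturbMeasure_real hs, ← integral_const_mul,
    ← integral_sub (integrable_gaussianPDFReal θ w).integrableOn
      (integrable_gaussianPDFReal 0 1).integrableOn]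
  refine (abs_integral_le_integral_abs).trans (integral_mono ?_ ?_ fun x =>
    gaussianPDFReal_perturb hd hθ hw x)
  · exact ((integrable_gaussianPDFReal θ w).sub (integrable_gaussianPDFReal 0 1)).integrableOn.abs
  · exact (integrable_perturbDensity.const_mul d).integrableOn

/-- The truncated distribution function is stable under small changes of the parameters, unless
the truncation set has exceptionally small probability. -/
lemma truncCdf_perturb {θ d κ : ℝ} {w : ℝ≥0} (hd : d ≤ 1 / 2) (hθ : |θ| ≤ d)
    (hw : |(w : ℝ) - 1| ≤ d) {B : Set ℝ} (hB : MeasurableSet B) (hκ : κ ≤ 1 / 2)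
    (hpos : 0 < (gaussianReal 0 1).real B)
    (hG : d * perturbMeasure.real B ≤ κ * (gaussianReal 0 1).real B) (r : ℝ) :
    |truncCdf B θ w r - truncCdf B 0 1 r| ≤ 4 * κ := by
  have hd0 : 0 ≤ d := (abs_nonneg _).trans hθ
  rw [truncCdf_eq hB, truncCdf_eq hB]
  have h1 := gaussianReal_real_perturb hd hθ hw hB
  have h2 := gaussianReal_real_perturb hd hθ hw (hB.inter (measurableSet_Iic (a := r)))
  have h3 : perturbMeasure.real (B ∩ Set.Iic r) ≤ perturbMeasure.real B :=
    measureReal_mono Set.inter_subset_left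
  have h4 : (gaussianReal 0 1).real (B ∩ Set.Iic r) ≤ (gaussianReal 0 1).real B :=
    measureReal_mono Set.inter_subset_left
  have h5 : (0 : ℝ) ≤ (gaussianReal 0 1).real (B ∩ Set.Iic r) := measureReal_nonneg
  set a' := (gaussianReal θ w).real (B ∩ Set.Iic r)
  set b' := (gaussianReal θ w).real B
  set a := (gaussianReal 0 1).real (B ∩ Set.Iic r)
  set b := (gaussianReal 0 1).real B
  have h6 : |b' - b| ≤ κ * b := h1.trans hG
  have h7 : |a' - a| ≤ κ * b := h2.trans ((mul_le_mul_of_nonneg_left h3 hd0).trans hG)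
  have hb' : b / 2 ≤ b' := by
    have := (abs_le.1 h6).1; nlinarith
  have hb'0 : 0 < b' := by linarith
  have hκ0 : 0 ≤ κ * b := (abs_nonneg _).trans h6
  rw [div_sub_div _ _ hb'0.ne' hpos.ne', abs_div, abs_of_pos (mul_pos hb'0 hpos),
    div_le_iff₀ (mul_pos hb'0 hpos)]
  have h8 : a' * b - b' * a = (a' - a) * b - a * (b' - b) := by ring
  rw [h8]
  calc |(a' - a) * b - a * (b' - b)| ≤ |(a' - a) * b| + |a * (b' - b)| := abs_sub _ _
    _ = |a' - a| * b + a * |b' - b| := by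
        rw [abs_mul, abs_mul, abs_of_pos hpos, abs_of_nonneg h5]
    _ ≤ (κ * b) * b + b * (κ * b) :=
        add_le_add (mul_le_mul_of_nonneg_right h7 hpos.le)
          (mul_le_mul h4 h6 (abs_nonneg _) hpos.le)
    _ ≤ 4 * κ * (b' * b) := by nlinarith

/-! ### The probability integral transform -/

/-- Under an atomless law the distribution function at the sample point falls into the tails
`(-∞, a]` and `[1 - a, ∞)` with probability at most `2 a`. -/
lemma prob_cdf_tails_le (ν : Measure ℝ) [IsProbabilityMeasure ν] [NullSingletonClass ν] (a : ℝ) :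
    ν {t | ν.real (Set.Iic t) ≤ a ∨ 1 - a ≤ ν.real (Set.Iic t)} ≤ 2 * ENNReal.ofReal a := by
  have hmono : Monotone fun t => ν.real (Set.Iic t) := fun s t hst =>
    measureReal_mono (Set.Iic_subset_Iic.2 hst)
  have hl : ν {t | ν.real (Set.Iic t) ≤ a} ≤ ENNReal.ofReal a := by
    rw [(measurableSet_le hmono.measurable measurable_const).measure_eq_iSup_isCompact]
    refine iSup₂_le fun K hK => iSup_le fun hKc => ?_
    rcases K.eq_empty_or_nonempty with rfl | hne
    · simp
    · obtain ⟨t, ht, htmax⟩ := hKc.exists_isGreatest hne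
      calc ν K ≤ ν (Set.Iic t) := measure_mono htmax
        _ = ENNReal.ofReal (ν.real (Set.Iic t)) := (ofReal_measureReal).symm
        _ ≤ _ := ENNReal.ofReal_le_ofReal (hK ht)
  have hu : ν {t | 1 - a ≤ ν.real (Set.Iic t)} ≤ ENNReal.ofReal a := by
    rw [(measurableSet_le measurable_const hmono.measurable).measure_eq_iSup_isCompact]
    refine iSup₂_le fun K hK => iSup_le fun hKc => ?_
    rcases K.eq_empty_or_nonempty with rfl | hne
    · simp
    · obtain ⟨t, ht, htmin⟩ := hKc.exists_isLeast hne
      have h1 : ν.real (Set.Iic t)ᶜ = 1 - ν.real (Set.Iic t) :=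
        probReal_compl_eq_one_sub measurableSet_Iic
      have h2 : 1 - a ≤ ν.real (Set.Iic t) := hK ht
      calc ν K ≤ ν (Set.Ici t) := measure_mono htmin
        _ = ν (Set.Iic t)ᶜ := by rw [Set.compl_Iic]; exact (measure_congr Ioi_ae_eq_Ici).symm
        _ = ENNReal.ofReal (ν.real (Set.Iic t)ᶜ) := (ofReal_measureReal).symm
        _ ≤ _ := ENNReal.ofReal_le_ofReal (by linarith)
  rw [Set.ofPred_or, two_mul]
  exact (measure_union_le _ _).trans (add_le_add hl hu)

/-- The pivot of a standard normal variable truncated to `B` is uniform given `B`. -/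
lemma gaussian_truncCdf_tails_le {B : Set ℝ} (hB : MeasurableSet B) (a : ℝ) :
    gaussianReal 0 1 {t | t ∈ B ∧ (truncCdf B 0 1 t ≤ a ∨ 1 - a ≤ truncCdf B 0 1 t)} ≤
      2 * ENNReal.ofReal a * gaussianReal 0 1 B := by
  rcases eq_or_ne (gaussianReal 0 1 B) 0 with h0 | h0
  · rw [h0, mul_zero, nonpos_iff_eq_zero]
    exact measure_mono_null (fun t ht => ht.1) h0
  · have := cond_isProbabilityMeasure h0
    have hna : NullSingletonClass (gaussianReal 0 1)[|B] := by
      have := nullSingletonClass_gaussianReal (μ := 0) (v := 1) one_ne_zero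
      refine ⟨fun x => ?_⟩
      exact cond_absolutelyContinuous (measure_singleton x)
    have h1 := prob_cdf_tails_le (gaussianReal 0 1)[|B] a
    rw [cond_apply hB, ENNReal.inv_mul_le_iff h0 (measure_ne_top _ _), mul_comm] at h1
    exact h1

/-! ### The joint law of treatment, confounders and observed noise -/

section Law
variable {Ω : Type*} [MeasurableSpace Ω] {P : Measure Ω} [IsProbabilityMeasure P]
  {H : ℕ} {E : Type*} [MeasurableSpace E]

/-- Weak ignorability turns conditioning on the treatment `h` into a density: on the event
`{A = h}` the pair `(X, Y)` has the law of `(X, Y)` weighted by the propensity score. -/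
lemma map_restrict_eq_of_condIndep {A : Ω → Fin H} (hA : Measurable A) {X : Ω → E}
    (hX : Measurable X) {Y : Ω → ℝ} (hY : Measurable Y) (h : Fin H)
    (hci : CondIndepGiven P Y (assigned A h) X) {e : E → ℝ} (he : Measurable e)
    (hprop : P⟦A ⁻¹' {h} | MeasurableSpace.comap X inferInstance⟧ =ᵐ[P] fun ω => e (X ω))
    (hpos : ∀ᵐ ω ∂P, 0 < e (X ω) ∧ e (X ω) < 1) :
    (P.restrict (A ⁻¹' {h})).map (fun ω => (X ω, Y ω)) =
      (P.withDensity fun ω => ENNReal.ofReal (e (X ω))).map fun ω => (X ω, Y ω) := by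
  have hXY : Measurable fun ω => (X ω, Y ω) := hX.prodMk hY
  have hint : Integrable (fun ω => e (X ω)) P := by
    refine Integrable.of_bound (he.comp hX).aestronglyMeasurable 1 ?_
    filter_upwards [hpos] with ω hω
    rw [Real.norm_eq_abs, abs_of_pos hω.1]; exact hω.2.le
  refine Measure.ext_prod fun {B s} hB hs => ?_
  have hm : MeasurableSpace.comap X inferInstance ≤ (inferInstance : MeasurableSpace Ω) :=
    hX.comap_le
  have hT : assigned A h ⁻¹' {1} = A ⁻¹' {h} := by
    ext ω; simp [assigned]
  have hBm : MeasurableSet[MeasurableSpace.comap X inferInstance] (X ⁻¹' B) := ⟨B, hB, rfl⟩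
  have hYs : MeasurableSet (Y ⁻¹' s) := hY hs
  have hAh : MeasurableSet (A ⁻¹' {h}) := hA (measurableSet_singleton h)
  have h1 := hci s {1} hs (measurableSet_singleton 1)
  rw [hT] at h1
  have hYint : Integrable ((Y ⁻¹' s).indicator fun _ => (1 : ℝ)) P :=
    (integrable_const 1).indicator hYs
  have hprod : Integrable ((Y ⁻¹' s).indicator (fun _ => (1 : ℝ)) * fun ω => e (X ω)) P := by
    have : (Y ⁻¹' s).indicator (fun _ => (1 : ℝ)) * (fun ω => e (X ω)) =
        (Y ⁻¹' s).indicator fun ω => e (X ω) := by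
      ext ω; by_cases hω : ω ∈ Y ⁻¹' s <;> simp [Set.indicator, hω]
    rw [this]; exact hint.indicator hYs
  have h2 : P⟦Y ⁻¹' s ∩ A ⁻¹' {h} | MeasurableSpace.comap X inferInstance⟧ =ᵐ[P]
      P[(Y ⁻¹' s).indicator (fun _ => (1 : ℝ)) * (fun ω => e (X ω)) |
        MeasurableSpace.comap X inferInstance] := by
    have h3 := condExp_mul_of_stronglyMeasurable_right (μ := P)
      (m := MeasurableSpace.comap X inferInstance) (f := (Y ⁻¹' s).indicator fun _ => (1 : ℝ))
      (g := fun ω => e (X ω)) (he.comp (comap_measurable X)).stronglyMeasurable hprod hYint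
    refine h1.trans (EventuallyEq.trans ?_ h3.symm)
    filter_upwards [hprop] with ω hω
    rw [Pi.mul_apply, Pi.mul_apply, hω]
  have h4 := setIntegral_condExp hm ((integrable_const (1 : ℝ)).indicator (hYs.inter hAh)) hBm
    (μ := P)
  rw [setIntegral_congr_ae (hm _ hBm) (h2.mono fun ω hω _ => hω),
    setIntegral_condExp hm hprod hBm] at h4
  rw [Measure.map_apply hXY (hB.prod hs), Measure.map_apply hXY (hB.prod hs),
    Measure.restrict_apply (hXY (hB.prod hs)), withDensity_apply _ (hXY (hB.prod hs))]
  have e1 : (fun ω => (X ω, Y ω)) ⁻¹' B ×ˢ s = Y ⁻¹' s ∩ X ⁻¹' B := by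
    ext ω; simp [and_comm]
  have e2 : ∫ ω in X ⁻¹' B, ((Y ⁻¹' s).indicator (fun _ => (1 : ℝ)) * fun ω => e (X ω)) ω ∂P =
      ∫ ω in Y ⁻¹' s ∩ X ⁻¹' B, e (X ω) ∂P := by
    rw [← Measure.restrict_restrict hYs, ← integral_indicator hYs]
    refine integral_congr_ae (Eventually.of_forall fun ω => ?_)
    by_cases hω : ω ∈ Y ⁻¹' s <;> simp [Set.indicator, hω]
  have e3 : ∫ ω in X ⁻¹' B, (Y ⁻¹' s ∩ A ⁻¹' {h}).indicator (fun _ => (1 : ℝ)) ω ∂P =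
      P.real ((Y ⁻¹' s ∩ X ⁻¹' B) ∩ A ⁻¹' {h}) := by
    rw [integral_indicator (hYs.inter hAh), Measure.restrict_restrict (hYs.inter hAh)]
    simp only [integral_const, smul_eq_mul, mul_one, measureReal_restrict_apply_univ]
    congr 1; ext ω; simp only [Set.mem_inter_iff]; tauto
  rw [e2, e3] at h4
  rw [e1, ← ofReal_measureReal, ← h4, ofReal_integral_eq_lintegral_ofReal hint.integrableOn]
  exact ae_restrict_of_ae (hpos.mono fun ω hω => hω.1.le)

/-- The probability of receiving treatment `h` with confounders in `B`. -/
lemma measure_treat_inter {A : Ω → Fin H} (hA : Measurable A) {X : Ω → E}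
    (hX : Measurable X) (h : Fin H) {e : E → ℝ} (he : Measurable e)
    (hprop : P⟦A ⁻¹' {h} | MeasurableSpace.comap X inferInstance⟧ =ᵐ[P] fun ω => e (X ω))
    (hpos : ∀ᵐ ω ∂P, 0 < e (X ω) ∧ e (X ω) < 1) {B : Set E} (hB : MeasurableSet B) :
    P (A ⁻¹' {h} ∩ X ⁻¹' B) = ∫⁻ ω in X ⁻¹' B, ENNReal.ofReal (e (X ω)) ∂P := by
  have hci : CondIndepGiven P (fun _ => (0 : ℝ)) (assigned A h) X := by
    intro s t _ ht
    have hm : MeasurableSpace.comap X inferInstance ≤ (inferInstance : MeasurableSpace Ω) :=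
      hX.comap_le
    by_cases h0 : (0 : ℝ) ∈ s
    · have : (fun _ : Ω => (0 : ℝ)) ⁻¹' s = Set.univ := by ext; simp [h0]
      rw [this, Set.univ_inter, Set.indicator_univ, condExp_const hm]
      exact Eventually.of_forall fun ω => by simp
    · have : (fun _ : Ω => (0 : ℝ)) ⁻¹' s = ∅ := by ext; simp [h0]
      rw [this, Set.empty_inter, Set.indicator_empty]
      have : P[(fun _ => (0 : ℝ)) | MeasurableSpace.comap X inferInstance] = 0 := condExp_zero
      rw [this, zero_mul]
  have h1 := congrArg (fun m => m (B ×ˢ Set.univ))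
    (map_restrict_eq_of_condIndep hA hX measurable_const h hci he hprop hpos)
  have hXY : Measurable fun ω => (X ω, (0 : ℝ)) := hX.prodMk measurable_const
  have e1 : (fun ω => (X ω, (0 : ℝ))) ⁻¹' B ×ˢ Set.univ = X ⁻¹' B := by ext ω; simp
  rw [Measure.map_apply hXY (hB.prod MeasurableSet.univ),
    Measure.map_apply hXY (hB.prod MeasurableSet.univ), e1, Measure.restrict_apply (hX hB),
    withDensity_apply _ (hX hB)] at h1
  rw [Set.inter_comm]; exact h1

/-- The noise of arm `h` is independent of the treatment indicator and the confounders. -/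
lemma measure_treat_inter_noise {A : Ω → Fin H} (hA : Measurable A) {X : Ω → E}
    (hX : Measurable X) {φ : E → ℝ} (hφ : Measurable φ) {ε : Ω → ℝ} (hε : Measurable ε)
    (h : Fin H) (hci : CondIndepGiven P (fun ω => φ (X ω) + ε ω) (assigned A h) X)
    {e : E → ℝ} (he : Measurable e)
    (hprop : P⟦A ⁻¹' {h} | MeasurableSpace.comap X inferInstance⟧ =ᵐ[P] fun ω => e (X ω))
    (hpos : ∀ᵐ ω ∂P, 0 < e (X ω) ∧ e (X ω) < 1) (hindep : IndepFun ε X P)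
    {B : Set E} (hB : MeasurableSet B) {s : Set ℝ} (hs : MeasurableSet s) :
    P (A ⁻¹' {h} ∩ X ⁻¹' B ∩ ε ⁻¹' s) = P (A ⁻¹' {h} ∩ X ⁻¹' B) * P (ε ⁻¹' s) := by
  have hY : Measurable fun ω => φ (X ω) + ε ω := (hφ.comp hX).add hε
  have hXY : Measurable fun ω => (X ω, φ (X ω) + ε ω) := hX.prodMk hY
  set C : Set (E × ℝ) := {q | q.1 ∈ B ∧ q.2 - φ q.1 ∈ s} with hC
  have hCm : MeasurableSet C :=
    (measurable_fst hB).inter ((measurable_snd.sub (hφ.comp measurable_fst)) hs)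
  have h1 := congrArg (fun m => m C) (map_restrict_eq_of_condIndep hA hX hY h hci he hprop hpos)
  have e1 : (fun ω => (X ω, φ (X ω) + ε ω)) ⁻¹' C = X ⁻¹' B ∩ ε ⁻¹' s := by
    ext ω; simp [hC]
  rw [Measure.map_apply hXY hCm, Measure.map_apply hXY hCm, e1,
    Measure.restrict_apply ((hX hB).inter (hε hs)),
    withDensity_apply _ ((hX hB).inter (hε hs))] at h1
  rw [show A ⁻¹' {h} ∩ X ⁻¹' B ∩ ε ⁻¹' s = X ⁻¹' B ∩ ε ⁻¹' s ∩ A ⁻¹' {h} by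
    ext ω; simp only [Set.mem_inter_iff]; tauto, h1,
    measure_treat_inter hA hX h he hprop hpos hB]
  have hF : Measurable fun x => B.indicator (fun x => ENNReal.ofReal (e x)) x :=
    (he.ennreal_ofReal).indicator hB
  have hG : Measurable fun x : ℝ => s.indicator (fun _ => (1 : ℝ≥0∞)) x :=
    measurable_const.indicator hs
  have h2 := lintegral_mul_eq_lintegral_mul_lintegral_of_indepFun (μ := P) (hF.comp hX)
    (hG.comp hε) (hindep.symm.comp hF hG)
  have e2 : ∫⁻ ω, ((fun x => B.indicator (fun x => ENNReal.ofReal (e x)) x) ∘ X) ω ∂P =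
      ∫⁻ ω in X ⁻¹' B, ENNReal.ofReal (e (X ω)) ∂P := by
    rw [← lintegral_indicator (hX hB)]; rfl
  have e3 : ∫⁻ ω, ((fun x : ℝ => s.indicator (fun _ => (1 : ℝ≥0∞)) x) ∘ ε) ω ∂P =
      P (ε ⁻¹' s) := by
    rw [← lintegral_indicator_one (hε hs)]; rfl
  rw [e2, e3] at h2
  rw [← h2, ← lintegral_indicator ((hX hB).inter (hε hs))]
  refine lintegral_congr fun ω => ?_
  by_cases h3 : X ω ∈ B <;> by_cases h4 : ε ω ∈ s <;> simp [Set.indicator, h3, h4]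

/-- Treatment and confounders are independent of the observed noise `ε^{(A)}`, whose
standardization is standard normal. -/
lemma map_obs_eq_prod {A : Ω → Fin H} (hA : Measurable A) {X : Ω → E}
    (hX : Measurable X) {φ : Fin H → E → ℝ} (hφ : ∀ h, Measurable (φ h)) {ε : Fin H → Ω → ℝ}
    (hε : ∀ h, Measurable (ε h))
    (hci : ∀ h, CondIndepGiven P (fun ω => φ h (X ω) + ε h ω) (assigned A h) X)
    {e : Fin H → E → ℝ} (he : ∀ h, Measurable (e h))
    (hprop : ∀ h, P⟦A ⁻¹' {h} | MeasurableSpace.comap X inferInstance⟧ =ᵐ[P] fun ω => e h (X ω))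
    (hpos : ∀ h, ∀ᵐ ω ∂P, 0 < e h (X ω) ∧ e h (X ω) < 1) (hindep : ∀ h, IndepFun (ε h) X P)
    {σ : ℝ} (hσ : 0 < σ) (hgauss : ∀ h, P.map (ε h) = gaussianReal 0 (σ ^ 2).toNNReal) :
    P.map (fun ω => ((A ω, X ω), ε (A ω) ω / σ)) =
      (P.map fun ω => (A ω, X ω)).prod (gaussianReal 0 1) := by
  have hAX : Measurable fun ω => (A ω, X ω) := hA.prodMk hX
  have hz : Measurable fun ω => ε (A ω) ω / σ := by
    refine Measurable.div_const ?_ _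
    exact (measurable_from_prod_countable_left fun h => hε h : Measurable
      fun q : Ω × Fin H => ε q.2 q.1).comp (measurable_id.prodMk hA)
  have hstd : ∀ h, P.map (fun ω => ε h ω / σ) = gaussianReal 0 1 := by
    intro h
    have : (fun ω => ε h ω / σ) = (fun x => x / σ) ∘ ε h := rfl
    rw [this, ← Measure.map_map (by fun_prop) (hε h), hgauss h, gaussianReal_map_div_const,
      zero_div]
    congr 1
    ext
    simp [hσ.ne', sq_nonneg]
  refine Measure.ext_prod fun {D s} hD hs => ?_
  rw [Measure.map_apply (hAX.prodMk hz) (hD.prod hs), Measure.prod_prod,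
    Measure.map_apply hAX hD]
  have hDh : ∀ h, MeasurableSet {x | (h, x) ∈ D} := fun h => measurable_prodMk_left hD
  have hdec : ∀ G : Set Ω, MeasurableSet G → P G = ∑ h, P (A ⁻¹' {h} ∩ G) := by
    intro G hG
    rw [← measure_biUnion_finset]
    · congr 1; ext ω; simp
    · intro a _ b _ hab
      exact Set.disjoint_left.2 fun ω h1 h2 => hab (by
        have := h1.1; have := h2.1; simp_all)
    · exact fun h _ => (hA (measurableSet_singleton h)).inter hG
  rw [hdec _ ((hAX.prodMk hz) (hD.prod hs)), hdec _ (hAX hD), Finset.sum_mul]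
  refine Finset.sum_congr rfl fun h _ => ?_
  have e1 : A ⁻¹' {h} ∩ (fun ω => ((A ω, X ω), ε (A ω) ω / σ)) ⁻¹' D ×ˢ s =
      A ⁻¹' {h} ∩ X ⁻¹' {x | (h, x) ∈ D} ∩ (ε h) ⁻¹' ((fun x => x / σ) ⁻¹' s) := by
    ext ω
    simp only [Set.mem_inter_iff, Set.mem_preimage, Set.mem_singleton_iff, Set.mem_prod,
      Set.mem_ofPred_eq, and_assoc]
    refine and_congr_right fun h1 => ?_
    rw [h1]
  have e2 : A ⁻¹' {h} ∩ (fun ω => (A ω, X ω)) ⁻¹' D = A ⁻¹' {h} ∩ X ⁻¹' {x | (h, x) ∈ D} := by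
    ext ω
    simp only [Set.mem_inter_iff, Set.mem_preimage, Set.mem_singleton_iff, Set.mem_ofPred_eq]
    refine and_congr_right fun h1 => ?_
    rw [h1]
  have hsm : MeasurableSet ((fun x : ℝ => x / σ) ⁻¹' s) := (measurable_id.div_const σ) hs
  rw [e1, e2, measure_treat_inter_noise hA hX (hφ h) (hε h) h (hci h) (he h) (hprop h) (hpos h)
    (hindep h) (hDh h) hsm, ← hstd h, Measure.map_apply ((hε h).div_const σ) hs]
  rfl

end Law

section Observation
variable {Ω : Type*} [MeasurableSpace Ω] {P : Measure Ω} {α : Type*} [MeasurableSpace α]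
  {π : Measure α} {D : ℕ → Ω → α} {Z : ℕ → Ω → ℝ}

/-- Independent observations: the treatment and confounders `D i` of individual `i` have the law
`π`, and are independent of its standardised noise `Z i`, which is standard normal. -/
structure IsObservation (P : Measure Ω) (π : Measure α) (D : ℕ → Ω → α) (Z : ℕ → Ω → ℝ) :
    Prop where
  measurable_data : ∀ i, Measurable (D i)
  measurable_noise : ∀ i, Measurable (Z i)
  indep : iIndepFun (fun i ω => (D i ω, Z i ω)) P
  law : ∀ i, P.map (fun ω => (D i ω, Z i ω)) = π.prod (gaussianReal 0 1)

lemma IsObservation.measurable_vector (h : IsObservation P π D Z) (n : ℕ) :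
    Measurable fun ω => (fun i : Fin n => D i ω, fun i : Fin n => Z i ω) :=
  (measurable_pi_lambda _ fun i : Fin n => h.measurable_data i).prodMk
    (measurable_pi_lambda _ fun i : Fin n => h.measurable_noise i)

variable [IsProbabilityMeasure π]

lemma IsObservation.law_vector (h : IsObservation P π D Z) (n : ℕ) :
    P.map (fun ω => (fun i : Fin n => D i ω, fun i : Fin n => Z i ω)) =
      (Measure.pi fun _ => π).prod (Measure.pi fun _ => gaussianReal 0 1) := by
  have hm : ∀ i, Measurable fun ω => (D i ω, Z i ω) := fun i =>
    (h.measurable_data i).prodMk (h.measurable_noise i)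
  have h2 : iIndepFun (fun (i : Fin n) ω => (D i ω, Z i ω)) P :=
    h.indep.precomp Fin.val_injective
  have h3 := iIndepFun.map_fun_eq_pi_map (fun i : Fin n => (hm i).aemeasurable) h2
  simp only [h.law] at h3
  have h4 := (measurePreserving_arrowProdEquivProdArrow α ℝ (Fin n) (fun _ => π)
    (fun _ => gaussianReal 0 1)).map_eq
  rw [← h3, Measure.map_map (MeasurableEquiv.measurable _)
    (measurable_pi_lambda _ fun i : Fin n => hm i)] at h4
  exact h4

lemma IsObservation.law_data (h : IsObservation P π D Z) (n : ℕ) :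
    P.map (fun ω (i : Fin n) => D i ω) = Measure.pi fun _ => π := by
  have := congrArg (fun m => m.map Prod.fst) (h.law_vector n)
  simp only [Measure.map_map measurable_fst (h.measurable_vector n), Measure.map_fst_prod,
    measure_univ, one_smul] at this
  exact this

end Observation

lemma isObservation_of_iIndepFun {Ω : Type*} [MeasurableSpace Ω] {P : Measure Ω} {H : ℕ}
    {E : Type*} [MeasurableSpace E] {A : ℕ → Ω → Fin H} (hA : ∀ i, Measurable (A i))
    {X : ℕ → Ω → E} (hX : ∀ i, Measurable (X i)) {ε : ℕ → Fin H → Ω → ℝ}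
    (hε : ∀ i h, Measurable (ε i h))
    (hindep : iIndepFun (fun i ω => (A i ω, X i ω, fun h => ε i h ω)) P)
    {π : Measure (Fin H × E)} {σ : ℝ}
    (hlaw : ∀ i, P.map (fun ω => ((A i ω, X i ω), ε i (A i ω) ω / σ)) =
      π.prod (gaussianReal 0 1)) :
    IsObservation P π (fun i ω => (A i ω, X i ω)) (fun i ω => ε i (A i ω) ω / σ) := by
  have hev : Measurable fun q : (Fin H → ℝ) × Fin H => q.1 q.2 :=
    measurable_from_prod_countable_left fun h => measurable_pi_apply h
  have hg : Measurable fun q : Fin H × E × (Fin H → ℝ) => ((q.1, q.2.1), q.2.2 q.1 / σ) := by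
    refine Measurable.prodMk (by fun_prop) (Measurable.div_const ?_ _)
    exact hev.comp ((measurable_snd.comp measurable_snd).prodMk measurable_fst)
  have hm : ∀ i, Measurable fun ω => ((A i ω, X i ω), ε i (A i ω) ω / σ) := fun i =>
    hg.comp ((hA i).prodMk ((hX i).prodMk (measurable_pi_lambda _ fun h => hε i h)))
  exact ⟨fun i => (hA i).prodMk (hX i), fun i => measurable_snd.comp (hm i),
    hindep.comp (fun _ q => ((q.1, q.2.1), q.2.2 q.1 / σ)) fun _ => hg, hlaw⟩

/-! ### Decomposition of the standard Gaussian vector along a direction -/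

/-- The law of a vector of independent standard normal variables. -/
abbrev noiseLaw (n : ℕ) : Measure (Fin n → ℝ) := Measure.pi fun _ => gaussianReal 0 1

/-- Replacing the component along the unit vector `u` by an independent standard normal variable
does not change the law of a standard Gaussian vector. -/
lemma map_replace_component {n : ℕ} (u : Fin n → ℝ) (hu : u ⬝ᵥ u = 1) :
    ((noiseLaw n).prod (gaussianReal 0 1)).map
      (fun q : (Fin n → ℝ) × ℝ => q.1 + (q.2 - u ⬝ᵥ q.1) • u) = noiseLaw n := by
  have hT : Measurable fun q : (Fin n → ℝ) × ℝ => q.1 + (q.2 - u ⬝ᵥ q.1) • u := by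
    unfold dotProduct; fun_prop
  have htoLp : Measurable (WithLp.toLp 2 : (Fin n → ℝ) → EuclideanSpace ℝ (Fin n)) := by fun_prop
  have hinj : ∀ m₁ m₂ : Measure (Fin n → ℝ), m₁.map (WithLp.toLp 2) = m₂.map (WithLp.toLp 2) →
      m₁ = m₂ := fun m₁ m₂ h =>
    (MeasurableEquiv.toLp 2 (Fin n → ℝ)).map_measurableEquiv_injective h
  apply hinj
  rw [map_pi_eq_stdGaussian, Measure.map_map htoLp hT]
  apply Measure.ext_of_charFun
  ext a
  have hm : AEMeasurable (WithLp.toLp 2 ∘ fun q : (Fin n → ℝ) × ℝ => q.1 + (q.2 - u ⬝ᵥ q.1) • u)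
      ((noiseLaw n).prod (gaussianReal 0 1)) := (htoLp.comp hT).aemeasurable
  set s : ℝ := u ⬝ᵥ a.ofLp with hs
  set b : EuclideanSpace ℝ (Fin n) := WithLp.toLp 2 (a.ofLp - s • u) with hb
  have hinner : ∀ q : (Fin n → ℝ) × ℝ,
      inner ℝ (WithLp.toLp 2 (q.1 + (q.2 - u ⬝ᵥ q.1) • u) : EuclideanSpace ℝ (Fin n)) a =
        inner ℝ (WithLp.toLp 2 q.1 : EuclideanSpace ℝ (Fin n)) b + q.2 * s := by
    intro q
    simp only [EuclideanSpace.inner_eq_star_dotProduct, star_trivial, hb, hs, dotProduct_add,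
      dotProduct_smul, sub_dotProduct, smul_dotProduct, smul_eq_mul]
    rw [dotProduct_comm u a.ofLp, dotProduct_comm u q.1]
    ring
  have h1 : charFun (((noiseLaw n).prod (gaussianReal 0 1)).map
      (WithLp.toLp 2 ∘ fun q : (Fin n → ℝ) × ℝ => q.1 + (q.2 - u ⬝ᵥ q.1) • u)) a =
      charFun (stdGaussian (EuclideanSpace ℝ (Fin n))) b * charFun (gaussianReal 0 1) s := by
    rw [charFun_apply, integral_map hm (by fun_prop), ← map_pi_eq_stdGaussian, charFun_apply,
      integral_map htoLp.aemeasurable (by fun_prop), charFun_apply_real, ← integral_prod_mul]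
    refine integral_congr_ae (Eventually.of_forall fun q => ?_)
    simp only [Function.comp_apply]
    rw [hinner, ← Complex.exp_add]
    congr 1
    push_cast
    ring
  rw [h1, charFun_stdGaussian, charFun_stdGaussian, charFun_gaussianReal, ← Complex.exp_add]
  congr 1
  have hnorm : ‖b‖ ^ 2 = ‖a‖ ^ 2 - s ^ 2 := by
    have e1 : ∀ x : EuclideanSpace ℝ (Fin n), ‖x‖ ^ 2 = x.ofLp ⬝ᵥ x.ofLp := fun x => by
      rw [EuclideanSpace.real_norm_sq_eq]; simp [dotProduct, sq]
    rw [e1, e1, hb]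
    simp only [sub_dotProduct, dotProduct_sub, smul_dotProduct, dotProduct_smul, hu, smul_eq_mul]
    rw [dotProduct_comm a.ofLp u, ← hs]
    ring
  rw [← Complex.ofReal_pow, hnorm]
  push_cast
  ring

/-- The component of a standard Gaussian vector along a unit vector `u` is standard normal and
independent of everything that does not depend on this component. -/
lemma noiseLaw_apply_of_invariant {n : ℕ} (u : Fin n → ℝ) (hu : u ⬝ᵥ u = 1)
    {D : Set ((Fin n → ℝ) × ℝ)} (hD : MeasurableSet D)
    (hinv : ∀ (z : Fin n → ℝ) (s t : ℝ), (z + s • u, t) ∈ D ↔ (z, t) ∈ D) :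
    noiseLaw n {z | (z, u ⬝ᵥ z) ∈ D} = ((noiseLaw n).prod (gaussianReal 0 1)) D := by
  have hT : Measurable fun q : (Fin n → ℝ) × ℝ => q.1 + (q.2 - u ⬝ᵥ q.1) • u := by
    unfold dotProduct; fun_prop
  have hm : MeasurableSet {z : Fin n → ℝ | (z, u ⬝ᵥ z) ∈ D} := by
    refine Measurable.prodMk measurable_id ?_ hD
    unfold dotProduct; fun_prop
  rw [← map_replace_component u hu, Measure.map_apply hT hm, map_replace_component u hu]
  congr 1
  ext ⟨z, t⟩
  have : u ⬝ᵥ (z + (t - u ⬝ᵥ z) • u) = t := by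
    rw [dotProduct_add, dotProduct_smul, hu, smul_eq_mul]; ring
  simp only [Set.mem_preimage, Set.mem_ofPred_eq, this]
  exact hinv z _ t

lemma exists_unit_smul {n : ℕ} {a : Fin n → ℝ} (ha : a ≠ 0) :
    0 < √(a ⬝ᵥ a) ∧ ((√(a ⬝ᵥ a))⁻¹ • a) ⬝ᵥ ((√(a ⬝ᵥ a))⁻¹ • a) = 1 := by
  have h0 : 0 < a ⬝ᵥ a := lt_of_le_of_ne (Finset.sum_nonneg fun i _ => mul_self_nonneg _)
    (Ne.symm fun h => ha (dotProduct_self_eq_zero.1 h))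
  refine ⟨Real.sqrt_pos.2 h0, ?_⟩
  rw [smul_dotProduct, dotProduct_smul, smul_eq_mul, smul_eq_mul, ← mul_assoc, ← mul_inv,
    Real.mul_self_sqrt h0.le, inv_mul_cancel₀ h0.ne']

/-- Affine hyperplanes are null sets of the standard Gaussian law. -/
lemma noiseLaw_hyperplane {n : ℕ} {a : Fin n → ℝ} (ha : a ≠ 0) (r : ℝ) :
    noiseLaw n {z | a ⬝ᵥ z = r} = 0 := by
  obtain ⟨h0, hu⟩ := exists_unit_smul ha
  have h1 := noiseLaw_apply_of_invariant _ hu (D := Set.univ ×ˢ {r / √(a ⬝ᵥ a)})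
    (MeasurableSet.univ.prod (measurableSet_singleton _)) (fun z s t => by simp)
  have := nullSingletonClass_gaussianReal (μ := 0) (v := 1) one_ne_zero
  rw [Measure.prod_prod, measure_singleton, mul_zero] at h1
  refine measure_mono_null (fun z hz => ?_) h1
  have hz' : a ⬝ᵥ z = r := hz
  simp only [Set.mem_ofPred_eq, Set.mem_prod, Set.mem_univ, true_and, Set.mem_singleton_iff,
    smul_dotProduct, hz', smul_eq_mul]
  rw [div_eq_inv_mul]

/-! ### The pivot of a Gaussian vector conditionally on the selection event -/

section RandomSet
variable {Θ : Type*} [MeasurableSpace Θ] {B : Θ → Set ℝ}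
  (hB : MeasurableSet {q : Θ × ℝ | q.2 ∈ B q.1})
include hB

lemma measurable_measure_randomSet (ν : Measure ℝ) [SFinite ν] :
    Measurable fun q => ν (B q) :=
  measurable_measure_prodMk_left hB

lemma measurable_truncCdf_randomSet :
    Measurable fun q : Θ × ℝ => truncCdf (B q.1) 0 1 q.2 := by
  have hBq : ∀ q, MeasurableSet (B q) := fun q => measurable_prodMk_left hB
  have h1 : MeasurableSet {w : (Θ × ℝ) × ℝ | w.2 ∈ B w.1.1 ∩ Set.Iic w.1.2} := by
    refine MeasurableSet.inter ?_ ?_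
    · exact (measurable_fst.fst.prodMk measurable_snd) hB
    · exact measurableSet_le measurable_snd measurable_fst.snd
  have h2 : Measurable fun q : Θ × ℝ => gaussianReal 0 1 (B q.1 ∩ Set.Iic q.2) :=
    measurable_measure_prodMk_left h1
  have h3 : Measurable fun q : Θ × ℝ => gaussianReal 0 1 (B q.1) :=
    (measurable_measure_randomSet hB (gaussianReal 0 1)).comp measurable_fst
  have h4 : (fun q : Θ × ℝ => truncCdf (B q.1) 0 1 q.2) = fun q =>
      (gaussianReal 0 1 (B q.1 ∩ Set.Iic q.2)).toReal / (gaussianReal 0 1 (B q.1)).toReal := by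
    ext q; rw [truncCdf_eq (hBq _)]; rfl
  rw [h4]
  exact h2.ennreal_toReal.div h3.ennreal_toReal

end RandomSet

section Pivot
variable {n : ℕ} {u : Fin n → ℝ} (hu : u ⬝ᵥ u = 1) {B : (Fin n → ℝ) → Set ℝ}
  (hB : MeasurableSet {q : (Fin n → ℝ) × ℝ | q.2 ∈ B q.1})
  (hinv : ∀ (z : Fin n → ℝ) (s : ℝ), B (z + s • u) = B z)
include hu hB hinv

/-- Conditionally on `u' z ∈ B z`, the exact pivot falls into the tails with probability at most
`2 a`. -/
lemma noiseLaw_pivot_tails_le (a : ℝ) :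
    noiseLaw n {z | u ⬝ᵥ z ∈ B z ∧ (truncCdf (B z) 0 1 (u ⬝ᵥ z) ≤ a ∨
      1 - a ≤ truncCdf (B z) 0 1 (u ⬝ᵥ z))} ≤
      2 * ENNReal.ofReal a * noiseLaw n {z | u ⬝ᵥ z ∈ B z} := by
  have hF := measurable_truncCdf_randomSet hB
  have hD : MeasurableSet {q : (Fin n → ℝ) × ℝ | q.2 ∈ B q.1 ∧
      (truncCdf (B q.1) 0 1 q.2 ≤ a ∨ 1 - a ≤ truncCdf (B q.1) 0 1 q.2)} :=
    hB.inter ((measurableSet_le hF measurable_const).union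
      (measurableSet_le measurable_const hF))
  have h1 := noiseLaw_apply_of_invariant u hu hD fun z s t => by
    simp only [Set.mem_ofPred_eq, hinv]
  have h2 := noiseLaw_apply_of_invariant u hu hB fun z s t => by
    simp only [Set.mem_ofPred_eq, hinv]
  simp only [Set.mem_ofPred_eq] at h1 h2
  rw [h1, h2, Measure.prod_apply hD, Measure.prod_apply hB, ← lintegral_const_mul]
  · refine lintegral_mono fun z => ?_
    exact gaussian_truncCdf_tails_le (measurable_prodMk_left hB) a
  · exact measurable_measure_randomSet hB _

/-- It is unlikely that `u' z` lies in a set `B z` whose probability is small compared with its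
`perturbMeasure`. -/
lemma noiseLaw_small_set_le {κ d : ℝ} (hκ : 0 < κ) (hd : 0 ≤ d) :
    noiseLaw n {z | u ⬝ᵥ z ∈ B z ∧
      κ * (gaussianReal 0 1).real (B z) < d * perturbMeasure.real (B z)} ≤
      ENNReal.ofReal (d / κ * perturbMeasure.real Set.univ) := by
  have hN := (measurable_measure_randomSet hB (gaussianReal 0 1)).ennreal_toReal
  have hG := (measurable_measure_randomSet hB perturbMeasure).ennreal_toReal
  have hD : MeasurableSet {q : (Fin n → ℝ) × ℝ | q.2 ∈ B q.1 ∧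
      κ * (gaussianReal 0 1).real (B q.1) < d * perturbMeasure.real (B q.1)} := by
    refine hB.inter (measurable_fst ?_ : MeasurableSet (Prod.fst ⁻¹' {z : Fin n → ℝ |
      κ * (gaussianReal 0 1).real (B z) < d * perturbMeasure.real (B z)}))
    exact measurableSet_lt (hN.const_mul κ) (hG.const_mul d)
  have h1 := noiseLaw_apply_of_invariant u hu hD fun z s t => by
    simp only [Set.mem_ofPred_eq, hinv]
  simp only [Set.mem_ofPred_eq] at h1
  rw [h1, Measure.prod_apply hD]
  calc _ ≤ ∫⁻ _, ENNReal.ofReal (d / κ * perturbMeasure.real Set.univ) ∂(noiseLaw n) := by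
        refine lintegral_mono fun z => ?_
        by_cases hz : κ * (gaussianReal 0 1).real (B z) < d * perturbMeasure.real (B z)
        · have h2 : (gaussianReal 0 1).real (B z) ≤ d / κ * perturbMeasure.real Set.univ := by
            have h3 : perturbMeasure.real (B z) ≤ perturbMeasure.real Set.univ :=
              measureReal_mono (Set.subset_univ _)
            rw [div_mul_eq_mul_div, le_div_iff₀ hκ]
            nlinarith [mul_le_mul_of_nonneg_left h3 hd]
          calc gaussianReal 0 1 _ ≤ gaussianReal 0 1 (B z) := measure_mono fun t ht => ht.1
            _ = ENNReal.ofReal ((gaussianReal 0 1).real (B z)) := (ofReal_measureReal).symm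
            _ ≤ _ := ENNReal.ofReal_le_ofReal h2
        · have : Prod.mk z ⁻¹' {q : (Fin n → ℝ) × ℝ | q.2 ∈ B q.1 ∧
              κ * (gaussianReal 0 1).real (B q.1) < d * perturbMeasure.real (B q.1)} = ∅ := by
            ext t; simp only [Set.mem_preimage, Set.mem_ofPred_eq, hz, and_false,
              Set.mem_empty_iff_false]
          rw [this, measure_empty]; exact zero_le
    _ = _ := by simp

end Pivot

/-! ### Orthogonality of inverse-probability-weighted residuals -/

section Residual
variable {H : ℕ} {E : Type*} [MeasurableSpace E]

/-- The function `e` is the propensity score of the treatment `h` when treatment and confounders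
have the joint law `π`, and satisfies positivity. -/
structure IsPropensity (π : Measure (Fin H × E)) (h : Fin H) (e : E → ℝ) : Prop where
  measurable : Measurable e
  pos : ∀ᵐ z ∂π, 0 < e z.2 ∧ e z.2 < 1
  apply_inter : ∀ B : Set E, MeasurableSet B →
    π (Prod.fst ⁻¹' {h} ∩ Prod.snd ⁻¹' B) = ∫⁻ z in Prod.snd ⁻¹' B, ENNReal.ofReal (e z.2) ∂π

/-- The residual `T^{(h)} / e^{(h)}(x) - 1` of the inverse probability weight. -/
def ipwRes (h : Fin H) (e : E → ℝ) (z : Fin H × E) : ℝ := (if z.1 = h then 1 else 0) / e z.2 - 1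

lemma measurableSet_fst_eq (h : Fin H) :
    MeasurableSet (Prod.fst ⁻¹' {h} : Set (Fin H × E)) :=
  measurable_fst (measurableSet_singleton h)

lemma measurable_ipwRes (h : Fin H) {e : E → ℝ} (he : Measurable e) :
    Measurable (ipwRes h e) := by
  refine Measurable.sub (Measurable.div ?_ (he.comp measurable_snd)) measurable_const
  exact Measurable.ite (measurableSet_fst_eq h) measurable_const measurable_const

variable {π : Measure (Fin H × E)} {h : Fin H} {e : E → ℝ}

lemma IsPropensity.map_restrict (hp : IsPropensity π h e) :
    (π.restrict (Prod.fst ⁻¹' {h})).map Prod.snd =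
      (π.map Prod.snd).withDensity fun x => ENNReal.ofReal (e x) := by
  ext B hB
  rw [Measure.map_apply measurable_snd hB, Measure.restrict_apply (measurable_snd hB),
    Set.inter_comm, hp.apply_inter B hB, withDensity_apply _ hB,
    setLIntegral_map hB hp.measurable.ennreal_ofReal measurable_snd]

lemma IsPropensity.pos_map (hp : IsPropensity π h e) :
    ∀ᵐ x ∂π.map Prod.snd, 0 < e x ∧ e x < 1 := by
  rw [ae_map_iff measurable_snd.aemeasurable]
  · exact hp.pos
  · exact (measurableSet_lt measurable_const hp.measurable).inter
      (measurableSet_lt hp.measurable measurable_const)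

variable [IsProbabilityMeasure π]

lemma IsPropensity.map_restrict_compl (hp : IsPropensity π h e) :
    (π.restrict (Prod.fst ⁻¹' {h})ᶜ).map Prod.snd =
      (π.map Prod.snd).withDensity fun x => ENNReal.ofReal (1 - e x) := by
  have hm1 : Measurable fun x => 1 - e x := measurable_const.sub hp.measurable
  ext B hB
  have hBm : MeasurableSet (Prod.snd ⁻¹' B : Set (Fin H × E)) := measurable_snd hB
  rw [Measure.map_apply measurable_snd hB, Measure.restrict_apply hBm, withDensity_apply _ hB,
    setLIntegral_map hB hm1.ennreal_ofReal measurable_snd]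
  have h1 := measure_inter_add_sdiff (μ := π) (Prod.snd ⁻¹' B) (measurableSet_fst_eq (E := E) h)
  have h2 := hp.apply_inter B hB
  have h3 : ∫⁻ z in Prod.snd ⁻¹' B, ENNReal.ofReal (e z.2) ∂π +
      ∫⁻ z in Prod.snd ⁻¹' B, ENNReal.ofReal (1 - e z.2) ∂π = π (Prod.snd ⁻¹' B) := by
    have hem : Measurable fun z : Fin H × E => ENNReal.ofReal (e z.2) :=
      (hp.measurable.comp measurable_snd).ennreal_ofReal
    rw [← lintegral_add_left hem,
      ← setLIntegral_one]
    refine lintegral_congr_ae (ae_restrict_of_ae (hp.pos.mono fun z hz => ?_))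
    simp only
    rw [← ENNReal.ofReal_add hz.1.le (by linarith)]; simp
  rw [Set.inter_comm, h2, ← h3] at h1
  have hfin : ∫⁻ z in Prod.snd ⁻¹' B, ENNReal.ofReal (e z.2) ∂π ≠ ∞ := by
    rw [← h2]; exact measure_ne_top _ _
  rw [← Set.sdiff_eq]
  exact (ENNReal.add_right_inj hfin).1 h1

/-- The residual has mean zero given the confounders. No integrability is needed: if the
integrand is not integrable, both sides are `0`. -/
lemma IsPropensity.integral_ipwRes_mul (hp : IsPropensity π h e) {g : E → ℝ}
    (hg : Measurable g) : ∫ z, ipwRes h e z * g z.2 ∂π = 0 := by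
  by_cases hint : Integrable (fun z => ipwRes h e z * g z.2) π
  swap
  · exact integral_undef hint
  have hm1 : Measurable fun x => 1 - e x := measurable_const.sub hp.measurable
  have hS := measurableSet_fst_eq (E := E) h
  rw [← integral_add_compl hS hint]
  have h1 : ∫ z in Prod.fst ⁻¹' {h}, ipwRes h e z * g z.2 ∂π =
      ∫ x, (1 - e x) * g x ∂π.map Prod.snd := by
    have e1 : ∫ z in Prod.fst ⁻¹' {h}, ipwRes h e z * g z.2 ∂π =
        ∫ z in Prod.fst ⁻¹' {h}, (1 / e z.2 - 1) * g z.2 ∂π := by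
      refine setIntegral_congr_fun hS fun z hz => ?_
      have : z.1 = h := hz
      simp [ipwRes, this]
    have e2 : ∫ z in Prod.fst ⁻¹' {h}, (1 / e z.2 - 1) * g z.2 ∂π =
        ∫ x, (1 / e x - 1) * g x ∂(π.restrict (Prod.fst ⁻¹' {h})).map Prod.snd := by
      rw [integral_map measurable_snd.aemeasurable]
      exact (((measurable_const.div hp.measurable).sub measurable_const).mul
        hg).aestronglyMeasurable
    rw [e1, e2, hp.map_restrict, integral_withDensity_eq_integral_toReal_smul
      hp.measurable.ennreal_ofReal (Eventually.of_forall fun _ => ENNReal.ofReal_lt_top)]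
    refine integral_congr_ae (hp.pos_map.mono fun x hx => ?_)
    simp only [ENNReal.toReal_ofReal hx.1.le, smul_eq_mul]
    rw [← mul_assoc, mul_sub, mul_one_div_cancel hx.1.ne', mul_one]
  have h2 : ∫ z in (Prod.fst ⁻¹' {h})ᶜ, ipwRes h e z * g z.2 ∂π =
      ∫ x, -((1 - e x) * g x) ∂π.map Prod.snd := by
    have e1 : ∫ z in (Prod.fst ⁻¹' {h})ᶜ, ipwRes h e z * g z.2 ∂π =
        ∫ z in (Prod.fst ⁻¹' {h})ᶜ, -g z.2 ∂π := by
      refine setIntegral_congr_fun hS.compl fun z hz => ?_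
      have : z.1 ≠ h := hz
      simp [ipwRes, this]
    have e2 : ∫ z in (Prod.fst ⁻¹' {h})ᶜ, -g z.2 ∂π =
        ∫ x, -g x ∂(π.restrict (Prod.fst ⁻¹' {h})ᶜ).map Prod.snd := by
      rw [integral_map measurable_snd.aemeasurable]
      exact hg.neg.aestronglyMeasurable
    rw [e1, e2, hp.map_restrict_compl, integral_withDensity_eq_integral_toReal_smul
      hm1.ennreal_ofReal
      (Eventually.of_forall fun _ => ENNReal.ofReal_lt_top)]
    refine integral_congr_ae (hp.pos_map.mono fun x hx => ?_)
    simp only [ENNReal.toReal_ofReal (sub_nonneg.2 hx.2.le), smul_eq_mul]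
    ring
  rw [h1, h2, integral_neg, add_neg_cancel]

end Residual

section Resample
variable {Z : Type*} [MeasurableSpace Z] {π : Measure Z} [IsProbabilityMeasure π] {n : ℕ}

lemma measurable_update_pair (i : Fin n) :
    Measurable fun q : Z × (Fin n → Z) => Function.update q.2 i q.1 :=
  measurable_pi_lambda _ fun k => by
    by_cases hk : k = i
    · subst hk; simpa using measurable_fst
    · simp only [Function.update_of_ne hk]; fun_prop

/-- Resampling one coordinate does not change the law of an i.i.d. vector. -/
lemma map_update_pi (i : Fin n) :
    (π.prod (Measure.pi fun _ : Fin n => π)).map (fun q => Function.update q.2 i q.1) =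
      Measure.pi fun _ : Fin n => π := by
  have hm : Measurable fun q : Z × (Fin n → Z) => Function.update q.2 i q.1 :=
    measurable_update_pair i
  refine (Measure.pi_eq fun s hs => ?_).symm
  rw [Measure.map_apply hm (MeasurableSet.univ_pi hs)]
  have : (fun q : Z × (Fin n → Z) => Function.update q.2 i q.1) ⁻¹' Set.univ.pi s =
      s i ×ˢ Set.univ.pi (Function.update s i Set.univ) := by
    ext ⟨z, d⟩
    simp only [Set.mem_preimage, Set.mem_univ_pi, Set.mem_prod]
    constructor
    · intro hq
      refine ⟨by simpa using hq i, fun k => ?_⟩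
      by_cases hk : k = i
      · subst hk; simp
      · simpa [Function.update_of_ne hk] using hq k
    · rintro ⟨h1, h2⟩ k
      by_cases hk : k = i
      · subst hk; simpa using h1
      · simpa [Function.update_of_ne hk] using h2 k
  rw [this, Measure.prod_prod, Measure.pi_pi]
  have h2 : ∏ k, π (Function.update s i Set.univ k) = ∏ k ∈ Finset.univ.erase i, π (s k) := by
    rw [← Finset.mul_prod_erase _ _ (Finset.mem_univ i)]
    simp only [Function.update_self, measure_univ, one_mul]
    refine Finset.prod_congr rfl fun k hk => ?_
    rw [Function.update_of_ne (Finset.ne_of_mem_erase hk)]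
  rw [h2, Finset.mul_prod_erase _ (fun k => π (s k)) (Finset.mem_univ i)]

end Resample

section Orthogonality
variable {H : ℕ} {E : Type*} [MeasurableSpace E] {π : Measure (Fin H × E)}
  [IsProbabilityMeasure π] {h : Fin H} {e : E → ℝ} {n : ℕ}

/-- `F` does not depend on the treatment of individual `i`. -/
def FreeOfTreat (i : Fin n) (F : (Fin n → Fin H × E) → ℝ) : Prop :=
  ∀ d a, F (Function.update d i (a, (d i).2)) = F d

omit [MeasurableSpace E] in
lemma FreeOfTreat.mul {i : Fin n} {F G : (Fin n → Fin H × E) → ℝ} (hF : FreeOfTreat i F)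
    (hG : FreeOfTreat i G) : FreeOfTreat i (fun d => F d * G d) := fun d a => by
  simp only [hF d a, hG d a]

omit [MeasurableSpace E] in
lemma freeOfTreat_snd (i : Fin n) (g : E → ℝ) :
    FreeOfTreat i fun d : Fin n → Fin H × E => g (d i).2 := fun d a => by simp

omit [MeasurableSpace E] in
lemma freeOfTreat_of_ne {i k : Fin n} (hik : k ≠ i) (g : Fin H × E → ℝ) :
    FreeOfTreat i fun d : Fin n → Fin H × E => g (d k) := fun d a => by
  simp [Function.update_of_ne hik]

/-- The residual of individual `i` is orthogonal to all functions that do not depend on the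
treatment of individual `i`. -/
lemma IsPropensity.integral_ipwRes_mul_of_free (hp : IsPropensity π h e) (i : Fin n)
    {F : (Fin n → Fin H × E) → ℝ} (hF : Measurable F) (hfree : FreeOfTreat i F) :
    ∫ d, ipwRes h e (d i) * F d ∂(Measure.pi fun _ : Fin n => π) = 0 := by
  by_cases hint : Integrable (fun d => ipwRes h e (d i) * F d) (Measure.pi fun _ : Fin n => π)
  swap
  · exact integral_undef hint
  have hm : Measurable fun q : (Fin H × E) × (Fin n → Fin H × E) => Function.update q.2 i q.1 :=
    measurable_update_pair i
  rw [← map_update_pi i] at hint ⊢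
  rw [integrable_map_measure hint.aestronglyMeasurable hm.aemeasurable] at hint
  rw [integral_map hm.aemeasurable]
  erw [integral_prod_symm _ hint]
  · refine integral_eq_zero_of_ae (Eventually.of_forall fun d => ?_)
    have h1 : ∀ z : Fin H × E, F (Function.update d i z) =
        F (Function.update d i ((d i).1, z.2)) := fun z => by
      have := hfree (Function.update d i z) (d i).1
      simpa using this.symm
    have hgm : Measurable fun x : E => F (Function.update d i ((d i).1, x)) := by
      refine hF.comp (measurable_pi_lambda _ fun k => ?_)
      by_cases hk : k = i
      · subst hk; simpa using measurable_const.prodMk measurable_id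
      · simp [Function.update_of_ne hk]
    refine Eq.trans (integral_congr_ae (Eventually.of_forall fun z => ?_))
      (hp.integral_ipwRes_mul hgm)
    change ipwRes h e (Function.update d i z i) * F (Function.update d i z) = _
    rw [Function.update_self, h1 z]
  · have hi : Measurable fun d : Fin n → Fin H × E => ipwRes h e (d i) :=
      (measurable_ipwRes h hp.measurable).comp (measurable_pi_apply i)
    exact (hi.mul hF).aestronglyMeasurable

end Orthogonality

/-! ### A variance bound for weighted sums of local averages -/

lemma sum_sum_symm_le {n : ℕ} (q : Fin n → Fin n → ℝ)
    (hsymm : ∀ i k, q i k = q k i) (hsum : ∀ i, ∑ k, q i k ≤ 1) (a : Fin n → ℝ)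
    (ha : ∀ i, 0 ≤ a i) : ∑ i, ∑ k, q i k * ((a i + a k) / 2) ≤ ∑ i, a i := by
  have h1 : ∑ i, ∑ k, q i k * (a k / 2) = ∑ i, ∑ k, q i k * (a i / 2) := by
    rw [Finset.sum_comm]
    exact Finset.sum_congr rfl fun i _ => Finset.sum_congr rfl fun k _ => by rw [hsymm]
  have h2 : ∑ i, ∑ k, q i k * ((a i + a k) / 2) = ∑ i, (∑ k, q i k) * a i := by
    calc _ = ∑ i, ∑ k, q i k * (a i / 2) + ∑ i, ∑ k, q i k * (a k / 2) := by
          rw [← Finset.sum_add_distrib]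
          refine Finset.sum_congr rfl fun i _ => ?_
          rw [← Finset.sum_add_distrib]
          exact Finset.sum_congr rfl fun k _ => by ring
      _ = _ := by
          rw [h1, ← Finset.sum_add_distrib]
          refine Finset.sum_congr rfl fun i _ => ?_
          rw [← Finset.sum_add_distrib, Finset.sum_mul]
          exact Finset.sum_congr rfl fun k _ => by ring
  rw [h2]
  exact Finset.sum_le_sum fun i _ => mul_le_of_le_one_left (ha i) (hsum i)

section VarianceBound
variable {H : ℕ} {E : Type*} [MeasurableSpace E] {π : Measure (Fin H × E)}
  [IsProbabilityMeasure π] {h : Fin H} {e : E → ℝ} {n : ℕ}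

/-- A variance bound for the sums `∑ i, ipwRes_i g(x_i) R_i`, where `R_i` is a local average that
does not depend on the treatment of `i` and `R' i k` is the same average with individual `k` left
out. Since the residuals are orthogonal to functions which do not involve the treatment of the
same individual, in the off-diagonal terms `R_i R_k` may be replaced by
`(R_i - R'_{ik}) (R_k - R'_{ki})`, which is non-zero only if `i` and `k` are neighbours of each
other, and then small if both have many neighbours. The index `l` allows for vector-valued
averages. -/
lemma IsPropensity.integral_sq_sum_le (hp : IsPropensity π h e) {ι : Type*} [Fintype ι]
    {g ψ : E → ℝ} (hg : Measurable g) (hψ : Measurable ψ)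
    (hL2 : Integrable (fun z => (ipwRes h e z * g z.2 * ψ z.2) ^ 2) π)
    {R : ι → Fin n → (Fin n → Fin H × E) → ℝ} {R' : ι → Fin n → Fin n → (Fin n → Fin H × E) → ℝ}
    (hR : ∀ l i, Measurable (R l i)) (hR' : ∀ l i k, Measurable (R' l i k))
    (hRf : ∀ l i, FreeOfTreat i (R l i)) (hRf' : ∀ l i k, FreeOfTreat i (R' l i k))
    (hRf'' : ∀ l i k, FreeOfTreat k (R' l i k))
    (hRb : ∀ l i d, |R l i d| ≤ ψ (d i).2) (hRb' : ∀ l i k d, |R' l i k d| ≤ ψ (d i).2)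
    {N : Fin n → (Fin n → Fin H × E) → Finset (Fin n)} {κ : Fin n → (Fin n → Fin H × E) → ℝ}
    (hκm : ∀ i, Measurable (κ i)) (hκ0 : ∀ i d, 0 ≤ κ i d) (hκ : ∀ i d, κ i d ≤ ψ (d i).2 ^ 2)
    (hdiag : ∀ i d, ∑ l, R l i d ^ 2 ≤ κ i d)
    (hzero : ∀ l i k d, k ∉ N i d → R l i d = R' l i k d)
    (hcross : ∀ i k d, i ≠ k → k ∈ N i d → i ∈ N k d →
      ((N i d).card * (N k d).card *
        ∑ l, |(R l i d - R' l i k d) * (R l k d - R' l k i d)|) ^ 2 ≤ κ i d * κ k d) :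
    ∫ d, ∑ l, (∑ i, ipwRes h e (d i) * g (d i).2 * R l i d) ^ 2 ∂(Measure.pi fun _ => π) ≤
      2 * ∑ i, ∫ d, (ipwRes h e (d i) * g (d i).2) ^ 2 * κ i d ∂(Measure.pi fun _ => π) := by
  classical
  set Q : Measure (Fin n → Fin H × E) := Measure.pi fun _ => π with hQ
  set w : Fin n → (Fin n → Fin H × E) → ℝ := fun i d => ipwRes h e (d i) * g (d i).2 with hw
  have hwm0 : Measurable fun z : Fin H × E => ipwRes h e z * g z.2 :=
    (measurable_ipwRes h hp.measurable).mul (hg.comp measurable_snd)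
  have hwm : ∀ i, Measurable (w i) := fun i => hwm0.comp (measurable_pi_apply i)
  have hψm : ∀ i : Fin n, Measurable fun d : Fin n → Fin H × E => ψ (d i).2 := fun i =>
    (hψ.comp measurable_snd).comp (measurable_pi_apply i)
  have hmem : ∀ i, MemLp (fun d => w i d * ψ (d i).2) 2 Q := fun i => by
    refine (memLp_two_iff_integrable_sq (f := fun d => w i d * ψ (d i).2)
      ((hwm i).mul (hψm i)).aestronglyMeasurable).2 ?_
    exact (measurePreserving_eval (fun _ : Fin n => π) i).integrable_comp_of_integrable hL2
  have hbase : ∀ i k, Integrable (fun d => (w i d * ψ (d i).2) * (w k d * ψ (d k).2)) Q :=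
    fun i k => (hmem i).integrable_mul (hmem k)
  -- products of bounded averages are integrable
  have hint : ∀ i k (F G : (Fin n → Fin H × E) → ℝ) (C : ℝ), Measurable F → Measurable G →
      (∀ d, |F d| ≤ C * ψ (d i).2) → (∀ d, |G d| ≤ C * ψ (d k).2) →
      Integrable (fun d => (w i d * F d) * (w k d * G d)) Q := by
    intro i k F G C hF hG hFb hGb
    refine ((hbase i k).const_mul (C ^ 2)).mono
      (((hwm i).mul hF).mul ((hwm k).mul hG)).aestronglyMeasurable (Eventually.of_forall fun d => ?_)
    have h1 : |F d| ≤ |C * ψ (d i).2| := (hFb d).trans (le_abs_self _)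
    have h2 : |G d| ≤ |C * ψ (d k).2| := (hGb d).trans (le_abs_self _)
    calc ‖w i d * F d * (w k d * G d)‖ = |w i d| * |w k d| * (|F d| * |G d|) := by
          rw [Real.norm_eq_abs, abs_mul, abs_mul (w i d), abs_mul (w k d)]; ring
      _ ≤ |w i d| * |w k d| * (|C * ψ (d i).2| * |C * ψ (d k).2|) := by gcongr
      _ = ‖C ^ 2 * (w i d * ψ (d i).2 * (w k d * ψ (d k).2))‖ := by
          rw [Real.norm_eq_abs]; simp only [abs_mul, abs_pow]; ring
  have hRb1 : ∀ l i d, |R l i d| ≤ 1 * ψ (d i).2 := fun l i d => by rw [one_mul]; exact hRb l i d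
  have hRb1' : ∀ l i k d, |R' l i k d| ≤ 1 * ψ (d i).2 := fun l i k d => by
    rw [one_mul]; exact hRb' l i k d
  have hΔm : ∀ l i k, Measurable fun d => R l i d - R' l i k d := fun l i k =>
    (hR l i).sub (hR' l i k)
  have hΔb : ∀ l i k d, |R l i d - R' l i k d| ≤ 2 * ψ (d i).2 := fun l i k d => by
    have := abs_sub (R l i d) (R' l i k d)
    linarith [hRb l i d, hRb' l i k d]
  -- the terms of the expanded square, and their replacements
  set f : ι → Fin n → Fin n → (Fin n → Fin H × E) → ℝ :=
    fun l i k d => (w i d * R l i d) * (w k d * R l k d) with hf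
  set f' : ι → Fin n → Fin n → (Fin n → Fin H × E) → ℝ := fun l i k d => if i = k then f l i k d
    else (w i d * (R l i d - R' l i k d)) * (w k d * (R l k d - R' l k i d)) with hf'
  have hfi : ∀ l i k, Integrable (f l i k) Q := fun l i k =>
    hint i k _ _ 1 (hR l i) (hR l k) (hRb1 l i) (hRb1 l k)
  have hfi' : ∀ l i k, Integrable (f' l i k) Q := fun l i k => by
    by_cases hik : i = k
    · simp only [hf', hik, if_true]; exact hfi l k k
    · simp only [hf', hik, if_false]
      exact hint i k _ _ 2 (hΔm l i k) (hΔm l k i) (hΔb l i k) (hΔb l k i)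
  have horth : ∀ i k, i ≠ k → ∀ F G : (Fin n → Fin H × E) → ℝ, Measurable F → Measurable G →
      FreeOfTreat i F → FreeOfTreat i G → ∫ d, (w i d * F d) * (w k d * G d) ∂Q = 0 := by
    intro i k hik F G hF hG hFf hGf
    have hgi : Measurable fun d : Fin n → Fin H × E => g (d i).2 :=
      (hg.comp measurable_snd).comp (measurable_pi_apply i)
    have h1 := hp.integral_ipwRes_mul_of_free i
      (F := fun d => (g (d i).2 * F d) * (w k d * G d)) ((hgi.mul hF).mul ((hwm k).mul hG))
      (((freeOfTreat_snd i g).mul hFf).mul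
        ((freeOfTreat_of_ne (Ne.symm hik) fun z => ipwRes h e z * g z.2).mul hGf))
    rw [← h1]
    refine integral_congr_ae (Eventually.of_forall fun d => ?_)
    simp only [hw]; ring
  have hff' : ∀ l i k, ∫ d, f l i k d ∂Q = ∫ d, f' l i k d ∂Q := by
    intro l i k
    by_cases hik : i = k
    · simp [hf', hik]
    · have z1 := horth i k hik _ _ (hR l i) (hR' l k i) (hRf l i) (hRf'' l k i)
      have z2 := horth k i (Ne.symm hik) _ _ (hR l k) (hR' l i k) (hRf l k) (hRf'' l i k)
      have z3 := horth i k hik _ _ (hR' l i k) (hR' l k i) (hRf' l i k) (hRf'' l k i)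
      have i1 := hint i k _ _ 1 (hR l i) (hR' l k i) (hRb1 l i) (hRb1' l k i)
      have i2 := hint k i _ _ 1 (hR l k) (hR' l i k) (hRb1 l k) (hRb1' l i k)
      have i3 := hint i k _ _ 1 (hR' l i k) (hR' l k i) (hRb1' l i k) (hRb1' l k i)
      have hsplit : ∀ d, f' l i k d = f l i k d - (w i d * R l i d) * (w k d * R' l k i d)
          - (w k d * R l k d) * (w i d * R' l i k d)
          + (w i d * R' l i k d) * (w k d * R' l k i d) := fun d => by
        simp only [hf', hf, hik, if_false]; ring
      simp_rw [hsplit]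
      have i4 : Integrable (fun d => f l i k d - w i d * R l i d * (w k d * R' l k i d)) Q :=
        (hfi l i k).sub i1
      have i5 : Integrable (fun d => f l i k d - w i d * R l i d * (w k d * R' l k i d) -
          w k d * R l k d * (w i d * R' l i k d)) Q := i4.sub i2
      rw [integral_add i5 i3, integral_sub i4 i2, integral_sub (hfi l i k) i1, z1, z2, z3]
      ring
  have hκint : ∀ i, Integrable (fun d => w i d ^ 2 * κ i d) Q := fun i => by
    refine (hmem i).integrable_sq.mono (((hwm i).pow_const 2).mul (hκm i)).aestronglyMeasurable
      (Eventually.of_forall fun d => ?_)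
    rw [Real.norm_eq_abs, Real.norm_eq_abs, abs_of_nonneg (mul_nonneg (sq_nonneg _) (hκ0 i d)),
      abs_of_nonneg (sq_nonneg _), mul_pow (w i d)]
    exact mul_le_mul_of_nonneg_left (hκ i d) (sq_nonneg _)
  have hexp : ∀ d, ∑ l, (∑ i, w i d * R l i d) ^ 2 = ∑ l, ∑ i, ∑ k, f l i k d := fun d => by
    refine Finset.sum_congr rfl fun l _ => ?_
    rw [sq, Finset.sum_mul_sum]
  calc ∫ d, ∑ l, (∑ i, w i d * R l i d) ^ 2 ∂Q
      = ∫ d, ∑ l, ∑ i, ∑ k, f' l i k d ∂Q := by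
        simp_rw [hexp]
        have hI : ∀ F : ι → Fin n → Fin n → (Fin n → Fin H × E) → ℝ,
            (∀ l i k, Integrable (F l i k) Q) →
            ∫ d, ∑ l, ∑ i, ∑ k, F l i k d ∂Q = ∑ l, ∑ i, ∑ k, ∫ d, F l i k d ∂Q := by
          intro F hF
          rw [integral_finsetSum _ fun l _ => integrable_finsetSum _ fun i _ =>
            integrable_finsetSum _ fun k _ => hF l i k]
          refine Finset.sum_congr rfl fun l _ => ?_
          rw [integral_finsetSum _ fun i _ => integrable_finsetSum _ fun k _ => hF l i k]
          refine Finset.sum_congr rfl fun i _ => ?_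
          rw [integral_finsetSum _ fun k _ => hF l i k]
        rw [hI f hfi, hI f' hfi']
        simp_rw [hff']
    _ ≤ ∫ d, 2 * ∑ i, w i d ^ 2 * κ i d ∂Q := by
        refine integral_mono (integrable_finsetSum _ fun l _ => integrable_finsetSum _ fun i _ =>
          integrable_finsetSum _ fun k _ => hfi' l i k)
          ((integrable_finsetSum _ fun i _ => hκint i).const_mul 2) fun d => ?_
        -- the pointwise bound
        set q : Fin n → Fin n → ℝ := fun i k => if i ≠ k ∧ k ∈ N i d ∧ i ∈ N k d then
          ((N i d).card * (N k d).card : ℝ)⁻¹ else 0 with hq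
        have hpair : ∀ i k, ∑ l, f' l i k d ≤ (if i = k then w i d ^ 2 * κ i d else 0) +
            q i k * ((w i d ^ 2 * κ i d + w k d ^ 2 * κ k d) / 2) := by
          intro i k
          by_cases hik : i = k
          · subst hik
            have hq0 : q i i = 0 := by simp [hq]
            rw [if_pos rfl, hq0, zero_mul, add_zero]
            have : ∑ l, f' l i i d = w i d ^ 2 * ∑ l, R l i d ^ 2 := by
              rw [Finset.mul_sum]
              exact Finset.sum_congr rfl fun l _ => by simp only [hf', hf, if_true]; ring
            rw [this]
            exact mul_le_mul_of_nonneg_left (hdiag i d) (sq_nonneg _)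
          rw [if_neg hik, zero_add]
          by_cases hnb : k ∈ N i d ∧ i ∈ N k d
          · have hqv : q i k = ((N i d).card * (N k d).card : ℝ)⁻¹ := by
              simp only [hq]; rw [if_pos ⟨hik, hnb.1, hnb.2⟩]
            have hNi : (0 : ℝ) < (N i d).card := by
              exact_mod_cast Finset.card_pos.2 ⟨k, hnb.1⟩
            have hNk : (0 : ℝ) < (N k d).card := by
              exact_mod_cast Finset.card_pos.2 ⟨i, hnb.2⟩
            set T := ∑ l, |(R l i d - R' l i k d) * (R l k d - R' l k i d)| with hT
            have hT0 : 0 ≤ T := Finset.sum_nonneg fun l _ => abs_nonneg _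
            have h1 : ∑ l, f' l i k d ≤ |w i d * w k d| * T := by
              rw [hT, Finset.mul_sum]
              refine Finset.sum_le_sum fun l _ => ?_
              simp only [hf', hik, if_false]
              refine (le_abs_self _).trans (le_of_eq ?_)
              simp only [abs_mul]; ring
            rw [hqv, inv_mul_eq_div, le_div_iff₀ (mul_pos hNi hNk)]
            refine (mul_le_mul_of_nonneg_right h1 (mul_pos hNi hNk).le).trans ?_
            have h2 := hcross i k d hik hnb.1 hnb.2
            have ha := mul_nonneg (sq_nonneg (w i d)) (hκ0 i d)
            have hb := mul_nonneg (sq_nonneg (w k d)) (hκ0 k d)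
            -- the inequality of arithmetic and geometric means
            refine abs_le_of_sq_le_sq' ?_ (by linarith) |>.2
            calc (|w i d * w k d| * T * ((N i d).card * (N k d).card)) ^ 2
                = (w i d ^ 2 * w k d ^ 2) * ((N i d).card * (N k d).card * T) ^ 2 := by
                  rw [mul_pow, mul_pow, sq_abs]; ring
              _ ≤ (w i d ^ 2 * w k d ^ 2) * (κ i d * κ k d) :=
                  mul_le_mul_of_nonneg_left h2 (by positivity)
              _ ≤ ((w i d ^ 2 * κ i d + w k d ^ 2 * κ k d) / 2) ^ 2 := by
                  nlinarith [sq_nonneg (w i d ^ 2 * κ i d - w k d ^ 2 * κ k d)]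
          · have hqv : q i k = 0 := by
              simp only [hq]; rw [if_neg fun h0 => hnb h0.2]
            rw [hqv, zero_mul]
            refine le_of_eq (Finset.sum_eq_zero fun l _ => ?_)
            simp only [hf', hik, if_false]
            rcases not_and_or.1 hnb with h0 | h0
            · rw [hzero l i k d h0, sub_self]; ring
            · rw [hzero l k i d h0, sub_self]; ring
        have hqsum : ∀ i, ∑ k, q i k ≤ 1 := by
          intro i
          calc ∑ k, q i k ≤ ∑ k, if k ∈ N i d then ((N i d).card : ℝ)⁻¹ else 0 := by
                refine Finset.sum_le_sum fun k _ => ?_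
                simp only [hq]
                by_cases h0 : i ≠ k ∧ k ∈ N i d ∧ i ∈ N k d
                · rw [if_pos h0, if_pos h0.2.1]
                  have hNk : (1 : ℝ) ≤ (N k d).card := by
                    exact_mod_cast Finset.card_pos.2 ⟨i, h0.2.2⟩
                  have hNi : (0 : ℝ) < (N i d).card := by
                    exact_mod_cast Finset.card_pos.2 ⟨k, h0.2.1⟩
                  exact inv_anti₀ hNi (le_mul_of_one_le_right hNi.le hNk)
                · rw [if_neg h0]; positivity
            _ = (N i d).card * ((N i d).card : ℝ)⁻¹ := by
                rw [Finset.sum_ite_mem, Finset.univ_inter, Finset.sum_const, nsmul_eq_mul]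
            _ ≤ 1 := mul_inv_le_one
        have hqsymm : ∀ i k, q i k = q k i := by
          intro i k
          simp only [hq]
          by_cases h0 : i ≠ k ∧ k ∈ N i d ∧ i ∈ N k d
          · rw [if_pos h0, if_pos ⟨Ne.symm h0.1, h0.2.2, h0.2.1⟩, mul_comm]
          · rw [if_neg h0, if_neg fun h1 => h0 ⟨Ne.symm h1.1, h1.2.2, h1.2.1⟩]
        calc ∑ l, ∑ i, ∑ k, f' l i k d = ∑ i, ∑ k, ∑ l, f' l i k d := by
              rw [Finset.sum_comm]
              exact Finset.sum_congr rfl fun i _ => Finset.sum_comm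
          _ ≤ ∑ i, ∑ k, ((if i = k then w i d ^ 2 * κ i d else 0) +
              q i k * ((w i d ^ 2 * κ i d + w k d ^ 2 * κ k d) / 2)) :=
              Finset.sum_le_sum fun i _ => Finset.sum_le_sum fun k _ => hpair i k
          _ = ∑ i, w i d ^ 2 * κ i d + ∑ i, ∑ k,
              q i k * ((w i d ^ 2 * κ i d + w k d ^ 2 * κ k d) / 2) := by
              rw [← Finset.sum_add_distrib]
              refine Finset.sum_congr rfl fun i _ => ?_
              rw [Finset.sum_add_distrib]
              simp
          _ ≤ ∑ i, w i d ^ 2 * κ i d + ∑ i, w i d ^ 2 * κ i d :=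
              add_le_add le_rfl (sum_sum_symm_le q hqsymm hqsum _ fun i =>
                mul_nonneg (sq_nonneg _) (hκ0 i d))
          _ = 2 * ∑ i, w i d ^ 2 * κ i d := by ring
    _ = 2 * ∑ i, ∫ d, w i d ^ 2 * κ i d ∂Q := by
        rw [integral_const_mul, integral_finsetSum _ fun i _ => hκint i]

end VarianceBound

/-! ### Local averages over nearest neighbours -/

lemma inv_natCast_le_one (m : ℕ) : (m : ℝ)⁻¹ ≤ 1 := by
  rcases Nat.eq_zero_or_pos m with rfl | hm
  · simp
  · exact inv_le_one_of_one_le₀ (by exact_mod_cast hm)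

lemma snd_update {H n : ℕ} {E : Type*} (d : Fin n → Fin H × E) (k : Fin n) (a : Fin H) (l : Fin n) :
    (Function.update d k (a, (d k).2) l).2 = (d l).2 := by
  by_cases hl : l = k
  · subst hl; simp
  · rw [Function.update_of_ne hl]

section Neighbours
variable {H : ℕ} {E : Type*} [NormedAddCommGroup E] {n : ℕ}

/-- The neighbours of individual `i` within distance `δ` that received treatment `h`. -/
def neighbours (δ : ℝ) (h : Fin H) (d : Fin n → Fin H × E) (i : Fin n) : Finset (Fin n) :=
  Finset.univ.filter fun l => l ≠ i ∧ ‖(d l).2 - (d i).2‖ ≤ δ ∧ (d l).1 = h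

/-- The average of `v` over `s`, which is `0` for the empty set. -/
def avg (s : Finset (Fin n)) (v : Fin n → ℝ) : ℝ := (∑ l ∈ s, v l) / s.card

lemma mem_neighbours {δ : ℝ} {h : Fin H} {d : Fin n → Fin H × E} {i l : Fin n} :
    l ∈ neighbours δ h d i ↔ l ≠ i ∧ ‖(d l).2 - (d i).2‖ ≤ δ ∧ (d l).1 = h := by
  simp [neighbours]

lemma neighbours_update (δ : ℝ) (h : Fin H) (d : Fin n → Fin H × E) (i : Fin n) (a : Fin H) :
    neighbours δ h (Function.update d i (a, (d i).2)) i = neighbours δ h d i := by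
  ext l
  rw [mem_neighbours, mem_neighbours]
  by_cases hl : l = i
  · simp [hl]
  · simp [Function.update_of_ne hl]

lemma neighbours_erase_update (δ : ℝ) (h : Fin H) (d : Fin n → Fin H × E) (i k : Fin n)
    (a : Fin H) : (neighbours δ h (Function.update d k (a, (d k).2)) i).erase k =
      (neighbours δ h d i).erase k := by
  ext l
  simp only [Finset.mem_erase, mem_neighbours, snd_update]
  refine and_congr_right fun hl => ?_
  rw [Function.update_of_ne hl]

lemma abs_avg_sub_le {s : Finset (Fin n)} (hs : s.Nonempty) {v : Fin n → ℝ} {c r : ℝ}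
    (h : ∀ l ∈ s, |v l - c| ≤ r) : |avg s v - c| ≤ r := by
  have hc : (0 : ℝ) < s.card := by exact_mod_cast hs.card_pos
  have : avg s v - c = (∑ l ∈ s, (v l - c)) / s.card := by
    rw [avg, Finset.sum_sub_distrib, Finset.sum_const, nsmul_eq_mul, sub_div,
      mul_div_cancel_left₀ _ hc.ne']
  rw [this, abs_div, abs_of_pos hc, div_le_iff₀ hc]
  calc |∑ l ∈ s, (v l - c)| ≤ ∑ l ∈ s, |v l - c| := Finset.abs_sum_le_sum_abs _ _
    _ ≤ ∑ l ∈ s, r := Finset.sum_le_sum h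
    _ = r * s.card := by rw [Finset.sum_const, nsmul_eq_mul, mul_comm]

lemma avg_sub_avg_erase {s : Finset (Fin n)} {k : Fin n} (hk : k ∈ s) (v : Fin n → ℝ) :
    (s.card : ℝ) * (avg s v - avg (s.erase k) v) = v k - avg (s.erase k) v := by
  have hc : (0 : ℝ) < s.card := by exact_mod_cast Finset.card_pos.2 ⟨k, hk⟩
  have h1 : ((s.erase k).card : ℝ) = s.card - 1 := by
    rw [Finset.card_erase_of_mem hk, Nat.cast_sub (Finset.card_pos.2 ⟨k, hk⟩), Nat.cast_one]
  have h2 : (s.card : ℝ) * avg s v = v k + ∑ l ∈ s.erase k, v l := by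
    rw [avg, mul_div_cancel₀ _ hc.ne', Finset.add_sum_erase _ _ hk]
  have h3 : ((s.card : ℝ) - 1) * avg (s.erase k) v = ∑ l ∈ s.erase k, v l := by
    rcases (s.erase k).eq_empty_or_nonempty with h0 | h0
    · rw [h0]; simp [avg]
    · have : ((s.erase k).card : ℝ) ≠ 0 := by exact_mod_cast h0.card_pos.ne'
      rw [avg, ← h1, mul_div_cancel₀ _ this]
  rw [mul_sub, h2, ← h3]; ring

lemma abs_avg_neighbours_sub_le {δ : ℝ} {h : Fin H} {φ : E → ℝ} {C : ℝ≥0}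
    (hφ : LipschitzWith C φ) (d : Fin n → Fin H × E) (i : Fin n) {s : Finset (Fin n)}
    (hs : s ⊆ neighbours δ h d i) :
    |avg s (fun l => φ (d l).2) - φ (d i).2| ≤ C * |δ| + |φ (d i).2| := by
  have hC0 : 0 ≤ (C : ℝ) * |δ| := by positivity
  rcases s.eq_empty_or_nonempty with rfl | hne
  · simp only [avg, Finset.sum_empty, zero_div, zero_sub, abs_neg]
    linarith
  · have := abs_avg_sub_le hne (v := fun l => φ (d l).2) (c := φ (d i).2) (r := C * |δ|)
      fun l hl => by
        have h1 := hφ.dist_le_mul (d l).2 (d i).2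
        rw [Real.dist_eq, dist_eq_norm] at h1
        exact h1.trans (mul_le_mul_of_nonneg_left
          ((mem_neighbours.1 (hs hl)).2.1.trans (le_abs_self δ)) C.2)
    linarith [abs_nonneg (φ (d i).2)]

variable [MeasurableSpace E]

lemma measurable_sum_finset {D : Type*} [MeasurableSpace D] {s : D → Finset (Fin n)}
    (hs : ∀ l, MeasurableSet {d | l ∈ s d}) {v : Fin n → D → ℝ} (hv : ∀ l, Measurable (v l)) :
    Measurable fun d => ∑ l ∈ s d, v l d := by
  classical
  have : (fun d => ∑ l ∈ s d, v l d) = fun d => ∑ l, if l ∈ s d then v l d else 0 := by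
    ext d; rw [Finset.sum_ite_mem, Finset.univ_inter]
  rw [this]
  exact Finset.measurable_sum _ fun l _ => Measurable.ite (hs l) (hv l) measurable_const

lemma measurable_card_finset {D : Type*} [MeasurableSpace D] {s : D → Finset (Fin n)}
    (hs : ∀ l, MeasurableSet {d | l ∈ s d}) : Measurable fun d => ((s d).card : ℝ) := by
  have := measurable_sum_finset hs (v := fun _ _ => 1) fun _ => measurable_const
  simpa using this

lemma measurable_avg {D : Type*} [MeasurableSpace D] {s : D → Finset (Fin n)}
    (hs : ∀ l, MeasurableSet {d | l ∈ s d}) {v : Fin n → D → ℝ} (hv : ∀ l, Measurable (v l)) :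
    Measurable fun d => avg (s d) fun l => v l d :=
  (measurable_sum_finset hs hv).div (measurable_card_finset hs)

variable [BorelSpace E] [SecondCountableTopology E]

lemma measurableSet_mem_neighbours (δ : ℝ) (h : Fin H) (i l : Fin n) :
    MeasurableSet {d : Fin n → Fin H × E | l ∈ neighbours δ h d i} := by
  simp only [mem_neighbours]
  refine MeasurableSet.inter (MeasurableSet.const _) (MeasurableSet.inter ?_ ?_)
  · have : Measurable fun d : Fin n → Fin H × E => ‖(d l).2 - (d i).2‖ :=
      ((measurable_snd.comp (measurable_pi_apply l)).sub
        (measurable_snd.comp (measurable_pi_apply i))).norm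
    exact measurableSet_le this measurable_const
  · exact (measurable_fst.comp (measurable_pi_apply l)) (measurableSet_singleton h)

lemma measurableSet_mem_neighbours_erase (δ : ℝ) (h : Fin H) (i k l : Fin n) :
    MeasurableSet {d : Fin n → Fin H × E | l ∈ (neighbours δ h d i).erase k} := by
  simp only [Finset.mem_erase]
  exact MeasurableSet.inter (MeasurableSet.const _) (measurableSet_mem_neighbours δ h i l)

lemma measurable_card_neighbours (δ : ℝ) (h : Fin H) (i : Fin n) :
    Measurable fun d : Fin n → Fin H × E => ((neighbours δ h d i).card : ℝ) :=
  measurable_card_finset (measurableSet_mem_neighbours δ h i)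

variable {π : Measure (Fin H × E)} [IsProbabilityMeasure π] {h : Fin H} {e : E → ℝ}

/-- Variance bound for the smoothing bias of the nearest-neighbour average of a Lipschitz
function. An individual with at most one neighbour contributes `|φ|` as well, because the average
over the empty set, which remains when its only neighbour is left out, is `0`. -/
lemma IsPropensity.integral_sq_bias_le (hp : IsPropensity π h e) {g φ : E → ℝ}
    (hg : Measurable g) {C : ℝ≥0} (hφ : LipschitzWith C φ) (δ : ℝ)
    (hL2 : Integrable (fun z => (ipwRes h e z * g z.2 * (2 * C * |δ| + |φ z.2|)) ^ 2) π) :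
    ∫ d, (∑ i, ipwRes h e (d i) * g (d i).2 *
        (avg (neighbours δ h d i) (fun l => φ (d l).2) - φ (d i).2)) ^ 2
        ∂(Measure.pi fun _ : Fin n => π) ≤
      2 * ∑ i, ∫ d, (ipwRes h e (d i) * g (d i).2) ^ 2 *
        (2 * C * |δ| + if (neighbours δ h d i).card ≤ 1 then |φ (d i).2| else 0) ^ 2
        ∂(Measure.pi fun _ : Fin n => π) := by
  have hφm : Measurable φ := hφ.continuous.measurable
  have hφl : ∀ l : Fin n, Measurable fun d : Fin n → Fin H × E => φ (d l).2 := fun l =>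
    (hφm.comp measurable_snd).comp (measurable_pi_apply l)
  have hClip : ∀ (d : Fin n → Fin H × E) (i l : Fin n), l ∈ neighbours δ h d i →
      |φ (d l).2 - φ (d i).2| ≤ C * |δ| := by
    intro d i l hl
    have h1 := hφ.dist_le_mul (d l).2 (d i).2
    rw [Real.dist_eq, dist_eq_norm] at h1
    exact h1.trans (mul_le_mul_of_nonneg_left
      ((mem_neighbours.1 hl).2.1.trans (le_abs_self δ)) C.2)
  have hC0 : 0 ≤ (C : ℝ) * |δ| := by positivity
  have hbound : ∀ (d : Fin n → Fin H × E) (i : Fin n) (s : Finset (Fin n)),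
      s ⊆ neighbours δ h d i →
      |avg s (fun l => φ (d l).2) - φ (d i).2| ≤ 2 * C * |δ| + |φ (d i).2| := fun d i s hs =>
    (abs_avg_neighbours_sub_le hφ d i hs).trans (by linarith)
  have key := hp.integral_sq_sum_le (n := n) (ι := Unit) (g := g)
    (ψ := fun x => 2 * C * |δ| + |φ x|) hg (by fun_prop) hL2
    (R := fun _ i d => avg (neighbours δ h d i) (fun l => φ (d l).2) - φ (d i).2)
    (R' := fun _ i k d => avg ((neighbours δ h d i).erase k) (fun l => φ (d l).2) - φ (d i).2)
    (N := fun i d => neighbours δ h d i)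
    (κ := fun i d => (2 * C * |δ| +
      if (neighbours δ h d i).card ≤ 1 then |φ (d i).2| else 0) ^ 2)
    (fun _ i => (measurable_avg (measurableSet_mem_neighbours δ h i) hφl).sub (hφl i))
    (fun _ i k => (measurable_avg (measurableSet_mem_neighbours_erase δ h i k) hφl).sub (hφl i))
    (fun _ i d a => by simp only [neighbours_update, snd_update])
    (fun _ i k d a => by simp only [neighbours_update, snd_update])
    (fun _ i k d a => by simp only [neighbours_erase_update, snd_update])
    (fun _ i d => hbound d i _ subset_rfl)
    (fun _ i k d => hbound d i _ (Finset.erase_subset _ _))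
    (fun i => by
      refine Measurable.pow_const (Measurable.const_add (Measurable.ite ?_ (hφl i).abs
        measurable_const) _) 2
      have : {d : Fin n → Fin H × E | (neighbours δ h d i).card ≤ 1} =
          {d | ((neighbours δ h d i).card : ℝ) ≤ 1} := by ext d; simp
      rw [this]
      exact measurableSet_le (measurable_card_neighbours δ h i) measurable_const)
    (fun i d => sq_nonneg _)
    (fun i d => by
      refine pow_le_pow_left₀ (by positivity) (add_le_add_right ?_ _) 2
      split_ifs
      · exact le_rfl
      · positivity)
    (fun i d => by
      simp only [Finset.univ_unique, Finset.sum_const, Finset.card_singleton, one_smul]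
      rw [← sq_abs]
      refine pow_le_pow_left₀ (abs_nonneg _) ?_ 2
      rcases (neighbours δ h d i).eq_empty_or_nonempty with h0 | hne
      · rw [h0]; simp [avg]; linarith
      · have := abs_avg_sub_le hne fun l hl => hClip d i l hl
        have h2 : (0 : ℝ) ≤ if (neighbours δ h d i).card ≤ 1 then |φ (d i).2| else 0 := by
          split_ifs <;> positivity
        linarith)
    (fun _ i k d hk => by simp only [Finset.erase_eq_of_notMem hk])
    (fun i k d hik hki hik' => by
      have hstep : ∀ i k : Fin n, k ∈ neighbours δ h d i →
          |((neighbours δ h d i).card : ℝ) *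
            (avg (neighbours δ h d i) (fun l => φ (d l).2) -
              avg ((neighbours δ h d i).erase k) (fun l => φ (d l).2))| ≤
          2 * C * |δ| + if (neighbours δ h d i).card ≤ 1 then |φ (d i).2| else 0 := by
        intro i k hk
        rw [avg_sub_avg_erase hk]
        rcases ((neighbours δ h d i).erase k).eq_empty_or_nonempty with h0 | hne
        · have hcard : (neighbours δ h d i).card ≤ 1 := by
            have := Finset.card_erase_add_one hk
            rw [h0] at this; simp at this; omega
          rw [if_pos hcard, h0]
          simp only [avg, Finset.sum_empty, zero_div, sub_zero]
          have h1 := hClip d i k hk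
          have h2 := abs_add_le (φ (d k).2 - φ (d i).2) (φ (d i).2)
          rw [sub_add_cancel] at h2
          linarith
        · have h1 := hClip d i k hk
          have h2 := abs_avg_sub_le hne fun l hl => hClip d i l (Finset.mem_of_mem_erase hl)
          have h3 : (0 : ℝ) ≤ if (neighbours δ h d i).card ≤ 1 then |φ (d i).2| else 0 := by
            split_ifs <;> positivity
          have h4 := abs_sub (φ (d k).2 - φ (d i).2)
            (avg ((neighbours δ h d i).erase k) (fun l => φ (d l).2) - φ (d i).2)
          rw [sub_sub_sub_cancel_right] at h4
          linarith
      simp only [Finset.univ_unique, Finset.sum_const, Finset.card_singleton, one_smul,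
        sub_sub_sub_cancel_right]
      rw [← mul_pow]
      refine pow_le_pow_left₀ (by positivity) ?_ 2
      have h1 := mul_le_mul (hstep i k hki) (hstep k i hik') (abs_nonneg _)
        ((abs_nonneg _).trans (hstep i k hki))
      refine le_trans (le_of_eq ?_) h1
      rw [abs_mul, abs_mul, abs_mul, Nat.abs_cast, Nat.abs_cast]
      ring)
  simpa only [Finset.univ_unique, Finset.sum_const, Finset.card_singleton, one_smul] using key

/-- Variance bound for the weights that the noise variables receive in the nearest-neighbour
averages: the component `l` of the vector-valued average around `i` is `1 / |N_i|` if `l` is a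
neighbour of `i`, and `0` otherwise. -/
lemma IsPropensity.integral_sq_noiseWeight_le (hp : IsPropensity π h e) {g : E → ℝ}
    (hg : Measurable g) (δ : ℝ)
    (hL2 : Integrable (fun z => (ipwRes h e z * g z.2) ^ 2) π) :
    ∫ d, ∑ l, (∑ i, ipwRes h e (d i) * g (d i).2 *
        (if l ∈ neighbours δ h d i then ((neighbours δ h d i).card : ℝ)⁻¹ else 0)) ^ 2
        ∂(Measure.pi fun _ : Fin n => π) ≤
      2 * ∑ i, ∫ d, (ipwRes h e (d i) * g (d i).2) ^ 2 * (2 * ((neighbours δ h d i).card : ℝ)⁻¹)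
        ∂(Measure.pi fun _ : Fin n => π) := by
  have habs : ∀ (l : Fin n) (s : Finset (Fin n)),
      |if l ∈ s then (s.card : ℝ)⁻¹ else 0| ≤ 2 := fun l s => by
    split_ifs
    · rw [abs_of_nonneg (by positivity)]; linarith [inv_natCast_le_one s.card]
    · simp
  refine hp.integral_sq_sum_le (n := n) (ι := Fin n) (g := g) (ψ := fun _ => 2) hg
    measurable_const ?_
    (R := fun l i d => if l ∈ neighbours δ h d i then ((neighbours δ h d i).card : ℝ)⁻¹ else 0)
    (R' := fun l i k d => if l ∈ (neighbours δ h d i).erase k then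
      (((neighbours δ h d i).erase k).card : ℝ)⁻¹ else 0)
    (N := fun i d => neighbours δ h d i) ?_ ?_ ?_ ?_ ?_ ?_ ?_ ?_ ?_ ?_ ?_ ?_ ?_
  · refine (hL2.mul_const 4).congr (Eventually.of_forall fun z => ?_)
    simp only; ring
  · exact fun l i => Measurable.ite (measurableSet_mem_neighbours δ h i l)
      (measurable_card_neighbours δ h i).inv measurable_const
  · exact fun l i k => Measurable.ite (measurableSet_mem_neighbours_erase δ h i k l)
      (measurable_card_finset (measurableSet_mem_neighbours_erase δ h i k)).inv measurable_const
  · exact fun l i d a => by simp only [neighbours_update]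
  · exact fun l i k d a => by simp only [neighbours_update]
  · exact fun l i k d a => by simp only [neighbours_erase_update]
  · exact fun l i d => habs l _
  · exact fun l i k d => habs l _
  · exact fun i => (measurable_card_neighbours δ h i).inv.const_mul 2
  · exact fun i d => by positivity
  · exact fun i d => by linarith [inv_natCast_le_one (neighbours δ h d i).card]
  · intro i d
    have : ∀ l, (if l ∈ neighbours δ h d i then ((neighbours δ h d i).card : ℝ)⁻¹ else 0) ^ 2 =
        if l ∈ neighbours δ h d i then ((neighbours δ h d i).card : ℝ)⁻¹ ^ 2 else 0 := fun l => by
      split_ifs <;> simp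
    simp_rw [this]
    rw [Finset.sum_ite_mem, Finset.univ_inter, Finset.sum_const, nsmul_eq_mul, sq, ← mul_assoc]
    have h1 : (0 : ℝ) ≤ ((neighbours δ h d i).card : ℝ)⁻¹ := by positivity
    have h2 : ((neighbours δ h d i).card : ℝ) * ((neighbours δ h d i).card : ℝ)⁻¹ ≤ 1 :=
      mul_inv_le_one
    nlinarith
  · intro l i k d hk
    simp only [Finset.erase_eq_of_notMem hk]
  · intro i k d hik hki hik'
    set s := neighbours δ h d i with hs
    set t := neighbours δ h d k with ht
    have hsk : k ∉ t := fun h0 => (mem_neighbours.1 h0).1 rfl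
    have hti : i ∉ s := fun h0 => (mem_neighbours.1 h0).1 rfl
    obtain ⟨x, hx⟩ : ∃ x : ℕ, s.card = x + 1 :=
      ⟨s.card - 1, (Nat.sub_add_cancel (Finset.card_pos.2 ⟨k, hki⟩)).symm⟩
    obtain ⟨y, hy⟩ : ∃ y : ℕ, t.card = y + 1 :=
      ⟨t.card - 1, (Nat.sub_add_cancel (Finset.card_pos.2 ⟨i, hik'⟩)).symm⟩
    have hxe : (s.erase k).card = x := by rw [Finset.card_erase_of_mem hki, hx]; rfl
    have hye : (t.erase i).card = y := by rw [Finset.card_erase_of_mem hik', hy]; rfl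
    -- only common neighbours of `i` and `k` contribute, since `k` is not a neighbour of itself
    have hterm : ∀ l, |((if l ∈ s then (s.card : ℝ)⁻¹ else 0) -
        (if l ∈ s.erase k then ((s.erase k).card : ℝ)⁻¹ else 0)) *
        ((if l ∈ t then (t.card : ℝ)⁻¹ else 0) -
        (if l ∈ t.erase i then ((t.erase i).card : ℝ)⁻¹ else 0))| ≤
        if l ∈ s.erase k ∩ t.erase i then
          ((x : ℝ)⁻¹ * ((x : ℝ) + 1)⁻¹) * ((y : ℝ)⁻¹ * ((y : ℝ) + 1)⁻¹) else 0 := by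
      intro l
      rw [hxe, hye, hx, hy]
      push_cast
      by_cases h1 : l ∈ s.erase k ∩ t.erase i
      · obtain ⟨h2, h3⟩ := Finset.mem_inter.1 h1
        have hx0 : (0 : ℝ) < x := by rw [← hxe]; exact_mod_cast Finset.card_pos.2 ⟨l, h2⟩
        have hy0 : (0 : ℝ) < y := by rw [← hye]; exact_mod_cast Finset.card_pos.2 ⟨l, h3⟩
        rw [if_pos h1, if_pos h2, if_pos h3, if_pos (Finset.mem_of_mem_erase h2),
          if_pos (Finset.mem_of_mem_erase h3)]
        refine le_of_eq ?_
        have e1 : ((x : ℝ) + 1)⁻¹ - (x : ℝ)⁻¹ = -((x : ℝ)⁻¹ * ((x : ℝ) + 1)⁻¹) := by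
          field_simp; ring
        have e2 : ((y : ℝ) + 1)⁻¹ - (y : ℝ)⁻¹ = -((y : ℝ)⁻¹ * ((y : ℝ) + 1)⁻¹) := by
          field_simp; ring
        rw [e1, e2, neg_mul_neg, abs_of_nonneg (by positivity)]
      · rw [if_neg h1]
        refine le_of_eq (abs_eq_zero.2 ?_)
        by_cases hlk : l = k
        · subst hlk
          have : l ∉ t.erase i := fun h0 => hsk (Finset.mem_of_mem_erase h0)
          rw [if_neg hsk, if_neg this, sub_zero, mul_zero]
        by_cases hli : l = i
        · subst hli
          have : l ∉ s.erase k := fun h0 => hti (Finset.mem_of_mem_erase h0)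
          rw [if_neg hti, if_neg this, sub_zero, zero_mul]
        by_cases h2 : l ∈ s
        · have h3 : l ∉ t := fun h3 => h1 (by simp [hlk, hli, h2, h3])
          have : l ∉ t.erase i := fun h0 => h3 (Finset.mem_of_mem_erase h0)
          rw [if_neg h3, if_neg this, sub_zero, mul_zero]
        · have : l ∉ s.erase k := fun h0 => h2 (Finset.mem_of_mem_erase h0)
          rw [if_neg h2, if_neg this, sub_zero, zero_mul]
    set T := ∑ l, |((if l ∈ s then (s.card : ℝ)⁻¹ else 0) -
        (if l ∈ s.erase k then ((s.erase k).card : ℝ)⁻¹ else 0)) *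
        ((if l ∈ t then (t.card : ℝ)⁻¹ else 0) -
        (if l ∈ t.erase i then ((t.erase i).card : ℝ)⁻¹ else 0))| with hT
    have hT0 : 0 ≤ T := Finset.sum_nonneg fun l _ => abs_nonneg _
    have hT1 : T ≤ ((s.erase k ∩ t.erase i).card : ℝ) *
        (((x : ℝ)⁻¹ * ((x : ℝ) + 1)⁻¹) * ((y : ℝ)⁻¹ * ((y : ℝ) + 1)⁻¹)) := by
      refine (Finset.sum_le_sum fun l _ => hterm l).trans (le_of_eq ?_)
      rw [Finset.sum_ite_mem, Finset.univ_inter, Finset.sum_const, nsmul_eq_mul]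
    have hcx : ((s.erase k ∩ t.erase i).card : ℝ) ≤ x := by
      rw [← hxe]; exact_mod_cast Finset.card_le_card Finset.inter_subset_left
    have hcy : ((s.erase k ∩ t.erase i).card : ℝ) ≤ y := by
      rw [← hye]; exact_mod_cast Finset.card_le_card Finset.inter_subset_right
    rw [hx, hy]
    push_cast
    set m : ℝ := ((s.erase k ∩ t.erase i).card : ℝ) with hm
    have hm0 : 0 ≤ m := by positivity
    have hx0 : (0 : ℝ) ≤ x := by positivity
    have hy0 : (0 : ℝ) ≤ y := by positivity
    have hprod : ((x : ℝ) + 1) * (y + 1) * T ≤ m * ((x : ℝ)⁻¹ * (y : ℝ)⁻¹) := by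
      refine (mul_le_mul_of_nonneg_left hT1 (by positivity)).trans (le_of_eq ?_)
      field_simp
    have hsq : (m * ((x : ℝ)⁻¹ * (y : ℝ)⁻¹)) ^ 2 ≤ (x : ℝ)⁻¹ * (y : ℝ)⁻¹ := by
      have h1 : m ^ 2 ≤ x * y := by rw [sq]; exact mul_le_mul hcx hcy hm0 hx0
      calc (m * ((x : ℝ)⁻¹ * (y : ℝ)⁻¹)) ^ 2 = m ^ 2 * ((x : ℝ)⁻¹ * (y : ℝ)⁻¹) ^ 2 := by ring
        _ ≤ (x * y) * ((x : ℝ)⁻¹ * (y : ℝ)⁻¹) ^ 2 :=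
          mul_le_mul_of_nonneg_right h1 (by positivity)
        _ = (x * (x : ℝ)⁻¹) * (y * (y : ℝ)⁻¹) * ((x : ℝ)⁻¹ * (y : ℝ)⁻¹) := by ring
        _ ≤ 1 * 1 * ((x : ℝ)⁻¹ * (y : ℝ)⁻¹) := by
          gcongr
          · exact mul_inv_le_one
          · exact mul_inv_le_one
        _ = _ := by ring
    have hhalf : ∀ v : ℕ, (v : ℝ)⁻¹ ≤ 2 * ((v : ℝ) + 1)⁻¹ := fun v => by
      rcases Nat.eq_zero_or_pos v with rfl | hv
      · simp
      · have : (1 : ℝ) ≤ v := by exact_mod_cast hv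
        rw [inv_eq_one_div, ← div_eq_mul_inv, div_le_div_iff₀ (by positivity) (by positivity)]
        linarith
    calc (((x : ℝ) + 1) * (y + 1) * T) ^ 2 ≤ (m * ((x : ℝ)⁻¹ * (y : ℝ)⁻¹)) ^ 2 :=
          pow_le_pow_left₀ (by positivity) hprod 2
      _ ≤ (x : ℝ)⁻¹ * (y : ℝ)⁻¹ := hsq
      _ ≤ _ := mul_le_mul (hhalf x) (hhalf y) (by positivity) (by positivity)

end Neighbours

/-! ### Convergence of weighted neighbour averages in probability -/

section HighProbability
variable {Ω : Type*} [MeasurableSpace Ω] {P : Measure Ω}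

/-- The statement `G n ω` holds with a probability that tends to one as `n → ∞`. -/
def WithHighProb (P : Measure Ω) (G : ℕ → Ω → Prop) : Prop :=
  Tendsto (fun n => P {ω | ¬ G n ω}) atTop (𝓝 0)

lemma WithHighProb.mono_ae {G G' : ℕ → Ω → Prop} (hG : WithHighProb P G)
    (h : ∀ᶠ n in atTop, ∀ᵐ ω ∂P, G n ω → G' n ω) : WithHighProb P G' := by
  refine tendsto_of_tendsto_of_tendsto_of_le_of_le' tendsto_const_nhds hG
    (Eventually.of_forall fun _ => zero_le) (h.mono fun n hn => ?_)
  exact measure_mono_ae (hn.mono fun ω hω h1 h2 => h1 (hω h2))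

lemma WithHighProb.mono {G G' : ℕ → Ω → Prop} (hG : WithHighProb P G)
    (h : ∀ n ω, G n ω → G' n ω) : WithHighProb P G' :=
  hG.mono_ae (Eventually.of_forall fun n => Eventually.of_forall fun ω => h n ω)

lemma WithHighProb.and {G G' : ℕ → Ω → Prop} (hG : WithHighProb P G) (hG' : WithHighProb P G') :
    WithHighProb P fun n ω => G n ω ∧ G' n ω := by
  have := Tendsto.add hG hG'
  rw [add_zero] at this
  refine tendsto_of_tendsto_of_tendsto_of_le_of_le tendsto_const_nhds this (fun _ => zero_le)
    fun n => (measure_mono ?_).trans (measure_union_le _ _)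
  intro ω hω
  simp only [Set.mem_union, Set.mem_ofPred_eq] at hω ⊢
  tauto

lemma WithHighProb.of_forall {G : ℕ → Ω → Prop} (h : ∀ n ω, G n ω) : WithHighProb P G := by
  have : (fun n => P {ω | ¬ G n ω}) = fun _ => 0 := by
    ext n; simp [h]
  rw [WithHighProb, this]
  exact tendsto_const_nhds

lemma WithHighProb.all {ι : Type*} [Finite ι] {G : ι → ℕ → Ω → Prop}
    (h : ∀ k, WithHighProb P (G k)) : WithHighProb P fun n ω => ∀ k, G k n ω := by
  classical
  cases nonempty_fintype ι
  have : ∀ s : Finset ι, WithHighProb P fun n ω => ∀ k ∈ s, G k n ω := by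
    intro s
    induction s using Finset.induction_on with
    | empty => exact WithHighProb.of_forall fun n ω => by simp
    | insert a s _ ih =>
      refine ((h a).and ih).mono fun n ω hω => ?_
      intro k hk
      rcases Finset.mem_insert.1 hk with rfl | hk
      · exact hω.1
      · exact hω.2 k hk
  exact (this Finset.univ).mono fun n ω hω k => hω k (Finset.mem_univ k)

lemma WithHighProb.of_tendsto_ae [IsFiniteMeasure P] {F : Type*} [TopologicalSpace F]
    [TopologicalSpace.PseudoMetrizableSpace F] {f : ℕ → Ω → F} {c : F}
    (hf : ∀ n, AEStronglyMeasurable (f n) P) (h : ∀ᵐ ω ∂P, Tendsto (fun n => f n ω) atTop (𝓝 c))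
    {U : Set F} (hU : U ∈ 𝓝 c) : WithHighProb P fun n ω => f n ω ∈ U := by
  let _ : PseudoMetricSpace F := TopologicalSpace.pseudoMetrizableSpacePseudoMetric F
  have h1 := tendstoInMeasure_of_tendsto_ae hf h
  obtain ⟨r, hr, hrU⟩ := Metric.mem_nhds_iff.1 hU
  have h2 := h1 (ENNReal.ofReal r) (by simpa using hr)
  refine tendsto_of_tendsto_of_tendsto_of_le_of_le tendsto_const_nhds h2 (fun _ => zero_le)
    fun n => measure_mono fun ω hω => ?_
  by_contra h3
  refine hω (hrU ?_)
  simp only [Set.mem_ofPred_eq, not_le] at h3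
  rw [edist_dist] at h3
  exact (ENNReal.ofReal_lt_ofReal_iff hr).1 h3

/-- Markov's inequality: convergence of second moments to zero implies convergence in
probability. -/
lemma WithHighProb.of_lintegral_sq {V : ℕ → Ω → ℝ} (hV : ∀ n, AEMeasurable (V n) P)
    (h : Tendsto (fun n => ∫⁻ ω, ENNReal.ofReal (V n ω ^ 2) ∂P) atTop (𝓝 0)) {r : ℝ}
    (hr : 0 < r) : WithHighProb P fun n ω => |V n ω| ≤ r := by
  have hr2 : ENNReal.ofReal (r ^ 2) ≠ 0 := by simpa using hr.ne'
  have h1 := ENNReal.Tendsto.div_const h (b := ENNReal.ofReal (r ^ 2)) (Or.inr hr2)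
  rw [ENNReal.zero_div] at h1
  refine tendsto_of_tendsto_of_tendsto_of_le_of_le tendsto_const_nhds h1 (fun _ => zero_le)
    fun n => ?_
  refine le_trans (measure_mono fun ω hω => ?_) (meas_ge_le_lintegral_div
    ((hV n).pow_const 2).ennreal_ofReal hr2 ENNReal.ofReal_ne_top)
  simp only [Set.mem_ofPred_eq, not_le] at hω ⊢
  refine ENNReal.ofReal_le_ofReal ?_
  rw [← sq_abs (V n ω)]
  exact pow_le_pow_left₀ hr.le hω.le 2

end HighProbability

section Exchangeable
variable {H : ℕ} {E : Type*} [NormedAddCommGroup E] {n : ℕ}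

lemma card_neighbours_of_perm (δ : ℝ) (h : Fin H) {d d' : Fin n → Fin H × E}
    (s : Equiv.Perm (Fin n)) (hd : ∀ l, d' (s l) = d l) (i : Fin n) :
    (neighbours δ h d' (s i)).card = (neighbours δ h d i).card := by
  refine (Finset.card_equiv s fun l => ?_).symm
  rw [mem_neighbours, mem_neighbours, hd, hd, s.injective.ne_iff]

variable [MeasurableSpace E] {π : Measure (Fin H × E)} [IsProbabilityMeasure π]

/-- Individuals are exchangeable. -/
lemma integral_neighbours_eq (δ : ℝ) (h : Fin H) (Φ : Fin H × E → ℕ → ℝ) (i k : Fin n) :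
    ∫ d, Φ (d i) (neighbours δ h d i).card ∂(Measure.pi fun _ : Fin n => π) =
      ∫ d, Φ (d k) (neighbours δ h d k).card ∂(Measure.pi fun _ : Fin n => π) := by
  have h1 := (measurePreserving_piCongrLeft (fun _ : Fin n => π) (Equiv.swap i k)).integral_comp'
    (fun d : Fin n → Fin H × E => Φ (d k) (neighbours δ h d k).card)
  rw [← h1]
  refine integral_congr_ae (Eventually.of_forall fun d => ?_)
  set d' := MeasurableEquiv.piCongrLeft (fun _ : Fin n => Fin H × E) (Equiv.swap i k) d with hd'
  have hl : ∀ l, d' (Equiv.swap i k l) = d l := fun l => by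
    rw [hd', MeasurableEquiv.coe_piCongrLeft, Equiv.piCongrLeft_apply_apply]
  have h2 := card_neighbours_of_perm δ h (Equiv.swap i k) hl i
  have h3 := hl i
  rw [Equiv.swap_apply_left] at h2 h3
  simp only
  rw [h2]
  exact congrArg (fun z => Φ z _) h3.symm

end Exchangeable

lemma integral_comp_eval_pi {α : Type*} [MeasurableSpace α] {π : Measure α}
    [IsProbabilityMeasure π] {n : ℕ} (i : Fin n) {F : α → ℝ} (hF : AEStronglyMeasurable F π) :
    ∫ d, F (d i) ∂(Measure.pi fun _ : Fin n => π) = ∫ z, F z ∂π := by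
  have hmap := (measurePreserving_eval (fun _ : Fin n => π) i).map_eq
  have h1 := integral_map (μ := Measure.pi fun _ : Fin n => π)
    (measurable_pi_apply i).aemeasurable (f := F) (by rw [hmap]; exact hF)
  rw [hmap] at h1
  exact h1.symm

section Limit
variable {Ω : Type*} [MeasurableSpace Ω] {P : Measure Ω}
  {H : ℕ} {E : Type*} [NormedAddCommGroup E] [MeasurableSpace E] [BorelSpace E]
  [SecondCountableTopology E] {π : Measure (Fin H × E)} [IsProbabilityMeasure π] {h : Fin H}
  {D : ℕ → Ω → Fin H × E} {δ : ℕ → ℝ}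

lemma integrable_neighbours_ite {n : ℕ} (δ : ℝ) (h : Fin H) {F : Fin H × E → ℝ}
    (hF : Integrable F π) (K : ℕ) (i : Fin n) :
    Integrable (fun d => if (neighbours δ h d i).card ≤ K then F (d i) else 0)
      (Measure.pi fun _ : Fin n => π) := by
  have hm : MeasurableSet {d : Fin n → Fin H × E | (neighbours δ h d i).card ≤ K} := by
    have : {d : Fin n → Fin H × E | (neighbours δ h d i).card ≤ K} =
        {d | ((neighbours δ h d i).card : ℝ) ≤ K} := by ext d; simp
    rw [this]
    exact measurableSet_le (measurable_card_neighbours δ h i) measurable_const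
  refine (((measurePreserving_eval (fun _ : Fin n => π) i).integrable_comp_of_integrable
    hF).indicator hm).congr (Eventually.of_forall fun d => ?_)
  simp [Set.indicator]

/-- If the numbers of neighbours tend to infinity in probability, individuals with few neighbours
are asymptotically negligible: by exchangeability it suffices to consider the first individual. -/
lemma tendsto_mean_few_neighbours (hD : ∀ i, Measurable (D i))
    (hlaw : ∀ n, P.map (fun ω (i : Fin n) => D i ω) = Measure.pi fun _ => π)
    (hN : ∀ K : ℕ, Tendsto (fun n => P {ω | ∃ hi : 0 < n,
      (neighbours (δ n) h (fun i : Fin n => D i ω) ⟨0, hi⟩).card ≤ K}) atTop (𝓝 0))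
    {F : Fin H × E → ℝ} (hF : Integrable F π) (K : ℕ) :
    Tendsto (fun n : ℕ => (n : ℝ)⁻¹ * ∑ i : Fin n,
      ∫ d, (if (neighbours (δ n) h d i).card ≤ K then F (d i) else 0)
        ∂(Measure.pi fun _ : Fin n => π)) atTop (𝓝 0) := by
  have hD0 : P.map (D 0) = π := by
    have hm : Measurable fun ω => fun i : Fin 1 => D i ω := measurable_pi_lambda _ fun i => hD i
    rw [← (measurePreserving_eval (fun _ : Fin 1 => π) 0).map_eq, ← hlaw 1,
      Measure.map_map (measurable_pi_apply 0) hm]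
    rfl
  have hF0 : Integrable (fun ω => F (D 0 ω)) P := by
    rw [← hD0] at hF
    exact hF.comp_measurable (hD 0)
  have hlim := hF0.tendsto_setIntegral_nhds_zero (hN K)
  refine hlim.congr' ((eventually_gt_atTop 0).mono fun n hn => ?_)
  have hsum : ∑ i : Fin n, ∫ d, (if (neighbours (δ n) h d i).card ≤ K then F (d i) else 0)
      ∂(Measure.pi fun _ : Fin n => π) = n * ∫ d, (if (neighbours (δ n) h d ⟨0, hn⟩).card ≤ K
        then F (d ⟨0, hn⟩) else 0) ∂(Measure.pi fun _ : Fin n => π) := by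
    rw [Finset.sum_congr rfl fun i _ => integral_neighbours_eq (π := π) (δ n) h
      (fun z m => if m ≤ K then F z else 0) i ⟨0, hn⟩, Finset.sum_const, Finset.card_univ,
      Fintype.card_fin, nsmul_eq_mul]
  have hDm : Measurable fun ω => fun i : Fin n => D i ω := measurable_pi_lambda _ fun i => hD i
  have hn' : (n : ℝ) ≠ 0 := by exact_mod_cast hn.ne'
  beta_reduce
  rw [hsum, inv_mul_cancel_left₀ hn', ← hlaw n, integral_map hDm.aemeasurable
    (by rw [hlaw n]; exact (integrable_neighbours_ite (δ n) h hF K _).aestronglyMeasurable)]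
  have hset : MeasurableSet {ω | ∃ hi : 0 < n,
      (neighbours (δ n) h (fun i : Fin n => D i ω) ⟨0, hi⟩).card ≤ K} := by
    have : {ω | ∃ hi : 0 < n, (neighbours (δ n) h (fun i : Fin n => D i ω) ⟨0, hi⟩).card ≤ K} =
        (fun ω => fun i : Fin n => D i ω) ⁻¹'
          {d | ((neighbours (δ n) h d ⟨0, hn⟩).card : ℝ) ≤ K} := by
      ext ω; simp [hn]
    rw [this]
    exact hDm (measurableSet_le (measurable_card_neighbours (δ n) h _) measurable_const)
  rw [← integral_indicator hset]
  refine integral_congr_ae (Eventually.of_forall fun ω => ?_)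
  simp only [Set.indicator, Set.mem_ofPred_eq, hn, exists_true_left]

/-- Individuals with at most `K` neighbours are negligible, and all others contribute at most
`1 / K` times the mean of `F`. -/
lemma tendsto_mean_inv_neighbours (hD : ∀ i, Measurable (D i))
    (hlaw : ∀ n, P.map (fun ω (i : Fin n) => D i ω) = Measure.pi fun _ => π)
    (hN : ∀ K : ℕ, Tendsto (fun n => P {ω | ∃ hi : 0 < n,
      (neighbours (δ n) h (fun i : Fin n => D i ω) ⟨0, hi⟩).card ≤ K}) atTop (𝓝 0))
    {F : Fin H × E → ℝ} (hF : Integrable F π) (hF0 : ∀ z, 0 ≤ F z) :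
    Tendsto (fun n : ℕ => (n : ℝ)⁻¹ * ∑ i : Fin n,
      ∫ d, F (d i) * ((neighbours (δ n) h d i).card : ℝ)⁻¹
        ∂(Measure.pi fun _ : Fin n => π)) atTop (𝓝 0) := by
  have hI : 0 ≤ ∫ z, F z ∂π := integral_nonneg hF0
  refine tendsto_order.2 ⟨fun a ha => Eventually.of_forall fun n => lt_of_lt_of_le ha ?_,
    fun a ha => ?_⟩
  · refine mul_nonneg (by positivity) (Finset.sum_nonneg fun i _ => integral_nonneg fun d => ?_)
    exact mul_nonneg (hF0 _) (by positivity)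
  obtain ⟨K, hK⟩ := exists_nat_gt ((∫ z, F z ∂π) / (a / 2))
  have hKpos : (0 : ℝ) < K := lt_of_le_of_lt (by positivity) hK
  have hK2 : (∫ z, F z ∂π) * (K : ℝ)⁻¹ < a / 2 := by
    rw [div_lt_iff₀ (by positivity)] at hK
    rw [← div_eq_mul_inv, div_lt_iff₀ hKpos]
    linarith
  have hlim := (tendsto_order.1 (tendsto_mean_few_neighbours hD hlaw hN hF K)).2 (a / 2)
    (by positivity)
  refine (hlim.and (eventually_gt_atTop 0)).mono fun n ⟨hn, hn0⟩ => ?_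
  have hn' : (n : ℝ) ≠ 0 := by exact_mod_cast hn0.ne'
  have hint : ∀ i : Fin n, Integrable (fun d : Fin n → Fin H × E => F (d i))
      (Measure.pi fun _ : Fin n => π) := fun i =>
    (measurePreserving_eval (fun _ : Fin n => π) i).integrable_comp_of_integrable hF
  have hle : ∀ i : Fin n, ∫ d, F (d i) * ((neighbours (δ n) h d i).card : ℝ)⁻¹
      ∂(Measure.pi fun _ : Fin n => π) ≤ (∫ z, F z ∂π) * (K : ℝ)⁻¹ +
      ∫ d, (if (neighbours (δ n) h d i).card ≤ K then F (d i) else 0)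
        ∂(Measure.pi fun _ : Fin n => π) := by
    intro i
    have hev := integral_comp_eval_pi i hF.aestronglyMeasurable
    rw [← hev, ← integral_mul_const, ← integral_add ((hint i).mul_const _)
      (integrable_neighbours_ite (δ n) h hF K i)]
    refine integral_mono_of_nonneg (Eventually.of_forall fun d => ?_)
      (((hint i).mul_const _).add (integrable_neighbours_ite (δ n) h hF K i))
      (Eventually.of_forall fun d => ?_)
    · exact mul_nonneg (hF0 _) (by positivity)
    · simp only
      split_ifs with hc
      · have := inv_natCast_le_one (neighbours (δ n) h d i).card
        have h2 : 0 ≤ F (d i) * (K : ℝ)⁻¹ := mul_nonneg (hF0 _) (by positivity)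
        nlinarith [hF0 (d i)]
      · rw [add_zero]
        refine mul_le_mul_of_nonneg_left (inv_anti₀ hKpos ?_) (hF0 _)
        exact_mod_cast (not_le.1 hc).le
  calc _ ≤ (n : ℝ)⁻¹ * ∑ i : Fin n, ((∫ z, F z ∂π) * (K : ℝ)⁻¹ +
      ∫ d, (if (neighbours (δ n) h d i).card ≤ K then F (d i) else 0)
        ∂(Measure.pi fun _ : Fin n => π)) := by
        gcongr with i _
        exact hle i
    _ = (∫ z, F z ∂π) * (K : ℝ)⁻¹ + (n : ℝ)⁻¹ * ∑ i : Fin n,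
      ∫ d, (if (neighbours (δ n) h d i).card ≤ K then F (d i) else 0)
        ∂(Measure.pi fun _ : Fin n => π) := by
        rw [Finset.sum_add_distrib, Finset.sum_const, Finset.card_univ, Fintype.card_fin,
          nsmul_eq_mul, mul_add, inv_mul_cancel_left₀ hn']
    _ < a := by linarith

end Limit

section NeighbourConvergence
variable {Ω : Type*} [MeasurableSpace Ω] {P : Measure Ω}
  {H : ℕ} {E : Type*} [NormedAddCommGroup E] [MeasurableSpace E] [BorelSpace E]
  [SecondCountableTopology E] {π : Measure (Fin H × E)} [IsProbabilityMeasure π] {h : Fin H}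
  {e : E → ℝ} {D : ℕ → Ω → Fin H × E} {δ : ℕ → ℝ}

/-- The components of a standard Gaussian vector are uncorrelated with unit variance. -/
lemma lintegral_noiseLaw_dotProduct_sq {n : ℕ} (a : Fin n → ℝ) :
    ∫⁻ z, ENNReal.ofReal ((a ⬝ᵥ z) ^ 2) ∂noiseLaw n = ENNReal.ofReal (∑ l, a l ^ 2) := by
  have hm : ∀ l, MemLp (fun z : Fin n → ℝ => z l) 2 (noiseLaw n) := fun l =>
    (memLp_id_gaussianReal (μ := 0) (v := 1) 2).comp_measurePreserving
      (measurePreserving_eval (fun _ : Fin n => gaussianReal 0 1) l)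
  have hint : ∀ l k, Integrable (fun z : Fin n → ℝ => z l * z k) (noiseLaw n) := fun l k =>
    (hm l).integrable_mul (hm k)
  have hsq : ∀ z : Fin n → ℝ, (a ⬝ᵥ z) ^ 2 = ∑ l, ∑ k, a l * a k * (z l * z k) := fun z => by
    rw [sq, dotProduct, Finset.sum_mul_sum]
    exact Finset.sum_congr rfl fun l _ => Finset.sum_congr rfl fun k _ => by ring
  have hev : ∀ l k, ∫ z, z l * z k ∂noiseLaw n = if l = k then 1 else 0 := by
    intro l k
    have hmean : ∀ l, ∫ z, z l ∂noiseLaw n = 0 := fun l => by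
      have h1 := integral_map (μ := noiseLaw n) (measurable_pi_apply l).aemeasurable
        (f := fun t : ℝ => t) (by fun_prop)
      rw [(measurePreserving_eval (fun _ : Fin n => gaussianReal 0 1) l).map_eq,
        integral_id_gaussianReal] at h1
      exact h1.symm
    split_ifs with hlk
    · subst hlk
      have h1 := integral_map (μ := noiseLaw n) (measurable_pi_apply l).aemeasurable
        (f := fun t : ℝ => t ^ 2) (by fun_prop)
      rw [(measurePreserving_eval (fun _ : Fin n => gaussianReal 0 1) l).map_eq] at h1
      have h2 := variance_eq_sub (memLp_id_gaussianReal (μ := 0) (v := 1) 2)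
      rw [variance_id_gaussianReal] at h2
      simp only [id_eq, Pi.pow_apply, integral_id_gaussianReal, NNReal.coe_one] at h2
      simp_rw [← sq]
      rw [← h1]; linarith
    · have hI := iIndepFun_pi (μ := fun _ : Fin n => gaussianReal 0 1)
        (X := fun _ t => t) fun _ => aemeasurable_id
      have := (hI.indepFun hlk).integral_mul_eq_mul_integral (hm l).aestronglyMeasurable
        (hm k).aestronglyMeasurable
      simp only [Pi.mul_apply] at this
      rw [this, hmean, zero_mul]
  have hint2 : Integrable (fun z : Fin n → ℝ => (a ⬝ᵥ z) ^ 2) (noiseLaw n) := by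
    simp_rw [hsq]
    exact integrable_finsetSum _ fun l _ => integrable_finsetSum _ fun k _ =>
      (hint l k).const_mul _
  rw [← ofReal_integral_eq_lintegral_ofReal hint2 (Eventually.of_forall fun z => sq_nonneg _)]
  congr 1
  simp_rw [hsq]
  rw [integral_finsetSum _ fun l _ => integrable_finsetSum _ fun k _ => (hint l k).const_mul _]
  refine Finset.sum_congr rfl fun l _ => ?_
  rw [integral_finsetSum _ fun k _ => (hint l k).const_mul _]
  simp_rw [integral_const_mul, hev]
  simp [sq]

/-- The inverse-probability-weighted residuals of the nearest-neighbour averages of a Lipschitz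
function are asymptotically negligible at the scale `√n`. -/
lemma IsPropensity.withHighProb_bias_le (hp : IsPropensity π h e) (hD : ∀ i, Measurable (D i))
    (hlaw : ∀ n, P.map (fun ω (i : Fin n) => D i ω) = Measure.pi fun _ => π)
    (hδ : Tendsto δ atTop (𝓝 0))
    (hN : ∀ K : ℕ, Tendsto (fun n => P {ω | ∃ hi : 0 < n,
      (neighbours (δ n) h (fun i : Fin n => D i ω) ⟨0, hi⟩).card ≤ K}) atTop (𝓝 0))
    {g φ : E → ℝ} (hg : Measurable g) {C : ℝ≥0} (hφ : LipschitzWith C φ)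
    (h1 : Integrable (fun z => (ipwRes h e z * g z.2) ^ 2) π)
    (h2 : Integrable (fun z => (ipwRes h e z * g z.2) ^ 2 * φ z.2 ^ 2) π) {r : ℝ} (hr : 0 < r) :
    WithHighProb P fun n ω => |(√n)⁻¹ * ∑ i : Fin n, ipwRes h e (D i ω) * g (D i ω).2 *
      (avg (neighbours (δ n) h (fun l : Fin n => D l ω) i) (fun l => φ (D l ω).2) -
        φ (D i ω).2)| ≤ r := by
  have hwm : Measurable fun z : Fin H × E => ipwRes h e z * g z.2 :=
    (measurable_ipwRes h hp.measurable).mul (hg.comp measurable_snd)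
  have hφm : Measurable fun z : Fin H × E => φ z.2 := hφ.continuous.measurable.comp measurable_snd
  set S : ∀ n : ℕ, (Fin n → Fin H × E) → ℝ := fun n d => ∑ i, ipwRes h e (d i) * g (d i).2 *
    (avg (neighbours (δ n) h d i) (fun l => φ (d l).2) - φ (d i).2) with hS
  have hSm : ∀ n, Measurable (S n) := fun n =>
    Finset.measurable_sum _ fun i _ => (hwm.comp (measurable_pi_apply i)).mul
      ((measurable_avg (measurableSet_mem_neighbours (δ n) h i)
        fun l => hφm.comp (measurable_pi_apply l)).sub (hφm.comp (measurable_pi_apply i)))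
  have hDm : ∀ n : ℕ, Measurable fun ω => fun i : Fin n => D i ω := fun n =>
    measurable_pi_lambda _ fun i => hD i
  have hL2 : ∀ c : ℝ, Integrable (fun z => (ipwRes h e z * g z.2 * (c + |φ z.2|)) ^ 2) π := by
    intro c
    refine (((h1.const_mul (2 * c ^ 2)).add (h2.const_mul 2))).mono'
      ((hwm.mul (hφm.abs.const_add c)).pow_const 2).aestronglyMeasurable
      (Eventually.of_forall fun z => ?_)
    rw [Real.norm_of_nonneg (sq_nonneg _), mul_pow]
    have := sq_nonneg (c - |φ z.2|)
    have h3 : (c + |φ z.2|) ^ 2 ≤ 2 * c ^ 2 + 2 * φ z.2 ^ 2 := by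
      rw [← sq_abs (φ z.2)]; nlinarith
    calc _ ≤ (ipwRes h e z * g z.2) ^ 2 * (2 * c ^ 2 + 2 * φ z.2 ^ 2) := by gcongr
      _ = _ := by simp only [Pi.add_apply]; ring
  refine WithHighProb.of_lintegral_sq
    (V := fun n ω => (√n)⁻¹ * S n (fun i : Fin n => D i ω)) (fun n =>
      (((hSm n).comp (hDm n)).const_mul _).aemeasurable) ?_ hr
  -- the second moment, bounded by the variance inequality
  set I1 := ∫ z, (ipwRes h e z * g z.2) ^ 2 ∂π with hI1
  set T : ℕ → ℝ := fun n => (n : ℝ)⁻¹ * ∑ i : Fin n,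
      ∫ d, (if (neighbours (δ n) h d i).card ≤ 1 then
        (ipwRes h e (d i) * g (d i).2) ^ 2 * φ (d i).2 ^ 2 else 0)
        ∂(Measure.pi fun _ : Fin n => π) with hT
  have hTlim : Tendsto T atTop (𝓝 0) := tendsto_mean_few_neighbours hD hlaw hN h2 1
  have hlim : Tendsto (fun n => ENNReal.ofReal (16 * C ^ 2 * δ n ^ 2 * I1 + 4 * T n)) atTop
      (𝓝 0) := by
    rw [← ENNReal.ofReal_zero]
    refine (ENNReal.continuous_ofReal.tendsto 0).comp ?_
    have := ((((hδ.pow 2).const_mul (16 * (C : ℝ) ^ 2))).mul_const I1).add (hTlim.const_mul 4)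
    simpa using this
  refine tendsto_of_tendsto_of_tendsto_of_le_of_le' tendsto_const_nhds hlim
    (Eventually.of_forall fun _ => zero_le) ((eventually_gt_atTop 0).mono fun n hn => ?_)
  have hn' : (0 : ℝ) < n := by exact_mod_cast hn
  have hmemR : Integrable (fun d => S n d ^ 2) (Measure.pi fun _ : Fin n => π) := by
    refine (memLp_two_iff_integrable_sq (hSm n).aestronglyMeasurable).1 ?_
    refine memLp_finsetSum _ fun i _ => ?_
    have h3 : MemLp (fun d : Fin n → Fin H × E =>
        ipwRes h e (d i) * g (d i).2 * (C * |δ n| + |φ (d i).2|)) 2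
        (Measure.pi fun _ : Fin n => π) := by
      refine MemLp.comp_measurePreserving (g := fun z : Fin H × E =>
        ipwRes h e z * g z.2 * (C * |δ n| + |φ z.2|)) ?_
        (measurePreserving_eval (fun _ : Fin n => π) i)
      exact (memLp_two_iff_integrable_sq
        (hwm.mul (hφm.abs.const_add _)).aestronglyMeasurable).2 (hL2 _)
    refine h3.mono ((hwm.comp (measurable_pi_apply i)).mul
      ((measurable_avg (measurableSet_mem_neighbours (δ n) h i)
        fun l => hφm.comp (measurable_pi_apply l)).sub
        (hφm.comp (measurable_pi_apply i)))).aestronglyMeasurable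
      (Eventually.of_forall fun d => ?_)
    rw [norm_mul (ipwRes h e (d i) * g (d i).2), norm_mul (ipwRes h e (d i) * g (d i).2)]
    refine mul_le_mul_of_nonneg_left ?_ (norm_nonneg _)
    rw [Real.norm_eq_abs, Real.norm_eq_abs]
    refine le_trans ?_ (le_abs_self _)
    exact abs_avg_neighbours_sub_le hφ d i subset_rfl
  have hV : ∫⁻ ω, ENNReal.ofReal (((√n)⁻¹ * S n (fun i : Fin n => D i ω)) ^ 2) ∂P =
      ENNReal.ofReal ((n : ℝ)⁻¹ * ∫ d, S n d ^ 2 ∂(Measure.pi fun _ : Fin n => π)) := by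
    have hmm : Measurable fun d => ENNReal.ofReal (((√(n : ℝ))⁻¹ * S n d) ^ 2) :=
      (((hSm n).const_mul _).pow_const 2).ennreal_ofReal
    rw [← lintegral_map hmm (hDm n), hlaw n, ← integral_const_mul,
      ofReal_integral_eq_lintegral_ofReal (hmemR.const_mul _)
        (Eventually.of_forall fun d => by positivity)]
    refine lintegral_congr fun d => ?_
    rw [mul_pow, inv_pow, Real.sq_sqrt hn'.le]
  rw [hV]
  refine ENNReal.ofReal_le_ofReal ?_
  have hmain := hp.integral_sq_bias_le (n := n) hg hφ (δ n) (hL2 _)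
  have hterm : ∀ i : Fin n, ∫ d, (ipwRes h e (d i) * g (d i).2) ^ 2 *
      (2 * C * |δ n| + if (neighbours (δ n) h d i).card ≤ 1 then |φ (d i).2| else 0) ^ 2
        ∂(Measure.pi fun _ : Fin n => π) ≤ 8 * C ^ 2 * δ n ^ 2 * I1 +
        2 * ∫ d, (if (neighbours (δ n) h d i).card ≤ 1 then
        (ipwRes h e (d i) * g (d i).2) ^ 2 * φ (d i).2 ^ 2 else 0)
        ∂(Measure.pi fun _ : Fin n => π) := by
    intro i
    have hi1 : Integrable (fun d : Fin n → Fin H × E => (ipwRes h e (d i) * g (d i).2) ^ 2)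
        (Measure.pi fun _ : Fin n => π) :=
      (measurePreserving_eval (fun _ : Fin n => π) i).integrable_comp_of_integrable h1
    have hi2 := integrable_neighbours_ite (n := n) (δ n) h h2 1 i
    have hI1' : I1 = ∫ d, (ipwRes h e (d i) * g (d i).2) ^ 2 ∂(Measure.pi fun _ : Fin n => π) :=
      (integral_comp_eval_pi i h1.aestronglyMeasurable).symm
    rw [hI1', ← integral_const_mul, ← integral_const_mul,
      ← integral_add (hi1.const_mul _) (hi2.const_mul _)]
    refine integral_mono_of_nonneg (Eventually.of_forall fun d => by positivity)
      ((hi1.const_mul _).add (hi2.const_mul _)) (Eventually.of_forall fun d => ?_)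
    simp only
    split_ifs
    · have := sq_nonneg (2 * C * |δ n| - |φ (d i).2|)
      have h3 : (2 * C * |δ n| + |φ (d i).2|) ^ 2 ≤ 8 * C ^ 2 * δ n ^ 2 + 2 * φ (d i).2 ^ 2 := by
        rw [← sq_abs (φ (d i).2), ← sq_abs (δ n)]; nlinarith
      calc _ ≤ (ipwRes h e (d i) * g (d i).2) ^ 2 *
            (8 * C ^ 2 * δ n ^ 2 + 2 * φ (d i).2 ^ 2) := by gcongr
        _ = _ := by ring
    · rw [mul_zero, add_zero, add_zero, mul_pow (2 * (C : ℝ)), sq_abs]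
      have : 0 ≤ (ipwRes h e (d i) * g (d i).2) ^ 2 * (C ^ 2 * δ n ^ 2) := by positivity
      nlinarith
  calc (n : ℝ)⁻¹ * ∫ d, S n d ^ 2 ∂(Measure.pi fun _ : Fin n => π)
      ≤ (n : ℝ)⁻¹ * (2 * ∑ i : Fin n, (8 * C ^ 2 * δ n ^ 2 * I1 +
        2 * ∫ d, (if (neighbours (δ n) h d i).card ≤ 1 then
        (ipwRes h e (d i) * g (d i).2) ^ 2 * φ (d i).2 ^ 2 else 0)
        ∂(Measure.pi fun _ : Fin n => π))) := by
        refine mul_le_mul_of_nonneg_left (hmain.trans ?_) (by positivity)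
        gcongr with i _
        exact hterm i
    _ = 16 * C ^ 2 * δ n ^ 2 * I1 + 4 * T n := by
        rw [Finset.sum_add_distrib, Finset.sum_const, Finset.card_univ, Fintype.card_fin,
          nsmul_eq_mul, ← Finset.mul_sum, hT]
        field_simp
        ring

lemma sum_mul_avg_eq_dotProduct {n : ℕ} (N : Fin n → Finset (Fin n)) (w z : Fin n → ℝ) :
    ∑ i, w i * avg (N i) z =
      (fun l => ∑ i, w i * (if l ∈ N i then ((N i).card : ℝ)⁻¹ else 0)) ⬝ᵥ z := by
  simp only [dotProduct, Finset.sum_mul]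
  rw [Finset.sum_comm]
  refine Finset.sum_congr rfl fun i _ => ?_
  have : avg (N i) z = ∑ l, (if l ∈ N i then ((N i).card : ℝ)⁻¹ else 0) * z l := by
    simp_rw [ite_mul, zero_mul]
    rw [Finset.sum_ite_mem, Finset.univ_inter, ← Finset.mul_sum, avg, div_eq_inv_mul]
  rw [this, Finset.mul_sum]
  exact Finset.sum_congr rfl fun l _ => by ring

lemma measurable_sum_mul_avg {n : ℕ} (he : Measurable e) {g : E → ℝ} (hg : Measurable g) (δ : ℝ) :
    Measurable fun q : (Fin n → Fin H × E) × (Fin n → ℝ) =>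
      ∑ i, ipwRes h e (q.1 i) * g (q.1 i).2 * avg (neighbours δ h q.1 i) q.2 := by
  have hwm : Measurable fun z : Fin H × E => ipwRes h e z * g z.2 :=
    (measurable_ipwRes h he).mul (hg.comp measurable_snd)
  refine Finset.measurable_sum _ fun i _ => Measurable.mul
    (hwm.comp ((measurable_pi_apply i).comp measurable_fst)) ?_
  exact measurable_avg (s := fun q : (Fin n → Fin H × E) × (Fin n → ℝ) => neighbours δ h q.1 i)
    (v := fun l q => q.2 l) (fun l => measurable_fst (measurableSet_mem_neighbours δ h i l))
    fun l => (measurable_pi_apply l).comp measurable_snd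

/-- Second moment of the inverse-probability-weighted averages of the noise over nearest
neighbours. -/
lemma IsPropensity.lintegral_sq_noise_le (hp : IsPropensity π h e) {n : ℕ} {g : E → ℝ}
    (hg : Measurable g) (δ : ℝ) (h1 : Integrable (fun z => (ipwRes h e z * g z.2) ^ 2) π) :
    ∫⁻ q, ENNReal.ofReal ((∑ i, ipwRes h e (q.1 i) * g (q.1 i).2 *
      avg (neighbours δ h q.1 i) q.2) ^ 2) ∂((Measure.pi fun _ : Fin n => π).prod (noiseLaw n)) ≤
      ENNReal.ofReal (4 * ∑ i, ∫ d, (ipwRes h e (d i) * g (d i).2) ^ 2 *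
        ((neighbours δ h d i).card : ℝ)⁻¹ ∂(Measure.pi fun _ : Fin n => π)) := by
  have hwm : Measurable fun z : Fin H × E => ipwRes h e z * g z.2 :=
    (measurable_ipwRes h hp.measurable).mul (hg.comp measurable_snd)
  have hm0 : ∀ l i : Fin n, Measurable fun d : Fin n → Fin H × E =>
      ipwRes h e (d i) * g (d i).2 *
      (if l ∈ neighbours δ h d i then ((neighbours δ h d i).card : ℝ)⁻¹ else 0) :=
    fun l i => (hwm.comp (measurable_pi_apply i)).mul
      (Measurable.ite (measurableSet_mem_neighbours δ h i l)
        (measurable_card_neighbours δ h i).inv measurable_const)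
  have hint : Integrable (fun d : Fin n → Fin H × E => ∑ l, (∑ i, ipwRes h e (d i) * g (d i).2 *
      (if l ∈ neighbours δ h d i then ((neighbours δ h d i).card : ℝ)⁻¹ else 0)) ^ 2)
      (Measure.pi fun _ : Fin n => π) := by
    refine integrable_finsetSum _ fun l _ => ?_
    refine (memLp_two_iff_integrable_sq
      (Finset.measurable_sum _ fun i _ => hm0 l i).aestronglyMeasurable).1 ?_
    refine memLp_finsetSum _ fun i _ => ?_
    have h3 : MemLp (fun d : Fin n → Fin H × E => ipwRes h e (d i) * g (d i).2) 2
        (Measure.pi fun _ : Fin n => π) := by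
      refine MemLp.comp_measurePreserving (g := fun z : Fin H × E => ipwRes h e z * g z.2) ?_
        (measurePreserving_eval (fun _ : Fin n => π) i)
      exact (memLp_two_iff_integrable_sq hwm.aestronglyMeasurable).2 h1
    refine h3.mono (hm0 l i).aestronglyMeasurable (Eventually.of_forall fun d => ?_)
    rw [norm_mul]
    refine mul_le_of_le_one_right (norm_nonneg _) ?_
    split_ifs
    · rw [Real.norm_of_nonneg (by positivity)]
      exact inv_natCast_le_one _
    · simp
  rw [lintegral_prod _ ((measurable_sum_mul_avg hp.measurable hg δ).pow_const
    2).ennreal_ofReal.aemeasurable]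
  simp only [sum_mul_avg_eq_dotProduct, lintegral_noiseLaw_dotProduct_sq]
  rw [← ofReal_integral_eq_lintegral_ofReal hint
    (Eventually.of_forall fun d => Finset.sum_nonneg fun l _ => sq_nonneg _)]
  refine ENNReal.ofReal_le_ofReal ((hp.integral_sq_noiseWeight_le (n := n) hg δ h1).trans
    (le_of_eq ?_))
  simp_rw [mul_left_comm _ (2 : ℝ) _, integral_const_mul]
  rw [← Finset.mul_sum]
  ring

/-- The inverse-probability-weighted averages of the noise over nearest neighbours are
asymptotically negligible at the scale `√n`. -/
lemma IsPropensity.withHighProb_noise_le (hp : IsPropensity π h e) (hD : ∀ i, Measurable (D i))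
    {Z : ℕ → Ω → ℝ} (hZ : ∀ i, Measurable (Z i))
    (hlawZ : ∀ n, P.map (fun ω => (fun i : Fin n => D i ω, fun i : Fin n => Z i ω)) =
      (Measure.pi fun _ => π).prod (noiseLaw n))
    (hN : ∀ K : ℕ, Tendsto (fun n => P {ω | ∃ hi : 0 < n,
      (neighbours (δ n) h (fun i : Fin n => D i ω) ⟨0, hi⟩).card ≤ K}) atTop (𝓝 0))
    {g : E → ℝ} (hg : Measurable g)
    (h1 : Integrable (fun z => (ipwRes h e z * g z.2) ^ 2) π) {r : ℝ} (hr : 0 < r) :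
    WithHighProb P fun n ω => |(√n)⁻¹ * ∑ i : Fin n, ipwRes h e (D i ω) * g (D i ω).2 *
      avg (neighbours (δ n) h (fun l : Fin n => D l ω) i) (fun l => Z l ω)| ≤ r := by
  have hDm : ∀ n : ℕ, Measurable fun ω => fun i : Fin n => D i ω := fun n =>
    measurable_pi_lambda _ fun i => hD i
  have hZm : ∀ n : ℕ, Measurable fun ω => fun i : Fin n => Z i ω := fun n =>
    measurable_pi_lambda _ fun i => hZ i
  have hlaw : ∀ n, P.map (fun ω (i : Fin n) => D i ω) = Measure.pi fun _ => π := fun n => by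
    have := congrArg (fun m => m.map Prod.fst) (hlawZ n)
    simp only [Measure.map_map measurable_fst ((hDm n).prodMk (hZm n)), Measure.map_fst_prod,
      measure_univ, one_smul] at this
    exact this
  set S : ∀ n : ℕ, (Fin n → Fin H × E) × (Fin n → ℝ) → ℝ := fun n q =>
    ∑ i, ipwRes h e (q.1 i) * g (q.1 i).2 * avg (neighbours (δ n) h q.1 i) q.2 with hS
  have hSm : ∀ n, Measurable (S n) := fun n => measurable_sum_mul_avg hp.measurable hg (δ n)
  refine WithHighProb.of_lintegral_sq
    (V := fun (n : ℕ) ω => (√n)⁻¹ * S n (fun i : Fin n => D i ω, fun i : Fin n => Z i ω))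
    (fun n => (((hSm n).comp ((hDm n).prodMk (hZm n))).const_mul _).aemeasurable) ?_ hr
  have hTlim := (tendsto_mean_inv_neighbours hD hlaw hN h1 fun z => sq_nonneg _).const_mul 4
  have hlim := (ENNReal.continuous_ofReal.tendsto _).comp hTlim
  rw [mul_zero, ENNReal.ofReal_zero] at hlim
  refine tendsto_of_tendsto_of_tendsto_of_le_of_le tendsto_const_nhds hlim
    (fun _ => zero_le) fun n => ?_
  have hn' : (0 : ℝ) ≤ (n : ℝ)⁻¹ := by positivity
  have hmm : Measurable fun q => ENNReal.ofReal (((√(n : ℝ))⁻¹ * S n q) ^ 2) :=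
    (((hSm n).const_mul _).pow_const 2).ennreal_ofReal
  have hpush : ∫⁻ ω, ENNReal.ofReal (((√(n : ℝ))⁻¹ *
      S n (fun i : Fin n => D i ω, fun i : Fin n => Z i ω)) ^ 2) ∂P =
      ∫⁻ q, ENNReal.ofReal (((√(n : ℝ))⁻¹ * S n q) ^ 2)
        ∂((Measure.pi fun _ : Fin n => π).prod (noiseLaw n)) := by
    rw [← hlawZ n, lintegral_map hmm ((hDm n).prodMk (hZm n))]
  beta_reduce
  rw [hpush]
  have hsq : ∀ q, ENNReal.ofReal (((√(n : ℝ))⁻¹ * S n q) ^ 2) =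
      ENNReal.ofReal (n : ℝ)⁻¹ * ENNReal.ofReal (S n q ^ 2) := fun q => by
    rw [mul_pow, inv_pow, Real.sq_sqrt (Nat.cast_nonneg n), ENNReal.ofReal_mul hn']
  simp_rw [hsq]
  rw [lintegral_const_mul _ ((hSm n).pow_const 2).ennreal_ofReal]
  refine (mul_le_mul_right (hp.lintegral_sq_noise_le hg (δ n) h1) _).trans (le_of_eq ?_)
  rw [← ENNReal.ofReal_mul hn']
  exact congrArg ENNReal.ofReal (mul_left_comm _ _ _)

/-- Averages weighted by the inverse numbers of neighbours vanish asymptotically. -/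
lemma withHighProb_mean_inv_neighbours_le (hD : ∀ i, Measurable (D i))
    (hlaw : ∀ n, P.map (fun ω (i : Fin n) => D i ω) = Measure.pi fun _ => π)
    (hN : ∀ K : ℕ, Tendsto (fun n => P {ω | ∃ hi : 0 < n,
      (neighbours (δ n) h (fun i : Fin n => D i ω) ⟨0, hi⟩).card ≤ K}) atTop (𝓝 0))
    {F : Fin H × E → ℝ} (hFm : Measurable F) (hF : Integrable F π) (hF0 : ∀ z, 0 ≤ F z)
    {r : ℝ} (hr : 0 < r) :
    WithHighProb P fun n ω => (n : ℝ)⁻¹ * ∑ i : Fin n, F (D i ω) *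
      ((neighbours (δ n) h (fun l : Fin n => D l ω) i).card : ℝ)⁻¹ ≤ r := by
  have hDm : ∀ n : ℕ, Measurable fun ω => fun i : Fin n => D i ω := fun n =>
    measurable_pi_lambda _ fun i => hD i
  have hm : ∀ (n : ℕ) (i : Fin n), Measurable fun d : Fin n → Fin H × E =>
      F (d i) * ((neighbours (δ n) h d i).card : ℝ)⁻¹ := fun n i =>
    (hFm.comp (measurable_pi_apply i)).mul (measurable_card_neighbours (δ n) h i).inv
  have hlim' := (ENNReal.continuous_ofReal.tendsto _).comp
    ((tendsto_mean_inv_neighbours hD hlaw hN hF hF0).div_const r)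
  rw [zero_div, ENNReal.ofReal_zero] at hlim'
  refine tendsto_of_tendsto_of_tendsto_of_le_of_le tendsto_const_nhds hlim' (fun _ => zero_le)
    fun n => ?_
  have hint : ∀ i : Fin n, Integrable (fun d : Fin n → Fin H × E =>
      F (d i) * ((neighbours (δ n) h d i).card : ℝ)⁻¹) (Measure.pi fun _ : Fin n => π) := fun i => by
    refine ((measurePreserving_eval (fun _ : Fin n => π) i).integrable_comp_of_integrable hF).mono
      (hm n i).aestronglyMeasurable (Eventually.of_forall fun d => ?_)
    rw [norm_mul]
    refine mul_le_of_le_one_right (norm_nonneg _) ?_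
    rw [Real.norm_of_nonneg (by positivity)]
    exact inv_natCast_le_one _
  set G : (Fin n → Fin H × E) → ℝ := fun d => (n : ℝ)⁻¹ * ∑ i : Fin n, F (d i) *
      ((neighbours (δ n) h d i).card : ℝ)⁻¹ with hG
  have hGm : Measurable G := (Finset.measurable_sum _ fun i _ => hm n i).const_mul _
  have hGi : Integrable G (Measure.pi fun _ : Fin n => π) :=
    (integrable_finsetSum _ fun i _ => hint i).const_mul _
  have hG0 : ∀ d, 0 ≤ G d := fun d => mul_nonneg (by positivity)
    (Finset.sum_nonneg fun i _ => mul_nonneg (hF0 _) (by positivity))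
  have hset : MeasurableSet {d | ¬ G d ≤ r} := (measurableSet_le hGm measurable_const).compl
  calc P {ω | ¬ G (fun i : Fin n => D i ω) ≤ r}
      = (Measure.pi fun _ : Fin n => π) {d | ¬ G d ≤ r} := by
        rw [← hlaw n, Measure.map_apply (hDm n) hset]; rfl
    _ ≤ (Measure.pi fun _ : Fin n => π) {d | ENNReal.ofReal r ≤ ENNReal.ofReal (G d)} :=
        measure_mono fun d hd => ENNReal.ofReal_le_ofReal (not_le.1 hd).le
    _ ≤ (∫⁻ d, ENNReal.ofReal (G d) ∂(Measure.pi fun _ : Fin n => π)) / ENNReal.ofReal r :=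
        meas_ge_le_lintegral_div hGm.ennreal_ofReal.aemeasurable (by simpa using hr)
          ENNReal.ofReal_ne_top
    _ = _ := by
        rw [← ofReal_integral_eq_lintegral_ofReal hGi (Eventually.of_forall hG0),
          ← ENNReal.ofReal_div_of_pos hr, hG, integral_const_mul,
          integral_finsetSum _ fun i _ => hint i]
        rfl

end NeighbourConvergence

/-! ### Moments and laws of large numbers -/

section Moments
variable {H : ℕ} {E : Type*} [MeasurableSpace E] {π : Measure (Fin H × E)} {h : Fin H} {e : E → ℝ}

lemma IsPropensity.integrable_treat_div_sq (hp : IsPropensity π h e) {Ψ : E → ℝ}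
    (hΨ : Measurable Ψ) (hint : Integrable (fun z => Ψ z.2 / e z.2) π) :
    Integrable (fun z => (if z.1 = h then 1 else 0) / e z.2 ^ 2 * Ψ z.2) π := by
  have hem := hp.measurable
  have h1 : Integrable (fun x => Ψ x / e x) (π.map Prod.snd) :=
    (integrable_map_measure (hΨ.div hem).aestronglyMeasurable
      measurable_snd.aemeasurable).2 hint
  have h2 : Integrable (fun x => Ψ x / e x ^ 2)
      ((π.restrict (Prod.fst ⁻¹' {h})).map Prod.snd) := by
    rw [hp.map_restrict, integrable_withDensity_iff_integrable_smul' hem.ennreal_ofReal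
      (Eventually.of_forall fun x => ENNReal.ofReal_lt_top)]
    refine h1.congr (hp.pos_map.mono fun x hx => ?_)
    simp only [smul_eq_mul]
    rw [ENNReal.toReal_ofReal hx.1.le]
    have := hx.1.ne'
    field_simp
  have h3 := (integrable_map_measure (hΨ.div (hem.pow_const 2)).aestronglyMeasurable
    measurable_snd.aemeasurable).1 h2
  have h4 := (integrable_indicator_iff (measurableSet_fst_eq (E := E) h)).2 h3
  refine h4.congr (Eventually.of_forall fun z => ?_)
  by_cases hz : z.1 = h
  · simp [Set.indicator, hz, div_eq_inv_mul]
  · simp [Set.indicator, hz]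

lemma IsPropensity.integrable_snd (hp : IsPropensity π h e) {Ψ : E → ℝ}
    (hΨ : Measurable Ψ) (hint : Integrable (fun z => Ψ z.2 / e z.2) π) :
    Integrable (fun z => Ψ z.2) π := by
  refine hint.mono (hΨ.comp measurable_snd).aestronglyMeasurable (hp.pos.mono fun z hz => ?_)
  rw [norm_div, le_div_iff₀ (by simpa using hz.1.ne'), Real.norm_of_nonneg hz.1.le]
  exact mul_le_of_le_one_right (norm_nonneg _) hz.2.le

lemma IsPropensity.integrable_ipwRes_sq (hp : IsPropensity π h e) {Ψ : E → ℝ}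
    (hΨ : Measurable Ψ) (hint : Integrable (fun z => Ψ z.2 / e z.2) π) :
    Integrable (fun z => ipwRes h e z ^ 2 * Ψ z.2) π := by
  refine ((hp.integrable_treat_div_sq hΨ hint).norm.add (hp.integrable_snd hΨ hint).norm).mono'
    (((measurable_ipwRes h hp.measurable).pow_const 2).mul
      (hΨ.comp measurable_snd)).aestronglyMeasurable (hp.pos.mono fun z hz => ?_)
  have h1 : ipwRes h e z ^ 2 ≤ (if z.1 = h then 1 else 0) / e z.2 ^ 2 + 1 := by
    rw [ipwRes]
    split_ifs
    · have h2 : 1 / e z.2 ^ 2 = (1 / e z.2) ^ 2 := by rw [div_pow, one_pow]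
      have h3 : 0 < 1 / e z.2 := by have := hz.1; positivity
      rw [h2]; nlinarith
    · simp
  have h4 : 0 ≤ (if z.1 = h then (1 : ℝ) else 0) / e z.2 ^ 2 := by
    split_ifs <;> positivity
  simp only [Pi.add_apply, norm_mul]
  rw [Real.norm_of_nonneg (sq_nonneg (ipwRes h e z)), Real.norm_of_nonneg h4]
  nlinarith [norm_nonneg (Ψ z.2)]

lemma sq_mul_sq_le_of_le {b C r g φ : ℝ} (hg : |g| ≤ r) (hφ : |φ| ≤ b + C * r) :
    g ^ 2 * φ ^ 2 ≤ 2 * (b ^ 2 + C ^ 2) * (1 + r ^ 4) := by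
  have h1 : g ^ 2 ≤ r ^ 2 := by rw [← sq_abs g]; exact pow_le_pow_left₀ (abs_nonneg _) hg 2
  have h2 : φ ^ 2 ≤ (b + C * r) ^ 2 := by
    rw [← sq_abs φ]; exact pow_le_pow_left₀ (abs_nonneg _) hφ 2
  have h3 : (b + C * r) ^ 2 ≤ 2 * b ^ 2 + 2 * C ^ 2 * r ^ 2 := by nlinarith [sq_nonneg (b - C * r)]
  have h4 : r ^ 2 ≤ 1 + r ^ 4 := by nlinarith [sq_nonneg (r ^ 2 - 1), sq_nonneg r]
  calc g ^ 2 * φ ^ 2 ≤ r ^ 2 * (2 * b ^ 2 + 2 * C ^ 2 * r ^ 2) :=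
        mul_le_mul h1 (h2.trans h3) (sq_nonneg _) (sq_nonneg _)
    _ = 2 * b ^ 2 * r ^ 2 + 2 * C ^ 2 * r ^ 4 := by ring
    _ ≤ 2 * b ^ 2 * (1 + r ^ 4) + 2 * C ^ 2 * (1 + r ^ 4) := by
        have := sq_nonneg b; have := sq_nonneg C
        gcongr
        linarith
    _ = _ := by ring

lemma abs_le_add_mul_norm_of_lipschitz {E : Type*} [NormedAddCommGroup E] {φ : E → ℝ} {C : ℝ≥0}
    (hφ : LipschitzWith C φ) (x : E) :
    |φ x| ≤ |φ 0| + C * ‖x‖ := by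
  have h1 := hφ.dist_le_mul x 0
  rw [Real.dist_eq, dist_zero_right] at h1
  have h2 := abs_add_le (φ x - φ 0) (φ 0)
  rw [sub_add_cancel] at h2
  linarith

variable [NormedAddCommGroup E] (hmom : Integrable (fun z => (1 + ‖z.2‖ ^ 4) / e z.2) π)

include hmom in
lemma IsPropensity.integrable_div_of_le (hp : IsPropensity π h e) {Ψ : E → ℝ} (hΨ : Measurable Ψ)
    {K : ℝ} (hle : ∀ x, |Ψ x| ≤ K * (1 + ‖x‖ ^ 4)) :
    Integrable (fun z => Ψ z.2 / e z.2) π := by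
  refine (hmom.const_mul K).mono' ((hΨ.div hp.measurable).comp measurable_snd).aestronglyMeasurable
    (hp.pos.mono fun z hz => ?_)
  rw [norm_div, Real.norm_of_nonneg hz.1.le, ← mul_div_assoc]
  exact div_le_div_of_nonneg_right (hle _) hz.1.le

include hmom in
lemma IsPropensity.integrable_ipwRes_mul_sq (hp : IsPropensity π h e) {g : E → ℝ}
    (hg : Measurable g) (hgb : ∀ x, |g x| ≤ ‖x‖) :
    Integrable (fun z => (ipwRes h e z * g z.2) ^ 2) π := by
  refine (hp.integrable_ipwRes_sq (hg.pow_const 2) (hp.integrable_div_of_le hmom (hg.pow_const 2)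
    (K := 2) fun x => ?_)).congr (Eventually.of_forall fun z => ?_)
  · have := sq_mul_sq_le_of_le (b := 1) (C := 0) (hgb x) (φ := 1) (by simp)
    rw [abs_of_nonneg (sq_nonneg _)]
    linarith
  · simp only [mul_pow]

include hmom in
lemma IsPropensity.integrable_ipwRes_mul_sq_mul [BorelSpace E] (hp : IsPropensity π h e) {g φ : E → ℝ}
    (hg : Measurable g) (hgb : ∀ x, |g x| ≤ ‖x‖) {C : ℝ≥0} (hφ : LipschitzWith C φ) :
    Integrable (fun z => (ipwRes h e z * g z.2) ^ 2 * φ z.2 ^ 2) π := by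
  have hm : Measurable fun x => g x ^ 2 * φ x ^ 2 :=
    (hg.pow_const 2).mul (hφ.continuous.measurable.pow_const 2)
  refine (hp.integrable_ipwRes_sq hm (hp.integrable_div_of_le hmom hm
    (K := 2 * (|φ 0| ^ 2 + (C : ℝ) ^ 2)) fun x => ?_)).congr (Eventually.of_forall fun z => ?_)
  · rw [abs_of_nonneg (by positivity)]
    exact sq_mul_sq_le_of_le (hgb x) (abs_le_add_mul_norm_of_lipschitz hφ x)
  · simp only; ring

end Moments

section LawOfLargeNumbers
variable {Ω : Type*} [MeasurableSpace Ω] {P : Measure Ω} [IsProbabilityMeasure P] {α : Type*}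
  [MeasurableSpace α] {π : Measure α} {D : ℕ → Ω → α} {Z : ℕ → Ω → ℝ}

/-- The law of large numbers. -/
lemma IsObservation.withHighProb_mean (h : IsObservation P π D Z) {F : α × ℝ → ℝ}
    (hF : Measurable F) (hint : Integrable F (π.prod (gaussianReal 0 1))) {r : ℝ} (hr : 0 < r) :
    WithHighProb P fun n ω => |(n : ℝ)⁻¹ * ∑ i : Fin n, F (D i ω, Z i ω) -
      ∫ q, F q ∂(π.prod (gaussianReal 0 1))| ≤ r := by
  have hm : ∀ i, Measurable fun ω => (D i ω, Z i ω) := fun i =>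
    (h.measurable_data i).prodMk (h.measurable_noise i)
  have hFm : ∀ i, Measurable fun ω => F (D i ω, Z i ω) := fun i => hF.comp (hm i)
  have hint0 : Integrable (fun ω => F (D 0 ω, Z 0 ω)) P := by
    rw [← h.law 0] at hint
    exact hint.comp_measurable (hm 0)
  have hE : ∫ ω, F (D 0 ω, Z 0 ω) ∂P = ∫ q, F q ∂(π.prod (gaussianReal 0 1)) := by
    rw [← h.law 0, integral_map (hm 0).aemeasurable hF.aestronglyMeasurable]
  have hid : ∀ i, IdentDistrib (fun ω => F (D i ω, Z i ω)) (fun ω => F (D 0 ω, Z 0 ω)) P P :=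
    fun i => by
      have h1 : IdentDistrib (fun ω => (D i ω, Z i ω)) (fun ω => (D 0 ω, Z 0 ω)) P P :=
        ⟨(hm i).aemeasurable, (hm 0).aemeasurable, by rw [h.law i, h.law 0]⟩
      exact h1.comp hF
  have hind : Pairwise fun i k => IndepFun (fun ω => F (D i ω, Z i ω))
      (fun ω => F (D k ω, Z k ω)) P := fun i k hik => (h.indep.indepFun hik).comp hF hF
  have hS := strong_law_ae (fun i ω => F (D i ω, Z i ω)) hint0 hind hid
  simp only [smul_eq_mul] at hS
  have hsm : ∀ n : ℕ, AEStronglyMeasurable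
      (fun ω => (n : ℝ)⁻¹ * ∑ i ∈ Finset.range n, F (D i ω, Z i ω)) P := fun n =>
    ((Finset.measurable_sum _ fun i _ => hFm i).const_mul _).aestronglyMeasurable
  have hW := WithHighProb.of_tendsto_ae hsm hS (Metric.closedBall_mem_nhds _ hr)
  refine hW.mono fun n ω hω => ?_
  rw [Metric.mem_closedBall, Real.dist_eq, hE, Finset.sum_range] at hω
  exact hω

lemma IsObservation.withHighProb_mean_data [SFinite π] (h : IsObservation P π D Z) {F : α → ℝ}
    (hF : Measurable F) (hint : Integrable F π) {r : ℝ} (hr : 0 < r) :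
    WithHighProb P fun n ω => |(n : ℝ)⁻¹ * ∑ i : Fin n, F (D i ω) - ∫ q, F q ∂π| ≤ r := by
  have h1 : ∫ q : α × ℝ, F q.1 ∂(π.prod (gaussianReal 0 1)) = ∫ q, F q ∂π := by
    rw [integral_fun_fst]; simp
  have := h.withHighProb_mean (hF.comp measurable_fst) (hint.comp_fst _) hr
  simpa only [Function.comp_apply, h1] using this

end LawOfLargeNumbers

/-! ### Quadratic forms -/

section QuadraticForm
variable {m : Type*} [Fintype m]

/-- A positive definite form stays uniformly positive definite under small perturbations of its
coefficients. -/
lemma exists_quadForm_lower_bound (S : m → m → ℝ)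
    (hS : ∀ v : m → ℝ, v ≠ 0 → 0 < ∑ k, ∑ l, v k * S k l * v l) :
    ∃ κ, 0 < κ ∧ ∀ G : m → m → ℝ, (∀ k l, |G k l - S k l| ≤ κ) →
      ∀ v : m → ℝ, κ * ∑ k, v k ^ 2 ≤ ∑ k, ∑ l, v k * G k l * v l := by
  classical
  have hcont : Continuous fun v : m → ℝ => ∑ k, ∑ l, v k * S k l * v l := by fun_prop
  have hcont2 : Continuous fun v : m → ℝ => ∑ k, v k ^ 2 := by fun_prop
  -- the unit sphere of the Euclidean norm is compact
  have hK : IsCompact {v : m → ℝ | ∑ k, v k ^ 2 = 1} := by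
    refine Metric.isCompact_of_isClosed_isBounded (isClosed_singleton.preimage hcont2) ?_
    refine (Metric.isBounded_closedBall (x := (0 : m → ℝ)) (r := 1)).subset fun v hv => ?_
    rw [mem_closedBall_zero_iff, pi_norm_le_iff_of_nonneg zero_le_one]
    intro k
    have : v k ^ 2 ≤ 1 := by
      rw [← (show ∑ k, v k ^ 2 = 1 from hv)]
      exact Finset.single_le_sum (f := fun k => v k ^ 2) (fun i _ => sq_nonneg _)
        (Finset.mem_univ k)
    rw [Real.norm_eq_abs]
    exact abs_le_one_iff_mul_self_le_one.2 (by nlinarith)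
  obtain ⟨c, hc, hle⟩ : ∃ c, 0 < c ∧ ∀ v ∈ {v : m → ℝ | ∑ k, v k ^ 2 = 1},
      c ≤ ∑ k, ∑ l, v k * S k l * v l := by
    rcases Set.eq_empty_or_nonempty {v : m → ℝ | ∑ k, v k ^ 2 = 1} with h0 | h0
    · exact ⟨1, one_pos, by simp [h0]⟩
    · obtain ⟨v, hv, hmin⟩ := hK.exists_isMinOn h0 hcont.continuousOn
      refine ⟨_, hS v ?_, fun w hw => hmin hw⟩
      rintro rfl
      simp at hv
  have hSc : ∀ v : m → ℝ, c * ∑ k, v k ^ 2 ≤ ∑ k, ∑ l, v k * S k l * v l := by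
    intro v
    rcases eq_or_ne v 0 with rfl | hv
    · simp
    have hpos : 0 < ∑ k, v k ^ 2 := by
      obtain ⟨k, hk⟩ := Function.ne_iff.1 hv
      exact Finset.sum_pos' (fun i _ => sq_nonneg _) ⟨k, Finset.mem_univ k, by
        have : v k ≠ 0 := hk
        positivity⟩
    set R := √(∑ k, v k ^ 2) with hR
    have hR2 : R ^ 2 = ∑ k, v k ^ 2 := Real.sq_sqrt hpos.le
    have hR0 : R ≠ 0 := (Real.sqrt_pos.2 hpos).ne'
    have h1 := hle (fun k => R⁻¹ * v k) (by
      simp only [Set.mem_ofPred_eq, mul_pow]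
      rw [← Finset.mul_sum, ← hR2, inv_pow, inv_mul_cancel₀ (pow_ne_zero 2 hR0)])
    have h2 : ∑ k, ∑ l, R⁻¹ * v k * S k l * (R⁻¹ * v l) =
        (R ^ 2)⁻¹ * ∑ k, ∑ l, v k * S k l * v l := by
      simp only [Finset.mul_sum]
      exact Finset.sum_congr rfl fun k _ => Finset.sum_congr rfl fun l _ => by
        rw [← inv_pow]; ring
    rw [h2, hR2, ← div_eq_inv_mul, le_div_iff₀ hpos] at h1
    exact h1
  have hN : (0 : ℝ) < Fintype.card m + 1 := by positivity
  refine ⟨c / (Fintype.card m + 1), by positivity, fun G hG v => ?_⟩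
  set κ := c / ((Fintype.card m : ℝ) + 1) with hκ
  have hκ0 : 0 < κ := by positivity
  have hdiff : ∑ k, ∑ l, v k * S k l * v l - ∑ k, ∑ l, v k * G k l * v l ≤
      κ * (Fintype.card m * ∑ k, v k ^ 2) := by
    have h1 : ∀ k l, v k * S k l * v l - v k * G k l * v l ≤
        κ * ((v k ^ 2 + v l ^ 2) / 2) := by
      intro k l
      have h2 : v k * S k l * v l - v k * G k l * v l = -((G k l - S k l) * (v k * v l)) := by ring
      rw [h2]
      refine (neg_le_abs _).trans ?_
      rw [abs_mul]
      refine mul_le_mul (hG k l) ?_ (abs_nonneg _) hκ0.le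
      rw [abs_le]
      constructor <;> nlinarith [sq_nonneg (v k - v l), sq_nonneg (v k + v l)]
    calc _ = ∑ k, ∑ l, (v k * S k l * v l - v k * G k l * v l) := by
          simp only [Finset.sum_sub_distrib]
      _ ≤ ∑ k, ∑ l, κ * ((v k ^ 2 + v l ^ 2) / 2) :=
          Finset.sum_le_sum fun k _ => Finset.sum_le_sum fun l _ => h1 k l
      _ = _ := by
          simp only [← Finset.mul_sum, ← Finset.sum_div, Finset.sum_add_distrib, Finset.sum_const,
            Finset.card_univ, nsmul_eq_mul]
          ring
  have h2 : c = κ * (Fintype.card m + 1) := by rw [hκ]; field_simp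
  have h3 := hSc v
  rw [h2] at h3
  linarith

end QuadraticForm

/-! ### The statistics as functions of the observations -/

section ModelSample
variable {n p H : ℕ}

/-- The sample with treatments and confounders `d`, mean responses `φ` and standardised noise
`z`. -/
def modelSample (φ : Fin H → EuclideanSpace ℝ (Fin p) → ℝ) (σ : ℝ)
    (d : Fin n → Fin H × EuclideanSpace ℝ (Fin p)) (z : Fin n → ℝ) : Sample n p H where
  x := fun i => (d i).2
  a := fun i => (d i).1
  y := fun i => φ (d i).1 (d i).2 + σ * z i

lemma sampleOf_eq_modelSample {Ω : Type*} (μ : Fin H → EuclideanSpace ℝ (Fin p) → ℝ)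
    (f : EuclideanSpace ℝ (Fin p) → ℝ) (A : ℕ → Ω → Fin H)
    (X : ℕ → Ω → EuclideanSpace ℝ (Fin p)) (ε : ℕ → Fin H → Ω → ℝ) {σ : ℝ} (hσ : σ ≠ 0)
    (n : ℕ) (ω : Ω) :
    sampleOf μ f A X ε n ω = modelSample (fun h x => μ h x + f x) σ
      (fun i : Fin n => (A i ω, X i ω)) (fun i : Fin n => ε i (A i ω) ω / σ) := by
  simp only [sampleOf, modelSample, Sample.mk.injEq, true_and]
  funext i
  simp only [assigned, potential, ite_mul, one_mul, zero_mul, Finset.sum_ite_eq,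
    Finset.mem_univ, if_true]
  rw [mul_div_cancel₀ _ hσ]

variable (S : Sample n p H) (c : Fin H → ℝ) (e : Fin H → EuclideanSpace ℝ (Fin p) → ℝ)

lemma Sample.design_mulVec_apply (b : Fin p → ℝ) (i : Fin n) :
    (S.design *ᵥ b) i = ∑ k, b k * S.x i k := by
  simp only [Matrix.mulVec, dotProduct, Sample.design, Matrix.of_apply, mul_comm]

lemma Sample.gram_transpose (M : Finset (Fin p)) : (S.gram M)ᵀ = S.gram M := by
  rw [Sample.gram, Matrix.transpose_mul, Matrix.transpose_transpose]

lemma Sample.inv_gram_mul_mulVec (M : Finset (Fin p)) (v : Fin n → ℝ) (j : M) :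
    (((S.gram M)⁻¹ * (S.sub M)ᵀ) *ᵥ v) j = ∑ i, S.eta M j i * v i := by
  have h1 : (((S.gram M)⁻¹ * (S.sub M)ᵀ) *ᵥ v) j =
      Pi.single j 1 ⬝ᵥ (((S.gram M)⁻¹ * (S.sub M)ᵀ) *ᵥ v) := by simp
  rw [h1, Matrix.dotProduct_mulVec, ← Matrix.mulVec_transpose, Matrix.transpose_mul,
    Matrix.transpose_transpose, Matrix.transpose_nonsing_inv, S.gram_transpose,
    ← Matrix.mulVec_mulVec]
  rfl

lemma Sample.target_eq (μ : Fin H → EuclideanSpace ℝ (Fin p) → ℝ) (M : Finset (Fin p)) (j : M) :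
    S.target c μ M j = ∑ i, S.eta M j i * ∑ h, c h * μ h (S.x i) :=
  S.inv_gram_mul_mulVec M _ j

lemma Sample.tau_eq (M : Finset (Fin p)) (yd : Fin H → Fin n → ℝ) (j : M) :
    S.tau c e M yd j =
      ∑ i, S.eta M j i * ∑ h, c h * (ipwRes h (e h) (S.a i, S.x i) * yd h i) := by
  rw [Sample.tau, S.inv_gram_mul_mulVec]
  refine Finset.sum_congr rfl fun i _ => ?_
  rw [Finset.sum_apply]
  congr 1
  refine Finset.sum_congr rfl fun h _ => ?_
  rw [Pi.smul_apply, smul_eq_mul, Sample.weightArm, ← Matrix.diagonal_one, Matrix.diagonal_sub,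
    Matrix.mulVec_diagonal]
  rfl

/-- `η_j' W² η_j`. -/
def Sample.etaNormSq (M : Finset (Fin p)) (j : M) : ℝ :=
  ∑ i, wt c e (S.a i, S.x i) ^ 2 * S.eta M j i ^ 2

lemma Sample.weight_sq : S.weight c e ^ 2 =
    Matrix.diagonal fun i => wt c e (S.a i, S.x i) ^ 2 := by
  rw [S.weight_eq, Matrix.diagonal_pow]; rfl

lemma Sample.zeta_eq (σ : ℝ) (M : Finset (Fin p)) (j : M) :
    S.zeta c e σ M j = σ ^ 2 * S.etaNormSq c e M j := by
  rw [Sample.zeta]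
  congr 1
  have h1 : Pi.single j 1 ⬝ᵥ (((S.gram M)⁻¹ * (S.sub M)ᵀ * S.weight c e ^ 2 * S.sub M *
      (S.gram M)⁻¹) *ᵥ Pi.single j 1) =
      (((S.gram M)⁻¹ * (S.sub M)ᵀ) *ᵥ (S.weight c e ^ 2 *ᵥ S.eta M j)) j := by
    simp only [Sample.eta, Matrix.mulVec_mulVec, Matrix.mul_assoc]
    simp
  rw [h1, S.inv_gram_mul_mulVec, S.weight_sq]
  refine Finset.sum_congr rfl fun i _ => ?_
  rw [Matrix.mulVec_diagonal]; ring

lemma Sample.rho_eq (σ δ : ℝ) (M : Finset (Fin p)) (j : M) :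
    S.rho c e σ δ M j = S.zeta c e σ M j + σ ^ 2 * ∑ h, c h ^ 2 * ∑ i,
      S.eta M j i ^ 2 * ((1 / e h (S.x i) - 1) * ((S.nbhd δ h i).card : ℝ)⁻¹) := by
  rw [Sample.rho]
  congr 2
  refine Finset.sum_congr rfl fun h _ => ?_
  congr 1
  refine Finset.sum_congr rfl fun i _ => ?_
  rw [Sample.matK, Matrix.mulVec_diagonal, div_eq_mul_inv]; ring

lemma Sample.stat_eq (M : Finset (Fin p)) (j : M) :
    S.stat c e M j = ∑ i, S.eta M j i * (wt c e (S.a i, S.x i) * S.y i) := by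
  rw [Sample.stat, S.weight_eq]
  refine Finset.sum_congr rfl fun i _ => ?_
  rw [Matrix.mulVec_diagonal]

/-- The coefficients of `η_j` as a combination of the columns of the design, which are
`(X_M' X_M)⁻¹ e_j` on `M` and `0` outside. -/
def Sample.etaCoef (M : Finset (Fin p)) (j : M) : Fin p → ℝ :=
  extendModel M ((S.gram M)⁻¹ *ᵥ Pi.single j 1)

lemma Sample.eta_eq_sum (M : Finset (Fin p)) (j : M) (i : Fin n) :
    S.eta M j i = ∑ k, S.etaCoef M j k * S.x i k := by
  have h1 : S.eta M j = S.design *ᵥ S.etaCoef M j := by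
    rw [Sample.etaCoef, S.design_mulVec_extendModel]; rfl
  rw [h1, S.design_mulVec_apply]

variable {S}

lemma Sample.FullRank.sum_col_mul_eta (hS : S.FullRank) (M : Finset (Fin p)) (j k : M) :
    ∑ i, S.x i k * S.eta M j i = if k = j then 1 else 0 := by
  have h1 : (S.sub M)ᵀ *ᵥ S.eta M j = Pi.single j 1 := by
    rw [Sample.eta, Matrix.mulVec_mulVec, Matrix.mulVec_mulVec, ← Sample.gram,
      Matrix.mul_nonsing_inv _ (hS.isUnit_det M), Matrix.one_mulVec]
  have h2 := congrFun h1 k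
  rw [Pi.single_apply] at h2
  exact h2

lemma Sample.FullRank.sum_eta_sq (hS : S.FullRank) (M : Finset (Fin p)) (j : M) :
    ∑ i, S.eta M j i ^ 2 = S.etaCoef M j j := by
  have h1 : ∀ i, S.eta M j i ^ 2 = ∑ k : M, S.etaCoef M j k * (S.x i k * S.eta M j i) := by
    intro i
    rw [sq]
    nth_rw 1 [S.eta_eq_sum]
    rw [Finset.sum_mul, ← Finset.sum_subset (Finset.subset_univ M) (fun k _ hk => by
      simp [Sample.etaCoef, extendModel, hk]), ← Finset.sum_coe_sort M]
    exact Finset.sum_congr rfl fun k _ => by ring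
  simp_rw [h1]
  rw [Finset.sum_comm]
  simp_rw [← Finset.mul_sum, hS.sum_col_mul_eta]
  simp

lemma Sample.FullRank.one_eq_sum (hS : S.FullRank) (M : Finset (Fin p)) (j : M) :
    1 = ∑ k, S.etaCoef M j k * ∑ i, S.x i j * S.x i k := by
  have h1 := hS.sum_col_mul_eta M j j
  rw [if_pos rfl] at h1
  rw [← h1]
  simp_rw [S.eta_eq_sum, Finset.mul_sum]
  rw [Finset.sum_comm]
  exact Finset.sum_congr rfl fun k _ => Finset.sum_congr rfl fun i _ => by ring

end ModelSample

section Bounds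
variable {n p H : ℕ} {S : Sample n p H}

/-- If the empirical second moments of the confounders are bounded below by `κ`, the coefficients
of `η_j` are at most of order `1 / n`. -/
lemma Sample.FullRank.abs_etaCoef_le (hS : S.FullRank) (hn : 0 < n) {κ : ℝ} (hκ : 0 < κ)
    (hlow : ∀ v : Fin p → ℝ, κ * ∑ k, v k ^ 2 ≤ (n : ℝ)⁻¹ * ∑ i, (∑ k, v k * S.x i k) ^ 2)
    (M : Finset (Fin p)) (j : M) (k : Fin p) : |S.etaCoef M j k| ≤ (κ * n)⁻¹ := by
  have hn' : (0 : ℝ) < n := by exact_mod_cast hn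
  set g := S.etaCoef M j with hg
  have h1 := hlow g
  simp_rw [hg, ← S.eta_eq_sum, hS.sum_eta_sq] at h1
  rw [← hg, ← div_eq_inv_mul, le_div_iff₀ hn'] at h1
  have hsum : ∀ k, g k ^ 2 ≤ ∑ k, g k ^ 2 := fun k =>
    Finset.single_le_sum (f := fun k => g k ^ 2) (fun i _ => sq_nonneg _) (Finset.mem_univ k)
  set s := ∑ k, g k ^ 2 with hs
  have hs0 : 0 ≤ s := Finset.sum_nonneg fun k _ => sq_nonneg _
  have hκn : 0 < κ * n := by positivity
  have h2 : g j ≤ (κ * n)⁻¹ := by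
    by_contra! hlt
    have hgj : 0 < g j := lt_trans (by positivity) hlt
    have h3 : κ * n * g j ^ 2 ≤ g j := by
      calc κ * n * g j ^ 2 ≤ κ * n * s := mul_le_mul_of_nonneg_left (hsum j) hκn.le
        _ ≤ g j := by linarith
    have h4 : κ * n * g j ≤ 1 := by
      by_contra! h5
      nlinarith
    have h5 : 1 < κ * n * g j := by
      calc (1 : ℝ) = κ * n * (κ * n)⁻¹ := (mul_inv_cancel₀ hκn.ne').symm
        _ < _ := mul_lt_mul_of_pos_left hlt hκn
    linarith
  have h3 : s ≤ ((κ * n)⁻¹) ^ 2 := by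
    have h4 : κ * n * s ≤ (κ * n)⁻¹ := by linarith
    calc s = (κ * n)⁻¹ * (κ * n * s) := by rw [inv_mul_cancel_left₀ hκn.ne']
      _ ≤ (κ * n)⁻¹ * (κ * n)⁻¹ := mul_le_mul_of_nonneg_left h4 (by positivity)
      _ = _ := (sq _).symm
  exact abs_le_of_sq_le_sq ((hsum k).trans h3) (by positivity)

/-- Lower bound of order `1 / n` for the conditional variance of the statistic. -/
lemma Sample.FullRank.le_etaNormSq (hS : S.FullRank) (hn : 0 < n) {κ K : ℝ} (hκ : 0 < κ)
    (hK : 0 < K) {c : Fin H → ℝ} {e : Fin H → EuclideanSpace ℝ (Fin p) → ℝ}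
    (hlow : ∀ v : Fin p → ℝ, κ * ∑ k, v k ^ 2 ≤
      (n : ℝ)⁻¹ * ∑ i, wt c e (S.a i, S.x i) ^ 2 * (∑ k, v k * S.x i k) ^ 2)
    (hup : ∀ k l, |(n : ℝ)⁻¹ * ∑ i, S.x i k * S.x i l| ≤ K) (M : Finset (Fin p)) (j : M) :
    κ / (K ^ 2 * p) / n ≤ S.etaNormSq c e M j := by
  have hn' : (0 : ℝ) < n := by exact_mod_cast hn
  have hp' : (0 : ℝ) < p := by
    have : 0 < p := (Nat.zero_le _).trans_lt j.1.2
    exact_mod_cast this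
  set g := S.etaCoef M j with hg
  have h1 := hlow g
  simp_rw [hg, ← S.eta_eq_sum] at h1
  rw [← hg, ← div_eq_inv_mul, le_div_iff₀ hn'] at h1
  have h2 : 1 ≤ n * K * ∑ k, |g k| := by
    calc (1 : ℝ) = ∑ k, g k * ∑ i, S.x i j * S.x i k := hS.one_eq_sum M j
      _ ≤ ∑ k, |g k| * (n * K) := by
          refine Finset.sum_le_sum fun k _ => ?_
          refine (le_abs_self _).trans ?_
          rw [abs_mul]
          refine mul_le_mul_of_nonneg_left ?_ (abs_nonneg _)
          have h3 := hup j k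
          rw [abs_mul, abs_of_pos (inv_pos.2 hn'), ← div_eq_inv_mul, div_le_iff₀ hn'] at h3
          linarith
      _ = _ := by rw [← Finset.sum_mul]; ring
  have h3 : (∑ k, |g k|) ^ 2 ≤ p * ∑ k, g k ^ 2 := by
    have := sq_sum_le_card_mul_sum_sq (s := Finset.univ) (f := fun k => |g k|)
    simpa only [Finset.card_univ, Fintype.card_fin, sq_abs] using this
  have h4 : 1 ≤ (n * K) ^ 2 * (p * ∑ k, g k ^ 2) := by
    calc (1 : ℝ) = 1 ^ 2 := by norm_num
      _ ≤ (n * K * ∑ k, |g k|) ^ 2 := pow_le_pow_left₀ zero_le_one h2 2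
      _ = (n * K) ^ 2 * (∑ k, |g k|) ^ 2 := by ring
      _ ≤ _ := mul_le_mul_of_nonneg_left h3 (sq_nonneg _)
  have h5 : κ / (K ^ 2 * p) / n ≤ κ * (∑ k, g k ^ 2) * n := by
    rw [div_div, div_le_iff₀ (by positivity)]
    calc κ = κ * 1 := (mul_one _).symm
      _ ≤ κ * ((n * K) ^ 2 * (p * ∑ k, g k ^ 2)) := mul_le_mul_of_nonneg_left h4 hκ.le
      _ = _ := by ring
  exact h5.trans h1

lemma Sample.fullRank_of_quadForm_lower {κ : ℝ} (hκ : 0 < κ)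
    (hlow : ∀ v : Fin p → ℝ, κ * ∑ k, v k ^ 2 ≤ (n : ℝ)⁻¹ * ∑ i, (∑ k, v k * S.x i k) ^ 2) :
    S.FullRank := by
  intro b hb
  have h1 : ∀ i, ∑ k, b k * S.x i k = 0 := fun i => by
    rw [← S.design_mulVec_apply, hb, Pi.zero_apply]
  have h2 := hlow b
  simp only [h1, ne_eq, OfNat.ofNat_ne_zero, not_false_eq_true, zero_pow, Finset.sum_const_zero,
    mul_zero] at h2
  have h3 : ∑ k, b k ^ 2 ≤ 0 := by
    by_contra! h4
    exact absurd h2 (not_le.2 (mul_pos hκ h4))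
  funext k
  have h4 := (Finset.sum_eq_zero_iff_of_nonneg fun k _ => sq_nonneg (b k)).1
    (le_antisymm h3 (Finset.sum_nonneg fun k _ => sq_nonneg _)) k (Finset.mem_univ k)
  exact pow_eq_zero_iff (two_ne_zero) |>.1 h4

/-- The least-squares coefficients of a treatment are bounded, since their loss is at most that
of the zero vector. -/
lemma Sample.sq_le_of_isMinOn_armLoss {κ K : ℝ} (hκ : 0 < κ) {h : Fin H}
    (hlow : ∀ v : Fin p → ℝ, κ * ∑ k, v k ^ 2 ≤
      (n : ℝ)⁻¹ * ∑ i, S.treat h i * (∑ k, v k * S.x i k) ^ 2)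
    (hy : (n : ℝ)⁻¹ * ∑ i, S.y i ^ 2 ≤ K) {b : Fin p → ℝ}
    (hb : IsMinOn (S.armLoss h) Set.univ b) (k : Fin p) : b k ^ 2 ≤ 4 * K / κ := by
  have h0 : S.armLoss h b ≤ S.armLoss h 0 := hb (Set.mem_univ _)
  have hT : ∀ i, S.treat h i = 0 ∨ S.treat h i = 1 := fun i => by
    rw [Sample.treat]; split_ifs <;> simp
  have hx : ∀ i, (S.design *ᵥ b) i = ∑ k, b k * S.x i k := fun i =>
    S.design_mulVec_apply b i
  have h1 : ∑ i, S.treat h i * (∑ k, b k * S.x i k) ^ 2 ≤ 4 * ∑ i, S.y i ^ 2 := by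
    have h2 : S.armLoss h 0 ≤ ∑ i, S.y i ^ 2 := by
      refine Finset.sum_le_sum fun i _ => ?_
      rw [Matrix.mulVec_zero, Pi.zero_apply, sub_zero]
      rcases hT i with h3 | h3 <;> rw [h3]
      · rw [zero_mul, zero_pow two_ne_zero]; positivity
      · rw [one_mul]
    have h3 : ∑ i, S.treat h i * (∑ k, b k * S.x i k) ^ 2 ≤
        2 * S.armLoss h b + 2 * ∑ i, S.y i ^ 2 := by
      rw [Sample.armLoss, Finset.mul_sum, Finset.mul_sum, ← Finset.sum_add_distrib]
      refine Finset.sum_le_sum fun i _ => ?_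
      rw [hx]
      rcases hT i with h4 | h4 <;> rw [h4]
      · simp only [zero_mul]; positivity
      · nlinarith [sq_nonneg (2 * S.y i - ∑ k, b k * S.x i k)]
    linarith
  have h2 : κ * ∑ k, b k ^ 2 ≤ 4 * K := by
    refine (hlow b).trans ?_
    calc _ ≤ (n : ℝ)⁻¹ * (4 * ∑ i, S.y i ^ 2) := mul_le_mul_of_nonneg_left h1 (by positivity)
      _ = 4 * ((n : ℝ)⁻¹ * ∑ i, S.y i ^ 2) := by ring
      _ ≤ 4 * K := by linarith
  rw [le_div_iff₀ hκ]
  have h3 : b k ^ 2 ≤ ∑ k, b k ^ 2 :=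
    Finset.single_le_sum (f := fun k => b k ^ 2) (fun i _ => sq_nonneg _) (Finset.mem_univ k)
  nlinarith

end Bounds

/-! ### Consistency of the plug-in mean and variance -/

section QuadFormLimit
variable {p H : ℕ} {π : Measure (Fin H × EuclideanSpace ℝ (Fin p))}

/-- A second-moment matrix of the confounders is positive definite if its weight is positive on
one treatment arm, because by positivity every set of confounders of positive probability is met
by each arm. -/
lemma IsPropensity.quadForm_pos {h : Fin H} {e : EuclideanSpace ℝ (Fin p) → ℝ}
    (hp : IsPropensity π h e)
    (hnd : ∀ v : Fin p → ℝ, v ≠ 0 → ¬ ∀ᵐ z ∂π, ∑ k, v k * z.2 k = 0)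
    {u : Fin H × EuclideanSpace ℝ (Fin p) → ℝ} (hu0 : ∀ z, 0 ≤ u z)
    (hu : ∀ᵐ z ∂π, z.1 = h → 0 < u z)
    (hint : ∀ k l, Integrable (fun z => u z * (z.2 k * z.2 l)) π) (v : Fin p → ℝ) (hv : v ≠ 0) :
    0 < ∑ k, ∑ l, v k * (∫ z, u z * (z.2 k * z.2 l) ∂π) * v l := by
  have hsq : ∀ z : Fin H × EuclideanSpace ℝ (Fin p), u z * (∑ k, v k * z.2 k) ^ 2 =
      ∑ k, ∑ l, v k * v l * (u z * (z.2 k * z.2 l)) := fun z => by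
    rw [sq, Finset.sum_mul_sum, Finset.mul_sum]
    refine Finset.sum_congr rfl fun k _ => ?_
    rw [Finset.mul_sum]
    exact Finset.sum_congr rfl fun l _ => by ring
  have hi : Integrable (fun z => u z * (∑ k, v k * z.2 k) ^ 2) π := by
    simp_rw [hsq]
    exact integrable_finsetSum _ fun k _ => integrable_finsetSum _ fun l _ =>
      (hint k l).const_mul _
  have hE : ∑ k, ∑ l, v k * (∫ z, u z * (z.2 k * z.2 l) ∂π) * v l =
      ∫ z, u z * (∑ k, v k * z.2 k) ^ 2 ∂π := by
    simp_rw [hsq]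
    rw [integral_finsetSum _ fun k _ => integrable_finsetSum _ fun l _ => (hint k l).const_mul _]
    refine Finset.sum_congr rfl fun k _ => ?_
    rw [integral_finsetSum _ fun l _ => (hint k l).const_mul _]
    refine Finset.sum_congr rfl fun l _ => ?_
    rw [integral_const_mul]; ring
  have hnn : ∀ z, 0 ≤ u z * (∑ k, v k * z.2 k) ^ 2 := fun z => mul_nonneg (hu0 z) (sq_nonneg _)
  rw [hE]
  refine lt_of_le_of_ne (integral_nonneg hnn) fun h0 => hnd v hv ?_
  have h1 := (integral_eq_zero_iff_of_nonneg hnn hi).1 h0.symm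
  have hlin : Measurable fun x : EuclideanSpace ℝ (Fin p) => ∑ k, v k * x k := by fun_prop
  set B : Set (EuclideanSpace ℝ (Fin p)) := {x | ∑ k, v k * x k ≠ 0} with hB
  have hBm : MeasurableSet B := (hlin (measurableSet_singleton 0)).compl
  have h2 : π (Prod.fst ⁻¹' {h} ∩ Prod.snd ⁻¹' B) = 0 := by
    refine measure_mono_null (t := {z | ¬ ((z.1 = h → 0 < u z) ∧
      u z * (∑ k, v k * z.2 k) ^ 2 = 0)}) ?_ (ae_iff.1 (hu.and h1))
    intro z hz hz'
    exact (mul_pos (hz'.1 hz.1) (lt_of_le_of_ne (sq_nonneg _)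
      (Ne.symm (pow_ne_zero 2 hz.2)))).ne' hz'.2
  rw [hp.apply_inter B hBm] at h2
  have h3 := (setLIntegral_eq_zero_iff (measurable_snd hBm)
    (hp.measurable.comp measurable_snd).ennreal_ofReal).1 h2
  filter_upwards [h3, hp.pos] with z hz1 hz2
  by_contra hz3
  have := hz1 hz3
  simp only [ENNReal.ofReal_eq_zero, Function.comp_apply] at this
  linarith [hz2.1]

variable [IsProbabilityMeasure π] {Ω : Type*} [MeasurableSpace Ω] {P : Measure Ω}
  [IsProbabilityMeasure P]
  {D : ℕ → Ω → Fin H × EuclideanSpace ℝ (Fin p)} {Z : ℕ → Ω → ℝ}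

/-- The law of large numbers for the entries of the matrix transfers positive definiteness of the
limit to the empirical quadratic form. -/
lemma IsObservation.withHighProb_quadForm_lower (hobs : IsObservation P π D Z)
    {u : Fin H × EuclideanSpace ℝ (Fin p) → ℝ} (hu : Measurable u)
    (hint : ∀ k l, Integrable (fun z => u z * (z.2 k * z.2 l)) π)
    (hpos : ∀ v : Fin p → ℝ, v ≠ 0 → 0 < ∑ k, ∑ l, v k * (∫ z, u z * (z.2 k * z.2 l) ∂π) * v l) :
    ∃ κ, 0 < κ ∧ WithHighProb P fun n ω => ∀ v : Fin p → ℝ, κ * ∑ k, v k ^ 2 ≤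
      (n : ℝ)⁻¹ * ∑ i : Fin n, u (D i ω) * (∑ k, v k * (D i ω).2 k) ^ 2 := by
  obtain ⟨κ, hκ, h⟩ := exists_quadForm_lower_bound _ hpos
  refine ⟨κ, hκ, ?_⟩
  have hW := WithHighProb.all fun k : Fin p => WithHighProb.all fun l : Fin p =>
    hobs.withHighProb_mean_data (F := fun z => u z * (z.2 k * z.2 l)) (by fun_prop) (hint k l) hκ
  refine hW.mono fun n ω hω v => (h _ hω v).trans (le_of_eq ?_)
  have : ∀ i : Fin n, u (D i ω) * (∑ k, v k * (D i ω).2 k) ^ 2 =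
      ∑ k, ∑ l, v k * (u (D i ω) * ((D i ω).2 k * (D i ω).2 l)) * v l := fun i => by
    rw [sq, Finset.sum_mul_sum, Finset.mul_sum]
    refine Finset.sum_congr rfl fun k _ => ?_
    rw [Finset.mul_sum]
    exact Finset.sum_congr rfl fun l _ => by ring
  simp_rw [this]
  symm
  rw [Finset.sum_comm, Finset.mul_sum]
  refine Finset.sum_congr rfl fun k _ => ?_
  rw [Finset.sum_comm, Finset.mul_sum]
  refine Finset.sum_congr rfl fun l _ => ?_
  rw [← Finset.sum_mul, ← Finset.mul_sum]
  ring

end QuadFormLimit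

section PlugInError
variable {n p H : ℕ}

lemma modelSample_nbhd (φ : Fin H → EuclideanSpace ℝ (Fin p) → ℝ) (σ δ : ℝ)
    (d : Fin n → Fin H × EuclideanSpace ℝ (Fin p)) (z : Fin n → ℝ) (h : Fin H) (i : Fin n) :
    (modelSample φ σ d z).nbhd δ h i = neighbours δ h d i := rfl

lemma modelSample_yStar_sub (φ : Fin H → EuclideanSpace ℝ (Fin p) → ℝ) (σ δ : ℝ)
    (d : Fin n → Fin H × EuclideanSpace ℝ (Fin p)) (z : Fin n → ℝ) (b : Fin H → Fin p → ℝ)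
    (h : Fin H) (i : Fin n) :
    (modelSample φ σ d z).yStar δ b h i - φ h (d i).2 =
      (avg (neighbours δ h d i) (fun l => φ h (d l).2) - φ h (d i).2) -
      ∑ m, b h m * (avg (neighbours δ h d i) (fun l => (d l).2 m) - (d i).2 m) +
      σ * avg (neighbours δ h d i) z := by
  have h1 : ∑ l ∈ neighbours δ h d i, ((modelSample φ σ d z).y l -
      ((modelSample φ σ d z).design *ᵥ b h) l) =
      ∑ l ∈ neighbours δ h d i, φ h (d l).2 - ∑ m, b h m * ∑ l ∈ neighbours δ h d i, (d l).2 m +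
      σ * ∑ l ∈ neighbours δ h d i, z l := by
    simp_rw [Finset.mul_sum]
    rw [Finset.sum_comm, ← Finset.sum_sub_distrib, ← Finset.sum_add_distrib]
    refine Finset.sum_congr rfl fun l hl => ?_
    have h2 : (d l).1 = h := (mem_neighbours.1 hl).2.2
    rw [Sample.design_mulVec_apply]
    simp only [modelSample, h2]
    ring
  rw [Sample.yStar, modelSample_nbhd, h1, Sample.design_mulVec_apply]
  simp only [avg, modelSample, mul_sub, Finset.sum_sub_distrib, add_div, sub_div, Finset.sum_div,
    mul_div_assoc]
  ring

/-- The error of the estimated mean shift in terms of local averages. -/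
lemma modelSample_tau_yStar_sub (c : Fin H → ℝ) (e : Fin H → EuclideanSpace ℝ (Fin p) → ℝ)
    (φ : Fin H → EuclideanSpace ℝ (Fin p) → ℝ) (σ δ : ℝ)
    (d : Fin n → Fin H × EuclideanSpace ℝ (Fin p)) (z : Fin n → ℝ) (b : Fin H → Fin p → ℝ)
    (M : Finset (Fin p)) (j : M) :
    (modelSample φ σ d z).tau c e M ((modelSample φ σ d z).yStar δ b) j -
      (modelSample φ σ d z).tau c e M (fun h i => φ h (d i).2) j =
    ∑ k, (modelSample φ σ d z).etaCoef M j k * ∑ h, c h *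
      (∑ i, ipwRes h (e h) (d i) * (d i).2 k *
          (avg (neighbours δ h d i) (fun l => φ h (d l).2) - φ h (d i).2) -
        ∑ m, b h m * ∑ i, ipwRes h (e h) (d i) * (d i).2 k *
          (avg (neighbours δ h d i) (fun l => (d l).2 m) - (d i).2 m) +
        σ * ∑ i, ipwRes h (e h) (d i) * (d i).2 k * avg (neighbours δ h d i) z) := by
  rw [Sample.tau_eq, Sample.tau_eq, ← Finset.sum_sub_distrib]
  have h1 : ∀ i, (modelSample φ σ d z).eta M j i * ∑ h, c h *
      (ipwRes h (e h) ((modelSample φ σ d z).a i, (modelSample φ σ d z).x i) *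
        (modelSample φ σ d z).yStar δ b h i) - (modelSample φ σ d z).eta M j i * ∑ h, c h *
      (ipwRes h (e h) ((modelSample φ σ d z).a i, (modelSample φ σ d z).x i) * φ h (d i).2) =
      ∑ k, ∑ h, (modelSample φ σ d z).etaCoef M j k * (c h *
        (ipwRes h (e h) (d i) * (d i).2 k *
          ((modelSample φ σ d z).yStar δ b h i - φ h (d i).2))) := by
    intro i
    rw [← mul_sub, ← Finset.sum_sub_distrib, Sample.eta_eq_sum, Finset.sum_mul_sum]
    refine Finset.sum_congr rfl fun k _ => Finset.sum_congr rfl fun h _ => ?_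
    change _ * (d i).2 k * (c h * (ipwRes h (e h) (d i) * _) -
      c h * (ipwRes h (e h) (d i) * _)) = _
    ring
  simp_rw [h1]
  rw [Finset.sum_comm]
  refine Finset.sum_congr rfl fun k _ => ?_
  rw [Finset.sum_comm, Finset.mul_sum]
  refine Finset.sum_congr rfl fun h _ => ?_
  rw [← Finset.mul_sum, ← Finset.mul_sum]
  congr 2
  simp_rw [modelSample_yStar_sub, Finset.mul_sum]
  rw [Finset.sum_comm, ← Finset.sum_sub_distrib, ← Finset.sum_add_distrib]
  refine Finset.sum_congr rfl fun i _ => ?_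
  rw [mul_add, mul_sub, Finset.mul_sum]
  congr 1
  · congr 1
    exact Finset.sum_congr rfl fun m _ => by ring
  · ring

end PlugInError

section PlugIn
variable {p H : ℕ} {Ω : Type*} [MeasurableSpace Ω] {P : Measure Ω}
  {π : Measure (Fin H × EuclideanSpace ℝ (Fin p))} {e φ : Fin H → EuclideanSpace ℝ (Fin p) → ℝ}
  {D : ℕ → Ω → Fin H × EuclideanSpace ℝ (Fin p)} {Z : ℕ → Ω → ℝ} {δ : ℕ → ℝ}

/-- The standing assumptions on the observations `D i` (treatment and confounders, with law `π`)
and `Z i` (standardised noise), the propensity scores `e`, the mean responses `φ` and the radii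
`δ n` of the neighbourhoods. -/
structure IsIPWModel (P : Measure Ω) (π : Measure (Fin H × EuclideanSpace ℝ (Fin p)))
    (e φ : Fin H → EuclideanSpace ℝ (Fin p) → ℝ) (D : ℕ → Ω → Fin H × EuclideanSpace ℝ (Fin p))
    (Z : ℕ → Ω → ℝ) (δ : ℕ → ℝ) : Prop where
  observation : IsObservation P π D Z
  propensity : ∀ h, IsPropensity π h (e h)
  moment : ∀ h, Integrable (fun z => (1 + ‖z.2‖ ^ 4) / e h z.2) π
  lipschitz : ∀ h, ∃ C : ℝ≥0, LipschitzWith C (φ h)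
  nondegenerate : ∀ v : Fin p → ℝ, v ≠ 0 → ¬ ∀ᵐ z ∂π, ∑ k, v k * z.2 k = 0
  radius : Tendsto δ atTop (𝓝 0)
  card_neighbours : ∀ (h : Fin H) (K : ℕ), Tendsto (fun n => P {ω | ∃ hi : 0 < n,
    (neighbours (δ n) h (fun i : Fin n => D i ω) ⟨0, hi⟩).card ≤ K}) atTop (𝓝 0)

/-- The sample of the first `n` individuals. -/
def obsSample (φ : Fin H → EuclideanSpace ℝ (Fin p) → ℝ) (σ : ℝ)
    (D : ℕ → Ω → Fin H × EuclideanSpace ℝ (Fin p)) (Z : ℕ → Ω → ℝ) (n : ℕ) (ω : Ω) :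
    Sample n p H :=
  modelSample φ σ (fun i : Fin n => D i ω) (fun i : Fin n => Z i ω)

lemma abs_coord_le_norm (k : Fin p) (x : EuclideanSpace ℝ (Fin p)) : |x k| ≤ ‖x‖ :=
  PiLp.norm_apply_le x k

lemma abs_coord_mul_le (k l : Fin p) (x : EuclideanSpace ℝ (Fin p)) :
    |x k * x l| ≤ 1 * (1 + ‖x‖ ^ 4) := by
  have h1 := mul_le_mul (abs_coord_le_norm k x) (abs_coord_le_norm l x) (abs_nonneg _)
    (norm_nonneg _)
  rw [abs_mul]
  nlinarith [sq_nonneg (‖x‖ ^ 2 - 1), sq_nonneg ‖x‖]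

lemma lipschitzWith_coord (k : Fin p) :
    LipschitzWith 1 fun x : EuclideanSpace ℝ (Fin p) => x k :=
  LipschitzWith.of_dist_le_mul fun x y => by
    rw [dist_eq_norm, dist_eq_norm, NNReal.coe_one, one_mul]
    exact abs_coord_le_norm k (x - y)

lemma measurable_wt {c : Fin H → ℝ} (he : ∀ h, Measurable (e h)) : Measurable (wt c e) :=
  measurable_from_prod_countable_right fun h =>
    (measurable_const.div (he h) : Measurable fun x => c h / e h x)

lemma wt_sq_eq (c : Fin H → ℝ) (z : Fin H × EuclideanSpace ℝ (Fin p)) :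
    wt c e z ^ 2 = ∑ h, c h ^ 2 * ((if z.1 = h then 1 else 0) / e h z.2 ^ 2) := by
  simp only [ite_div, zero_div, mul_ite, mul_zero, Finset.sum_ite_eq, Finset.mem_univ, if_true]
  rw [wt, div_pow]; ring

lemma IsIPWModel.integrable_of_le (hM : IsIPWModel P π e φ D Z δ) (h : Fin H)
    {Ψ : EuclideanSpace ℝ (Fin p) → ℝ} (hΨ : Measurable Ψ) {K : ℝ}
    (hle : ∀ x, |Ψ x| ≤ K * (1 + ‖x‖ ^ 4)) : Integrable (fun z => Ψ z.2) π :=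
  (hM.propensity h).integrable_snd hΨ ((hM.propensity h).integrable_div_of_le (hM.moment h) hΨ hle)

variable [IsProbabilityMeasure π]

/-- All local averages which enter the estimated mean shift and variance are negligible. -/
lemma IsIPWModel.withHighProb_averages (hM : IsIPWModel P π e φ D Z δ) {r : ℝ} (hr : 0 < r) :
    WithHighProb P fun n ω =>
      (∀ h k, |(√n)⁻¹ * ∑ i : Fin n, ipwRes h (e h) (D i ω) * (D i ω).2 k *
        (avg (neighbours (δ n) h (fun l : Fin n => D l ω) i) (fun l => φ h (D l ω).2) -
          φ h (D i ω).2)| ≤ r) ∧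
      (∀ h k m, |(√n)⁻¹ * ∑ i : Fin n, ipwRes h (e h) (D i ω) * (D i ω).2 k *
        (avg (neighbours (δ n) h (fun l : Fin n => D l ω) i) (fun l => (D l ω).2 m) -
          (D i ω).2 m)| ≤ r) ∧
      (∀ h k, |(√n)⁻¹ * ∑ i : Fin n, ipwRes h (e h) (D i ω) * (D i ω).2 k *
        avg (neighbours (δ n) h (fun l : Fin n => D l ω) i) (fun l => Z l ω)| ≤ r) ∧
      ∀ h, (n : ℝ)⁻¹ * ∑ i : Fin n, ‖(D i ω).2‖ ^ 2 * |1 / e h (D i ω).2 - 1| *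
        ((neighbours (δ n) h (fun l : Fin n => D l ω) i).card : ℝ)⁻¹ ≤ r := by
  have hobs := hM.observation
  have hcm : ∀ k : Fin p, Measurable fun x : EuclideanSpace ℝ (Fin p) => x k := fun k => by
    fun_prop
  have hbias : ∀ (h : Fin H) (k : Fin p) (ψ : EuclideanSpace ℝ (Fin p) → ℝ) (C : ℝ≥0),
      LipschitzWith C ψ → WithHighProb P fun n ω =>
        |(√n)⁻¹ * ∑ i : Fin n, ipwRes h (e h) (D i ω) * (D i ω).2 k *
        (avg (neighbours (δ n) h (fun l : Fin n => D l ω) i) (fun l => ψ (D l ω).2) -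
          ψ (D i ω).2)| ≤ r := fun h k ψ C hψ =>
    (hM.propensity h).withHighProb_bias_le hobs.measurable_data hobs.law_data hM.radius
      (hM.card_neighbours h) (hcm k) hψ
      ((hM.propensity h).integrable_ipwRes_mul_sq (hM.moment h) (hcm k) (abs_coord_le_norm k))
      ((hM.propensity h).integrable_ipwRes_mul_sq_mul (hM.moment h) (hcm k)
        (abs_coord_le_norm k) hψ) hr
  refine (WithHighProb.all fun h => WithHighProb.all fun k => ?_).and
    ((WithHighProb.all fun h => WithHighProb.all fun k => WithHighProb.all fun m =>
      hbias h k (fun x => x m) 1 (lipschitzWith_coord m)).and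
    ((WithHighProb.all fun h => WithHighProb.all fun k => ?_).and
    (WithHighProb.all fun h => ?_)))
  · obtain ⟨C, hC⟩ := hM.lipschitz h
    exact hbias h k _ C hC
  · exact (hM.propensity h).withHighProb_noise_le hobs.measurable_data hobs.measurable_noise
      hobs.law_vector (hM.card_neighbours h) (hcm k)
      ((hM.propensity h).integrable_ipwRes_mul_sq (hM.moment h) (hcm k) (abs_coord_le_norm k)) hr
  · have hem := (hM.propensity h).measurable
    have hFm : Measurable fun z : Fin H × EuclideanSpace ℝ (Fin p) =>
        ‖z.2‖ ^ 2 * |1 / e h z.2 - 1| :=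
      (measurable_snd.norm.pow_const 2).mul
        ((measurable_const.div (hem.comp measurable_snd)).sub_const 1).abs
    refine withHighProb_mean_inv_neighbours_le (D := D)
      (F := fun z => ‖z.2‖ ^ 2 * |1 / e h z.2 - 1|) hobs.measurable_data
      hobs.law_data (hM.card_neighbours h) hFm ?_
      (fun z => by positivity) hr
    refine (hM.moment h).mono' hFm.aestronglyMeasurable ((hM.propensity h).pos.mono fun z hz => ?_)
    have h1 : 1 ≤ 1 / e h z.2 := by rw [le_div_iff₀ hz.1]; linarith [hz.2]
    have h2 : ‖z.2‖ ^ 2 ≤ 1 + ‖z.2‖ ^ 4 := by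
      nlinarith [sq_nonneg (‖z.2‖ ^ 2 - 1), sq_nonneg ‖z.2‖]
    have h3 : |1 / e h z.2 - 1| ≤ 1 / e h z.2 := by rw [abs_of_nonneg] <;> linarith
    rw [Real.norm_of_nonneg (by positivity)]
    calc _ ≤ (1 + ‖z.2‖ ^ 4) * (1 / e h z.2) := mul_le_mul h2 h3 (abs_nonneg _) (by positivity)
      _ = _ := by ring

variable [IsProbabilityMeasure P]

/-- Empirical second moments are bounded below, for the full sample, with squared weights, and on
each treatment arm. -/
lemma IsIPWModel.exists_lower_bounds (hM : IsIPWModel P π e φ D Z δ) {c : Fin H → ℝ}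
    {h₀ : Fin H} (hc : c h₀ ≠ 0) :
    ∃ κ, 0 < κ ∧ WithHighProb P fun n ω =>
      (∀ v : Fin p → ℝ, κ * ∑ k, v k ^ 2 ≤
        (n : ℝ)⁻¹ * ∑ i : Fin n, (∑ k, v k * (D i ω).2 k) ^ 2) ∧
      (∀ v : Fin p → ℝ, κ * ∑ k, v k ^ 2 ≤
        (n : ℝ)⁻¹ * ∑ i : Fin n, wt c e (D i ω) ^ 2 * (∑ k, v k * (D i ω).2 k) ^ 2) ∧
      ∀ h, ∀ v : Fin p → ℝ, κ * ∑ k, v k ^ 2 ≤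
        (n : ℝ)⁻¹ * ∑ i : Fin n, (if (D i ω).1 = h then 1 else 0) *
          (∑ k, v k * (D i ω).2 k) ^ 2 := by
  have hcoord : ∀ k l : Fin p, Measurable fun x : EuclideanSpace ℝ (Fin p) => x k * x l :=
    fun k l => by fun_prop
  have hint : ∀ k l, Integrable (fun z : Fin H × EuclideanSpace ℝ (Fin p) => z.2 k * z.2 l) π :=
    fun k l => hM.integrable_of_le h₀ (hcoord k l) (abs_coord_mul_le k l)
  have hintW : ∀ k l, Integrable (fun z : Fin H × EuclideanSpace ℝ (Fin p) =>
      wt c e z ^ 2 * (z.2 k * z.2 l)) π := fun k l => by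
    simp_rw [wt_sq_eq, Finset.sum_mul, mul_assoc]
    refine integrable_finsetSum _ fun h _ => Integrable.const_mul ?_ _
    exact (hM.propensity h).integrable_treat_div_sq (hcoord k l)
      ((hM.propensity h).integrable_div_of_le (hM.moment h) (hcoord k l) (abs_coord_mul_le k l))
  have htm : ∀ h : Fin H, Measurable fun z : Fin H × EuclideanSpace ℝ (Fin p) =>
      if z.1 = h then (1 : ℝ) else 0 := fun h =>
    Measurable.ite (measurableSet_fst_eq h) measurable_const measurable_const
  have hintT : ∀ (h : Fin H) (k l), Integrable (fun z : Fin H × EuclideanSpace ℝ (Fin p) =>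
      (if z.1 = h then 1 else 0) * (z.2 k * z.2 l)) π := fun h k l => by
    refine (hint k l).mono ((htm h).mul ((hcoord k l).comp measurable_snd)).aestronglyMeasurable
      (Eventually.of_forall fun z => ?_)
    rw [norm_mul]
    refine mul_le_of_le_one_left (norm_nonneg _) ?_
    split_ifs <;> simp
  have hint1 : ∀ k l, Integrable (fun z : Fin H × EuclideanSpace ℝ (Fin p) =>
      (fun _ => (1 : ℝ)) z * (z.2 k * z.2 l)) π := by simpa only [one_mul] using hint
  obtain ⟨κ₁, hκ₁, h1⟩ := hM.observation.withHighProb_quadForm_lower measurable_const hint1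
    ((hM.propensity h₀).quadForm_pos hM.nondegenerate (fun _ => zero_le_one)
      (Eventually.of_forall fun z _ => one_pos) hint1)
  obtain ⟨κ₂, hκ₂, h2⟩ := hM.observation.withHighProb_quadForm_lower
    ((measurable_wt fun h => (hM.propensity h).measurable).pow_const 2) hintW
    ((hM.propensity h₀).quadForm_pos hM.nondegenerate (fun _ => sq_nonneg _)
      ((hM.propensity h₀).pos.mono fun z hz hz1 => by
        have : wt c e z ≠ 0 := by
          rw [wt, hz1]; exact div_ne_zero hc hz.1.ne'
        positivity) hintW)
  choose κ₃ hκ₃ h3 using fun h : Fin H => hM.observation.withHighProb_quadForm_lower (htm h)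
    (hintT h) ((hM.propensity h).quadForm_pos hM.nondegenerate
      (fun z => by split_ifs <;> positivity)
      (Eventually.of_forall fun z hz => by simp [hz]) (hintT h))
  have hne : (Finset.univ : Finset (Fin H)).Nonempty := ⟨h₀, Finset.mem_univ _⟩
  obtain ⟨κ, hκ, hκ1, hκ2, hκ3⟩ : ∃ κ, 0 < κ ∧ κ ≤ κ₁ ∧ κ ≤ κ₂ ∧ ∀ h, κ ≤ κ₃ h :=
    ⟨min (min κ₁ κ₂) (Finset.univ.inf' hne κ₃),
      lt_min (lt_min hκ₁ hκ₂) ((Finset.lt_inf'_iff hne).2 fun h _ => hκ₃ h),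
      (min_le_left _ _).trans (min_le_left _ _), (min_le_left _ _).trans (min_le_right _ _),
      fun h => (min_le_right _ _).trans (Finset.inf'_le _ (Finset.mem_univ h))⟩
  have hle : ∀ {a : ℝ} (v : Fin p → ℝ), κ ≤ a → κ * ∑ k, v k ^ 2 ≤ a * ∑ k, v k ^ 2 :=
    fun v h => mul_le_mul_of_nonneg_right h (Finset.sum_nonneg fun k _ => sq_nonneg _)
  refine ⟨κ, hκ, (h1.and (h2.and (WithHighProb.all h3))).mono fun n ω hω => ⟨fun v => ?_,
    fun v => (hle v hκ2).trans (hω.2.1 v), fun h v => (hle v (hκ3 h)).trans (hω.2.2 h v)⟩⟩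
  have := (hle v hκ1).trans (hω.1 v)
  simpa only [one_mul] using this

/-- Empirical second moments are bounded above. -/
lemma IsIPWModel.exists_upper_bounds (hM : IsIPWModel P π e φ D Z δ) (h₀ : Fin H) (σ : ℝ) :
    ∃ K, 0 < K ∧ WithHighProb P fun n ω =>
      (∀ k l, |(n : ℝ)⁻¹ * ∑ i : Fin n, (D i ω).2 k * (D i ω).2 l| ≤ K) ∧
      (n : ℝ)⁻¹ * ∑ i : Fin n, (obsSample φ σ D Z n ω).y i ^ 2 ≤ K := by
  have hcoord : ∀ k l : Fin p, Measurable fun x : EuclideanSpace ℝ (Fin p) => x k * x l :=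
    fun k l => by fun_prop
  have hint : ∀ k l, Integrable (fun z : Fin H × EuclideanSpace ℝ (Fin p) => z.2 k * z.2 l) π :=
    fun k l => hM.integrable_of_le h₀ (hcoord k l) (abs_coord_mul_le k l)
  have h1 := WithHighProb.all fun k : Fin p => WithHighProb.all fun l : Fin p =>
    hM.observation.withHighProb_mean_data (F := fun z => z.2 k * z.2 l) (by fun_prop)
      (hint k l) one_pos
  choose C hC using hM.lipschitz
  have hφm : ∀ h, Measurable (φ h) := fun h => (hC h).continuous.measurable
  set F : (Fin H × EuclideanSpace ℝ (Fin p)) × ℝ → ℝ :=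
    fun q => (φ q.1.1 q.1.2 + σ * q.2) ^ 2 with hF
  have hφj : Measurable fun z : Fin H × EuclideanSpace ℝ (Fin p) => φ z.1 z.2 :=
    measurable_from_prod_countable_right hφm
  have hFm : Measurable F :=
    ((hφj.comp measurable_fst).add (measurable_snd.const_mul σ)).pow_const 2
  have hφi : ∀ h, Integrable (fun z : Fin H × EuclideanSpace ℝ (Fin p) => φ h z.2 ^ 2) π := by
    intro h
    refine hM.integrable_of_le h₀ ((hφm h).pow_const 2)
      (K := 4 * (|φ h 0| ^ 2 + (C h : ℝ) ^ 2)) fun x => ?_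
    have h2 := abs_le_add_mul_norm_of_lipschitz (hC h) x
    have h3 : φ h x ^ 2 ≤ (|φ h 0| + C h * ‖x‖) ^ 2 := by
      rw [← sq_abs (φ h x)]; exact pow_le_pow_left₀ (abs_nonneg _) h2 2
    rw [abs_of_nonneg (sq_nonneg _)]
    have h4 : ‖x‖ ^ 2 ≤ 1 + ‖x‖ ^ 4 := by nlinarith [sq_nonneg (‖x‖ ^ 2 - 1), sq_nonneg ‖x‖]
    have h5 : (C h : ℝ) ^ 2 * ‖x‖ ^ 2 ≤ (C h : ℝ) ^ 2 * (1 + ‖x‖ ^ 4) :=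
      mul_le_mul_of_nonneg_left h4 (sq_nonneg _)
    have h6 : |φ h 0| ^ 2 * 1 ≤ |φ h 0| ^ 2 * (1 + ‖x‖ ^ 4) :=
      mul_le_mul_of_nonneg_left (by linarith [pow_nonneg (norm_nonneg x) 4]) (sq_nonneg _)
    nlinarith [sq_nonneg (|φ h 0| - C h * ‖x‖)]
  have hFi : Integrable F (π.prod (gaussianReal 0 1)) := by
    have hs : Integrable (fun z : Fin H × EuclideanSpace ℝ (Fin p) => ∑ h, 2 * φ h z.2 ^ 2) π :=
      integrable_finsetSum _ fun h _ => (hφi h).const_mul 2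
    have ht : Integrable (fun t : ℝ => 2 * σ ^ 2 * t ^ 2) (gaussianReal 0 1) :=
      ((memLp_id_gaussianReal (μ := 0) (v := 1) 2).integrable_sq).const_mul _
    refine ((hs.comp_fst _).add (ht.comp_snd _)).mono' hFm.aestronglyMeasurable
      (Eventually.of_forall fun q => ?_)
    rw [Real.norm_of_nonneg (sq_nonneg _)]
    have h2 : 2 * φ q.1.1 q.1.2 ^ 2 ≤ ∑ h, 2 * φ h q.1.2 ^ 2 :=
      Finset.single_le_sum (f := fun h => 2 * φ h q.1.2 ^ 2) (fun h _ => by positivity)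
        (Finset.mem_univ q.1.1)
    simp only [Pi.add_apply]
    nlinarith [sq_nonneg (φ q.1.1 q.1.2 - σ * q.2)]
  have h2 := hM.observation.withHighProb_mean hFm hFi one_pos
  set K₁ := ∑ k, ∑ l, |∫ z, z.2 k * z.2 l ∂π| with hK₁
  set K₂ := |∫ q, F q ∂(π.prod (gaussianReal 0 1))| with hK₂
  have hK₁0 : 0 ≤ K₁ := Finset.sum_nonneg fun k _ => Finset.sum_nonneg fun l _ => abs_nonneg _
  have hK₂0 : 0 ≤ K₂ := abs_nonneg _
  refine ⟨K₁ + K₂ + 1, by positivity, (h1.and h2).mono fun n ω hω => ⟨fun k l => ?_, ?_⟩⟩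
  · have h3 := hω.1 k l
    have h4 : |∫ z, z.2 k * z.2 l ∂π| ≤ K₁ :=
      (Finset.single_le_sum (f := fun l => |∫ z, z.2 k * z.2 l ∂π|) (fun l _ => abs_nonneg _)
        (Finset.mem_univ l)).trans (Finset.single_le_sum
          (f := fun k => ∑ l, |∫ z, z.2 k * z.2 l ∂π|)
          (fun k _ => Finset.sum_nonneg fun l _ => abs_nonneg _) (Finset.mem_univ k))
    have h5 := abs_sub_abs_le_abs_sub ((n : ℝ)⁻¹ * ∑ i : Fin n, (D i ω).2 k * (D i ω).2 l)
      (∫ z, z.2 k * z.2 l ∂π)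
    linarith
  · have h3 := (abs_le.1 hω.2).2
    have h4 := le_abs_self (∫ q, F q ∂(π.prod (gaussianReal 0 1)))
    change (n : ℝ)⁻¹ * ∑ i : Fin n, F (D i ω, Z i ω) ≤ _
    linarith

end PlugIn

section PlugInBound
variable {n p H : ℕ} {c : Fin H → ℝ} {e φ : Fin H → EuclideanSpace ℝ (Fin p) → ℝ}

/-- Deterministic bounds for the errors of the estimated mean shift and variance. -/
lemma modelSample_plugIn_error_le {σ δ : ℝ} (hσ : 0 < σ)
    {d : Fin n → Fin H × EuclideanSpace ℝ (Fin p)} {z : Fin n → ℝ} {b : Fin H → Fin p → ℝ}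
    (hn : 0 < n) {κ B r : ℝ} (hκ : 0 < κ)
    (hlow : ∀ v : Fin p → ℝ, κ * ∑ k, v k ^ 2 ≤ (n : ℝ)⁻¹ * ∑ i, (∑ k, v k * (d i).2 k) ^ 2)
    (hb : ∀ h m, |b h m| ≤ B)
    (h1 : ∀ h k, |(√n)⁻¹ * ∑ i, ipwRes h (e h) (d i) * (d i).2 k *
        (avg (neighbours δ h d i) (fun l => φ h (d l).2) - φ h (d i).2)| ≤ r)
    (h2 : ∀ h k m, |(√n)⁻¹ * ∑ i, ipwRes h (e h) (d i) * (d i).2 k *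
        (avg (neighbours δ h d i) (fun l => (d l).2 m) - (d i).2 m)| ≤ r)
    (h3 : ∀ h k, |(√n)⁻¹ * ∑ i, ipwRes h (e h) (d i) * (d i).2 k *
        avg (neighbours δ h d i) z| ≤ r)
    (h4 : ∀ h, (n : ℝ)⁻¹ * ∑ i, ‖(d i).2‖ ^ 2 * |1 / e h (d i).2 - 1| *
        ((neighbours δ h d i).card : ℝ)⁻¹ ≤ r) (M : Finset (Fin p)) (j : M) :
    |(modelSample φ σ d z).tau c e M ((modelSample φ σ d z).yStar δ b) j -
      (modelSample φ σ d z).tau c e M (fun h i => φ h (d i).2) j| ≤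
        p / κ * (∑ h, |c h|) * (1 + p * B + σ) * r / √n ∧
    |(modelSample φ σ d z).rho c e σ δ M j - (modelSample φ σ d z).zeta c e σ M j| ≤
        σ ^ 2 * (∑ h, c h ^ 2) * (p / κ) ^ 2 * r / n := by
  set S := modelSample φ σ d z with hSdef
  have hn' : (0 : ℝ) < n := by exact_mod_cast hn
  have hs : 0 < √(n : ℝ) := Real.sqrt_pos.2 hn'
  have hS : S.FullRank := Sample.fullRank_of_quadForm_lower hκ hlow
  have hg := hS.abs_etaCoef_le hn hκ hlow M j
  have hscale : ∀ {t : ℝ}, |(√(n : ℝ))⁻¹ * t| ≤ r → |t| ≤ √n * r := fun {t} ht => by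
    rw [abs_mul, abs_of_pos (inv_pos.2 hs), ← div_eq_inv_mul, div_le_iff₀ hs] at ht
    linarith
  constructor
  · rw [hSdef, modelSample_tau_yStar_sub]
    have hin : ∀ h k, |∑ i, ipwRes h (e h) (d i) * (d i).2 k *
          (avg (neighbours δ h d i) (fun l => φ h (d l).2) - φ h (d i).2) -
        ∑ m, b h m * ∑ i, ipwRes h (e h) (d i) * (d i).2 k *
          (avg (neighbours δ h d i) (fun l => (d l).2 m) - (d i).2 m) +
        σ * ∑ i, ipwRes h (e h) (d i) * (d i).2 k * avg (neighbours δ h d i) z| ≤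
        (1 + p * B + σ) * (√n * r) := by
      intro h k
      have e1 := hscale (h1 h k)
      have e3 := hscale (h3 h k)
      have e2 : |∑ m, b h m * ∑ i, ipwRes h (e h) (d i) * (d i).2 k *
          (avg (neighbours δ h d i) (fun l => (d l).2 m) - (d i).2 m)| ≤ p * (B * (√n * r)) := by
        refine (Finset.abs_sum_le_sum_abs _ _).trans ?_
        refine (Finset.sum_le_card_nsmul _ _ (B * (√n * r)) fun m _ => ?_).trans (le_of_eq ?_)
        · rw [abs_mul]
          exact mul_le_mul (hb h m) (hscale (h2 h k m)) (abs_nonneg _)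
            ((abs_nonneg _).trans (hb h m))
        · rw [Finset.card_univ, Fintype.card_fin, nsmul_eq_mul]
      refine (abs_add_le _ _).trans ?_
      have e4 := abs_sub (∑ i, ipwRes h (e h) (d i) * (d i).2 k *
          (avg (neighbours δ h d i) (fun l => φ h (d l).2) - φ h (d i).2))
        (∑ m, b h m * ∑ i, ipwRes h (e h) (d i) * (d i).2 k *
          (avg (neighbours δ h d i) (fun l => (d l).2 m) - (d i).2 m))
      have e5 : |σ * ∑ i, ipwRes h (e h) (d i) * (d i).2 k * avg (neighbours δ h d i) z| ≤
          σ * (√n * r) := by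
        rw [abs_mul, abs_of_pos hσ]
        exact mul_le_mul_of_nonneg_left e3 hσ.le
      linarith
    refine (Finset.abs_sum_le_sum_abs _ _).trans ?_
    refine (Finset.sum_le_card_nsmul _ _
      ((κ * n)⁻¹ * ((∑ h, |c h|) * ((1 + p * B + σ) * (√n * r)))) fun k _ => ?_).trans
      (le_of_eq ?_)
    · rw [abs_mul]
      refine mul_le_mul (hg k) ?_ (abs_nonneg _) (by positivity)
      refine (Finset.abs_sum_le_sum_abs _ _).trans ?_
      rw [Finset.sum_mul]
      refine Finset.sum_le_sum fun h _ => ?_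
      rw [abs_mul]
      exact mul_le_mul_of_nonneg_left (hin h k) (abs_nonneg _)
    · rw [Finset.card_univ, Fintype.card_fin, nsmul_eq_mul]
      have e1 : (n : ℝ)⁻¹ * √n = (√n)⁻¹ := by
        rw [inv_mul_eq_div, Real.sqrt_div_self', one_div]
      linear_combination (p * κ⁻¹ * (∑ h, |c h|) * (1 + p * B + σ) * r) * e1
  · rw [S.rho_eq, add_sub_cancel_left, abs_mul, abs_of_nonneg (sq_nonneg σ)]
    have hη : ∀ i, S.eta M j i ^ 2 ≤ (p * (κ * n)⁻¹) ^ 2 * ‖(d i).2‖ ^ 2 := by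
      intro i
      rw [← mul_pow, ← sq_abs]
      refine pow_le_pow_left₀ (abs_nonneg _) ?_ 2
      rw [S.eta_eq_sum]
      refine (Finset.abs_sum_le_sum_abs _ _).trans ?_
      refine (Finset.sum_le_card_nsmul _ _ ((κ * n)⁻¹ * ‖(d i).2‖) fun k _ => ?_).trans
        (le_of_eq ?_)
      · rw [abs_mul]
        exact mul_le_mul (hg k) (abs_coord_le_norm k _) (abs_nonneg _) (by positivity)
      · rw [Finset.card_univ, Fintype.card_fin, nsmul_eq_mul, mul_assoc]
    have hh : ∀ h, |∑ i, S.eta M j i ^ 2 * ((1 / e h (S.x i) - 1) *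
        ((S.nbhd δ h i).card : ℝ)⁻¹)| ≤ (p * (κ * n)⁻¹) ^ 2 * (n * r) := by
      intro h
      have e1 := h4 h
      rw [← div_eq_inv_mul, div_le_iff₀ hn'] at e1
      refine (Finset.abs_sum_le_sum_abs _ _).trans ?_
      calc _ ≤ ∑ i, (p * (κ * n)⁻¹) ^ 2 * (‖(d i).2‖ ^ 2 * |1 / e h (d i).2 - 1| *
            ((neighbours δ h d i).card : ℝ)⁻¹) := by
            refine Finset.sum_le_sum fun i _ => ?_
            rw [abs_mul, abs_mul, abs_of_nonneg (sq_nonneg (S.eta M j i)),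
              abs_of_nonneg (by positivity : (0 : ℝ) ≤ ((S.nbhd δ h i).card : ℝ)⁻¹)]
            have e2 := mul_le_mul_of_nonneg_right (hη i)
              (by positivity : (0 : ℝ) ≤ |1 / e h (d i).2 - 1| *
                ((neighbours δ h d i).card : ℝ)⁻¹)
            refine e2.trans (le_of_eq ?_)
            ring
        _ ≤ _ := by
            rw [← Finset.mul_sum]
            exact mul_le_mul_of_nonneg_left (by linarith) (sq_nonneg _)
    calc _ ≤ σ ^ 2 * ∑ h, c h ^ 2 * ((p * (κ * n)⁻¹) ^ 2 * (n * r)) := by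
          refine mul_le_mul_of_nonneg_left ?_ (sq_nonneg σ)
          refine (Finset.abs_sum_le_sum_abs _ _).trans (Finset.sum_le_sum fun h _ => ?_)
          rw [abs_mul, abs_of_nonneg (sq_nonneg (c h))]
          exact mul_le_mul_of_nonneg_left (hh h) (sq_nonneg _)
      _ = _ := by
          rw [← Finset.sum_mul]
          field_simp

variable {Ω : Type*} [MeasurableSpace Ω] {P : Measure Ω} [IsProbabilityMeasure P]
  {π : Measure (Fin H × EuclideanSpace ℝ (Fin p))} [IsProbabilityMeasure π]
  {D : ℕ → Ω → Fin H × EuclideanSpace ℝ (Fin p)} {Z : ℕ → Ω → ℝ} {δ : ℕ → ℝ}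

/-- With a probability tending to one, the design has full rank, and the errors of the estimated
mean shift and variance are small compared with the conditional standard deviation and variance
of the statistics. -/
lemma IsIPWModel.withHighProb_plugIn (hM : IsIPWModel P π e φ D Z δ) {h₀ : Fin H}
    (hc : c h₀ ≠ 0) {σ : ℝ} (hσ : 0 < σ) {bLS : ℕ → Ω → Fin H → Fin p → ℝ}
    (hbLS : ∀ n, ∀ᵐ ω ∂P, ∀ h,
      IsMinOn ((obsSample φ σ D Z n ω).armLoss h) Set.univ (bLS n ω h)) {r : ℝ} (hr : 0 < r) :
    WithHighProb P fun n ω => (obsSample φ σ D Z n ω).FullRank ∧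
      ∀ (M : Finset (Fin p)) (j : M), 0 < (obsSample φ σ D Z n ω).etaNormSq c e M j ∧
      |(obsSample φ σ D Z n ω).tau c e M ((obsSample φ σ D Z n ω).yStar (δ n) (bLS n ω)) j -
        (obsSample φ σ D Z n ω).tau c e M (fun h i => φ h ((obsSample φ σ D Z n ω).x i)) j| ≤
        r * √((obsSample φ σ D Z n ω).zeta c e σ M j) ∧
      |(obsSample φ σ D Z n ω).rho c e σ (δ n) M j /
        (obsSample φ σ D Z n ω).zeta c e σ M j - 1| ≤ r := by
  obtain ⟨κ, hκ, hlow⟩ := hM.exists_lower_bounds hc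
  obtain ⟨K, hK, hup⟩ := hM.exists_upper_bounds h₀ σ
  -- `c₀ / n` bounds `η_j' W² η_j` from below, and a bound `t` for the local averages yields errors
  -- `C₁ t / √n` of the mean shift and `C₂ t / n` of the variance
  set c₀ := κ / (K ^ 2 * (p + 1)) with hc₀
  have hc₀pos : 0 < c₀ := by positivity
  set B := √(4 * K / κ) with hB
  set C₁ := p / κ * (∑ h, |c h|) * (1 + p * B + σ) with hC₁
  set C₂ := σ ^ 2 * (∑ h, c h ^ 2) * (p / κ) ^ 2 with hC₂
  have hC₁0 : 0 ≤ C₁ := by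
    have : 0 ≤ ∑ h, |c h| := Finset.sum_nonneg fun h _ => abs_nonneg _
    positivity
  have hC₂0 : 0 ≤ C₂ := by
    have : 0 ≤ ∑ h, c h ^ 2 := Finset.sum_nonneg fun h _ => sq_nonneg _
    positivity
  obtain ⟨t, ht, ht1, ht2⟩ : ∃ t, 0 < t ∧ C₁ * t ≤ r * (σ * √c₀) ∧ C₂ * t ≤ r * (σ ^ 2 * c₀) := by
    have hq : 0 < √c₀ := Real.sqrt_pos.2 hc₀pos
    refine ⟨min (r * (σ * √c₀) / (C₁ + 1)) (r * (σ ^ 2 * c₀) / (C₂ + 1)), by positivity, ?_, ?_⟩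
    · calc C₁ * _ ≤ (C₁ + 1) * (r * (σ * √c₀) / (C₁ + 1)) :=
            mul_le_mul (by linarith) (min_le_left _ _) (by positivity) (by positivity)
        _ = _ := by field_simp
    · calc C₂ * _ ≤ (C₂ + 1) * (r * (σ ^ 2 * c₀) / (C₂ + 1)) :=
            mul_le_mul (by linarith) (min_le_right _ _) (by positivity) (by positivity)
        _ = _ := by field_simp
  have hav := hM.withHighProb_averages ht
  refine ((hlow.and hup).and hav).mono_ae ((eventually_gt_atTop 0).mono fun n hn => ?_)
  filter_upwards [hbLS n] with ω hb ⟨⟨⟨hl1, hl2, hl3⟩, hu1, hu2⟩, ha1, ha2, ha3, ha4⟩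
  have hn' : (0 : ℝ) < n := by exact_mod_cast hn
  have hS : (obsSample φ σ D Z n ω).FullRank := Sample.fullRank_of_quadForm_lower hκ hl1
  refine ⟨hS, fun M j => ?_⟩
  have hp' : (0 : ℝ) < p := by
    have : 0 < p := (Nat.zero_le _).trans_lt j.1.2
    exact_mod_cast this
  have hq : c₀ / n ≤ (obsSample φ σ D Z n ω).etaNormSq c e M j := by
    refine le_trans ?_ (hS.le_etaNormSq hn hκ hK hl2 hu1 M j)
    rw [hc₀]
    gcongr
    linarith
  have hbB : ∀ h m, |bLS n ω h m| ≤ B := fun h m =>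
    Real.abs_le_sqrt (Sample.sq_le_of_isMinOn_armLoss hκ (hl3 h) hu2 (hb h) m)
  obtain ⟨e1, e2⟩ := modelSample_plugIn_error_le (c := c) hσ (z := fun i : Fin n => Z i ω) hn hκ
    hl1 hbB ha1 ha2 ha3 ha4 M j
  have hq0 : 0 < (obsSample φ σ D Z n ω).etaNormSq c e M j := lt_of_lt_of_le (by positivity) hq
  have hs : 0 < √(n : ℝ) := Real.sqrt_pos.2 hn'
  refine ⟨hq0, ?_, ?_⟩
  · refine e1.trans ?_
    rw [Sample.zeta_eq, Real.sqrt_mul (sq_nonneg σ), Real.sqrt_sq hσ.le, div_le_iff₀ hs]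
    have h5 : √c₀ ≤ √((obsSample φ σ D Z n ω).etaNormSq c e M j) * √n := by
      rw [← Real.sqrt_mul hq0.le]
      exact Real.sqrt_le_sqrt ((div_le_iff₀ hn').1 hq)
    calc C₁ * t ≤ r * (σ * √c₀) := ht1
      _ ≤ r * (σ * (√((obsSample φ σ D Z n ω).etaNormSq c e M j) * √n)) := by gcongr
      _ = _ := by ring
  · have hζ : 0 < (obsSample φ σ D Z n ω).zeta c e σ M j := by
      rw [Sample.zeta_eq]; positivity
    rw [div_sub_one hζ.ne', abs_div, abs_of_pos hζ, div_le_iff₀ hζ]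
    refine e2.trans ?_
    rw [Sample.zeta_eq, div_le_iff₀ hn']
    have h5 := (div_le_iff₀ hn').1 hq
    calc C₂ * t ≤ r * (σ ^ 2 * c₀) := ht2
      _ ≤ r * (σ ^ 2 * ((obsSample φ σ D Z n ω).etaNormSq c e M j * n)) := by gcongr
      _ = _ := by ring

end PlugInBound

/-! ### Measurability of the truncation set -/

section MeasurableEntries
variable {Θ : Type*} [MeasurableSpace Θ] {l m q : Type*}

/-- All entries of a matrix depend measurably on a parameter. -/
def MeasurableEntries (A : Θ → Matrix l m ℝ) : Prop := ∀ i k, Measurable fun θ => A θ i k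

variable {A B : Θ → Matrix l m ℝ}

lemma MeasurableEntries.transpose (hA : MeasurableEntries A) :
    MeasurableEntries fun θ => (A θ)ᵀ := fun i k => hA k i

lemma MeasurableEntries.neg (hA : MeasurableEntries A) : MeasurableEntries fun θ => -A θ :=
  fun i k => (hA i k).neg

lemma MeasurableEntries.sub (hA : MeasurableEntries A) (hB : MeasurableEntries B) :
    MeasurableEntries fun θ => A θ - B θ := fun i k => (hA i k).sub (hB i k)

lemma MeasurableEntries.const_smul (hA : MeasurableEntries A) (r : ℝ) :
    MeasurableEntries fun θ => r • A θ := fun i k => (hA i k).const_mul r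

lemma measurableEntries_const (A : Matrix l m ℝ) : MeasurableEntries fun _ : Θ => A :=
  fun _ _ => measurable_const

lemma MeasurableEntries.mul [Fintype m] (hA : MeasurableEntries A) {C : Θ → Matrix m q ℝ}
    (hC : MeasurableEntries C) : MeasurableEntries fun θ => A θ * C θ := fun i k => by
  simp only [Matrix.mul_apply]
  exact Finset.measurable_sum _ fun r _ => (hA i r).mul (hC r k)

lemma MeasurableEntries.mulVec [Fintype m] (hA : MeasurableEntries A) {v : Θ → m → ℝ}
    (hv : ∀ k, Measurable fun θ => v θ k) (i : l) : Measurable fun θ => (A θ *ᵥ v θ) i :=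
  Finset.measurable_sum _ fun r _ => (hA i r).mul (hv r)

lemma MeasurableEntries.fromRows (hA : MeasurableEntries A) {C : Θ → Matrix q m ℝ}
    (hC : MeasurableEntries C) : MeasurableEntries fun θ => Matrix.fromRows (A θ) (C θ) := by
  rintro (i | i) k
  · exact hA i k
  · exact hC i k

lemma MeasurableEntries.det [Fintype m] [DecidableEq m] {G : Θ → Matrix m m ℝ}
    (hG : MeasurableEntries G) : Measurable fun θ => (G θ).det := by
  simp only [Matrix.det_apply, Units.smul_def, zsmul_eq_mul]
  exact Finset.measurable_sum _ fun s _ => (Finset.measurable_prod _ fun i _ =>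
    hG _ _).const_mul _

lemma MeasurableEntries.inv [Fintype m] [DecidableEq m] {G : Θ → Matrix m m ℝ}
    (hG : MeasurableEntries G) : MeasurableEntries fun θ => (G θ)⁻¹ := fun i k => by
  simp only [Matrix.inv_def, Matrix.smul_apply, Ring.inverse_eq_inv', Matrix.adjugate_apply,
    smul_eq_mul]
  refine hG.det.inv.mul (MeasurableEntries.det fun r t => ?_)
  by_cases hr : r = k
  · subst hr; simp only [Matrix.updateRow_self]; exact measurable_const
  · simp only [Matrix.updateRow_ne hr]; exact hG r t

end MeasurableEntries

section MeasurableSample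
variable {Θ : Type*} [MeasurableSpace Θ] {n p H : ℕ}

/-- A sample that depends measurably on a parameter. -/
structure MeasurableSample (S : Θ → Sample n p H) : Prop where
  confounder : ∀ i, Measurable fun θ => (S θ).x i
  treatment : ∀ i, Measurable fun θ => (S θ).a i
  outcome : ∀ i, Measurable fun θ => (S θ).y i

variable {S : Θ → Sample n p H} (hS : MeasurableSample S)
include hS

lemma MeasurableSample.sub (M : Finset (Fin p)) : MeasurableEntries fun θ => (S θ).sub M :=
  fun i k => by
    have := hS.confounder i
    simp only [Sample.sub, Matrix.of_apply]
    fun_prop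

lemma MeasurableSample.gram (M : Finset (Fin p)) : MeasurableEntries fun θ => (S θ).gram M :=
  (hS.sub M).transpose.mul (hS.sub M)

lemma MeasurableSample.polyA (lam : ℝ) (M : Finset (Fin p)) (s : M → ℝ) :
    MeasurableEntries fun θ => (S θ).polyA lam M s := by
  have h1 : MeasurableEntries fun θ => ((S θ).sub Mᶜ)ᵀ *
      (1 - (S θ).sub M * ((S θ).gram M)⁻¹ * ((S θ).sub M)ᵀ) :=
    (hS.sub Mᶜ).transpose.mul ((measurableEntries_const 1).sub
      (((hS.sub M).mul (hS.gram M).inv).mul (hS.sub M).transpose))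
  exact ((h1.fromRows h1.neg).fromRows (((measurableEntries_const (Matrix.diagonal s)).mul
    (hS.gram M).inv).mul (hS.sub M).transpose).neg).const_smul lam⁻¹

lemma MeasurableSample.polyB (M : Finset (Fin p)) (s : M → ℝ) (k : (↥Mᶜ ⊕ ↥Mᶜ) ⊕ M) :
    Measurable fun θ => (S θ).polyB M s k := by
  have h1 : MeasurableEntries fun θ => ((S θ).sub Mᶜ)ᵀ * (S θ).sub M * ((S θ).gram M)⁻¹ :=
    ((hS.sub Mᶜ).transpose.mul (hS.sub M)).mul (hS.gram M).inv
  have h2 : MeasurableEntries fun θ => Matrix.diagonal s * ((S θ).gram M)⁻¹ :=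
    (measurableEntries_const (Matrix.diagonal s)).mul (hS.gram M).inv
  rcases k with (k | k) | k
  · exact (h1.mulVec (v := fun _ => s) (fun _ => measurable_const) k).const_sub 1
  · exact (h1.mulVec (v := fun _ => s) (fun _ => measurable_const) k).const_add 1
  · exact (h2.mulVec (v := fun _ => s) (fun _ => measurable_const) k).neg

lemma MeasurableSample.eta (M : Finset (Fin p)) (j : M) (i : Fin n) :
    Measurable fun θ => (S θ).eta M j i := by
  have h1 : ∀ k, Measurable fun θ => (((S θ).gram M)⁻¹ *ᵥ Pi.single j 1) k := fun k =>
    (hS.gram M).inv.mulVec (v := fun _ => Pi.single j 1) (fun _ => measurable_const) k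
  exact (hS.sub M).mulVec h1 i

variable {c : Fin H → ℝ} {e : Fin H → EuclideanSpace ℝ (Fin p) → ℝ} (he : ∀ h, Measurable (e h))
include he

lemma MeasurableSample.wt (i : Fin n) :
    Measurable fun θ => IPW.wt c e ((S θ).a i, (S θ).x i) :=
  (measurable_wt he).comp ((hS.treatment i).prodMk (hS.confounder i))

lemma MeasurableSample.weight_mulVec (i : Fin n) :
    Measurable fun θ => ((S θ).weight c e *ᵥ (S θ).y) i := by
  simp only [Sample.weight_eq, Matrix.mulVec_diagonal]
  exact (hS.wt he i).mul (hS.outcome i)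

lemma MeasurableSample.etaNormSq (M : Finset (Fin p)) (j : M) :
    Measurable fun θ => (S θ).etaNormSq c e M j :=
  Finset.measurable_sum _ fun i _ => ((hS.wt he i).pow_const 2).mul ((hS.eta M j i).pow_const 2)

lemma MeasurableSample.stat (M : Finset (Fin p)) (j : M) :
    Measurable fun θ => (S θ).stat c e M j := by
  simp only [Sample.stat, dotProduct]
  exact Finset.measurable_sum _ fun i _ => (hS.eta M j i).mul (hS.weight_mulVec he i)

lemma MeasurableSample.vecD (M : Finset (Fin p)) (j : M) (i : Fin n) :
    Measurable fun θ => (S θ).vecD c e M j i := by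
  have h1 : ∀ i, Measurable fun θ => ((S θ).weight c e ^ 2 *ᵥ (S θ).eta M j) i := fun i => by
    simp only [Sample.weight_sq, Matrix.mulVec_diagonal]
    exact ((hS.wt he i).pow_const 2).mul (hS.eta M j i)
  exact (Finset.measurable_sum _ fun i _ => (hS.eta M j i).mul (h1 i)).inv.mul (h1 i)

lemma MeasurableSample.vecZ (M : Finset (Fin p)) (j : M) (i : Fin n) :
    Measurable fun θ => (S θ).vecZ c e M j i :=
  (hS.weight_mulVec he i).sub ((hS.stat he M j).mul (hS.vecD he M j i))

lemma MeasurableSample.measurableSet_truncSet (lam : ℝ) (M : Finset (Fin p)) (j : M) :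
    MeasurableSet {q : Θ × ℝ | q.2 ∈ (S q.1).truncSet c e lam M j} := by
  have hfin : {s : M → ℝ | ∀ k, s k = -1 ∨ s k = 1}.Finite :=
    Set.Finite.pi' (t := fun _ : M => ({-1, 1} : Set ℝ)) fun _ => by simp
  have hset : {q : Θ × ℝ | q.2 ∈ (S q.1).truncSet c e lam M j} =
      ⋃ s ∈ {s : M → ℝ | ∀ k, s k = -1 ∨ s k = 1}, ⋂ k,
        {q : Θ × ℝ | (S q.1).slope c e lam M j s k * q.2 ≤ (S q.1).slack c e lam M j s k} := by
    ext q
    simp only [Set.mem_ofPred_eq, Sample.mem_truncSet_iff, Set.mem_iUnion, Set.mem_iInter,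
      exists_prop]
  rw [hset]
  refine MeasurableSet.biUnion hfin.countable fun s _ => MeasurableSet.iInter fun k =>
    measurableSet_le ?_ ?_
  · exact (((hS.polyA lam M s).mulVec (hS.vecD he M j) k).comp measurable_fst).mul measurable_snd
  · exact ((hS.polyB M s k).sub
      ((hS.polyA lam M s).mulVec (hS.vecZ he M j) k)).comp measurable_fst

end MeasurableSample

/-! ### The confidence limits and the pivot with known parameters -/

/-- If `θ` lies outside the interval spanned by the solutions of the two pivot equations, whose
mean and variance parameters are off by at most a fraction `d` of the scale `b`, then the pivot
with the exact parameters is close to `0` or `1`, unless the truncation set is so small that the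
error of the parameters matters. -/
lemma pivot_extreme_of_not_mem_Icc {T : Set ℝ} (hT : MeasurableSet T) {a b t : ℝ} (hb : 0 < b)
    (hmem : T ∈ 𝓝 (a + b * t)) {θ τ d κ α l u : ℝ} {v : ℝ≥0} (hα0 : 0 < α) (hα1 : α < 1)
    (hκ : κ ≤ 1 / 2) (hd : d ≤ 1 / 2) (hm : |θ + τ - a| ≤ d * b)
    (hv : |(v : ℝ) / b ^ 2 - 1| ≤ d)
    (hl : (∃ m, truncCdf T (m + τ) v (a + b * t) = 1 - α / 2) →
      truncCdf T (l + τ) v (a + b * t) = 1 - α / 2)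
    (hu : (∃ m, truncCdf T (m + τ) v (a + b * t) = α / 2) →
      truncCdf T (u + τ) v (a + b * t) = α / 2)
    (hθ : θ ∉ Set.Icc l u) :
    κ * (gaussianReal 0 1).real ((fun t => a + b * t) ⁻¹' T) <
        d * perturbMeasure.real ((fun t => a + b * t) ⁻¹' T) ∨
      truncCdf ((fun t => a + b * t) ⁻¹' T) 0 1 t ≤ α / 2 + 4 * κ ∨
      1 - (α / 2 + 4 * κ) ≤ truncCdf ((fun t => a + b * t) ⁻¹' T) 0 1 t := by
  refine or_iff_not_imp_left.2 fun hG => ?_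
  rw [not_lt] at hG
  set B := (fun t => a + b * t) ⁻¹' T with hBdef
  have hB : MeasurableSet B := hT.preimage (by fun_prop)
  have hBt : B ∈ 𝓝 t := by
    have hc : ContinuousAt (fun t => a + b * t) t := by fun_prop
    exact hc.preimage_mem_nhds hmem
  have hpos : 0 < (gaussianReal 0 1).real B := by
    rw [measureReal_def, ENNReal.toReal_pos_iff]
    refine ⟨pos_iff_ne_zero.2 fun h0 => ?_, measure_lt_top _ _⟩
    have h1 := gaussianReal_absolutelyContinuous' 0 one_ne_zero h0
    exact (Measure.measure_pos_of_mem_nhds volume hBt).ne' h1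
  have hb2 : (0 : ℝ) < b ^ 2 := by positivity
  have hv0 : v ≠ 0 := by
    rintro rfl
    rw [NNReal.coe_zero, zero_div] at hv
    norm_num at hv; linarith
  -- standardization of the pivot
  obtain ⟨w, hw⟩ : ∃ w : ℝ≥0, v = .mk (b ^ 2) (sq_nonneg b) * w := by
    refine ⟨(.mk (b ^ 2) (sq_nonneg b))⁻¹ * v, ?_⟩
    rw [mul_inv_cancel_left₀]
    intro h0
    exact hb2.ne' (congrArg NNReal.toReal h0)
  have hw' : |(w : ℝ) - 1| ≤ d := by
    rw [hw, NNReal.coe_mul, NNReal.coe_mk, mul_div_cancel_left₀ _ hb2.ne'] at hv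
    exact hv
  have hθ' : |(θ + τ - a) / b| ≤ d := by
    rwa [abs_div, abs_of_pos hb, div_le_iff₀ hb]
  have hF : truncCdf T (θ + τ) v (a + b * t) = truncCdf B ((θ + τ - a) / b) w t := by
    rw [hBdef, ← truncCdf_affine hT a hb, ← hw, mul_div_cancel₀ _ hb.ne', add_sub_cancel]
  have hclose := abs_le.1 (truncCdf_perturb hd hθ' hw' hB hκ hpos hG t)
  rw [← hF] at hclose
  have hanti := truncCdf_antitone hT hv0 hmem
  have hsolve : ∀ q, 0 < q → q < 1 → ∃ m, truncCdf T (m + τ) v (a + b * t) = q := by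
    intro q hq0 hq1
    obtain ⟨m, hm⟩ := exists_truncCdf_eq hT hv0 hmem hq0 hq1
    exact ⟨m - τ, by rwa [sub_add_cancel]⟩
  rw [Set.mem_Icc, not_and_or, not_le, not_le] at hθ
  rcases hθ with hθ | hθ
  · right
    have h1 := hl (hsolve _ (by linarith) (by linarith))
    have h2 : truncCdf T (l + τ) v (a + b * t) ≤ truncCdf T (θ + τ) v (a + b * t) :=
      hanti (by linarith)
    linarith [hclose.2]
  · left
    have h1 := hu (hsolve _ (by linarith) (by linarith))
    have h2 : truncCdf T (θ + τ) v (a + b * t) ≤ truncCdf T (u + τ) v (a + b * t) :=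
      hanti (by linarith)
    linarith [hclose.1]

/-! ### Fixed treatments and confounders -/

section FixedDesign
variable {n p H : ℕ} {c : Fin H → ℝ} {e φ : Fin H → EuclideanSpace ℝ (Fin p) → ℝ} {σ : ℝ}

/-- The coefficients `W η_j` of the noise in the statistic `η_j' W Y`. -/
def Sample.noiseCoef (S : Sample n p H) (c : Fin H → ℝ)
    (e : Fin H → EuclideanSpace ℝ (Fin p) → ℝ) (M : Finset (Fin p)) (j : M) (i : Fin n) : ℝ :=
  wt c e (S.a i, S.x i) * S.eta M j i

/-- The mean of the statistic `η_j' W Y` given treatments and confounders. -/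
def Sample.condMean (S : Sample n p H) (c : Fin H → ℝ)
    (e φ : Fin H → EuclideanSpace ℝ (Fin p) → ℝ) (M : Finset (Fin p)) (j : M) : ℝ :=
  ∑ i, S.eta M j i * (wt c e (S.a i, S.x i) * φ (S.a i) (S.x i))

/-- The noise of the statistic `η_j' W Y`, scaled to unit variance. -/
def Sample.unitCoef (S : Sample n p H) (c : Fin H → ℝ)
    (e : Fin H → EuclideanSpace ℝ (Fin p) → ℝ) (M : Finset (Fin p)) (j : M) : Fin n → ℝ :=
  (√(S.etaNormSq c e M j))⁻¹ • S.noiseCoef c e M j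

lemma Sample.noiseCoef_dotProduct_self (S : Sample n p H) (M : Finset (Fin p)) (j : M) :
    S.noiseCoef c e M j ⬝ᵥ S.noiseCoef c e M j = S.etaNormSq c e M j :=
  Finset.sum_congr rfl fun i _ => by rw [Sample.noiseCoef]; ring

lemma Sample.unitCoef_dotProduct_self {S : Sample n p H} {M : Finset (Fin p)} {j : M}
    (hq : 0 < S.etaNormSq c e M j) : S.unitCoef c e M j ⬝ᵥ S.unitCoef c e M j = 1 := by
  rw [Sample.unitCoef, smul_dotProduct, dotProduct_smul, S.noiseCoef_dotProduct_self, smul_eq_mul,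
    smul_eq_mul, ← mul_assoc, ← mul_inv, Real.mul_self_sqrt hq.le, inv_mul_cancel₀ hq.ne']

/-- Weighting by `W` adds the residuals of the propensity scores to the contrast of the mean
responses; a component common to all treatments cancels since the contrast sums to zero. -/
lemma Sample.condMean_eq_target_add_tau (S : Sample n p H) (hc : ∑ h, c h = 0)
    (μ : Fin H → EuclideanSpace ℝ (Fin p) → ℝ) (f : EuclideanSpace ℝ (Fin p) → ℝ)
    (M : Finset (Fin p)) (j : M) :
    S.condMean c e (fun h x => μ h x + f x) M j = S.target c μ M j +
      S.tau c e M (fun h i => μ h (S.x i) + f (S.x i)) j := by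
  rw [Sample.condMean, S.target_eq, S.tau_eq, ← Finset.sum_add_distrib]
  refine Finset.sum_congr rfl fun i _ => ?_
  rw [← mul_add]
  congr 1
  have h1 : ∑ h, c h * f (S.x i) = 0 := by rw [← Finset.sum_mul, hc, zero_mul]
  have h2 : wt c e (S.a i, S.x i) * (μ (S.a i) (S.x i) + f (S.x i)) =
      ∑ h, c h * ((if S.a i = h then 1 else 0) / e h (S.x i) * (μ h (S.x i) + f (S.x i))) := by
    rw [Finset.sum_eq_single (S.a i)]
    · rw [if_pos rfl, wt]; ring
    · intro h _ hne
      rw [if_neg hne.symm, zero_div, zero_mul, mul_zero]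
    · simp
  have h3 : ∑ h, c h * μ h (S.x i) = ∑ h, c h * (μ h (S.x i) + f (S.x i)) := by
    simp only [mul_add, Finset.sum_add_distrib, h1, add_zero]
  rw [h2, h3, ← Finset.sum_add_distrib]
  refine Finset.sum_congr rfl fun h _ => ?_
  rw [ipwRes]
  ring

variable (d : Fin n → Fin H × EuclideanSpace ℝ (Fin p))

/-- The statistic as a function of the noise. -/
lemma modelSample_stat (z : Fin n → ℝ) (M : Finset (Fin p)) (j : M) :
    (modelSample φ σ d z).stat c e M j = (modelSample φ σ d z).condMean c e φ M j +
      σ * ((modelSample φ σ d z).noiseCoef c e M j ⬝ᵥ z) := by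
  rw [Sample.stat_eq, Sample.condMean, dotProduct, Finset.mul_sum, ← Finset.sum_add_distrib]
  refine Finset.sum_congr rfl fun i _ => ?_
  rw [Sample.noiseCoef]
  change _ * (_ * (φ (d i).1 (d i).2 + σ * z i)) = _ * (_ * φ (d i).1 (d i).2) + _
  ring

/-- The truncation set of the standardised statistic. -/
def pivotSet (c : Fin H → ℝ) (e φ : Fin H → EuclideanSpace ℝ (Fin p) → ℝ) (σ lam : ℝ)
    (d : Fin n → Fin H × EuclideanSpace ℝ (Fin p)) (M : Finset (Fin p)) (j : M)
    (z : Fin n → ℝ) : Set ℝ :=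
  (fun t => (modelSample φ σ d z).condMean c e φ M j +
    √((modelSample φ σ d z).zeta c e σ M j) * t) ⁻¹'
      (modelSample φ σ d z).truncSet c e lam M j

variable {d}

lemma modelSample_stat_eq_unitCoef (hσ : 0 < σ) {z : Fin n → ℝ} {M : Finset (Fin p)} {j : M}
    (hq : 0 < (modelSample φ σ d z).etaNormSq c e M j) :
    (modelSample φ σ d z).stat c e M j = (modelSample φ σ d z).condMean c e φ M j +
      √((modelSample φ σ d z).zeta c e σ M j) *
        ((modelSample φ σ d z).unitCoef c e M j ⬝ᵥ z) := by
  rw [modelSample_stat, Sample.zeta_eq, Real.sqrt_mul (sq_nonneg σ), Real.sqrt_sq hσ.le,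
    Sample.unitCoef, smul_dotProduct, smul_eq_mul, mul_assoc,
    mul_inv_cancel_left₀ (Real.sqrt_pos.2 hq).ne']

/-- The statistic varies along `u` only: moving the noise along `u` leaves `Z` unchanged. -/
lemma modelSample_vecZ_add_smul (z : Fin n → ℝ) (s : ℝ) {M : Finset (Fin p)} {j : M}
    (hq : 0 < (modelSample φ σ d z).etaNormSq c e M j) :
    (modelSample φ σ d (z + s • (modelSample φ σ d z).unitCoef c e M j)).vecZ c e M j =
      (modelSample φ σ d z).vecZ c e M j := by
  set u := (modelSample φ σ d z).unitCoef c e M j with hu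
  have hD : (modelSample φ σ d (z + s • u)).vecD c e M j = (modelSample φ σ d z).vecD c e M j :=
    rfl
  have hstat : (modelSample φ σ d (z + s • u)).stat c e M j =
      (modelSample φ σ d z).stat c e M j +
        σ * s * √((modelSample φ σ d z).etaNormSq c e M j) := by
    have h1 : (modelSample φ σ d z).noiseCoef c e M j ⬝ᵥ u =
        √((modelSample φ σ d z).etaNormSq c e M j) := by
      rw [hu, Sample.unitCoef, dotProduct_smul, Sample.noiseCoef_dotProduct_self, smul_eq_mul,
        inv_mul_eq_div, Real.div_sqrt]
    rw [modelSample_stat, modelSample_stat, dotProduct_add, dotProduct_smul]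
    have h2 : (modelSample φ σ d (z + s • u)).noiseCoef c e M j =
      (modelSample φ σ d z).noiseCoef c e M j := rfl
    have h3 : (modelSample φ σ d (z + s • u)).condMean c e φ M j =
      (modelSample φ σ d z).condMean c e φ M j := rfl
    rw [h2, h3, h1, smul_eq_mul]; ring
  have hDi : ∀ i, (modelSample φ σ d z).vecD c e M j i =
      ((modelSample φ σ d z).etaNormSq c e M j)⁻¹ *
        (wt c e (d i) ^ 2 * (modelSample φ σ d z).eta M j i) := fun i => by
    rw [Sample.vecD, Pi.smul_apply, Sample.weight_sq, Matrix.mulVec_diagonal, smul_eq_mul]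
    congr 2
    refine Finset.sum_congr rfl fun k _ => ?_
    rw [Matrix.mulVec_diagonal]; ring
  funext i
  simp only [Sample.vecZ, Pi.sub_apply, Pi.smul_apply, hD, hstat, Sample.weight_eq,
    Matrix.mulVec_diagonal, smul_eq_mul, hDi]
  have hui : u i = (√((modelSample φ σ d z).etaNormSq c e M j))⁻¹ *
      (wt c e (d i) * (modelSample φ σ d z).eta M j i) := rfl
  change wt c e (d i) * (φ (d i).1 (d i).2 + σ * (z i + s * u i)) - _ =
    wt c e (d i) * (φ (d i).1 (d i).2 + σ * z i) - _
  rw [hui]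
  set q := (modelSample φ σ d z).etaNormSq c e M j
  have hq1 : √q * q⁻¹ = (√q)⁻¹ := by
    have hs := Real.sqrt_pos.2 hq
    nth_rw 2 [← Real.mul_self_sqrt hq.le]
    field_simp
  rw [← hq1]
  ring

lemma pivotSet_add_smul (lam : ℝ) (z₀ z : Fin n → ℝ) (s : ℝ) {M : Finset (Fin p)} {j : M}
    (hq : 0 < (modelSample φ σ d z₀).etaNormSq c e M j) :
    pivotSet c e φ σ lam d M j (z + s • (modelSample φ σ d z₀).unitCoef c e M j) =
      pivotSet c e φ σ lam d M j z := by
  have hZ := modelSample_vecZ_add_smul (φ := φ) (σ := σ) (c := c) (e := e) (d := d) z s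
    (M := M) (j := j) hq
  ext t
  simp only [pivotSet, Set.mem_preimage, Sample.mem_truncSet_iff, Sample.slack]
  refine exists_congr fun σ' => and_congr_right fun _ => forall_congr' fun k => ?_
  have hZ' : (modelSample φ σ d (z + s • (modelSample φ σ d z₀).unitCoef c e M j)).vecZ c e M j =
    (modelSample φ σ d z).vecZ c e M j := hZ
  rw [hZ']
  exact Iff.rfl

/-- If the row `k` of the constraints involves the noise, it is almost surely not tight. -/
lemma noiseLaw_tight_eq_zero (hσ : 0 < σ) (lam : ℝ) (M : Finset (Fin p)) (s : M → ℝ)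
    (k : (↥Mᶜ ⊕ ↥Mᶜ) ⊕ M)
    (hk : ∃ i, (modelSample φ σ d 0).polyA lam M s k i * wt c e (d i) ≠ 0) :
    noiseLaw n {z | ((modelSample φ σ d z).polyA lam M s *ᵥ
      ((modelSample φ σ d z).weight c e *ᵥ (modelSample φ σ d z).y)) k =
        (modelSample φ σ d z).polyB M s k} = 0 := by
  set a : Fin n → ℝ := fun i => (modelSample φ σ d 0).polyA lam M s k i * wt c e (d i) with ha
  have ha0 : a ≠ 0 := fun h0 => by
    obtain ⟨i, hi⟩ := hk
    exact hi (congrFun h0 i)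
  refine measure_mono_null (fun z hz => ?_) (noiseLaw_hyperplane ha0
    (((modelSample φ σ d 0).polyB M s k - ∑ i, a i * φ (d i).1 (d i).2) / σ))
  have h1 : ((modelSample φ σ d z).polyA lam M s *ᵥ
      ((modelSample φ σ d z).weight c e *ᵥ (modelSample φ σ d z).y)) k =
      ∑ i, a i * φ (d i).1 (d i).2 + σ * (a ⬝ᵥ z) := by
    rw [Matrix.mulVec, dotProduct, dotProduct, Finset.mul_sum, ← Finset.sum_add_distrib]
    refine Finset.sum_congr rfl fun i _ => ?_
    rw [Sample.weight_eq, Matrix.mulVec_diagonal]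
    change (modelSample φ σ d 0).polyA lam M s k i * (wt c e (d i) *
      (φ (d i).1 (d i).2 + σ * z i)) = _
    rw [ha]; ring
  have h2 : ∑ i, a i * φ (d i).1 (d i).2 + σ * (a ⬝ᵥ z) = (modelSample φ σ d 0).polyB M s k :=
    h1.symm.trans hz
  rw [Set.mem_ofPred_eq, eq_div_iff hσ.ne']
  linarith

lemma Sample.polyA_inr (S : Sample n p H) (lam : ℝ) (M : Finset (Fin p)) (s : M → ℝ) (k : M)
    (i : Fin n) : S.polyA lam M s (Sum.inr k) i = -(lam⁻¹ * (s k * S.eta M k i)) := by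
  have h1 : S.eta M k i = ((S.gram M)⁻¹ * (S.sub M)ᵀ) k i := by
    have h2 := S.inv_gram_mul_mulVec M (Pi.single i 1) k
    simpa [Pi.single_apply] using h2.symm
  rw [Sample.polyA, Matrix.smul_apply, Matrix.fromRows_apply_inr, Matrix.neg_apply,
    Matrix.mul_assoc, Matrix.diagonal_mul, h1, smul_eq_mul, mul_neg]

/-- A constraint that involves the statistic involves the weighted response. -/
lemma Sample.exists_polyA_mul_wt_ne_zero_of_slope {S : Sample n p H} {lam : ℝ}
    {M : Finset (Fin p)} {j : M} {s : M → ℝ} {k : (↥Mᶜ ⊕ ↥Mᶜ) ⊕ M}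
    (hk : S.slope c e lam M j s k ≠ 0) : ∃ i, S.polyA lam M s k i * wt c e (S.a i, S.x i) ≠ 0 := by
  by_contra! h0
  have h3 : ∀ a w q η : ℝ, a * w = 0 → a * (q * (w ^ 2 * η)) = 0 := fun a w q η h => by
    linear_combination (q * (w * η)) * h
  refine hk ?_
  rw [Sample.slope, Matrix.mulVec, dotProduct]
  refine Finset.sum_eq_zero fun i _ => ?_
  rw [Sample.vecD, Pi.smul_apply, Sample.weight_sq, Matrix.mulVec_diagonal, smul_eq_mul]
  exact h3 _ _ _ _ (h0 i)

/-- Every sign constraint involves the weighted response. -/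
lemma Sample.exists_polyA_inr_mul_wt_ne_zero {S : Sample n p H} {lam : ℝ} (hlam : 0 < lam)
    {M : Finset (Fin p)} {s : M → ℝ} (hs : ∀ k, s k = -1 ∨ s k = 1) {k : M}
    (hq : 0 < S.etaNormSq c e M k) :
    ∃ i, S.polyA lam M s (Sum.inr k) i * wt c e (S.a i, S.x i) ≠ 0 := by
  by_contra! h0
  refine hq.ne' ?_
  rw [Sample.etaNormSq]
  refine Finset.sum_eq_zero fun i _ => ?_
  have h2 := h0 i
  rw [Sample.polyA_inr] at h2
  have hs0 : s k ≠ 0 := by rcases hs k with h | h <;> rw [h] <;> norm_num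
  have h3 : S.eta M k i * wt c e (S.a i, S.x i) = 0 := by
    have h4 : lam⁻¹ * s k ≠ 0 := mul_ne_zero (inv_ne_zero hlam.ne') hs0
    refine (mul_eq_zero.1 ?_).resolve_left h4
    linarith
  rw [← mul_pow, mul_comm, h3, zero_pow two_ne_zero]

end FixedDesign

/-! ### Random treatments and confounders -/

section RandomDesign
variable {n p H : ℕ} {c : Fin H → ℝ} {e φ : Fin H → EuclideanSpace ℝ (Fin p) → ℝ} {σ : ℝ}

/-- The design has full column rank and the statistics `η_j' W Y` are non-degenerate. -/
def Sample.Regular (S : Sample n p H) (c : Fin H → ℝ)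
    (e : Fin H → EuclideanSpace ℝ (Fin p) → ℝ) : Prop :=
  (S.gram Finset.univ).det ≠ 0 ∧ ∀ (M : Finset (Fin p)) (j : M), 0 < S.etaNormSq c e M j

/-- No constraint that involves the weighted response is tight. -/
def Sample.NoTightConstraint (S : Sample n p H) (c : Fin H → ℝ)
    (e : Fin H → EuclideanSpace ℝ (Fin p) → ℝ) (lam : ℝ) : Prop :=
  ∀ (M : Finset (Fin p)), ∀ s ∈ {s : M → ℝ | ∀ k, s k = -1 ∨ s k = 1},
    ∀ k, (∃ i, S.polyA lam M s k i * wt c e (S.a i, S.x i) ≠ 0) →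
      (S.polyA lam M s *ᵥ (S.weight c e *ᵥ S.y)) k ≠ S.polyB M s k

lemma Sample.Regular.fullRank {S : Sample n p H} (hS : S.Regular c e) : S.FullRank := by
  intro b hb
  have h1 : S.sub Finset.univ *ᵥ (fun k : (Finset.univ : Finset (Fin p)) => b k) = 0 := by
    rw [← S.design_mulVec_extendModel]
    rw [← hb]
    congr 1
    funext k
    simp [extendModel]
  have h2 : S.gram Finset.univ *ᵥ (fun k : (Finset.univ : Finset (Fin p)) => b k) = 0 := by
    rw [Sample.gram, ← Matrix.mulVec_mulVec, h1, Matrix.mulVec_zero]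
  have h3 := Matrix.eq_zero_of_mulVec_eq_zero hS.1 h2
  funext k
  exact congrFun h3 ⟨k, Finset.mem_univ k⟩

lemma measurableSample_modelSample (hφ : ∀ h, Measurable (φ h)) :
    MeasurableSample fun q : (Fin n → Fin H × EuclideanSpace ℝ (Fin p)) × (Fin n → ℝ) =>
      modelSample φ σ q.1 q.2 where
  confounder i := by simp only [modelSample]; fun_prop
  treatment i := by simp only [modelSample]; fun_prop
  outcome i := by
    have h1 : Measurable fun z : Fin H × EuclideanSpace ℝ (Fin p) => φ z.1 z.2 :=
      measurable_from_prod_countable_right hφ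
    simp only [modelSample]
    exact (h1.comp (by fun_prop : Measurable fun q : (Fin n → Fin H × EuclideanSpace ℝ (Fin p)) ×
      (Fin n → ℝ) => q.1 i)).add (by fun_prop)

/-- The event that the Lasso selects `M`, up to a null set. -/
def selectEvent (n : ℕ) (c : Fin H → ℝ) (e φ : Fin H → EuclideanSpace ℝ (Fin p) → ℝ) (σ lam : ℝ)
    (M : Finset (Fin p)) (j : M) :
    Set ((Fin n → Fin H × EuclideanSpace ℝ (Fin p)) × (Fin n → ℝ)) :=
  {q | (modelSample φ σ q.1 q.2).Regular c e ∧
    (modelSample φ σ q.1 q.2).unitCoef c e M j ⬝ᵥ q.2 ∈ pivotSet c e φ σ lam q.1 M j q.2}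

/-- The event that `M` is selected and the pivot with known parameters is within `a` of `0`
or `1`. -/
def tailEvent (n : ℕ) (c : Fin H → ℝ) (e φ : Fin H → EuclideanSpace ℝ (Fin p) → ℝ) (σ lam : ℝ)
    (M : Finset (Fin p)) (j : M) (a : ℝ) :
    Set ((Fin n → Fin H × EuclideanSpace ℝ (Fin p)) × (Fin n → ℝ)) :=
  {q | (modelSample φ σ q.1 q.2).Regular c e ∧
    (modelSample φ σ q.1 q.2).unitCoef c e M j ⬝ᵥ q.2 ∈ pivotSet c e φ σ lam q.1 M j q.2 ∧
    (truncCdf (pivotSet c e φ σ lam q.1 M j q.2) 0 1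
        ((modelSample φ σ q.1 q.2).unitCoef c e M j ⬝ᵥ q.2) ≤ a ∨
      1 - a ≤ truncCdf (pivotSet c e φ σ lam q.1 M j q.2) 0 1
        ((modelSample φ σ q.1 q.2).unitCoef c e M j ⬝ᵥ q.2))}

/-- The event that `M` is selected and the truncation set is so small that a relative error `d` of
mean and variance may change the pivot substantially. -/
def smallEvent (n : ℕ) (c : Fin H → ℝ) (e φ : Fin H → EuclideanSpace ℝ (Fin p) → ℝ) (σ lam : ℝ)
    (M : Finset (Fin p)) (j : M) (κ d : ℝ) :
    Set ((Fin n → Fin H × EuclideanSpace ℝ (Fin p)) × (Fin n → ℝ)) :=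
  {q | (modelSample φ σ q.1 q.2).Regular c e ∧
    (modelSample φ σ q.1 q.2).unitCoef c e M j ⬝ᵥ q.2 ∈ pivotSet c e φ σ lam q.1 M j q.2 ∧
    κ * (gaussianReal 0 1).real (pivotSet c e φ σ lam q.1 M j q.2) <
      d * perturbMeasure.real (pivotSet c e φ σ lam q.1 M j q.2)}

section Measurability
variable (he : ∀ h, Measurable (e h)) (hφ : ∀ h, Measurable (φ h))
include he hφ

lemma measurableSet_regular : MeasurableSet
    {q : (Fin n → Fin H × EuclideanSpace ℝ (Fin p)) × (Fin n → ℝ) |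
      (modelSample φ σ q.1 q.2).Regular c e} := by
  have hS := measurableSample_modelSample (n := n) (σ := σ) hφ
  have h1 : MeasurableSet {q : (Fin n → Fin H × EuclideanSpace ℝ (Fin p)) × (Fin n → ℝ) |
      ((modelSample φ σ q.1 q.2).gram Finset.univ).det ≠ 0} :=
    (measurableSet_eq_fun (hS.gram Finset.univ).det measurable_const).compl
  refine h1.inter ?_
  change MeasurableSet {q : (Fin n → Fin H × EuclideanSpace ℝ (Fin p)) × (Fin n → ℝ) |
    ∀ (M : Finset (Fin p)) (j : M), 0 < (modelSample φ σ q.1 q.2).etaNormSq c e M j}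
  simp only [Set.ofPred_forall]
  exact MeasurableSet.iInter fun M => MeasurableSet.iInter fun j =>
    measurableSet_lt measurable_const (hS.etaNormSq he M j)

lemma measurable_unitCoef_dotProduct (M : Finset (Fin p)) (j : M) :
    Measurable fun q : (Fin n → Fin H × EuclideanSpace ℝ (Fin p)) × (Fin n → ℝ) =>
      (modelSample φ σ q.1 q.2).unitCoef c e M j ⬝ᵥ q.2 := by
  have hS := measurableSample_modelSample (n := n) (σ := σ) hφ
  exact Finset.measurable_sum _ fun i _ => (((hS.etaNormSq he M j).sqrt.inv).mul
    ((hS.wt he i).mul (hS.eta M j i))).mul (by fun_prop)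

lemma measurableSet_pivotSet (lam : ℝ) (M : Finset (Fin p)) (j : M) : MeasurableSet
    {q : ((Fin n → Fin H × EuclideanSpace ℝ (Fin p)) × (Fin n → ℝ)) × ℝ |
      q.2 ∈ pivotSet c e φ σ lam q.1.1 M j q.1.2} := by
  have hS := measurableSample_modelSample (n := n) (σ := σ) hφ
  have h0 : Measurable fun z : Fin H × EuclideanSpace ℝ (Fin p) => φ z.1 z.2 :=
    measurable_from_prod_countable_right hφ
  have h1 : Measurable fun q : (Fin n → Fin H × EuclideanSpace ℝ (Fin p)) × (Fin n → ℝ) =>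
      (modelSample φ σ q.1 q.2).condMean c e φ M j :=
    Finset.measurable_sum _ fun i _ => (hS.eta M j i).mul ((hS.wt he i).mul
      (h0.comp ((hS.treatment i).prodMk (hS.confounder i))))
  have h2 : Measurable fun q : (Fin n → Fin H × EuclideanSpace ℝ (Fin p)) × (Fin n → ℝ) =>
      √((modelSample φ σ q.1 q.2).zeta c e σ M j) := by
    simp only [Sample.zeta_eq]
    exact ((hS.etaNormSq he M j).const_mul _).sqrt
  exact (measurable_fst.prodMk ((h1.comp measurable_fst).add
    ((h2.comp measurable_fst).mul measurable_snd))) (hS.measurableSet_truncSet (c := c) he lam M j)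

lemma measurableSet_selectEvent (lam : ℝ) (M : Finset (Fin p)) (j : M) :
    MeasurableSet (selectEvent n c e φ σ lam M j) :=
  (measurableSet_regular he hφ).inter ((measurable_id.prodMk
    (measurable_unitCoef_dotProduct he hφ M j)) (measurableSet_pivotSet he hφ lam M j))

lemma measurableSet_tailEvent (lam : ℝ) (M : Finset (Fin p)) (j : M) (a : ℝ) :
    MeasurableSet (tailEvent n c e φ σ lam M j a) := by
  have h1 := (measurable_truncCdf_randomSet
    (B := fun q : (Fin n → Fin H × EuclideanSpace ℝ (Fin p)) × (Fin n → ℝ) =>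
      pivotSet c e φ σ lam q.1 M j q.2) (measurableSet_pivotSet (c := c) (σ := σ) (n := n) he hφ lam M j)).comp
      (measurable_id.prodMk (measurable_unitCoef_dotProduct (c := c) (σ := σ) he hφ M j))
  exact (measurableSet_regular he hφ).inter (((measurable_id.prodMk
    (measurable_unitCoef_dotProduct he hφ M j)) (measurableSet_pivotSet he hφ lam M j)).inter
      ((measurableSet_le h1 measurable_const).union (measurableSet_le measurable_const h1)))

lemma measurableSet_smallEvent (lam : ℝ) (M : Finset (Fin p)) (j : M) (κ d : ℝ) :
    MeasurableSet (smallEvent n c e φ σ lam M j κ d) := by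
  have h0 := measurableSet_pivotSet (c := c) (σ := σ) (n := n) he hφ lam M j
  exact (measurableSet_regular he hφ).inter (((measurable_id.prodMk
    (measurable_unitCoef_dotProduct he hφ M j)) h0).inter
      (measurableSet_lt ((measurable_measure_randomSet
        (B := fun q : (Fin n → Fin H × EuclideanSpace ℝ (Fin p)) × (Fin n → ℝ) =>
          pivotSet c e φ σ lam q.1 M j q.2) h0 _).ennreal_toReal.const_mul κ)
        ((measurable_measure_randomSet
        (B := fun q : (Fin n → Fin H × EuclideanSpace ℝ (Fin p)) × (Fin n → ℝ) =>
          pivotSet c e φ σ lam q.1 M j q.2) h0 _).ennreal_toReal.const_mul d)))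

variable (π : Measure (Fin H × EuclideanSpace ℝ (Fin p)))

lemma measure_tailEvent_le (lam : ℝ) (M : Finset (Fin p)) (j : M) (a : ℝ) :
    ((Measure.pi fun _ : Fin n => π).prod (noiseLaw n)) (tailEvent n c e φ σ lam M j a) ≤
      2 * ENNReal.ofReal a *
        ((Measure.pi fun _ : Fin n => π).prod (noiseLaw n)) (selectEvent n c e φ σ lam M j) := by
  have hsel := measurableSet_selectEvent (n := n) (c := c) (σ := σ) he hφ lam M j
  rw [Measure.prod_apply (measurableSet_tailEvent he hφ lam M j a), Measure.prod_apply hsel,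
    ← lintegral_const_mul _ (measurable_measure_prodMk_left hsel)]
  refine lintegral_mono fun d => ?_
  by_cases hreg : (modelSample φ σ d 0).Regular c e
  · have hB : MeasurableSet {q : (Fin n → ℝ) × ℝ | q.2 ∈ pivotSet c e φ σ lam d M j q.1} :=
      ((measurable_const.prodMk measurable_fst).prodMk measurable_snd :
        Measurable fun q : (Fin n → ℝ) × ℝ => ((d, q.1), q.2)) (measurableSet_pivotSet he hφ lam M j)
    refine le_trans (measure_mono ?_) ((noiseLaw_pivot_tails_le
      (Sample.unitCoef_dotProduct_self (hreg.2 M j)) hB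
      (fun z s => pivotSet_add_smul lam 0 z s (hreg.2 M j)) a).trans
        (mul_le_mul_right (measure_mono ?_) _))
    · exact fun z hz => hz.2
    · exact fun z hz => ⟨hreg, hz⟩
  · have : Prod.mk d ⁻¹' tailEvent n c e φ σ lam M j a = ∅ :=
      Set.eq_empty_of_forall_notMem fun z hz => hreg hz.1
    rw [this, measure_empty]
    exact zero_le

lemma measure_smallEvent_le [IsProbabilityMeasure π] (lam : ℝ) (M : Finset (Fin p)) (j : M)
    {κ r : ℝ} (hκ : 0 < κ)
    (hr : 0 ≤ r) :
    ((Measure.pi fun _ : Fin n => π).prod (noiseLaw n)) (smallEvent n c e φ σ lam M j κ r) ≤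
      ENNReal.ofReal (r / κ * perturbMeasure.real Set.univ) := by
  rw [Measure.prod_apply (measurableSet_smallEvent he hφ lam M j κ r)]
  refine (lintegral_mono (g := fun _ => ENNReal.ofReal (r / κ * perturbMeasure.real Set.univ))
    fun d => ?_).trans (by simp)
  by_cases hreg : (modelSample φ σ d 0).Regular c e
  · have hB : MeasurableSet {q : (Fin n → ℝ) × ℝ | q.2 ∈ pivotSet c e φ σ lam d M j q.1} :=
      ((measurable_const.prodMk measurable_fst).prodMk measurable_snd :
        Measurable fun q : (Fin n → ℝ) × ℝ => ((d, q.1), q.2)) (measurableSet_pivotSet he hφ lam M j)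
    refine le_trans (measure_mono ?_) (noiseLaw_small_set_le
      (Sample.unitCoef_dotProduct_self (hreg.2 M j)) hB
      (fun z s => pivotSet_add_smul lam 0 z s (hreg.2 M j)) hκ hr)
    exact fun z hz => hz.2
  · have : Prod.mk d ⁻¹' smallEvent n c e φ σ lam M j κ r = ∅ :=
      Set.eq_empty_of_forall_notMem fun z hz => hreg hz.1
    simp only [this, measure_empty]
    exact zero_le

lemma ae_noTightConstraint [SigmaFinite π] (hσ : 0 < σ) (lam : ℝ) :
    ∀ᵐ q ∂((Measure.pi fun _ : Fin n => π).prod (noiseLaw n)),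
      (modelSample φ σ q.1 q.2).NoTightConstraint c e lam := by
  have hS := measurableSample_modelSample (n := n) (σ := σ) hφ
  have hfin : ∀ M : Finset (Fin p), {s : M → ℝ | ∀ k, s k = -1 ∨ s k = 1}.Finite := fun M =>
    Set.Finite.pi' (t := fun _ : M => ({-1, 1} : Set ℝ)) fun _ => by simp
  simp only [Sample.NoTightConstraint]
  rw [ae_all_iff]
  intro M
  rw [ae_ball_iff (hfin M).countable]
  intro s _
  rw [ae_all_iff]
  intro k
  have hm : MeasurableSet {q : (Fin n → Fin H × EuclideanSpace ℝ (Fin p)) × (Fin n → ℝ) |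
      (∃ i, (modelSample φ σ q.1 q.2).polyA lam M s k i * wt c e
        ((modelSample φ σ q.1 q.2).a i, (modelSample φ σ q.1 q.2).x i) ≠ 0) ∧
      ((modelSample φ σ q.1 q.2).polyA lam M s *ᵥ ((modelSample φ σ q.1 q.2).weight c e *ᵥ
        (modelSample φ σ q.1 q.2).y)) k = (modelSample φ σ q.1 q.2).polyB M s k} := by
    refine MeasurableSet.inter ?_ (measurableSet_eq_fun
      ((hS.polyA lam M s).mulVec (hS.weight_mulVec he) k) (hS.polyB M s k))
    change MeasurableSet {q : (Fin n → Fin H × EuclideanSpace ℝ (Fin p)) × (Fin n → ℝ) |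
      ∃ i, (modelSample φ σ q.1 q.2).polyA lam M s k i * wt c e
        ((modelSample φ σ q.1 q.2).a i, (modelSample φ σ q.1 q.2).x i) ≠ 0}
    simp only [Set.ofPred_exists]
    exact MeasurableSet.iUnion fun i => (measurableSet_eq_fun
      ((hS.polyA lam M s k i).mul (hS.wt he i)) measurable_const).compl
  have h0 := (Measure.measure_prod_null (μ := Measure.pi fun _ : Fin n => π) (ν := noiseLaw n)
    hm).2 (Eventually.of_forall fun d => ?_)
  · filter_upwards [measure_eq_zero_iff_ae_notMem.1 h0] with q hq h1 h2
    exact hq ⟨h1, h2⟩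
  · by_cases hk : ∃ i, (modelSample φ σ d 0).polyA lam M s k i * wt c e (d i) ≠ 0
    · exact measure_mono_null (fun z hz => hz.2)
        (noiseLaw_tight_eq_zero (φ := φ) hσ lam M s k hk)
    · refine measure_mono_null (fun z hz => hk hz.1) measure_empty

end Measurability

end RandomDesign

/-! ### The false coverage rate -/

section SelectedModel
variable {n p H : ℕ} {c : Fin H → ℝ} {e μ : Fin H → EuclideanSpace ℝ (Fin p) → ℝ}
  {f : EuclideanSpace ℝ (Fin p) → ℝ} {σ : ℝ}

lemma Sample.measurableSet_truncSet (S : Sample n p H) (he : ∀ h, Measurable (e h)) (lam : ℝ)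
    (M : Finset (Fin p)) (j : M) : MeasurableSet (S.truncSet c e lam M j) := by
  have hS : MeasurableSample fun _ : Unit => S :=
    ⟨fun _ => measurable_const, fun _ => measurable_const, fun _ => measurable_const⟩
  exact (measurable_const.prodMk measurable_id : Measurable fun r : ℝ => (((), r) : Unit × ℝ))
    (hS.measurableSet_truncSet (c := c) he lam M j)

/-- The truncation set of a model contains its statistic only if the Lasso selects the model. -/
lemma Sample.supportModel_eq_of_stat_mem {S : Sample n p H} {lam : ℝ} (hlam : 0 < lam)
    (hreg : S.Regular c e) (htight : S.NoTightConstraint c e lam) {b : Fin p → ℝ}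
    (hb : IsMinOn (lassoObj S.design (S.weight c e *ᵥ S.y) lam) Set.univ b)
    {M : Finset (Fin p)} {j : M} (hmem : S.stat c e M j ∈ S.truncSet c e lam M j) :
    supportModel b = M := by
  obtain ⟨s, hs, h⟩ := (S.stat_mem_truncSet_iff c e lam M j).1 hmem
  exact S.supportModel_eq_of_polyA_le hreg.fullRank hlam _ hb M s hs h fun k =>
    htight M s hs _ (Sample.exists_polyA_inr_mul_wt_ne_zero hlam hs (hreg.2 M k))

lemma mem_selectEvent_iff {φ : Fin H → EuclideanSpace ℝ (Fin p) → ℝ} (hσ : 0 < σ) {lam : ℝ}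
    {M : Finset (Fin p)} {j : M}
    {q : (Fin n → Fin H × EuclideanSpace ℝ (Fin p)) × (Fin n → ℝ)}
    (hreg : (modelSample φ σ q.1 q.2).Regular c e) :
    q ∈ selectEvent n c e φ σ lam M j ↔
      (modelSample φ σ q.1 q.2).stat c e M j ∈ (modelSample φ σ q.1 q.2).truncSet c e lam M j := by
  rw [modelSample_stat_eq_unitCoef hσ (hreg.2 M j)]
  exact and_iff_right hreg

/-- An interval of a selected model misses its target only if the pivot with known parameters is
extreme, or if the truncation set is small. -/
lemma mem_tailEvent_or_mem_smallEvent (hc : ∑ h, c h = 0) (he : ∀ h, Measurable (e h))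
    (hσ : 0 < σ) {lam : ℝ}
    {q : (Fin n → Fin H × EuclideanSpace ℝ (Fin p)) × (Fin n → ℝ)} {S : Sample n p H}
    (hS : S = modelSample (fun h x => μ h x + f x) σ q.1 q.2) (hreg : S.Regular c e)
    (htight : S.NoTightConstraint c e lam) {M : Finset (Fin p)} {j : M}
    (hmem : S.stat c e M j ∈ S.truncSet c e lam M j) {δ : ℝ} {b : Fin H → Fin p → ℝ}
    {r κ α l u : ℝ} (hr : r ≤ 1 / 2) (hκ : κ ≤ 1 / 2) (hα0 : 0 < α) (hα1 : α < 1)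
    (hτ : |S.tau c e M (S.yStar δ b) j - S.tau c e M (fun h i => μ h (S.x i) + f (S.x i)) j| ≤
      r * √(S.zeta c e σ M j))
    (hρ : |S.rho c e σ δ M j / S.zeta c e σ M j - 1| ≤ r)
    (hl : (∃ m, S.pivot c e σ δ lam b M j m = 1 - α / 2) →
      S.pivot c e σ δ lam b M j l = 1 - α / 2)
    (hu : (∃ m, S.pivot c e σ δ lam b M j m = α / 2) → S.pivot c e σ δ lam b M j u = α / 2)
    (hθ : S.target c μ M j ∉ Set.Icc l u) :
    q ∈ tailEvent n c e (fun h x => μ h x + f x) σ lam M j (α / 2 + 4 * κ) ∨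
      q ∈ smallEvent n c e (fun h x => μ h x + f x) σ lam M j κ r := by
  have hζ : 0 < S.zeta c e σ M j := by
    rw [Sample.zeta_eq]; exact mul_pos (by positivity) (hreg.2 M j)
  have hstat : S.stat c e M j = S.condMean c e (fun h x => μ h x + f x) M j +
      √(S.zeta c e σ M j) * (S.unitCoef c e M j ⬝ᵥ q.2) := by
    subst hS
    exact modelSample_stat_eq_unitCoef hσ (hreg.2 M j)
  have hnhds := S.truncSet_mem_nhds c e lam M j hmem fun s hs k hk =>
    htight M s hs k (Sample.exists_polyA_mul_wt_ne_zero_of_slope hk)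
  have hρ0 : 0 ≤ S.rho c e σ δ M j := by
    have h1 := (abs_le.1 hρ).1
    have h2 : 0 ≤ S.rho c e σ δ M j / S.zeta c e σ M j := by linarith
    by_contra! h3
    exact absurd h2 (not_le.2 (div_neg_of_neg_of_pos h3 hζ))
  simp only [Sample.pivot, hstat] at hl hu
  rw [hstat] at hnhds hmem
  have hmean : |S.target c μ M j + S.tau c e M (S.yStar δ b) j -
      S.condMean c e (fun h x => μ h x + f x) M j| ≤ r * √(S.zeta c e σ M j) := by
    rw [S.condMean_eq_target_add_tau hc μ f M j, add_sub_add_left_eq_sub]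
    exact hτ
  have hvar : |((S.rho c e σ δ M j).toNNReal : ℝ) / √(S.zeta c e σ M j) ^ 2 - 1| ≤ r := by
    rw [Real.coe_toNNReal _ hρ0, Real.sq_sqrt hζ.le]
    exact hρ
  have key := pivot_extreme_of_not_mem_Icc (S.measurableSet_truncSet (c := c) he lam M j)
    (Real.sqrt_pos.2 hζ) hnhds hα0 hα1 hκ hr hmean hvar hl hu hθ
  subst hS
  rcases key with h | h
  · exact Or.inr ⟨hreg, hmem, h⟩
  · exact Or.inl ⟨hreg, hmem, h⟩

/-- The false coverage proportion is at most the average of any weights that are at least `1` on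
the indices of the intervals missing their targets. -/
lemma Sample.falseCoverage_le_sum (S : Sample n p H) {M : Finset (Fin p)} {L U : Fin p → ℝ}
    {w : M → ℝ} (hw0 : ∀ j, 0 ≤ w j)
    (hw : ∀ j : M, S.target c μ M j ∉ Set.Icc (L j) (U j) → 1 ≤ w j) :
    S.falseCoverage c μ M L U ≤ ∑ j, (M.card : ℝ)⁻¹ * w j := by
  classical
  rw [Sample.falseCoverage, ← Finset.mul_sum, div_eq_inv_mul]
  refine mul_le_mul_of_nonneg_left ?_ (by positivity)
  rw [Nat.card_eq_fintype_card, Fintype.card_subtype, Finset.card_filter, Nat.cast_sum]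
  refine Finset.sum_le_sum fun j _ => ?_
  split_ifs with h
  · rw [Nat.cast_zero]; exact hw0 j
  · rw [Nat.cast_one]; exact hw j h

lemma Sample.falseCoverage_nonneg (S : Sample n p H) (M : Finset (Fin p)) (L U : Fin p → ℝ) :
    0 ≤ S.falseCoverage c μ M L U := div_nonneg (Nat.cast_nonneg _) (Nat.cast_nonneg _)

lemma Sample.falseCoverage_le_one (S : Sample n p H) (M : Finset (Fin p)) (L U : Fin p → ℝ) :
    S.falseCoverage c μ M L U ≤ 1 := by
  refine (S.falseCoverage_le_sum (w := fun _ => 1) (fun _ => zero_le_one) fun _ _ => le_rfl).trans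
    ?_
  rw [Finset.sum_const, Finset.card_univ, Fintype.card_coe, nsmul_eq_mul, mul_one]
  exact mul_inv_le_one

end SelectedModel

section FalseCoverage
variable {p H : ℕ} {Ω : Type*} [MeasurableSpace Ω] {P : Measure Ω} [IsProbabilityMeasure P]
  {π : Measure (Fin H × EuclideanSpace ℝ (Fin p))} [IsProbabilityMeasure π]
  {c : Fin H → ℝ} {e φ μ : Fin H → EuclideanSpace ℝ (Fin p) → ℝ}
  {f : EuclideanSpace ℝ (Fin p) → ℝ} {σ : ℝ}
  {D : ℕ → Ω → Fin H × EuclideanSpace ℝ (Fin p)} {Z : ℕ → Ω → ℝ} {δ : ℕ → ℝ}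

lemma sum_sum_inv_card_le (p : ℕ) :
    ∑ M : Finset (Fin p), ∑ _j : M, (M.card : ℝ)⁻¹ ≤ Fintype.card (Finset (Fin p)) := by
  calc ∑ M : Finset (Fin p), ∑ _j : M, (M.card : ℝ)⁻¹ ≤ ∑ _M : Finset (Fin p), (1 : ℝ) := by
        refine Finset.sum_le_sum fun M _ => ?_
        rw [Finset.sum_const, Finset.card_univ, Fintype.card_coe, nsmul_eq_mul]
        exact mul_inv_le_one
    _ = _ := by simp

omit [IsProbabilityMeasure π] in
/-- Each sample selects one model only, so the average over its indices of the probabilities of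
selection is at most one. -/
lemma IsObservation.sum_measure_selectEvent_le (hob : IsObservation P π D Z)
    (he : ∀ h, Measurable (e h)) (hφ : ∀ h, Measurable (φ h)) (hσ : 0 < σ) {lam : ℝ}
    (hlam : 0 < lam) {n : ℕ} {b : Ω → Fin p → ℝ}
    (htight : ∀ᵐ ω ∂P, (obsSample φ σ D Z n ω).NoTightConstraint c e lam)
    (hb : ∀ᵐ ω ∂P, IsMinOn (lassoObj (obsSample φ σ D Z n ω).design
      ((obsSample φ σ D Z n ω).weight c e *ᵥ (obsSample φ σ D Z n ω).y) lam) Set.univ (b ω)) :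
    ∑ M : Finset (Fin p), ∑ j : M, (M.card : ℝ)⁻¹ *
      P.real ((fun ω => (fun i : Fin n => D i ω, fun i : Fin n => Z i ω)) ⁻¹'
        selectEvent n c e φ σ lam M j) ≤ 1 := by
  classical
  set V := fun ω => (fun i : Fin n => D i ω, fun i : Fin n => Z i ω) with hV
  have hVm : Measurable V := hob.measurable_vector n
  have hms : ∀ (M : Finset (Fin p)) (j : M),
      MeasurableSet (V ⁻¹' selectEvent n c e φ σ lam M j) := fun M j =>
    hVm (measurableSet_selectEvent he hφ lam M j)
  have hint : ∀ (M : Finset (Fin p)) (j : M), Integrable (fun ω => (M.card : ℝ)⁻¹ *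
      (V ⁻¹' selectEvent n c e φ σ lam M j).indicator (1 : Ω → ℝ) ω) P := fun M j =>
    ((integrable_const (1 : ℝ)).indicator (hms M j)).const_mul _
  have h1 : ∑ M : Finset (Fin p), ∑ j : M, (M.card : ℝ)⁻¹ *
      P.real (V ⁻¹' selectEvent n c e φ σ lam M j) =
      ∫ ω, ∑ M : Finset (Fin p), ∑ j : M, (M.card : ℝ)⁻¹ *
        (V ⁻¹' selectEvent n c e φ σ lam M j).indicator (1 : Ω → ℝ) ω ∂P := by
    rw [integral_finsetSum _ fun M _ => integrable_finsetSum _ fun j _ => hint M j]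
    refine Finset.sum_congr rfl fun M _ => ?_
    rw [integral_finsetSum _ fun j _ => hint M j]
    refine Finset.sum_congr rfl fun j _ => ?_
    rw [integral_const_mul, integral_indicator_one (hms M j)]
  rw [h1]
  calc _ ≤ ∫ _, (1 : ℝ) ∂P := by
        refine integral_mono_ae (integrable_finsetSum _ fun M _ =>
          integrable_finsetSum _ fun j _ => hint M j) (integrable_const _) ?_
        filter_upwards [htight, hb] with ω h2 h3
        have h4 : ∀ M : Finset (Fin p), M ≠ supportModel (b ω) → ∀ j : M,
            (V ⁻¹' selectEvent n c e φ σ lam M j).indicator (1 : Ω → ℝ) ω = 0 := by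
          intro M hM j
          refine Set.indicator_of_notMem (fun h5 => hM ?_) _
          have hreg : (obsSample φ σ D Z n ω).Regular c e := h5.1
          exact (Sample.supportModel_eq_of_stat_mem hlam hreg h2 h3
            ((mem_selectEvent_iff hσ h5.1).1 h5)).symm
        rw [Finset.sum_eq_single (supportModel (b ω))
          (fun M _ hM => Finset.sum_eq_zero fun j _ => by rw [h4 M hM j, mul_zero]) (by simp)]
        calc ∑ j : supportModel (b ω), ((supportModel (b ω)).card : ℝ)⁻¹ * _ ≤
            ∑ _j : supportModel (b ω), ((supportModel (b ω)).card : ℝ)⁻¹ := by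
              refine Finset.sum_le_sum fun j _ => mul_le_of_le_one_right (by positivity) ?_
              exact Set.indicator_le_self' (fun _ _ => zero_le_one) _
          _ ≤ 1 := by
              rw [Finset.sum_const, Finset.card_univ, Fintype.card_coe, nsmul_eq_mul]
              exact mul_inv_le_one
    _ = 1 := by simp

/-- The false coverage rate is asymptotically at most `α`. -/
theorem IsIPWModel.eventually_falseCoverage_le
    (hM : IsIPWModel P π e (fun h x => μ h x + f x) D Z δ) (he : ∀ h, Measurable (e h))
    (hc : ∑ h, c h = 0) {h₀ : Fin H} (hc₀ : c h₀ ≠ 0) (hσ : 0 < σ) {lam : ℕ → ℝ}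
    (hlam : ∀ n, 0 < lam n) {bhat : ℕ → Ω → Fin p → ℝ}
    (hbhat : ∀ n, ∀ᵐ ω ∂P, IsMinOn ((obsSample (fun h x => μ h x + f x) σ D Z n ω).lassoLoss c e
      (lam n)) Set.univ (bhat n ω))
    {bLS : ℕ → Ω → Fin H → Fin p → ℝ}
    (hbLS : ∀ n, ∀ᵐ ω ∂P, ∀ h, IsMinOn
      ((obsSample (fun h x => μ h x + f x) σ D Z n ω).armLoss h) Set.univ (bLS n ω h))
    {α : ℝ} (hα0 : 0 < α) (hα1 : α < 1) {L U : ℕ → Ω → Fin p → ℝ}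
    (hL : ∀ n, ∀ᵐ ω ∂P, ∀ j : supportModel (bhat n ω),
      (∃ l, (obsSample (fun h x => μ h x + f x) σ D Z n ω).pivot c e σ (δ n) (lam n) (bLS n ω)
        (supportModel (bhat n ω)) j l = 1 - α / 2) →
      (obsSample (fun h x => μ h x + f x) σ D Z n ω).pivot c e σ (δ n) (lam n) (bLS n ω)
        (supportModel (bhat n ω)) j (L n ω j) = 1 - α / 2)
    (hU : ∀ n, ∀ᵐ ω ∂P, ∀ j : supportModel (bhat n ω),
      (∃ l, (obsSample (fun h x => μ h x + f x) σ D Z n ω).pivot c e σ (δ n) (lam n) (bLS n ω)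
        (supportModel (bhat n ω)) j l = α / 2) →
      (obsSample (fun h x => μ h x + f x) σ D Z n ω).pivot c e σ (δ n) (lam n) (bLS n ω)
        (supportModel (bhat n ω)) j (U n ω j) = α / 2) {η : ℝ} (hη : 0 < η) :
    ∀ᶠ n in atTop, ∫ ω in {ω | 0 < (supportModel (bhat n ω)).card},
      (obsSample (fun h x => μ h x + f x) σ D Z n ω).falseCoverage c μ
        (supportModel (bhat n ω)) (L n ω) (U n ω) ∂P ≤ α + η := by
  classical
  set φ : Fin H → EuclideanSpace ℝ (Fin p) → ℝ := fun h x => μ h x + f x with hφdef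
  have hφ : ∀ h, Measurable (φ h) := fun h => by
    obtain ⟨C, hC⟩ := hM.lipschitz h
    exact hC.continuous.measurable
  set N : ℝ := (Fintype.card (Finset (Fin p)) : ℝ) with hN
  have hN0 : 0 < N := by rw [hN]; exact_mod_cast Fintype.card_pos
  set G := perturbMeasure.real Set.univ with hG
  have hG0 : 0 ≤ G := measureReal_nonneg
  -- `κ` controls the error of the pivot, and `r` the relative errors of its parameters
  set κ := min (1 / 2) (η / 32) with hκdef
  have hκ0 : 0 < κ := by positivity
  have hκη : 8 * κ ≤ η / 4 := by linarith [min_le_right (1 / 2) (η / 32)]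
  set r := min (1 / 2) (η * κ / (4 * N * (G + 1))) with hrdef
  have hr0 : 0 < r := by positivity
  have hrG : N * (r / κ * G) ≤ η / 4 := by
    have h1 : r / κ ≤ η / (4 * N * (G + 1)) := by
      rw [div_le_iff₀ hκ0]
      exact (min_le_right _ _).trans (le_of_eq (by ring))
    calc N * (r / κ * G) ≤ N * (η / (4 * N * (G + 1)) * (G + 1)) := by
          gcongr; linarith
      _ = η / 4 := by field_simp
  have hplug := hM.withHighProb_plugIn (c := c) hc₀ hσ hbLS hr0
  have hev := ENNReal.tendsto_nhds_zero.1 hplug (ENNReal.ofReal (η / 4)) (by simpa using hη)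
  filter_upwards [hev] with n hn
  have hob := hM.observation
  have hind : ∀ s : Set Ω, MeasurableSet s → Integrable (s.indicator (1 : Ω → ℝ)) P :=
    fun s hs => (integrable_const (1 : ℝ)).indicator hs
  set V := fun ω => (fun i : Fin n => D i ω, fun i : Fin n => Z i ω) with hV
  have hVm : Measurable V := hob.measurable_vector n
  have hlaw : P.map V = (Measure.pi fun _ => π).prod (noiseLaw n) := hob.law_vector n
  have htight : ∀ᵐ ω ∂P, (obsSample φ σ D Z n ω).NoTightConstraint c e (lam n) := by
    refine ae_of_ae_map (f := V) hVm.aemeasurable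
      (p := fun q => (modelSample φ σ q.1 q.2).NoTightConstraint c e (lam n)) ?_
    rw [hlaw]
    exact ae_noTightConstraint he hφ π hσ (lam n)
  have hlasso : ∀ᵐ ω ∂P, IsMinOn (lassoObj (obsSample φ σ D Z n ω).design
      ((obsSample φ σ D Z n ω).weight c e *ᵥ (obsSample φ σ D Z n ω).y) (lam n)) Set.univ
        (bhat n ω) := hbhat n
  have hsel := hob.sum_measure_selectEvent_le he hφ hσ (hlam n) htight hlasso
  rw [← hV] at hsel
  -- the event that the plug-in parameters are inaccurate need not be measurable
  set bad : Set Ω := toMeasurable P {ω | ¬((obsSample φ σ D Z n ω).FullRank ∧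
      ∀ (M : Finset (Fin p)) (j : M), 0 < (obsSample φ σ D Z n ω).etaNormSq c e M j ∧
      |(obsSample φ σ D Z n ω).tau c e M ((obsSample φ σ D Z n ω).yStar (δ n) (bLS n ω)) j -
        (obsSample φ σ D Z n ω).tau c e M (fun h i => φ h ((obsSample φ σ D Z n ω).x i)) j| ≤
        r * √((obsSample φ σ D Z n ω).zeta c e σ M j) ∧
      |(obsSample φ σ D Z n ω).rho c e σ (δ n) M j /
        (obsSample φ σ D Z n ω).zeta c e σ M j - 1| ≤ r)} with hbad
  have hbadm : MeasurableSet bad := measurableSet_toMeasurable _ _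
  have hbadP : P.real bad ≤ η / 4 := by
    rw [hbad, measureReal_def, measure_toMeasurable]
    exact ENNReal.toReal_le_of_le_ofReal (by positivity) hn
  set a := α / 2 + 4 * κ with ha
  have ha0 : 0 ≤ a := by positivity
  set T : ∀ M : Finset (Fin p), M → Set Ω := fun M j =>
    V ⁻¹' tailEvent n c e φ σ (lam n) M j a with hT
  set Sm : ∀ M : Finset (Fin p), M → Set Ω := fun M j =>
    V ⁻¹' smallEvent n c e φ σ (lam n) M j κ r with hSm
  have hTm : ∀ M j, MeasurableSet (T M j) := fun M j =>
    hVm (measurableSet_tailEvent he hφ (lam n) M j a)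
  have hSmm : ∀ M j, MeasurableSet (Sm M j) := fun M j =>
    hVm (measurableSet_smallEvent he hφ (lam n) M j κ r)
  have hTP : ∀ M j, P.real (T M j) ≤
      2 * a * P.real (V ⁻¹' selectEvent n c e φ σ (lam n) M j) := by
    intro M j
    rw [hT, ← map_measureReal_apply hVm (measurableSet_tailEvent he hφ (lam n) M j a),
      ← map_measureReal_apply hVm (measurableSet_selectEvent he hφ (lam n) M j), hlaw,
      measureReal_def, measureReal_def]
    have h1 := measure_tailEvent_le (n := n) (c := c) (σ := σ) he hφ π (lam n) M j a
    refine (ENNReal.toReal_mono (by finiteness) h1).trans (le_of_eq ?_)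
    rw [ENNReal.toReal_mul, ENNReal.toReal_mul, ENNReal.toReal_ofReal ha0]
    norm_num
  have hSmP : ∀ M j, P.real (Sm M j) ≤ r / κ * G := by
    intro M j
    rw [hSm, ← map_measureReal_apply hVm (measurableSet_smallEvent he hφ (lam n) M j κ r), hlaw]
    exact ENNReal.toReal_le_of_le_ofReal (by positivity)
      (measure_smallEvent_le (n := n) (c := c) (σ := σ) he hφ π (lam n) M j hκ0 hr0.le)
  set w : ∀ M : Finset (Fin p), M → Ω → ℝ := fun M j ω =>
    (T M j).indicator (1 : Ω → ℝ) ω + (Sm M j).indicator (1 : Ω → ℝ) ω with hw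
  have hw0 : ∀ M j ω, 0 ≤ w M j ω := fun M j ω =>
    add_nonneg (Set.indicator_nonneg (fun _ _ => zero_le_one) _)
      (Set.indicator_nonneg (fun _ _ => zero_le_one) _)
  have hwint : ∀ M j, Integrable (w M j) P := fun M j =>
    (hind _ (hTm M j)).add
      (hind _ (hSmm M j))
  have hwI : ∀ M j, ∫ ω, w M j ω ∂P = P.real (T M j) + P.real (Sm M j) := fun M j => by
    rw [hw, integral_add (hind _ (hTm M j))
      (hind _ (hSmm M j)), integral_indicator_one (hTm M j),
      integral_indicator_one (hSmm M j)]
  have hRint : Integrable (fun ω => bad.indicator (1 : Ω → ℝ) ω +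
      ∑ M : Finset (Fin p), ∑ j : M, (M.card : ℝ)⁻¹ * w M j ω) P :=
    (hind _ hbadm).add (integrable_finsetSum _ fun M _ =>
      integrable_finsetSum _ fun j _ => (hwint M j).const_mul _)
  have hR0 : ∀ ω, 0 ≤ bad.indicator (1 : Ω → ℝ) ω +
      ∑ M : Finset (Fin p), ∑ j : M, (M.card : ℝ)⁻¹ * w M j ω := fun ω =>
    add_nonneg (Set.indicator_nonneg (fun _ _ => zero_le_one) _)
      (Finset.sum_nonneg fun M _ => Finset.sum_nonneg fun j _ =>
        mul_nonneg (by positivity) (hw0 M j ω))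
  -- the false coverage proportion is dominated by the exceptional events
  have hle : ∀ᵐ ω ∂P, (obsSample φ σ D Z n ω).falseCoverage c μ (supportModel (bhat n ω))
      (L n ω) (U n ω) ≤ bad.indicator (1 : Ω → ℝ) ω +
        ∑ M : Finset (Fin p), ∑ j : M, (M.card : ℝ)⁻¹ * w M j ω := by
    filter_upwards [htight, hlasso, hL n, hU n] with ω h1 h2 h3 h4
    by_cases hω : ω ∈ bad
    · refine ((obsSample φ σ D Z n ω).falseCoverage_le_one _ _ _).trans ?_
      rw [Set.indicator_of_mem hω, Pi.one_apply]
      exact le_add_of_nonneg_right (Finset.sum_nonneg fun M _ => Finset.sum_nonneg fun j _ =>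
        mul_nonneg (by positivity) (hw0 M j ω))
    · rw [Set.indicator_of_notMem hω, zero_add]
      obtain ⟨hrank, hgood⟩ := not_not.1 fun h5 => hω (subset_toMeasurable P _ h5)
      have hreg : (obsSample φ σ D Z n ω).Regular c e :=
        ⟨(hrank.isUnit_det _).ne_zero, fun M j => (hgood M j).1⟩
      refine le_trans ?_ (Finset.single_le_sum
        (f := fun M : Finset (Fin p) => ∑ j : M, (M.card : ℝ)⁻¹ * w M j ω)
        (fun M _ => Finset.sum_nonneg fun j _ => mul_nonneg (by positivity) (hw0 M j ω))
        (Finset.mem_univ (supportModel (bhat n ω))))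
      refine Sample.falseCoverage_le_sum _ (hw0 _ · ω) fun j hj => ?_
      obtain ⟨s, hs, h5⟩ := (obsSample φ σ D Z n ω).polyA_le_of_isMinOn hrank (hlam n) _ h2
      have hmem := ((obsSample φ σ D Z n ω).stat_mem_truncSet_iff c e (lam n)
        (supportModel (bhat n ω)) j).2 ⟨s, hs, h5⟩
      obtain ⟨-, h6, h7⟩ := hgood (supportModel (bhat n ω)) j
      have key := mem_tailEvent_or_mem_smallEvent (q := V ω) hc he hσ rfl hreg h1 hmem
        (min_le_left _ _ : r ≤ 1 / 2) (min_le_left _ _ : κ ≤ 1 / 2) hα0 hα1 h6 h7 (h3 j) (h4 j) hj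
      rcases key with h8 | h8
      · have h9 : ω ∈ T (supportModel (bhat n ω)) j := h8
        simp only [hw, Set.indicator_of_mem h9, Pi.one_apply]
        exact le_add_of_nonneg_right (Set.indicator_nonneg (fun _ _ => zero_le_one) _)
      · have h9 : ω ∈ Sm (supportModel (bhat n ω)) j := h8
        simp only [hw, Set.indicator_of_mem h9, Pi.one_apply]
        exact le_add_of_nonneg_left (Set.indicator_nonneg (fun _ _ => zero_le_one) _)
  calc _ ≤ ∫ ω in {ω | 0 < (supportModel (bhat n ω)).card}, (bad.indicator (1 : Ω → ℝ) ω +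
        ∑ M : Finset (Fin p), ∑ j : M, (M.card : ℝ)⁻¹ * w M j ω) ∂P :=
        integral_mono_of_nonneg (Eventually.of_forall fun ω => Sample.falseCoverage_nonneg _ _ _ _)
          hRint.integrableOn (ae_restrict_of_ae hle)
    _ ≤ ∫ ω, (bad.indicator (1 : Ω → ℝ) ω +
        ∑ M : Finset (Fin p), ∑ j : M, (M.card : ℝ)⁻¹ * w M j ω) ∂P :=
        setIntegral_le_integral hRint (Eventually.of_forall hR0)
    _ = P.real bad + ∑ M : Finset (Fin p), ∑ j : M, (M.card : ℝ)⁻¹ *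
        (P.real (T M j) + P.real (Sm M j)) := by
        rw [integral_add (hind _ hbadm) (integrable_finsetSum _
          fun M _ => integrable_finsetSum _ fun j _ => (hwint M j).const_mul _),
          integral_indicator_one hbadm, integral_finsetSum _ fun M _ =>
          integrable_finsetSum _ fun j _ => (hwint M j).const_mul _]
        congr 1
        refine Finset.sum_congr rfl fun M _ => ?_
        rw [integral_finsetSum _ fun j _ => (hwint M j).const_mul _]
        refine Finset.sum_congr rfl fun j _ => ?_
        rw [integral_const_mul, hwI]
    _ ≤ η / 4 + ∑ M : Finset (Fin p), ∑ j : M, (M.card : ℝ)⁻¹ *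
        (2 * a * P.real (V ⁻¹' selectEvent n c e φ σ (lam n) M j) + r / κ * G) := by
        gcongr with M _ j _
        · exact hTP M j
        · exact hSmP M j
    _ = η / 4 + 2 * a * ∑ M : Finset (Fin p), ∑ j : M, (M.card : ℝ)⁻¹ *
        P.real (V ⁻¹' selectEvent n c e φ σ (lam n) M j) +
        (∑ M : Finset (Fin p), ∑ _j : M, (M.card : ℝ)⁻¹) * (r / κ * G) := by
        rw [add_assoc]
        congr 1
        simp only [Finset.mul_sum, Finset.sum_mul, ← Finset.sum_add_distrib]
        refine Finset.sum_congr rfl fun M _ => Finset.sum_congr rfl fun j _ => ?_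
        ring
    _ ≤ η / 4 + 2 * a * 1 + N * (r / κ * G) := by
        gcongr
        exact sum_sum_inv_card_le p
    _ ≤ α + η := by linarith

end FalseCoverage

/-! ### The causal model -/

section CausalModel
variable {n p H : ℕ}

/-- If all contrast coefficients vanish, so does the weighted response, and nothing is selected. -/
lemma Sample.supportModel_eq_empty_of_contrast_eq_zero (S : Sample n p H) {c : Fin H → ℝ}
    (hc : ∀ h, c h = 0) (e : Fin H → EuclideanSpace ℝ (Fin p) → ℝ) {lam : ℝ} (hlam : 0 < lam)
    {b : Fin p → ℝ} (hb : IsMinOn (S.lassoLoss c e lam) Set.univ b) : supportModel b = ∅ := by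
  have hW : S.weight c e *ᵥ S.y = 0 := by
    rw [S.weight_eq]
    funext i
    rw [Matrix.mulVec_diagonal, wt, hc, zero_div, zero_mul, Pi.zero_apply]
  have h1 : S.lassoLoss c e lam b ≤ S.lassoLoss c e lam 0 := hb (Set.mem_univ _)
  have h2 : S.lassoLoss c e lam 0 = 0 := by simp [Sample.lassoLoss, hW]
  have h3 : lam * ∑ k, |b k| ≤ S.lassoLoss c e lam b :=
    le_add_of_nonneg_left (mul_nonneg (by norm_num) (Finset.sum_nonneg fun i _ => sq_nonneg _))
  have h4 : ∑ k, |b k| ≤ 0 := by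
    by_contra! h5
    have := mul_pos hlam h5
    linarith
  refine Finset.filter_eq_empty_iff.2 fun k _ => not_not.2 ?_
  have h5 : |b k| ≤ ∑ k, |b k| :=
    Finset.single_le_sum (f := fun k => |b k|) (fun _ _ => abs_nonneg _) (Finset.mem_univ k)
  exact abs_nonpos_iff.1 (h5.trans h4)

variable {Ω : Type*} [MeasurableSpace Ω] {P : Measure Ω}

lemma not_ae_sum_eq_zero_of_posDef {X : Ω → EuclideanSpace ℝ (Fin p)}
    (hint : ∀ k l, Integrable (fun ω => X ω k * X ω l) P)
    (hgram : (Matrix.of fun k l : Fin p => ∫ ω, X ω k * X ω l ∂P).PosDef) {v : Fin p → ℝ}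
    (hv : v ≠ 0) : ¬ ∀ᵐ ω ∂P, ∑ k, v k * X ω k = 0 := by
  intro h0
  have h1 := hgram.dotProduct_mulVec_pos hv
  refine h1.ne' ?_
  have h2 : star v ⬝ᵥ ((Matrix.of fun k l : Fin p => ∫ ω, X ω k * X ω l ∂P) *ᵥ v) =
      ∫ ω, ∑ k, v k * ∑ l, v l * (X ω k * X ω l) ∂P := by
    rw [integral_finsetSum _ fun k _ => (integrable_finsetSum _ fun l _ =>
      (hint k l).const_mul _).const_mul _]
    refine Finset.sum_congr rfl fun k _ => ?_
    rw [integral_const_mul, integral_finsetSum _ fun l _ => (hint k l).const_mul _]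
    congr 1
    rw [Matrix.mulVec, dotProduct]
    refine Finset.sum_congr rfl fun l _ => ?_
    rw [integral_const_mul, Matrix.of_apply, mul_comm]
  rw [h2]
  refine integral_eq_zero_of_ae ?_
  filter_upwards [h0] with ω hω
  rw [Pi.zero_apply]
  refine Finset.sum_eq_zero fun k _ => ?_
  rw [show ∑ l, v l * (X ω k * X ω l) = X ω k * ∑ l, v l * X ω l by
    rw [Finset.mul_sum]; exact Finset.sum_congr rfl fun l _ => by ring, hω, mul_zero, mul_zero]

variable [IsProbabilityMeasure P]

/-- The causal model provides independent observations with Gaussian noise: by ignorability, the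
noise of the observed outcome is independent of treatment and confounders together. -/
lemma isIPWModel_of_ignorable {μ : Fin H → EuclideanSpace ℝ (Fin p) → ℝ}
    (hμ : ∀ h, ∃ C : ℝ≥0, LipschitzWith C (μ h)) {f : EuclideanSpace ℝ (Fin p) → ℝ}
    (hf : ∃ C : ℝ≥0, LipschitzWith C f) {e : Fin H → EuclideanSpace ℝ (Fin p) → ℝ}
    (he : ∀ h, Measurable (e h)) {σ : ℝ} (hσ : 0 < σ)
    {A : ℕ → Ω → Fin H} {X : ℕ → Ω → EuclideanSpace ℝ (Fin p)} {ε : ℕ → Fin H → Ω → ℝ}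
    (hA : ∀ i, Measurable (A i)) (hX : ∀ i, Measurable (X i)) (hε : ∀ i h, Measurable (ε i h))
    (hindep : iIndepFun (fun i ω => (A i ω, X i ω, fun h => ε i h ω)) P)
    (hident : ∀ i, IdentDistrib (fun ω => (A i ω, X i ω, fun h => ε i h ω))
      (fun ω => (A 0 ω, X 0 ω, fun h => ε 0 h ω)) P P)
    (hgauss : ∀ i h, P.map (ε i h) = gaussianReal 0 (σ ^ 2).toNNReal)
    (hεX : ∀ i h, IndepFun (ε i h) (X i) P)
    (hign : ∀ i h, CondIndepGiven P (potential μ f (X i) (ε i) h) (assigned (A i) h) (X i))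
    (hprop : ∀ i h, P⟦A i ⁻¹' {h} | MeasurableSpace.comap (X i) inferInstance⟧
      =ᵐ[P] fun ω => e h (X i ω))
    (hpos : ∀ i h, ∀ᵐ ω ∂P, 0 < e h (X i ω) ∧ e h (X i ω) < 1)
    (hmom : ∀ h, Integrable (fun ω => (1 + ‖X 0 ω‖ ^ 4) / e h (X 0 ω)) P)
    (hgram : (Matrix.of fun k l : Fin p => ∫ ω, X 0 ω k * X 0 ω l ∂P).PosDef)
    {δ : ℕ → ℝ} (hδ : Tendsto δ atTop (𝓝 0))
    (hnbhd : ∀ (h : Fin H) (K : ℕ), Tendsto (fun n => P {ω | ∃ hi : 0 < n,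
      ((sampleOf μ f A X ε n ω).nbhd (δ n) h ⟨0, hi⟩).card ≤ K}) atTop (𝓝 0)) :
    IsIPWModel P (P.map fun ω => (A 0 ω, X 0 ω)) e (fun h x => μ h x + f x)
      (fun i ω => (A i ω, X i ω)) (fun i ω => ε i (A i ω) ω / σ) δ := by
  have hlip : ∀ h, ∃ C : ℝ≥0, LipschitzWith C (fun x => μ h x + f x) := fun h => by
    obtain ⟨C, hC⟩ := hμ h
    obtain ⟨C', hC'⟩ := hf
    exact ⟨C + C', hC.add hC'⟩
  have hAX : ∀ i, Measurable fun ω => (A i ω, X i ω) := fun i => (hA i).prodMk (hX i)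
  have hπ : ∀ i, P.map (fun ω => (A i ω, X i ω)) = P.map fun ω => (A 0 ω, X 0 ω) := fun i =>
    ((hident i).comp (u := fun q : Fin H × EuclideanSpace ℝ (Fin p) × (Fin H → ℝ) =>
      (q.1, q.2.1)) (by fun_prop)).map_eq
  have hposm : ∀ h, MeasurableSet {z : Fin H × EuclideanSpace ℝ (Fin p) |
      0 < e h z.2 ∧ e h z.2 < 1} := fun h =>
    (measurableSet_lt measurable_const ((he h).comp measurable_snd)).inter
      (measurableSet_lt ((he h).comp measurable_snd) measurable_const)
  have hmomm : ∀ h, Measurable fun z : Fin H × EuclideanSpace ℝ (Fin p) =>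
      (1 + ‖z.2‖ ^ 4) / e h z.2 := fun h =>
    Measurable.div (by fun_prop) ((he h).comp measurable_snd)
  -- positivity makes the moments of the confounders finite
  have hint : ∀ k l, Integrable (fun ω => X 0 ω k * X 0 ω l) P := fun k l => by
    obtain hH | ⟨⟨h⟩⟩ := isEmpty_or_nonempty (Fin H)
    · have : IsEmpty Ω := ⟨fun ω => hH.false (A 0 ω)⟩
      exact Integrable.of_bound (Measurable.aestronglyMeasurable (by
        have := hX 0; fun_prop)) 0 (Eventually.of_forall fun ω => isEmptyElim ω)
    · refine (hmom h).mono' (Measurable.aestronglyMeasurable (by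
        have := hX 0; fun_prop)) ?_
      filter_upwards [hpos 0 h] with ω hω
      have h1 := abs_coord_mul_le k l (X 0 ω)
      rw [one_mul] at h1
      rw [Real.norm_eq_abs, le_div_iff₀ hω.1]
      exact (mul_le_of_le_one_right (abs_nonneg _) hω.2.le).trans h1
  refine ⟨isObservation_of_iIndepFun hA hX hε hindep fun i => ?_, fun h => ⟨he h, ?_, ?_⟩,
    fun h => ?_, hlip, fun v hv h0 => ?_, hδ, fun h K => hnbhd h K⟩
  · rw [← hπ i]
    exact map_obs_eq_prod (hA i) (hX i) (fun h => (hlip h).choose_spec.continuous.measurable)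
      (hε i) (hign i) he (hprop i) (hpos i) (hεX i) hσ (hgauss i)
  · rw [ae_map_iff (hAX 0).aemeasurable (hposm h)]
    exact hpos 0 h
  · intro B hB
    have hBm : MeasurableSet (Prod.snd ⁻¹' B : Set (Fin H × EuclideanSpace ℝ (Fin p))) :=
      measurable_snd hB
    rw [Measure.map_apply (hAX 0) ((measurableSet_fst_eq h).inter hBm),
      setLIntegral_map hBm (f := fun z => ENNReal.ofReal (e h z.2))
        ((he h).comp measurable_snd).ennreal_ofReal (hAX 0)]
    exact measure_treat_inter (hA 0) (hX 0) h (he h) (hprop 0 h) (hpos 0 h) hB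
  · rw [integrable_map_measure (hmomm h).aestronglyMeasurable (hAX 0).aemeasurable]
    exact hmom h
  · refine not_ae_sum_eq_zero_of_posDef hint hgram hv ?_
    rwa [ae_map_iff (hAX 0).aemeasurable (measurableSet_eq_fun (by fun_prop) measurable_const)]
      at h0

end CausalModel

end IPW

end

theorem theorem3 {Ω : Type*} [MeasurableSpace Ω] (P : Measure Ω) [IsProbabilityMeasure P]
    {p H : ℕ}
    -- contrast, outcome model, propensity scores, noise level
    (c : Fin H → ℝ) (hc : ∑ h, c h = 0)
    (μ : Fin H → EuclideanSpace ℝ (Fin p) → ℝ) (hμ : ∀ h, ∃ C : ℝ≥0, LipschitzWith C (μ h))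
    (f : EuclideanSpace ℝ (Fin p) → ℝ) (hf : ∃ C : ℝ≥0, LipschitzWith C f)
    (e : Fin H → EuclideanSpace ℝ (Fin p) → ℝ) (he : ∀ h, Measurable (e h))
    (σ : ℝ) (hσ : 0 < σ)
    -- treatments, confounders and errors of an i.i.d. sequence of individuals
    (A : ℕ → Ω → Fin H) (X : ℕ → Ω → EuclideanSpace ℝ (Fin p)) (ε : ℕ → Fin H → Ω → ℝ)
    (hA : ∀ i, Measurable (A i)) (hX : ∀ i, Measurable (X i))
    (hε : ∀ i h, Measurable (ε i h))
    (hindep : iIndepFun (fun i ω => (A i ω, X i ω, fun h => ε i h ω)) P)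
    (hident : ∀ i, IdentDistrib (fun ω => (A i ω, X i ω, fun h => ε i h ω))
      (fun ω => (A 0 ω, X 0 ω, fun h => ε 0 h ω)) P P)
    -- Gaussian errors independent of the confounders
    (hgauss : ∀ i h, P.map (ε i h) = gaussianReal 0 (σ ^ 2).toNNReal)
    (hεX : ∀ i h, IndepFun (ε i h) (X i) P)
    -- weak ignorability, propensity scores and positivity
    (hign : ∀ i h, IPW.CondIndepGiven P (IPW.potential μ f (X i) (ε i) h)
      (IPW.assigned (A i) h) (X i))
    (hprop : ∀ i h, P⟦A i ⁻¹' {h} | MeasurableSpace.comap (X i) inferInstance⟧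
      =ᵐ[P] fun ω => e h (X i ω))
    (hpos : ∀ i h, ∀ᵐ ω ∂P, 0 < e h (X i ω) ∧ e h (X i ω) < 1)
    -- moments and non-degeneracy of the design
    (hmom : ∀ h, Integrable (fun ω => (1 + ‖X 0 ω‖ ^ 4) / e h (X 0 ω)) P)
    (hgram : (Matrix.of fun k l : Fin p => ∫ ω, X 0 ω k * X 0 ω l ∂P).PosDef)
    -- the radii of the neighbourhoods
    (δ : ℕ → ℝ) (hδ : Tendsto δ atTop (𝓝 0))
    (hnbhd : ∀ (i : ℕ) (h : Fin H) (K : ℕ),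
      Tendsto (fun n => P {ω | ∃ hi : i < n,
        ((IPW.sampleOf μ f A X ε n ω).nbhd (δ n) h ⟨i, hi⟩).card ≤ K}) atTop (𝓝 0))
    -- the Lasso estimator and the least-squares estimator of each treatment
    (lam : ℕ → ℝ) (hlam : ∀ n, 0 < lam n)
    (bhat : ℕ → Ω → Fin p → ℝ) (hbhat_meas : ∀ n, AEMeasurable (bhat n) P)
    (hbhat : ∀ n, ∀ᵐ ω ∂P,
      IsMinOn ((IPW.sampleOf μ f A X ε n ω).lassoLoss c e (lam n)) Set.univ (bhat n ω))
    (bLS : ℕ → Ω → Fin H → Fin p → ℝ) (hbLS_meas : ∀ n, AEMeasurable (bLS n) P)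
    (hbLS : ∀ n, ∀ᵐ ω ∂P, ∀ h,
      IsMinOn ((IPW.sampleOf μ f A X ε n ω).armLoss h) Set.univ (bLS n ω h))
    -- the confidence limits, which solve the pivot equations wherever these have a solution
    (α : ℝ) (hα0 : 0 < α) (hα1 : α < 1)
    (L U : ℕ → Ω → Fin p → ℝ)
    (hL_meas : ∀ n, AEMeasurable (L n) P) (hU_meas : ∀ n, AEMeasurable (U n) P)
    (hL : ∀ n, ∀ᵐ ω ∂P, ∀ j : IPW.supportModel (bhat n ω),
      (∃ l, (IPW.sampleOf μ f A X ε n ω).pivot c e σ (δ n) (lam n) (bLS n ω)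
        (IPW.supportModel (bhat n ω)) j l = 1 - α / 2) →
      (IPW.sampleOf μ f A X ε n ω).pivot c e σ (δ n) (lam n) (bLS n ω)
        (IPW.supportModel (bhat n ω)) j (L n ω j) = 1 - α / 2)
    (hU : ∀ n, ∀ᵐ ω ∂P, ∀ j : IPW.supportModel (bhat n ω),
      (∃ l, (IPW.sampleOf μ f A X ε n ω).pivot c e σ (δ n) (lam n) (bLS n ω)
        (IPW.supportModel (bhat n ω)) j l = α / 2) →
      (IPW.sampleOf μ f A X ε n ω).pivot c e σ (δ n) (lam n) (bLS n ω)
        (IPW.supportModel (bhat n ω)) j (U n ω j) = α / 2) :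
    -- the false coverage rate is asymptotically at most `α`
    ∀ η : ℝ, 0 < η → ∀ᶠ n in atTop,
      ∫ ω in {ω | 0 < (IPW.supportModel (bhat n ω)).card},
        (IPW.sampleOf μ f A X ε n ω).falseCoverage c μ
          (IPW.supportModel (bhat n ω)) (L n ω) (U n ω) ∂P ≤ α + η := by
  by_cases hc₀ : ∀ h, c h = 0
  · -- without a contrast the Lasso selects the empty model
    refine fun η hη => Eventually.of_forall fun n => ?_
    have h0 : P {ω | 0 < (IPW.supportModel (bhat n ω)).card} = 0 := by
      rw [measure_eq_zero_iff_ae_notMem]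
      filter_upwards [hbhat n] with ω hω
      simp [(IPW.sampleOf μ f A X ε n ω).supportModel_eq_empty_of_contrast_eq_zero hc₀ e
        (hlam n) hω]
    rw [setIntegral_measure_zero _ h0]
    positivity
  · obtain ⟨h₀, hh₀⟩ := not_forall.1 hc₀
    have hM := IPW.isIPWModel_of_ignorable hμ hf he hσ hA hX hε hindep hident hgauss hεX hign
      hprop hpos hmom hgram hδ (hnbhd 0)
    have hAX : Measurable fun ω => (A 0 ω, X 0 ω) := (hA 0).prodMk (hX 0)
    have := Measure.isProbabilityMeasure_map (μ := P) hAX.aemeasurable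
    simp only [IPW.sampleOf_eq_modelSample μ f A X ε hσ.ne'] at hbhat hbLS hL hU ⊢
    exact fun η hη => hM.eventually_falseCoverage_le he hc hh₀ hσ hlam hbhat hbLS hα0 hα1 hL hU hη
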